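/- **Setting.** Let $\varphi(z)=\frac{z-i}{z+i}$ and identify $SL(2,\mathbb R)$ with $SU(1,1)$, acting on the unit disc $\mathbb D$ and on $\partial\mathbb D$, by conjugation with $\varphi$. Let $\Gamma<SL(2,\mathbb R)$ be a non-uniform lattice, let $A_1,\dots,A_p\in SL(2,\mathbb R)$ be such that $A_1\infty,\dots,A_p\infty$ is a complete set of inequivalent parabolic fixed points of $\Gamma$, and let $\Gamma_0<\Gamma$ be a finite index free subgroup. For $F\in SU(1,1)$, with rows $(\alpha,\bar\beta)$, $(\beta,\bar\alpha)$ and $\beta\neq0$, let $I_F$ be its isometric circle (centre $-\bar\alpha/\beta$, radius $|\beta|^{-1}$) and $U_F$ the interior of $I_F$. Assume that the Dirichlet region $\Omega_0=\overline{\mathbb D\setminus\bigcup_{F\in\Gamma_0\setminus\{1\}}U_F}$ is an ideal polygon, that is, all its sides are complete geodesics and consecutive sides meet at a vertex on $\partial\mathbb D$. Label the sides by a finite alphabet $\mathcal A$ with a fixed point free involution $a\mapsto\hat a$, with side pairings $F_a\in\Gamma_0$, $F_{\hat a}=F_a^{-1}$, $F_a(s_{\hat a})=s_a$, $s_a=I_{F_{\hat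 a}}\cap\mathbb D$. Let $[a]\subset\partial\mathbb D$ be the arc $U_{F_{\hat a}}\cap\partial\mathbb D$, with its clockwise-initial endpoint $\xi^L_a$ included and its clockwise-final endpoint $\xi_a^R$ excluded. Write $o(b)=o(a)+1$ if $\xi^R_a=\xi^L_b$. A word $(a_0,\dots,a_n)$ is admissible if $a_{k+1}\ne\hat a_k$ for all $k$; put $F_W=F_{a_0}\circ\dots\circ F_{a_n}$. A cuspidal word is a non-empty initial factor of an admissible word $V$ such that $F_V$ is parabolic and fixes a vertex of $\Omega_0$. A cuspidal word with at least two letters has type $R$ if $o(a_{k+1})=o(\hat a_k)-1$ for all $k$, and type $L$ if $o(a_{k+1})=o(\hat a_k)+1$ for all $k$. Its geometric length $|W|$ is the distance between the two parallel vertical lines obtained from $s_{a_0}$ and $F_{a_0}\cdots F_{a_{n-1}}(s_{a_n})$ by applying $(BA_k)^{-1}\varphi^{-1}$, where $B\in\Gamma$ and $k$ are such that $\varphi(BA_k\infty)$ is the common endpoint $\xi_W$ of these geodesics ($\xi_W=\xi_{a_0}^R$ for type $R$, $\xi_W=\xi_{a_0}^L$ for type $L$); $|W|=0$ for one-letter words.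 For a cuspidal word $W$ with last letter $b$, write $[a]\subset\mathrm{dom}(W)$ if $a\ne\hat b$ and, moreover, $o(a)\neq o(\hat b)\pm1$ if $W$ has one letter, $o(a)\ne o(\hat b)+1$ if $W$ has type $L$, $o(a)\neq o(\hat b)-1$ if $W$ has type $R$. For cuspidal $W,W'$ the transition $M_{W,W'}=1$ is allowed if $[a]\subset\mathrm{dom}(W)$ for the first letter $a$ of $W'$. Let $\mathcal B$ be the Banach space of functions $f:\partial\mathbb D\to\mathbb C$ that are Lipschitz on each $[a]$, with norm $\|f\|_\infty+\max_a\mathrm{Lip}(f|_{[a]})$. For $s>1/2$, $0<T\le\infty$ (for $\Delta$: $0<T<\infty$), $a\in\mathcal A$ and $\xi\in[a]$ let $$L_{(s,T)}f(\xi)=\sum_{[a]\subset\mathrm{dom}(W),\,|W|\le T}|D_\xi F_W|^s f(F_W\xi),\qquad \Delta_{(s,T)}f(\xi)=\sum_{[a]\subset\mathrm{dom}(W),\,|W|>T}|D_\xi F_W|^s f(F_W\xi),$$ sums over cuspidal words. Let $g_{(s,\infty)}\in\mathcal B$ denote a strictly positive eigenfunction of $L_{(s,\infty)}$ with positive eigenvalue,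 and let $\mu_{(1,\infty)}=g_{(1,\infty)}^{-1}\nu$, where $\nu$ is a Borel probability measure on $\partial\mathbb D$ such that $\int \hat Lf\,d\nu=\int f\,d\nu$ for all $f\in\mathcal B$, $\hat L f=g_{(1,\infty)}^{-1}L_{(1,\infty)}(g_{(1,\infty)}f)$. For $0<T<\infty$ let $\Sigma_T$ be the one-sided subshift of sequences $(W_r)_{r\ge0}$ of cuspidal words with $|W_r|\le T$ and $M_{W_r,W_{r+1}}=1$, with shift $\sigma$, and let $\Pi(w)\in\partial\mathbb D$ be the point coded by $w$, that is, the common point of the arcs $F_{a_0}\cdots F_{a_{n-1}}[a_n]$ associated with the words $(a_0,\dots,a_n)=W_0*\dots*W_r$, $r\ge0$. For $0\le s\le1$ let $\lambda(s,T)>0$ be the eigenvalue of $\mathcal L_{(s,T)}h(w)=\sum_{\sigma w'=w}|D_{\Pi(w)}F_{W_0(w')}|^sh(w')$ having a strictly positive eigenfunction that is Lipschitz for a distance $d_\theta$, $0<\theta<1$ (where $d_\theta(w,w')=\theta^n$ if $w,w'$ agree exactly up to the index $n$), and let $s_T\in[0,1]$ be the solution of $\log\lambda(s_T,T)=0$.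 Let $\varepsilon>0$ be such that $1\in\mathrm{Sp}(L_{(1,\infty)})$ and $\mathrm{Sp}(L_{(1,\infty)})\setminus\{1\}\subset B(0,1-2\varepsilon)$. Let $P_{(s,\infty)}=\frac{-1}{2\pi i}\oint_{|z-1|=\varepsilon}(L_{(s,\infty)}-z)^{-1}dz$, defined when the circle $|z-1|=\varepsilon$ lies in the resolvent set, and let $\beta_T\in\mathbb R$ be the coefficient in the decomposition $$\Delta_{(s_T,T)}g_{(s_T,\infty)}=\beta_T\,g_{(s_T,\infty)}+u,\qquad P_{(s_T,\infty)}u=0 .$$ **Statement.** The operators $L_{(s,T)}$, $\Delta_{(s,T)}$ are well defined and bounded on $\mathcal B$ for $s>1/2$. A pair $g_{(1,\infty)},\mu_{(1,\infty)}$ as above, with eigenvalue $1$, exists. There is a real number $\beta>0$ such that, for every such pair, $$\lim_{T\to+\infty}T\cdot\int\Delta_{(1,T)}g_{(1,\infty)}\,d\mu_{(1,\infty)}=\beta .$$ Moreover some $\varepsilon$ as above exists; for all $T$ big enough $s_T$ exists and is unique; for every $\varepsilon$ as above and all $T$ big enough (depending on $\varepsilon$), the projector $P_{(s_T,\infty)}$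 is defined, $g_{(s_T,\infty)}$ exists, $\beta_T$ is well defined (it exists, is unique, and does not depend on the choice of $g_{(s_T,\infty)}$); and, as $T\to+\infty$, $$\beta_T=\frac{\beta}{T}+O\big(|s_T-1|\,T^{-3/5}\big)+o(T^{-1}).$$ -/

import Mathlib

open Filter Topology MeasureTheory Complex
open scoped MatrixGroups ComplexConjugate

namespace CuspidalCoding

noncomputable section

/-! ### The disc model: the conjugate of `SL(2,ℝ)` under `φ(z) = (z - i) / (z + i)` -/

instance : MeasurableSpace Circle := borel Circle

instance : BorelSpace Circle := ⟨rfl⟩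

/-- The coefficient `α` of the element `φ G φ⁻¹` of `SU(1,1)`. -/
def alpha (G : SL(2, ℝ)) : ℂ :=
  ⟨(G 0 0 + G 1 1) / 2, (G 0 1 - G 1 0) / 2⟩

/-- The coefficient `β` of the element `φ G φ⁻¹` of `SU(1,1)`. -/
def beta (G : SL(2, ℝ)) : ℂ :=
  ⟨(G 0 0 - G 1 1) / 2, (G 0 1 + G 1 0) / 2⟩

/-- `φ G = F φ` where `F` has rows `(α, conj β)` and `(β, conj α)`. -/
theorem cayley_conj (G : SL(2, ℝ)) :
    !![alpha G, conj (beta G); beta G, conj (alpha G)] * !![1, -I; 1, I] =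
      !![1, -I; 1, I] * (G : Matrix (Fin 2) (Fin 2) ℝ).map (fun x : ℝ => (x : ℂ)) := by
  ext i j
  fin_cases i <;> fin_cases j <;> apply Complex.ext <;>
    simp [alpha, beta, Matrix.mul_apply, Fin.sum_univ_two] <;> ring

theorem normSq_alpha_sub (G : SL(2, ℝ)) : normSq (alpha G) - normSq (beta G) = 1 := by
  have h := Matrix.det_fin_two (G : Matrix (Fin 2) (Fin 2) ℝ)
  rw [G.det_coe] at h
  simp [alpha, beta, normSq_apply]
  nlinarith

/-- The Möbius map `F = φ G φ⁻¹` of the unit disc. -/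
def discMap (G : SL(2, ℝ)) (z : ℂ) : ℂ :=
  (alpha G * z + conj (beta G)) / (beta G * z + conj (alpha G))

theorem norm_discMap (G : SL(2, ℝ)) (z : Circle) : ‖discMap G z‖ = 1 := by
  have hz : normSq (z : ℂ) = 1 := Circle.normSq_coe z
  have hlt : ‖beta G‖ < ‖alpha G‖ := by
    have h := normSq_alpha_sub G
    rw [normSq_eq_norm_sq, normSq_eq_norm_sq] at h
    exact lt_of_pow_lt_pow_left₀ 2 (norm_nonneg _) (by linarith)
  have hne : beta G * z + conj (alpha G) ≠ 0 := by
    intro h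
    have h2 : beta G * z = -conj (alpha G) := eq_neg_of_add_eq_zero_left h
    have h3 := congrArg norm h2
    rw [norm_mul, Circle.norm_coe, mul_one, norm_neg, RCLike.norm_conj] at h3
    exact hlt.ne h3
  have hmul : alpha G * z + conj (beta G) = z * conj (beta G * z + conj (alpha G)) := by
    have h1 : (z : ℂ) * conj (z : ℂ) = 1 := by rw [mul_conj, hz]; simp
    simp only [map_add, map_mul, conj_conj]
    linear_combination -(conj (beta G)) * h1
  rw [discMap, norm_div, hmul, norm_mul, Circle.norm_coe, one_mul, RCLike.norm_conj]
  exact div_self (norm_ne_zero_iff.mpr hne)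

/-- The action of `F = φ G φ⁻¹` on the unit circle `∂𝔻`. -/
def act (G : SL(2, ℝ)) (ξ : Circle) : Circle :=
  ⟨discMap G ξ, mem_sphere_zero_iff_norm.mpr (norm_discMap G ξ)⟩

/-- `|D_ξ F|` for `F = φ G φ⁻¹`. -/
def derivNorm (G : SL(2, ℝ)) (ξ : Circle) : ℝ := ‖deriv (discMap G) (ξ : ℂ)‖

/-- The inverse `w ↦ i (1 + w) / (1 - w)` of `φ`. -/
def cayleyInv (w : ℂ) : ℂ := I * (1 + w) / (1 - w)

/-! ### Non-uniform lattices and their cusps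

The boundary `ℝ ∪ {∞}` of the upper half plane is identified through `φ` with the circle; the point
`∞` is then the point `1`, and the point `G · ∞` is the point `act G 1`. -/

/-- The Dirichlet region of `Γ` centred at `p`. -/
def dirichletRegion (Γ : Subgroup SL(2, ℝ)) (p : UpperHalfPlane) : Set UpperHalfPlane :=
  {z | ∀ G ∈ Γ, dist z p ≤ dist z (G • p)}

/-- `Γ` is discrete and has a Dirichlet region with finite hyperbolic area which is not compact.
The measure `volume` on the upper half plane is `dx dy / y²`. -/
def IsNonuniformLattice (Γ : Subgroup SL(2, ℝ)) : Prop :=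
  DiscreteTopology Γ ∧
    ∃ p : UpperHalfPlane, (∀ G ∈ Γ, G • p = p → G = 1 ∨ G = -1) ∧
      volume (dirichletRegion Γ p) < ⊤ ∧ ¬ IsCompact (dirichletRegion Γ p)

/-- The parabolic fixed points of `Γ`. -/
def IsParabolicPoint (Γ : Subgroup SL(2, ℝ)) (ξ : Circle) : Prop :=
  ∃ G ∈ Γ, (G : Matrix (Fin 2) (Fin 2) ℝ).IsParabolic ∧ act G ξ = ξ

/-- The points `S k · ∞` are a complete set of inequivalent parabolic fixed points of `Γ`. -/
def IsCuspSystem (Γ : Subgroup SL(2, ℝ)) {p : ℕ} (S : Fin p → SL(2, ℝ)) : Prop :=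
  (∀ k, IsParabolicPoint Γ (act (S k) 1)) ∧
  (∀ ξ, IsParabolicPoint Γ ξ → ∃ B ∈ Γ, ∃ k, act (B * S k) 1 = ξ) ∧
  (∀ j k, ∀ B ∈ Γ, act (B * S k) 1 = act (S j) 1 → j = k)

/-! ### Isometric circles and labelled ideal polygons -/

/-- The pole `ω_F = - conj α / β`. -/
def pole (G : SL(2, ℝ)) : ℂ := -conj (alpha G) / beta G

/-- The isometric circle `I_F`. -/
def isoCircle (G : SL(2, ℝ)) : Set ℂ := Metric.sphere (pole G) (‖beta G‖⁻¹)

/-- The interior `U_F` of the isometric circle (empty if `β = 0`, in particular for the identity). -/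
def isoDisc (G : SL(2, ℝ)) : Set ℂ := Metric.ball (pole G) (‖beta G‖⁻¹)

/-- The initial point, in the clockwise direction, of the arc `U_F ∩ ∂𝔻`. The disc `U_F` is
orthogonal to `∂𝔻`, so that the arc is centred at `ω_F / |ω_F|`, with half-opening
`arccos (1 / |ω_F|)`. -/
def arcStart (G : SL(2, ℝ)) : Circle :=
  Circle.exp (arg (pole G) + Real.arccos (‖pole G‖⁻¹))

/-- The final point, in the clockwise direction, of the arc `U_F ∩ ∂𝔻`. -/
def arcEnd (G : SL(2, ℝ)) : Circle :=
  Circle.exp (arg (pole G) - Real.arccos (‖pole G‖⁻¹))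

/-- The region `Ω₀`, closure of the complement in `𝔻` of all the discs `U_F` with `F ∈ Γ₀`. -/
def region (Γ₀ : Subgroup SL(2, ℝ)) : Set ℂ :=
  closure (Metric.ball 0 1 \ ⋃ G ∈ Γ₀, isoDisc G)

/-- A labelling by the alphabet `A` of the sides of `Ω₀`, which is required to be an ideal polygon.
The side with label `a` is the complete geodesic `s_a = I_{F_{â}} ∩ 𝔻`, and `F_a(s_{â}) = s_a`. -/
structure LabelledIdealPolygon (Γ₀ : Subgroup SL(2, ℝ)) (A : Type*) where
  /-- the involution `a ↦ â` of the alphabet -/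
  hat : A → A
  hat_hat : ∀ a, hat (hat a) = a
  hat_ne : ∀ a, hat a ≠ a
  /-- the side pairings: `F_a = φ (gen a) φ⁻¹` -/
  gen : A → SL(2, ℝ)
  gen_mem : ∀ a, gen a ∈ Γ₀
  gen_hat : ∀ a, gen (hat a) = (gen a)⁻¹
  side_subset : ∀ a, isoCircle (gen (hat a)) ∩ Metric.ball 0 1 ⊆ region Γ₀
  side_injective :
    Function.Injective fun a => isoCircle (gen (hat a)) ∩ (Metric.ball 0 1 : Set ℂ)
  frontier_region :
    frontier (region Γ₀) ∩ Metric.ball 0 1 =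
      ⋃ a, isoCircle (gen (hat a)) ∩ (Metric.ball 0 1 : Set ℂ)
  /-- consecutive sides meet at a vertex on `∂𝔻` -/
  ideal : ∀ a, ∃ b, arcEnd (gen (hat a)) = arcStart (gen (hat b))

section Polygon

variable {Γ₀ : Subgroup SL(2, ℝ)} {A : Type*} (P : LabelledIdealPolygon Γ₀ A)

/-- The endpoint `ξ^L_a` of the arc `[a]`. -/
def xiL (a : A) : Circle := arcStart (P.gen (P.hat a))

/-- The endpoint `ξ^R_a` of the arc `[a]`. -/
def xiR (a : A) : Circle := arcEnd (P.gen (P.hat a))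

/-- The right open arc `[a]` cut by the side `s_a`. -/
def arc (a : A) : Set Circle := {ξ | (ξ : ℂ) ∈ isoDisc (P.gen (P.hat a)) ∨ ξ = xiL P a}

/-- `o(b) = o(a) + 1` in the cyclic order of the letters. -/
def Succ (a b : A) : Prop := xiR P a = xiL P b

/-! ### Admissible and cuspidal words -/

/-- The no backtracking condition. -/
def Admissible (W : List A) : Prop := W.IsChain fun a b => b ≠ P.hat a

/-- The element of `Γ₀` corresponding to `F_{a₀,…,aₙ} = F_{a₀} ∘ … ∘ F_{aₙ}`. -/
def elt (W : List A) : SL(2, ℝ) := (W.map P.gen).prod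

/-- Cuspidal words: non-empty initial factors of admissible words `V` such that `F_V` is parabolic
and fixes a vertex of the polygon. -/
def IsCuspidal (W : List A) : Prop :=
  W ≠ [] ∧ ∃ V : List A, W <+: V ∧ Admissible P V ∧
    (elt P V : Matrix (Fin 2) (Fin 2) ℝ).IsParabolic ∧
    ∃ b, (act (elt P V) (xiL P b) = xiL P b ∨ act (elt P V) (xiR P b) = xiR P b)

/-- The condition `ε(W) = R`: there are at least two letters and
`o(a_{k+1}) = o(â_k) - 1` for all `k`. -/
def IsRight (W : List A) : Prop := 2 ≤ W.length ∧ W.IsChain fun a b => Succ P b (P.hat a)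

/-- The condition `ε(W) = L`: there are at least two letters and
`o(a_{k+1}) = o(â_k) + 1` for all `k`. -/
def IsLeft (W : List A) : Prop := 2 ≤ W.length ∧ W.IsChain fun a b => Succ P (P.hat a) b

/-- The condition `[a] ⊆ dom(W)`: the letter `a` may start a word following `W`. -/
def Follows (W : List A) (a : A) : Prop :=
  ∀ b ∈ W.getLast?, a ≠ P.hat b ∧
    (W.length = 1 → ¬ Succ P (P.hat b) a ∧ ¬ Succ P a (P.hat b)) ∧
    (IsLeft P W → ¬ Succ P (P.hat b) a) ∧
    (IsRight P W → ¬ Succ P a (P.hat b))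

/-- The transition condition `M_{W,W'} = 1`. -/
def Transition (W W' : List A) : Prop := ∀ a ∈ W'.head?, Follows P W a

/-! ### Geometric length -/

variable (Γ : Subgroup SL(2, ℝ)) {p : ℕ} (S : Fin p → SL(2, ℝ))

open Classical in
/-- An element `B A_k`, with `B ∈ Γ` and `A_k` in the family `S`, sending `∞` to `ξ`. -/
def cuspFrame (ξ : Circle) : SL(2, ℝ) :=
  if h : ∃ C : SL(2, ℝ), (∃ B ∈ Γ, ∃ k, C = B * S k) ∧ act C 1 = ξ then h.choose else 1

/-- The abscissa of the vertical half line which is the image under `(B A_k)⁻¹ φ⁻¹` of the geodesic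
of `𝔻` with endpoints `ξ` and `η`, where `ξ` is the image of `∞` under `φ B A_k`. -/
def abscissa (ξ η : Circle) : ℝ := (cayleyInv (act (cuspFrame Γ S ξ)⁻¹ η)).re

open Classical in
/-- The geometric length `|W|` of a cuspidal word `W = (a₀,…,aₙ)`: the distance between the vertical
lines corresponding to the geodesics `s_{a₀}` and `F_{a₀,…,a_{n-1}}(s_{aₙ})`, which have a
common endpoint `ξ_W`. -/
def geomLength (W : List A) : ℝ :=
  match W.head?, W.getLast? with
  | some a, some b =>
    if IsRight P W then
      |abscissa Γ S (xiR P a) (xiL P a)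
        - abscissa Γ S (xiR P a) (act (elt P W.dropLast) (xiL P b))|
    else if IsLeft P W then
      |abscissa Γ S (xiL P a) (xiR P a)
        - abscissa Γ S (xiL P a) (act (elt P W.dropLast) (xiR P b))|
    else 0
  | _, _ => 0

/-- The set `𝒲(a,T)`, for `0 < T ≤ ∞`. -/
def words (T : EReal) (a : A) : Set (List A) :=
  {W | IsCuspidal P W ∧ Follows P W a ∧ (geomLength P Γ S W : EReal) ≤ T}

/-- The set `𝒱(a,T) = 𝒲(a) \ 𝒲(a,T)`. -/
def longWords (T : ℝ) (a : A) : Set (List A) :=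
  {W | IsCuspidal P W ∧ Follows P W a ∧ T < geomLength P Γ S W}

/-! ### The subshift, its transfer operator and the exponent `s_T` -/

/-- The shift space: sequences of cuspidal words of geometric length at most `T`, with transitions
allowed by `M`. -/
def ShiftSpace (T : ℝ) : Type _ :=
  {w : ℕ → List A // ∀ r, IsCuspidal P (w r) ∧ geomLength P Γ S (w r) ≤ T ∧
    Transition P (w r) (w (r + 1))}

/-- The shift map. -/
def shift {T : ℝ} (w : ShiftSpace P Γ S T) : ShiftSpace P Γ S T :=
  ⟨fun r => w.1 (r + 1), fun r => w.2 (r + 1)⟩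

/-- The arc `[a₀,…,aₙ] = F_{a₀,…,a_{n-1}}[aₙ]`. -/
def cylinder (V : List A) : Set Circle :=
  {ξ | ∃ b ∈ V.getLast?, ξ ∈ act (elt P V.dropLast) '' arc P b}

/-- The coding map `Π(w) = [W₀ * W₁ * …]`, the point common to all the arcs `[W₀ * … * W_r]`. -/
def coding {T : ℝ} (w : ShiftSpace P Γ S T) : Circle :=
  Classical.epsilon fun ξ => ∀ r : ℕ, ξ ∈ cylinder P ((List.range (r + 1)).map w.1).flatten

/-- `lam` is the eigenvalue of the transfer operator with potential `s · φ_T` on the shift space,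
`(ℒ h)(w) = ∑_{σ w' = w} |D_{Π w} F_{W₀(w')}|^s h(w')`, which has a strictly positive
eigenfunction `h`, Lipschitz for the distance `d_θ`. -/
def IsLeadingEigenvalue (s T lam : ℝ) : Prop :=
  0 < lam ∧ ∃ (h : ShiftSpace P Γ S T → ℝ) (θ C : ℝ), 0 < θ ∧ θ < 1 ∧
    (∀ w, 0 < h w) ∧
    (∀ (n : ℕ) (w w' : ShiftSpace P Γ S T),
      (∀ r ≤ n, w.1 r = w'.1 r) → |h w - h w'| ≤ C * θ ^ n) ∧
    ∀ w : ShiftSpace P Γ S T,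
      HasSum (fun w' : {w' : ShiftSpace P Γ S T // shift P Γ S w' = w} =>
        derivNorm (elt P (w'.1.1 0)) (coding P Γ S w) ^ s * h w'.1) (lam * h w)

/-- Bowen's equation `log λ(s,T) = 0`, for `0 ≤ s ≤ 1`. -/
def IsBowenRoot (T s : ℝ) : Prop :=
  0 ≤ s ∧ s ≤ 1 ∧ ∃ lam, IsLeadingEigenvalue P Γ S s T lam ∧ Real.log lam = 0

end Polygon

/-! ### The Banach space of piecewise Lipschitz functions -/

section PLip

variable {Γ₀ : Subgroup SL(2, ℝ)} {A : Type*} (P : LabelledIdealPolygon Γ₀ A)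

/-- The difference quotients of `f` over pairs of points in the same arc. -/
def slope (f : Circle → ℂ) (q : Σ a : A, arc P a × arc P a) : ℝ :=
  ‖f q.2.1 - f q.2.2‖ / dist (q.2.1 : Circle) (q.2.2 : Circle)

theorem slope_nonneg (f : Circle → ℂ) (q : Σ a : A, arc P a × arc P a) : 0 ≤ slope P f q := by
  unfold slope; positivity

theorem slope_add_le (f g : Circle → ℂ) (q : Σ a : A, arc P a × arc P a) :
    slope P (f + g) q ≤ slope P f q + slope P g q := by
  unfold slope
  rw [← add_div]
  gcongr
  simp only [Pi.add_apply]
  rw [add_sub_add_comm]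
  exact norm_add_le _ _

theorem slope_smul (c : ℂ) (f : Circle → ℂ) (q : Σ a : A, arc P a × arc P a) :
    slope P (c • f) q = ‖c‖ * slope P f q := by
  unfold slope
  simp only [Pi.smul_apply, ← smul_sub, norm_smul, mul_div_assoc]

/-- Bounded functions on the circle whose restriction to each arc `[a]` is Lipschitz. -/
def plipSubmodule : Submodule ℂ (Circle → ℂ) where
  carrier := {f | BddAbove (Set.range fun ξ => ‖f ξ‖) ∧ BddAbove (Set.range (slope P f))}
  zero_mem' := by
    refine ⟨⟨0, ?_⟩, ⟨0, ?_⟩⟩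
    · rintro _ ⟨ξ, rfl⟩; simp
    · rintro _ ⟨q, rfl⟩; simp [slope]
  add_mem' := by
    rintro f g ⟨⟨C, hC⟩, ⟨K, hK⟩⟩ ⟨⟨C', hC'⟩, ⟨K', hK'⟩⟩
    refine ⟨⟨C + C', ?_⟩, ⟨K + K', ?_⟩⟩
    · rintro _ ⟨ξ, rfl⟩
      exact (norm_add_le _ _).trans (add_le_add (hC ⟨ξ, rfl⟩) (hC' ⟨ξ, rfl⟩))
    · rintro _ ⟨q, rfl⟩
      exact (slope_add_le P f g q).trans (add_le_add (hK ⟨q, rfl⟩) (hK' ⟨q, rfl⟩))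
  smul_mem' := by
    rintro c f ⟨⟨C, hC⟩, ⟨K, hK⟩⟩
    refine ⟨⟨‖c‖ * C, ?_⟩, ⟨‖c‖ * K, ?_⟩⟩
    · rintro _ ⟨ξ, rfl⟩
      simp only [Pi.smul_apply, norm_smul]
      exact mul_le_mul_of_nonneg_left (hC ⟨ξ, rfl⟩) (norm_nonneg c)
    · rintro _ ⟨q, rfl⟩
      rw [slope_smul]
      exact mul_le_mul_of_nonneg_left (hK ⟨q, rfl⟩) (norm_nonneg c)

/-- The space `ℬ` of piecewise Lipschitz functions, to be normed by
`‖f‖_* = ‖f‖_∞ + max_a Lip(f|[a])`. -/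
def PLip : Type := ↥(plipSubmodule P)

instance : AddCommGroup (PLip P) := inferInstanceAs (AddCommGroup ↥(plipSubmodule P))

instance : Module ℂ (PLip P) := inferInstanceAs (Module ℂ ↥(plipSubmodule P))

instance : CoeFun (PLip P) (fun _ => Circle → ℂ) := ⟨fun f => f.1⟩

instance : Norm (PLip P) := ⟨fun f => (⨆ ξ, ‖f.1 ξ‖) + ⨆ q, slope P f.1 q⟩

theorem PLip.norm_def (f : PLip P) : ‖f‖ = (⨆ ξ, ‖f.1 ξ‖) + ⨆ q, slope P f.1 q := rfl

theorem PLip.core : NormedSpace.Core ℂ (PLip P) where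
  norm_nonneg f :=
    add_nonneg (Real.iSup_nonneg fun _ => norm_nonneg _)
      (Real.iSup_nonneg fun q => slope_nonneg P f.1 q)
  norm_smul c f := by
    have h1 : (c • f).1 = c • f.1 := rfl
    rw [PLip.norm_def, PLip.norm_def, h1, mul_add, Real.mul_iSup_of_nonneg (norm_nonneg c),
      Real.mul_iSup_of_nonneg (norm_nonneg c)]
    simp only [slope_smul, Pi.smul_apply, norm_smul]
  norm_triangle f g := by
    have h1 : (f + g).1 = f.1 + g.1 := rfl
    rw [PLip.norm_def, PLip.norm_def, PLip.norm_def, h1, add_add_add_comm]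
    refine add_le_add ?_ ?_
    · refine ciSup_le fun ξ => (norm_add_le _ _).trans ?_
      exact add_le_add (le_ciSup f.2.1 ξ) (le_ciSup g.2.1 ξ)
    · refine Real.iSup_le (fun q => (slope_add_le P _ _ q).trans ?_)
        (add_nonneg (Real.iSup_nonneg fun q => slope_nonneg P f.1 q)
          (Real.iSup_nonneg fun q => slope_nonneg P g.1 q))
      exact add_le_add (le_ciSup f.2.2 q) (le_ciSup g.2.2 q)
  norm_eq_zero_iff f := by
    constructor
    · intro h
      have h2 : 0 ≤ ⨆ q, slope P f.1 q := Real.iSup_nonneg fun q => slope_nonneg P f.1 q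
      have h3 : (⨆ ξ, ‖f.1 ξ‖) ≤ 0 := by rw [PLip.norm_def] at h; linarith
      apply Subtype.ext
      funext ξ
      exact norm_le_zero_iff.mp ((le_ciSup f.2.1 ξ).trans h3)
    · rintro rfl
      have h1 : (0 : PLip P).1 = 0 := rfl
      rw [PLip.norm_def, h1]
      simp [slope]

instance : NormedAddCommGroup (PLip P) := NormedAddCommGroup.ofCore (PLip.core P)

instance : NormedSpace ℂ (PLip P) := NormedSpace.ofCore (PLip.core P)

/-! ### Transfer operators on the circle -/

/-- The bounded operator `L` on `ℬ` is given by `L f(ξ) = ∑_{W ∈ X(a)} |D_ξ F_W|^s f(F_W ξ)`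
for `ξ ∈ [a]`. -/
def IsWordOperator (s : ℝ) (X : A → Set (List A)) (L : PLip P →L[ℂ] PLip P) : Prop :=
  ∀ (f : PLip P) (a : A) (ξ : Circle), ξ ∈ arc P a →
    HasSum (fun W : X a =>
      ((derivNorm (elt P (W : List A)) ξ ^ s : ℝ) : ℂ) * f (act (elt P (W : List A)) ξ)) (L f ξ)

open Classical in
/-- The bounded operator of the previous definition, if there is one, and `0` otherwise. -/
def wordOperator (s : ℝ) (X : A → Set (List A)) : PLip P →L[ℂ] PLip P :=
  if h : ∃ L, IsWordOperator P s X L then h.choose else 0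

variable (Γ : Subgroup SL(2, ℝ)) {p : ℕ} (S : Fin p → SL(2, ℝ))

/-- The transfer operator `L_{(s,T)}`, for `0 < T ≤ ∞`. -/
def transferOp (s : ℝ) (T : EReal) : PLip P →L[ℂ] PLip P := wordOperator P s (words P Γ S T)

/-- The operator `Δ_{(s,T)}`. -/
def deltaOp (s T : ℝ) : PLip P →L[ℂ] PLip P := wordOperator P s (longWords P Γ S T)

variable {P}

/-- `g` is a strictly positive eigenfunction of `L`, for the eigenvalue `lam > 0`. -/
def IsPositiveEigenfunction (L : PLip P →L[ℂ] PLip P) (g : PLip P) (lam : ℝ) : Prop :=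
  0 < lam ∧ (∀ ξ, 0 < (g ξ).re ∧ (g ξ).im = 0) ∧ L g = (lam : ℂ) • g

/-- `μ = g⁻¹ ν`, where `ν` is a Borel probability measure on the circle invariant under the
normalized operator `f ↦ lam⁻¹ g⁻¹ L(g f)`, that is `∫ lam⁻¹ g⁻¹ L(g f) dν = ∫ f dν` for all
`f ∈ ℬ`. -/
def IsEigenmeasure (L : PLip P →L[ℂ] PLip P) (g : PLip P) (lam : ℝ) (μ : Measure Circle) : Prop :=
  ∃ ν : Measure Circle, IsProbabilityMeasure ν ∧
    (∀ f gf : PLip P, (∀ ξ, gf ξ = g ξ * f ξ) →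
      ∫ ξ, (lam : ℂ)⁻¹ * (g ξ)⁻¹ * L gf ξ ∂ν = ∫ ξ, f ξ ∂ν) ∧
    μ = ν.withDensity fun ξ => ENNReal.ofReal ((g ξ).re)⁻¹

/-- The operator `L` has `1` in the spectrum, and the rest of the spectrum is contained in the ball
`B(0, 1 - 2ε)`. -/
def HasSpectralGap (L : PLip P →L[ℂ] PLip P) (ε : ℝ) : Prop :=
  0 < ε ∧ (1 : ℂ) ∈ spectrum ℂ L ∧ spectrum ℂ L \ {1} ⊆ Metric.ball 0 (1 - 2 * ε)

/-- The spectral projector `-(2πi)⁻¹ ∮ (L - z)⁻¹ dz` along the circle of centre `1` and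
radius `ε`. -/
def spectralProjector (L : PLip P →L[ℂ] PLip P) (ε : ℝ) : PLip P →L[ℂ] PLip P :=
  (-1 / (2 * Real.pi * I) : ℂ) •
    ∮ z in C(1, ε), Ring.inverse (L - z • ContinuousLinearMap.id ℂ (PLip P))

variable (P)

/-- `b` is the coefficient of `g` in the decomposition `Δ_{(s,T)} g = b g + u`, where `g` is the
positive eigenfunction of `L_{(s,∞)}` and `u` is in the kernel of its spectral projector along the
circle of centre `1` and radius `ε`, which is required to be in the resolvent set. -/
def IsSpectralCoefficient (ε s T b : ℝ) : Prop :=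
  Metric.sphere (1 : ℂ) ε ⊆ resolventSet ℂ (transferOp P Γ S s ⊤) ∧
  (∃ g lam, IsPositiveEigenfunction (transferOp P Γ S s ⊤) g lam) ∧
  ∀ g lam, IsPositiveEigenfunction (transferOp P Γ S s ⊤) g lam →
    ∀ c : ℂ, (∃ u : PLip P, spectralProjector (transferOp P Γ S s ⊤) ε u = 0 ∧
      deltaOp P Γ S s T g = c • g + u) ↔ c = (b : ℂ)

end PLip

end

end CuspidalCoding

namespace CuspidalCoding

noncomputable section

/-! ### Algebra of the disc model -/

/-! The proof rests on one change of coordinate. At a vertex `ζ` of the polygon use `cot (θ / 2)` at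
the point `ζ exp (i θ)`. A cuspidal word is determined by an orientation, its first letter and its
number of letters (`isCuspidal_iff`). Between the coordinates at the two vertices attached to it,
its branch is a translation `x ↦ x + t` (`xs_act_elt_cw`), where `t` is comparable with the number
of letters. The derivative is then `(1 + x²) / (1 + (x + t)²)` with `x` bounded. This gives uniform
contraction, bounded distortion and decay like the inverse square of the number of letters
(`exists_word_bounds`), so all the series converge for `s > 1/2` and depend on `s` in a Lipschitz
way near `s = 1`.

For `s = 1` the weight is a Jacobian. The images of the branches are disjoint and cover the circle
up to the vertices (`eq_of_act_eq`, `exists_branch`), so `L_{(1,∞)}` preserves the integral for the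
uniform measure (`integral_transferOp`). It contracts a cone of functions with Lipschitz logarithm,
and any two arcs are connected by a word. A Doeblin argument (`exists_doeblin`) then gives `L^n f →
(∫ f) g₀` exponentially fast (`exists_limit_eigenfunction`), hence the spectral gap. It also shows
that every admissible pair `(g, μ)` gives the same integral, namely that of `Δ g₀` for the uniform
measure (`IsEigenmeasure.integral_eq`).

The geometric length is affine in the coordinate of the word (`geomLength_cw`). The images of the
words with `|W| > T` therefore fill, up to null sets, neighbourhoods `{x > y_T}` of the vertices
(`branchImage_longWords`), with `y_T ~ T / scale` and measure `~ 1 / (π y_T)`. The integral of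
`Δ_{(1,T)} g₀` is the integral of `g₀` over these neighbourhoods. Multiplied by `T`, it tends to the
sum over the ends of the arcs of `scale / π` times the boundary value of `g₀`, which is `β > 0`.

Bowen's equation is solved by perturbation. The operator `L - 1 - g₀ ⊗ ψ₀`, where `ψ₀` is the mean,
stays invertible for `L = L_{(s,T)}` close to `L_{(1,∞)}`, and `1` is an eigenvalue of `L` as soon
as the vector `v` it produces has `ψ₀ v = 1`. The intermediate value theorem in `s` gives a root
with `1 - C/T ≤ s_T ≤ 1` (`exists_bowenRoot`). Uniqueness compares two positive eigenfunctions at a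
maximum of their quotient on the compact shift space.

Finally the spectral projector of `L_{(s_T,∞)}` has rank one, of the form `ψ_T ⊗ v_T`, so that `β_T
= ψ_T (Δ_{(s_T,T)} v_T)`. Since `v_T → g₀`, `ψ_T` tends to the mean, `T ‖Δ_{(1,T)}‖` is bounded and
`T ‖Δ_{(s_T,T)} - Δ_{(1,T)}‖ → 0`, one gets `T β_T → β`. This is the expansion with a vanishing
first error term. -/

theorem continuous_circle_iff {X : Type*} [TopologicalSpace X] {f : X → Circle} :
    Continuous f ↔ Continuous fun x => (f x : ℂ) :=
  (Topology.IsInducing.subtypeVal (t := (Submonoid.unitSphere ℂ : Set ℂ))).continuous_iff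

theorem alpha_mul (G H : SL(2, ℝ)) :
    alpha (G * H) = alpha G * alpha H + conj (beta G) * beta H := by
  apply Complex.ext <;>
    simp [alpha, beta, Matrix.SpecialLinearGroup.coe_mul, Matrix.mul_apply, Fin.sum_univ_two] <;>
    ring

theorem beta_mul (G H : SL(2, ℝ)) :
    beta (G * H) = beta G * alpha H + conj (alpha G) * beta H := by
  apply Complex.ext <;>
    simp [alpha, beta, Matrix.SpecialLinearGroup.coe_mul, Matrix.mul_apply, Fin.sum_univ_two] <;>
    ring

theorem alpha_one : alpha 1 = 1 := by
  apply Complex.ext <;> simp [alpha]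

theorem beta_one : beta 1 = 0 := by
  apply Complex.ext <;> simp [beta]

theorem alpha_inv (G : SL(2, ℝ)) : alpha G⁻¹ = conj (alpha G) := by
  apply Complex.ext <;>
    simp [alpha, Matrix.SpecialLinearGroup.coe_inv, Matrix.adjugate_fin_two] <;> ring

theorem beta_inv (G : SL(2, ℝ)) : beta G⁻¹ = -beta G := by
  apply Complex.ext <;>
    simp [beta, Matrix.SpecialLinearGroup.coe_inv, Matrix.adjugate_fin_two] <;> ring

/-- The denominator of the Möbius map `F = φ G φ⁻¹`. -/
def jac (G : SL(2, ℝ)) (z : ℂ) : ℂ := beta G * z + conj (alpha G)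

theorem alpha_mul_conj (G : SL(2, ℝ)) :
    alpha G * conj (alpha G) = 1 + beta G * conj (beta G) := by
  have h := normSq_alpha_sub G
  rw [mul_conj, mul_conj]
  have : normSq (alpha G) = 1 + normSq (beta G) := by linarith
  rw [this]; push_cast; ring

theorem norm_alpha_sq (G : SL(2, ℝ)) : ‖alpha G‖ ^ 2 = 1 + ‖beta G‖ ^ 2 := by
  have h := normSq_alpha_sub G
  rw [normSq_eq_norm_sq, normSq_eq_norm_sq] at h
  linarith

theorem norm_beta_lt (G : SL(2, ℝ)) : ‖beta G‖ < ‖alpha G‖ :=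
  lt_of_pow_lt_pow_left₀ 2 (norm_nonneg _) (by linarith [norm_alpha_sq G])

theorem jac_ne_zero (G : SL(2, ℝ)) (ξ : Circle) : jac G ξ ≠ 0 := by
  intro h
  have h2 : beta G * ξ = -conj (alpha G) := eq_neg_of_add_eq_zero_left h
  have h3 := congrArg norm h2
  rw [norm_mul, Circle.norm_coe, mul_one, norm_neg, RCLike.norm_conj] at h3
  exact (norm_beta_lt G).ne h3

theorem coe_act (G : SL(2, ℝ)) (ξ : Circle) :
    (act G ξ : ℂ) = (alpha G * ξ + conj (beta G)) / jac G ξ := rfl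

theorem coe_act_mul_jac (G : SL(2, ℝ)) (ξ : Circle) :
    (act G ξ : ℂ) * jac G ξ = alpha G * ξ + conj (beta G) := by
  rw [coe_act, div_mul_cancel₀ _ (jac_ne_zero G ξ)]

/-- Cocycle relation of the denominators. Both the action property `act_mul` and the chain rule
`derivNorm_mul` follow from it. -/
theorem jac_mul (G H : SL(2, ℝ)) (ξ : Circle) :
    jac (G * H) ξ = jac G (act H ξ) * jac H ξ := by
  have h := coe_act_mul_jac H ξ
  have : jac G (act H ξ) * jac H ξ =
      beta G * ((act H ξ : ℂ) * jac H ξ) + conj (alpha G) * jac H ξ := by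
    rw [jac]; ring
  rw [this, h]
  simp only [jac, beta_mul, alpha_mul, map_add, map_mul, conj_conj]
  ring

theorem act_mul (G H : SL(2, ℝ)) (ξ : Circle) : act (G * H) ξ = act G (act H ξ) := by
  apply Circle.ext
  have h1 := jac_ne_zero (G * H) ξ
  have h2 := jac_ne_zero H ξ
  have h3 := jac_ne_zero G (act H ξ)
  rw [coe_act G, coe_act (G * H), div_eq_div_iff h1 h3, jac_mul]
  have h := coe_act_mul_jac H ξ
  have h4 : (alpha G * (act H ξ) + conj (beta G)) * (jac G (act H ξ) * jac H ξ) =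
      (alpha G * ((act H ξ : ℂ) * jac H ξ) + conj (beta G) * jac H ξ) * jac G (act H ξ) := by ring
  rw [h4, h]
  congr 1
  simp only [jac, beta_mul, alpha_mul, map_add, map_mul, conj_conj]
  ring

theorem act_one (ξ : Circle) : act 1 ξ = ξ := by
  apply Circle.ext
  simp [coe_act, jac, alpha_one, beta_one]

theorem act_inv_act (G : SL(2, ℝ)) (ξ : Circle) : act G⁻¹ (act G ξ) = ξ := by
  rw [← act_mul, inv_mul_cancel, act_one]

theorem act_act_inv (G : SL(2, ℝ)) (ξ : Circle) : act G (act G⁻¹ ξ) = ξ := by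
  rw [← act_mul, mul_inv_cancel, act_one]

theorem act_injective (G : SL(2, ℝ)) : Function.Injective (act G) :=
  Function.LeftInverse.injective (act_inv_act G)

theorem derivNorm_eq (G : SL(2, ℝ)) (ξ : Circle) : derivNorm G ξ = (‖jac G ξ‖ ^ 2)⁻¹ := by
  have h := jac_ne_zero G ξ
  have h1 : HasDerivAt (fun z : ℂ => alpha G * z + conj (beta G)) (alpha G) (ξ : ℂ) := by
    simpa using ((hasDerivAt_id (ξ : ℂ)).const_mul (alpha G)).add_const (conj (beta G))
  have h2 : HasDerivAt (fun z : ℂ => beta G * z + conj (alpha G)) (beta G) (ξ : ℂ) := by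
    simpa using ((hasDerivAt_id (ξ : ℂ)).const_mul (beta G)).add_const (conj (alpha G))
  have h3 := (h1.div h2 h).deriv
  have h4 : deriv (discMap G) ξ = 1 / (jac G ξ) ^ 2 := by
    have : discMap G = fun z => (alpha G * z + conj (beta G)) / (beta G * z + conj (alpha G)) := rfl
    rw [this]
    refine Eq.trans h3 ?_
    have := alpha_mul_conj G
    rw [jac]
    congr 1
    linear_combination this
  rw [derivNorm, h4, norm_div, norm_one, norm_pow, one_div]

theorem derivNorm_pos (G : SL(2, ℝ)) (ξ : Circle) : 0 < derivNorm G ξ := by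
  rw [derivNorm_eq]
  have := norm_pos_iff.mpr (jac_ne_zero G ξ)
  positivity

theorem derivNorm_mul (G H : SL(2, ℝ)) (ξ : Circle) :
    derivNorm (G * H) ξ = derivNorm G (act H ξ) * derivNorm H ξ := by
  simp only [derivNorm_eq, jac_mul, norm_mul, mul_pow, mul_inv]

theorem derivNorm_one (ξ : Circle) : derivNorm 1 ξ = 1 := by
  simp [derivNorm_eq, jac, alpha_one, beta_one]

theorem derivNorm_inv (G : SL(2, ℝ)) (ξ : Circle) :
    derivNorm G⁻¹ (act G ξ) = (derivNorm G ξ)⁻¹ := by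
  have h := derivNorm_mul G⁻¹ G ξ
  rw [inv_mul_cancel, derivNorm_one] at h
  exact eq_inv_of_mul_eq_one_left h.symm

theorem continuous_jac (G : SL(2, ℝ)) : Continuous fun ξ : Circle => jac G ξ := by
  unfold jac; fun_prop

theorem continuous_derivNorm (G : SL(2, ℝ)) : Continuous (derivNorm G) := by
  have : derivNorm G = fun ξ : Circle => (‖jac G ξ‖ ^ 2)⁻¹ := funext (derivNorm_eq G)
  rw [this]
  refine Continuous.inv₀ ((continuous_jac G).norm.pow 2) fun ξ => ?_
  have := norm_pos_iff.mpr (jac_ne_zero G ξ)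
  positivity

theorem continuous_act (G : SL(2, ℝ)) : Continuous (act G) := by
  rw [continuous_circle_iff]
  change Continuous fun ξ : Circle => (alpha G * ξ + conj (beta G)) / jac G ξ
  exact Continuous.div (by fun_prop) (continuous_jac G) (jac_ne_zero G)

/-- A consequence of `|α|² - |β|² = 1`. It makes the action multiply distances by the geometric mean
of the two derivatives, so contraction estimates need no mean value theorem. -/
theorem coe_act_sub (G : SL(2, ℝ)) (ξ η : Circle) :
    (act G ξ : ℂ) - act G η = (ξ - η) / (jac G ξ * jac G η) := by
  rw [coe_act, coe_act, div_sub_div _ _ (jac_ne_zero G ξ) (jac_ne_zero G η)]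
  congr 1
  simp only [jac]
  linear_combination ((ξ : ℂ) - η) * alpha_mul_conj G

theorem circle_dist (ξ η : Circle) : dist ξ η = ‖(ξ : ℂ) - η‖ := by
  rw [← dist_eq_norm]; rfl

theorem circle_dist_le_two (ξ η : Circle) : dist ξ η ≤ 2 := by
  rw [circle_dist]
  refine (norm_sub_le _ _).trans ?_
  rw [Circle.norm_coe, Circle.norm_coe]; norm_num

theorem dist_act (G : SL(2, ℝ)) (ξ η : Circle) :
    dist (act G ξ) (act G η) = √(derivNorm G ξ * derivNorm G η) * dist ξ η := by
  rw [circle_dist, circle_dist, coe_act_sub, derivNorm_eq, derivNorm_eq, norm_div, norm_mul,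
    ← mul_inv, ← mul_pow, Real.sqrt_inv, Real.sqrt_sq (by positivity), div_eq_inv_mul]

theorem dist_act_sq (G : SL(2, ℝ)) (ξ η : Circle) :
    dist (act G ξ) (act G η) ^ 2 = derivNorm G ξ * derivNorm G η * dist ξ η ^ 2 := by
  rw [dist_act, mul_pow, Real.sq_sqrt]
  exact (mul_pos (derivNorm_pos _ _) (derivNorm_pos _ _)).le

theorem derivNorm_ge (G : SL(2, ℝ)) (ξ : Circle) :
    ((‖beta G‖ + ‖alpha G‖) ^ 2)⁻¹ ≤ derivNorm G ξ := by
  rw [derivNorm_eq]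
  have := norm_pos_iff.mpr (jac_ne_zero G ξ)
  gcongr
  refine (norm_add_le _ _).trans ?_
  rw [norm_mul, Circle.norm_coe, mul_one, RCLike.norm_conj]

/-! ### The coordinate `cot (θ / 2)` at a point of the circle -/

/-- The coordinate on `∂𝔻 ∖ {ζ}` which is `cot (θ / 2)` at the point `ζ exp (i θ)`. -/
def xc (ζ ξ : Circle) : ℝ := (I * (ξ + ζ) / (ξ - ζ) : ℂ).re

theorem circle_conj (ξ : Circle) : conj (ξ : ℂ) = (ξ : ℂ)⁻¹ := by
  rw [← Circle.coe_inv, Circle.coe_inv_eq_conj]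

theorem circle_sub_ne {ζ ξ : Circle} (h : ξ ≠ ζ) : (ξ : ℂ) - ζ ≠ 0 :=
  sub_ne_zero.mpr fun h' => h (Circle.ext h')

/-- On the circle conjugation is inversion, and the fraction is invariant under it, hence real. -/
theorem coe_xc {ζ ξ : Circle} (h : ξ ≠ ζ) : (xc ζ ξ : ℂ) = I * (ξ + ζ) / (ξ - ζ) := by
  have h1 := circle_sub_ne h
  have hξ := Circle.coe_ne_zero ξ
  have hζ := Circle.coe_ne_zero ζ
  rw [xc]
  refine (conj_eq_iff_re.mp ?_)
  simp only [map_div₀, map_mul, map_add, map_sub, conj_I, circle_conj]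
  have h2 : (ξ : ℂ)⁻¹ - (ζ : ℂ)⁻¹ ≠ 0 := by
    intro h3
    exact h1 (by rw [inv_inj.mp (sub_eq_zero.mp h3), sub_self])
  rw [div_eq_div_iff h2 h1]
  field_simp
  ring

theorem coe_eq_of_xc {ζ ξ : Circle} (h : ξ ≠ ζ) :
    (ξ : ℂ) * (xc ζ ξ - I) = ζ * (xc ζ ξ + I) := by
  have h1 := circle_sub_ne h
  have := coe_xc h
  rw [eq_div_iff h1] at this
  linear_combination this

/-- For `ξ = ζ exp (i θ)` this is the identity `4 sin² (θ/2) (1 + cot² (θ/2)) = 4`. -/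
theorem one_add_xc_sq {ζ ξ : Circle} (h : ξ ≠ ζ) : dist ξ ζ ^ 2 * (1 + xc ζ ξ ^ 2) = 4 := by
  have h1 := circle_sub_ne h
  have h2 : ((ξ : ℂ) - ζ) * (xc ζ ξ - I) = 2 * I * ζ := by
    linear_combination coe_eq_of_xc h
  have h3 := congrArg (fun z => ‖z‖ ^ 2) h2
  simp only [norm_mul, mul_pow, Circle.norm_coe, norm_I, ← circle_dist] at h3
  rw [← normSq_eq_norm_sq ((xc ζ ξ : ℂ) - I), normSq_apply] at h3
  simp at h3
  nlinarith

theorem dist_sq_of_xc {ζ ξ : Circle} (h : ξ ≠ ζ) : dist ξ ζ ^ 2 = 4 / (1 + xc ζ ξ ^ 2) := by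
  rw [eq_div_iff (by positivity)]; exact one_add_xc_sq h

theorem xc_sub {ζ ξ η : Circle} (h : ξ ≠ ζ) (h' : η ≠ ζ) :
    ((xc ζ ξ : ℂ) - xc ζ η) * (((ξ : ℂ) - ζ) * (η - ζ)) = -2 * I * ζ * (ξ - η) := by
  rw [coe_xc h, coe_xc h']
  field_simp [circle_sub_ne h, circle_sub_ne h']
  ring

/-- The chordal distance in the coordinate. It compares bounds in the variable `x` with Lipschitz
bounds on the circle. -/
theorem dist_sq_xc {ζ ξ η : Circle} (h : ξ ≠ ζ) (h' : η ≠ ζ) :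
    dist ξ η ^ 2 * ((1 + xc ζ ξ ^ 2) * (1 + xc ζ η ^ 2)) = 4 * (xc ζ ξ - xc ζ η) ^ 2 := by
  have h3 := congrArg (fun z => ‖z‖ ^ 2) (xc_sub h h')
  simp only [norm_mul, mul_pow, Circle.norm_coe, norm_I, ← circle_dist, ← ofReal_sub,
    norm_real, Real.norm_eq_abs, sq_abs, norm_neg] at h3
  have h1 := one_add_xc_sq h
  have h2 := one_add_xc_sq h'
  norm_num at h3
  have e : 4 * dist ξ η ^ 2 * ((1 + xc ζ ξ ^ 2) * (1 + xc ζ η ^ 2)) =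
    (xc ζ ξ - xc ζ η) ^ 2 * ((dist ξ ζ ^ 2 * (1 + xc ζ ξ ^ 2)) *
      (dist η ζ ^ 2 * (1 + xc ζ η ^ 2))) := by
    linear_combination (-((1 + xc ζ ξ ^ 2) * (1 + xc ζ η ^ 2))) * h3
  rw [h1, h2] at e
  linarith

theorem xc_injective {ζ ξ η : Circle} (h : ξ ≠ ζ) (h' : η ≠ ζ) (he : xc ζ ξ = xc ζ η) :
    ξ = η := by
  have h1 := dist_sq_xc h h'
  rw [he, sub_self] at h1
  have h2 : dist ξ η ^ 2 = 0 := by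
    have : (0 : ℝ) < (1 + xc ζ η ^ 2) * (1 + xc ζ η ^ 2) := by positivity
    have h3 : dist ξ η ^ 2 * ((1 + xc ζ η ^ 2) * (1 + xc ζ η ^ 2)) = 0 := by linarith
    rcases mul_eq_zero.mp h3 with h | h
    · exact h
    · exact absurd h this.ne'
  exact dist_eq_zero.mp (pow_eq_zero_iff (two_ne_zero) |>.mp h2)

theorem norm_add_I_sub_I (x : ℝ) : ‖((x : ℂ) + I) / (x - I)‖ = 1 := by
  have h1 : ‖(x : ℂ) + I‖ ^ 2 = 1 + x ^ 2 := by
    rw [← normSq_eq_norm_sq, normSq_apply]; simp; ring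
  have h2 : ‖(x : ℂ) - I‖ ^ 2 = 1 + x ^ 2 := by
    rw [← normSq_eq_norm_sq, normSq_apply]; simp; ring
  have h3 : ‖(x : ℂ) + I‖ = ‖(x : ℂ) - I‖ := by
    rw [← h2] at h1
    exact (pow_left_inj₀ (norm_nonneg _) (norm_nonneg _) two_ne_zero).mp h1
  rw [norm_div, h3, div_self]
  intro h; rw [h] at h2; nlinarith [sq_nonneg x]

theorem real_sub_I_ne (x : ℝ) : (x : ℂ) - I ≠ 0 := by
  intro h
  have := congrArg Complex.im h
  simp at this

/-- The point with coordinate `x` at `ζ`. -/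
def pt (ζ : Circle) (x : ℝ) : Circle :=
  ζ * ⟨((x : ℂ) + I) / (x - I), mem_sphere_zero_iff_norm.mpr (norm_add_I_sub_I x)⟩

theorem coe_pt (ζ : Circle) (x : ℝ) : (pt ζ x : ℂ) = ζ * (((x : ℂ) + I) / (x - I)) := by
  rfl

theorem pt_ne (ζ : Circle) (x : ℝ) : pt ζ x ≠ ζ := by
  intro h
  have h1 := congrArg (fun ξ : Circle => (ξ : ℂ)) h
  simp only [coe_pt] at h1
  have h2 : ((x : ℂ) + I) / (x - I) = 1 :=
    mul_left_cancel₀ (Circle.coe_ne_zero ζ) (h1.trans (mul_one _).symm)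
  rw [div_eq_one_iff_eq (real_sub_I_ne x)] at h2
  have := congrArg Complex.im h2
  simp at this
  norm_num at this

theorem xc_pt (ζ : Circle) (x : ℝ) : xc ζ (pt ζ x) = x := by
  have h := coe_eq_of_xc (pt_ne ζ x)
  rw [coe_pt] at h
  have h1 := real_sub_I_ne x
  have h2 := Circle.coe_ne_zero ζ
  have h3 : ((x : ℂ) + I) * (xc ζ (pt ζ x) - I) = (xc ζ (pt ζ x) + I) * (x - I) := by
    apply mul_left_cancel₀ h2
    have : (ζ : ℂ) * (((x : ℂ) + I) * (xc ζ (pt ζ x) - I)) =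
      ζ * (((x : ℂ) + I) / (x - I)) * (xc ζ (pt ζ x) - I) * (x - I) := by
      field_simp
    rw [this, h]; ring
  have h4 : (2 * I : ℂ) * ((xc ζ (pt ζ x) : ℂ) - x) = 0 := by linear_combination h3
  have h5 : ((xc ζ (pt ζ x) : ℂ) - x) = 0 := by
    rcases mul_eq_zero.mp h4 with h | h
    · simp at h
    · exact h
  exact_mod_cast sub_eq_zero.mp h5

theorem pt_xc {ζ ξ : Circle} (h : ξ ≠ ζ) : pt ζ (xc ζ ξ) = ξ :=
  xc_injective (pt_ne _ _) h (xc_pt _ _)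

theorem continuous_pt (ζ : Circle) : Continuous (pt ζ) := by
  rw [continuous_circle_iff]
  have : (fun x => (pt ζ x : ℂ)) = fun x : ℝ => (ζ : ℂ) * (((x : ℂ) + I) / (x - I)) :=
    funext (coe_pt ζ)
  change Continuous fun x => (pt ζ x : ℂ)
  rw [this]
  exact continuous_const.mul (Continuous.div (by fun_prop) (by fun_prop) real_sub_I_ne)

/-- A group element acts on the coordinates at `ζ` and at its image by an affine map. -/
theorem xc_act_sub_mul (G : SL(2, ℝ)) {ζ ξ η : Circle} (h : ξ ≠ ζ) (h' : η ≠ ζ) :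
    (xc (act G ζ) (act G ξ) - xc (act G ζ) (act G η)) =
      (xc ζ ξ - xc ζ η) * (derivNorm G ζ)⁻¹ := by
  have h1 : act G ξ ≠ act G ζ := fun e => h (act_injective G e)
  have h2 : act G η ≠ act G ζ := fun e => h' (act_injective G e)
  have e1 := xc_sub h1 h2
  have e2 := xc_sub h h'
  have hj := jac_ne_zero G ζ
  have hj1 := jac_ne_zero G ξ
  have hj2 := jac_ne_zero G η
  rw [coe_act_sub, coe_act_sub, coe_act_sub] at e1
  have hc : jac G ζ * conj (jac G ζ) = ‖jac G ζ‖ ^ 2 := by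
    rw [mul_conj, normSq_eq_norm_sq]; push_cast; rfl
  -- Since `G ζ` is `ζ` times `conj (jac) / jac`, the product `G ζ · jac²` is `ζ |jac|²`. This is
  -- why the dilation factor is a positive real number.
  have ha : (act G ζ : ℂ) * jac G ζ = ζ * conj (jac G ζ) := by
    rw [coe_act_mul_jac]
    simp only [jac, map_add, map_mul, conj_conj, circle_conj]
    field_simp [Circle.coe_ne_zero]
    ring
  have hz : (act G ζ : ℂ) * (jac G ζ * jac G ζ) = ζ * ‖jac G ζ‖ ^ 2 := by
    rw [← mul_assoc, ha, mul_assoc, mul_comm (conj _), hc]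
  have h3 : ((xc (act G ζ) (act G ξ) : ℂ) - xc (act G ζ) (act G η)) *
      (((ξ : ℂ) - ζ) * (η - ζ)) = -2 * I * ζ * (ξ - η) * ‖jac G ζ‖ ^ 2 := by
    have e3 : ((xc (act G ζ) (act G ξ) : ℂ) - xc (act G ζ) (act G η)) *
      (((ξ : ℂ) - ζ) * (η - ζ)) =
      ((xc (act G ζ) (act G ξ) : ℂ) - xc (act G ζ) (act G η)) *
      ((((ξ : ℂ) - ζ) / (jac G ξ * jac G ζ)) * ((η - ζ) / (jac G η * jac G ζ))) *
      (jac G ξ * jac G η * (jac G ζ * jac G ζ)) := by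
      field_simp
    rw [e3, e1]
    have e4 : -2 * I * (act G ζ : ℂ) * ((ξ - η) / (jac G ξ * jac G η)) *
      (jac G ξ * jac G η * (jac G ζ * jac G ζ)) =
      -2 * I * ((act G ζ : ℂ) * (jac G ζ * jac G ζ)) * (ξ - η) := by
      field_simp
    rw [e4, hz]
    ring
  rw [← e2] at h3
  have h4 : ((xc (act G ζ) (act G ξ) : ℂ) - xc (act G ζ) (act G η)) =
      (xc ζ ξ - xc ζ η) * ‖jac G ζ‖ ^ 2 := by
    apply mul_right_cancel₀ (mul_ne_zero (circle_sub_ne h) (circle_sub_ne h'))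
    rw [h3]; ring
  rw [derivNorm_eq, inv_inv]
  exact_mod_cast h4

/-- Where a group element has derivative of modulus one, it acts on the coordinates by
translation. -/
theorem xc_act_sub {G : SL(2, ℝ)} {ζ ξ η : Circle} (hG : derivNorm G ζ = 1) (h : ξ ≠ ζ)
    (h' : η ≠ ζ) :
    xc (act G ζ) (act G ξ) - xc (act G ζ) (act G η) = xc ζ ξ - xc ζ η := by
  rw [xc_act_sub_mul G h h', hG, inv_one, mul_one]

/-- The derivative in terms of the coordinates at a point with derivative of modulus one. -/
theorem derivNorm_of_xc {G : SL(2, ℝ)} {ζ ξ : Circle} (hG : derivNorm G ζ = 1) (h : ξ ≠ ζ) :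
    derivNorm G ξ = (1 + xc ζ ξ ^ 2) / (1 + xc (act G ζ) (act G ξ) ^ 2) := by
  have h1 : act G ξ ≠ act G ζ := fun e => h (act_injective G e)
  have h2 := dist_act_sq G ξ ζ
  rw [hG, mul_one, dist_sq_of_xc h, dist_sq_of_xc h1] at h2
  have : (0 : ℝ) < 1 + xc ζ ξ ^ 2 := by positivity
  have : (0 : ℝ) < 1 + xc (act G ζ) (act G ξ) ^ 2 := by positivity
  field_simp at h2 ⊢
  linarith

/-! ### Isometric circles -/

section IsoCircle

variable {G : SL(2, ℝ)}

theorem jac_eq_mul_sub_pole (hG : beta G ≠ 0) (z : ℂ) : jac G z = beta G * (z - pole G) := by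
  rw [jac, pole]; field_simp; ring

/-- The isometric circle is the locus `|β z + conj α| = 1`, where the derivative has modulus one.
From here on the arcs are described through `derivNorm` only. -/
theorem mem_isoDisc_iff (hG : beta G ≠ 0) (ξ : Circle) :
    (ξ : ℂ) ∈ isoDisc G ↔ 1 < derivNorm G ξ := by
  have h1 := norm_pos_iff.mpr (jac_ne_zero G ξ)
  have h2 := norm_pos_iff.mpr hG
  rw [derivNorm_eq, one_lt_inv₀ (by positivity), pow_lt_one_iff_of_nonneg h1.le two_ne_zero,
    jac_eq_mul_sub_pole hG, norm_mul, isoDisc, Metric.mem_ball, dist_eq_norm,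
    lt_inv_comm₀ (by rw [jac_eq_mul_sub_pole hG, norm_mul] at h1; exact pos_of_mul_pos_right h1 h2.le) h2,
    ← one_div, lt_div_iff₀
      (by rw [jac_eq_mul_sub_pole hG, norm_mul] at h1; exact pos_of_mul_pos_right h1 h2.le)]

theorem norm_pole_sq (hG : beta G ≠ 0) : ‖pole G‖ ^ 2 = 1 + (‖beta G‖ ^ 2)⁻¹ := by
  have h2 := norm_pos_iff.mpr hG
  rw [pole, norm_div, norm_neg, RCLike.norm_conj, div_pow, norm_alpha_sq, add_div, one_div,
    div_self (pow_pos h2 2).ne', add_comm]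

theorem norm_pole_gt (hG : beta G ≠ 0) : 1 < ‖pole G‖ := by
  have h2 := norm_pos_iff.mpr hG
  have h3 : 0 < (‖beta G‖ ^ 2)⁻¹ := by positivity
  have := norm_pole_sq hG
  nlinarith [norm_nonneg (pole G)]

/-- Orthogonality to the unit circle reads `|ω|² = 1 + r²` with `r = 1 / |β|`. The half-opening thus
has cosine `1 / |ω|` and sine `r / |ω|`. -/
theorem cos_sin_half_opening (hG : beta G ≠ 0) :
    (‖pole G‖ : ℂ) * Complex.cos (Real.arccos (‖pole G‖⁻¹) : ℝ) = 1 ∧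
    (‖pole G‖ : ℂ) * Complex.sin (Real.arccos (‖pole G‖⁻¹) : ℝ) = (‖beta G‖ : ℂ)⁻¹ := by
  have h1 := norm_pole_gt hG
  have h2 := norm_pos_iff.mpr hG
  have h3 : ‖pole G‖⁻¹ ≤ 1 := inv_le_one_of_one_le₀ h1.le
  have h4 : 0 ≤ ‖pole G‖⁻¹ := by positivity
  rw [← ofReal_cos, ← ofReal_sin, Real.cos_arccos (by linarith) h3, Real.sin_arccos]
  constructor
  · rw [← ofReal_mul, mul_inv_cancel₀ (by positivity)]; simp
  · rw [← ofReal_mul, ← ofReal_inv]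
    congr 1
    have h5 : ‖pole G‖ * √(1 - ‖pole G‖⁻¹ ^ 2) = √(‖pole G‖ ^ 2 - 1) := by
      rw [← Real.sqrt_sq (norm_nonneg (pole G)), ← Real.sqrt_mul (by positivity),
        Real.sqrt_sq (norm_nonneg (pole G))]
      congr 1
      field_simp
    rw [h5, norm_pole_sq hG, add_sub_cancel_left, ← inv_pow, Real.sqrt_sq (by positivity)]

theorem conj_pole_mul_exp (θ : ℝ) :
    conj (pole G) * Circle.exp (arg (pole G) + θ) =
      ‖pole G‖ * Complex.cos θ + ‖pole G‖ * Complex.sin θ * I := by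
  have h := norm_mul_exp_arg_mul_I (pole G)
  have h' : conj (pole G) * Complex.exp (arg (pole G) * I) = ‖pole G‖ := by
    by_cases h0 : pole G = 0
    · simp [h0]
    · have hn : (‖pole G‖ : ℂ) ≠ 0 := by simpa using h0
      have h2 : conj (pole G) * pole G = ‖pole G‖ * ‖pole G‖ := by
        rw [mul_comm, mul_conj, normSq_eq_norm_sq]; push_cast; ring
      apply mul_left_cancel₀ hn
      rw [← h2]
      linear_combination conj (pole G) * h
  rw [Circle.coe_exp, ofReal_add, add_mul, Complex.exp_add, ← mul_assoc, h', exp_mul_I]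
  ring

theorem conj_pole_mul_arcStart (hG : beta G ≠ 0) :
    conj (pole G) * arcStart G = 1 + (‖beta G‖ : ℂ)⁻¹ * I := by
  obtain ⟨h1, h2⟩ := cos_sin_half_opening hG
  rw [arcStart, conj_pole_mul_exp, h1, h2]

theorem conj_pole_mul_arcEnd (hG : beta G ≠ 0) :
    conj (pole G) * arcEnd G = 1 - (‖beta G‖ : ℂ)⁻¹ * I := by
  obtain ⟨h1, h2⟩ := cos_sin_half_opening hG
  rw [arcEnd, sub_eq_add_neg, conj_pole_mul_exp, ofReal_neg, cos_neg, sin_neg, mul_neg, h1, h2]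
  ring

/-- An endpoint of the arc cut by the isometric circle, as a function of the orientation. -/
def arcPt (e : Bool) (G : SL(2, ℝ)) : Circle := if e then arcEnd G else arcStart G

/-- The sign attached to an orientation. -/
def sg (e : Bool) : ℝ := if e then 1 else -1

theorem sg_not (e : Bool) : sg (!e) = -sg e := by cases e <;> simp [sg]

theorem sg_mul_self (e : Bool) : sg e * sg e = 1 := by cases e <;> simp [sg]

theorem conj_pole_mul_arcPt (hG : beta G ≠ 0) (e : Bool) :
    conj (pole G) * arcPt e G = 1 - sg e * (‖beta G‖ : ℂ)⁻¹ * I := by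
  cases e
  · simp [arcPt, sg, conj_pole_mul_arcStart hG]
  · simp [arcPt, sg, conj_pole_mul_arcEnd hG]

theorem alpha_ne_zero (G : SL(2, ℝ)) : alpha G ≠ 0 := by
  intro h
  have := norm_alpha_sq G
  rw [h] at this
  simp at this
  nlinarith [sq_nonneg ‖beta G‖]

theorem alpha_mul_arcPt (hG : beta G ≠ 0) (e : Bool) :
    alpha G * arcPt e G = -conj (beta G) * (1 - sg e * (‖beta G‖ : ℂ)⁻¹ * I) := by
  have h := conj_pole_mul_arcPt hG e
  have hb : conj (beta G) ≠ 0 := by simpa using hG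
  rw [pole, map_div₀, map_neg, conj_conj, div_mul_eq_mul_div, div_eq_iff hb] at h
  linear_combination -h

theorem jac_arcPt (hG : beta G ≠ 0) (e : Bool) :
    alpha G * jac G (arcPt e G) = 1 + sg e * ‖beta G‖ * I := by
  have h := alpha_mul_arcPt hG e
  have hn : (‖beta G‖ : ℂ) ≠ 0 := by simpa using hG
  have hb : beta G * conj (beta G) = ‖beta G‖ ^ 2 := by
    rw [mul_conj, normSq_eq_norm_sq]; push_cast; ring
  have : alpha G * jac G (arcPt e G) =
      beta G * (alpha G * arcPt e G) + alpha G * conj (alpha G) := by rw [jac]; ring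
  rw [this, h, alpha_mul_conj]
  have : beta G * (-conj (beta G) * (1 - sg e * (‖beta G‖ : ℂ)⁻¹ * I)) =
    -(beta G * conj (beta G)) * (1 - sg e * (‖beta G‖ : ℂ)⁻¹ * I) := by ring
  rw [this, hb]
  field_simp
  ring

theorem norm_sq_one_add (e : Bool) (x : ℝ) : ‖(1 + sg e * x * I : ℂ)‖ ^ 2 = 1 + x ^ 2 := by
  rw [← normSq_eq_norm_sq, normSq_apply]
  cases e <;> simp [sg] <;> ring

theorem derivNorm_arcPt (hG : beta G ≠ 0) (e : Bool) : derivNorm G (arcPt e G) = 1 := by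
  have h := congrArg (fun z => ‖z‖ ^ 2) (jac_arcPt hG e)
  simp only [norm_mul, mul_pow] at h
  have h2 := norm_sq_one_add e ‖beta G‖
  have hm : ‖(1 + sg e * ‖beta G‖ * I : ℂ)‖ ^ 2 = (‖(1 : ℂ) + sg e * ‖beta G‖ * I‖) ^ 2 := rfl
  rw [h2, norm_alpha_sq] at h
  have : ‖jac G (arcPt e G)‖ ^ 2 = 1 := by
    have h3 : (0 : ℝ) < 1 + ‖beta G‖ ^ 2 := by positivity
    have h4 : (1 + ‖beta G‖ ^ 2) * (‖jac G (arcPt e G)‖ ^ 2 - 1) = 0 := by linear_combination h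
    rcases mul_eq_zero.mp h4 with h5 | h5
    · exact absurd h5 h3.ne'
    · linarith
  rw [derivNorm_eq, this, inv_one]

/-- The interior of the isometric circle of `F` is sent to the exterior of that of `F⁻¹`, so the two
endpoints exchange their roles. -/
theorem act_arcPt (hG : beta G ≠ 0) (e : Bool) : act G (arcPt e G) = arcPt (!e) G⁻¹ := by
  have hG' : beta G⁻¹ ≠ 0 := by rw [beta_inv]; exact neg_ne_zero.mpr hG
  apply Circle.ext
  have hj := jac_ne_zero G (arcPt e G)
  have ha := alpha_ne_zero G
  have hac : conj (alpha G) ≠ 0 := by simpa using ha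
  have h1 := coe_act_mul_jac G (arcPt e G)
  have h2 := alpha_mul_arcPt hG' (!e)
  have h3 := alpha_mul_arcPt hG e
  have h4 := jac_arcPt hG e
  rw [alpha_inv, beta_inv, norm_neg, sg_not] at h2
  have hn : (‖beta G‖ : ℂ) ≠ 0 := by simpa using hG
  have hb : beta G * conj (beta G) = ‖beta G‖ ^ 2 := by
    rw [mul_conj, normSq_eq_norm_sq]; push_cast; ring
  have hs : (sg e : ℂ) * sg e = 1 := by rw [← ofReal_mul, sg_mul_self]; simp
  apply mul_right_cancel₀ hj
  apply mul_left_cancel₀ (mul_ne_zero ha hac)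
  rw [h1, h3]
  have e1 : alpha G * conj (alpha G) * ((arcPt (!e) G⁻¹ : ℂ) * jac G (arcPt e G)) =
    (conj (alpha G) * (arcPt (!e) G⁻¹)) * (alpha G * jac G (arcPt e G)) := by ring
  rw [e1, h2, h4, alpha_mul_conj, hb]
  simp only [ofReal_neg, map_neg]
  have hI := I_mul_I
  field_simp
  linear_combination (‖beta G‖ * conj (beta G)) * hs - ‖beta G‖ * conj (beta G) * sg e * sg e * hI

theorem arcPt_ne (hG : beta G ≠ 0) (e : Bool) : arcPt (!e) G ≠ arcPt e G := by
  intro h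
  have h1 := conj_pole_mul_arcPt hG e
  have h2 := conj_pole_mul_arcPt hG (!e)
  have hn : (‖beta G‖ : ℂ) ≠ 0 := by simpa using hG
  rw [h, h1, sg_not, ofReal_neg] at h2
  have h3 : (sg e : ℂ) * (‖beta G‖ : ℂ)⁻¹ * I = 0 := by linear_combination (-1 / 2 : ℂ) * h2
  cases e <;> simp [sg, hG] at h3

/-- Seen from one endpoint, the other is at an angle equal to the full opening of the arc. Its
coordinate is, up to sign, the cotangent of the half-opening, namely `(1 / |ω|) / (r / |ω|) = |β|`.
-/
theorem xc_arcPt (hG : beta G ≠ 0) (e : Bool) :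
    xc (arcPt e G) (arcPt (!e) G) = sg e * ‖beta G‖ := by
  have h := coe_xc (arcPt_ne hG e)
  have h0 := circle_sub_ne (arcPt_ne hG e)
  have h1 := conj_pole_mul_arcPt hG e
  have h2 := conj_pole_mul_arcPt hG (!e)
  rw [sg_not, ofReal_neg] at h2
  have hn : (‖beta G‖ : ℂ) ≠ 0 := by simpa using hG
  have hs : (sg e : ℂ) * sg e = 1 := by rw [← ofReal_mul, sg_mul_self]; simp
  have hp : conj (pole G) ≠ 0 := by
    have := norm_pole_gt hG
    intro h3
    rw [map_eq_zero] at h3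
    rw [h3] at this
    simp at this
    linarith
  have h5 : (xc (arcPt e G) (arcPt (!e) G) : ℂ) = (sg e * ‖beta G‖ : ℝ) := by
    rw [h, div_eq_iff h0]
    apply mul_left_cancel₀ hp
    have e1 : conj (pole G) * (I * ((arcPt (!e) G : ℂ) + arcPt e G)) =
      I * (conj (pole G) * arcPt (!e) G + conj (pole G) * arcPt e G) := by ring
    have e2 : conj (pole G) * (((sg e * ‖beta G‖ : ℝ) : ℂ) * ((arcPt (!e) G : ℂ) - arcPt e G)) =
      ((sg e * ‖beta G‖ : ℝ) : ℂ) *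
        (conj (pole G) * arcPt (!e) G - conj (pole G) * arcPt e G) := by ring
    rw [e1, e2, h1, h2]
    push_cast
    field_simp
    linear_combination (-2 * I * ‖beta G‖) * hs
  exact_mod_cast h5

/-- The action on the coordinate at an endpoint of the isometric circle. -/
theorem xc_act_arcPt (hG : beta G ≠ 0) (e : Bool) {ξ : Circle} (h : ξ ≠ arcPt e G) :
    xc (arcPt (!e) G⁻¹) (act G ξ) = xc (arcPt e G) ξ - 2 * (sg e * ‖beta G‖) := by
  have hG' : beta G⁻¹ ≠ 0 := by rw [beta_inv]; exact neg_ne_zero.mpr hG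
  have h1 := xc_act_sub (derivNorm_arcPt hG e) h (arcPt_ne hG e)
  have h2 := xc_arcPt hG' (!e)
  rw [act_arcPt hG, act_arcPt hG, xc_arcPt hG, h2, beta_inv, norm_neg, sg_not] at h1
  linarith

theorem derivNorm_of_arcPt (hG : beta G ≠ 0) (e : Bool) {ξ : Circle} (h : ξ ≠ arcPt e G) :
    derivNorm G ξ = (1 + xc (arcPt e G) ξ ^ 2) /
      (1 + (xc (arcPt e G) ξ - 2 * (sg e * ‖beta G‖)) ^ 2) := by
  rw [derivNorm_of_xc (derivNorm_arcPt hG e) h, act_arcPt hG, xc_act_arcPt hG e h]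

/-- By `derivNorm_of_arcPt` the derivative exceeds one exactly when the translation by `2 |β|`
decreases `x²`. -/
theorem one_lt_derivNorm_iff (hG : beta G ≠ 0) (e : Bool) {ξ : Circle} (h : ξ ≠ arcPt e G) :
    1 < derivNorm G ξ ↔ ‖beta G‖ < sg e * xc (arcPt e G) ξ := by
  have hb := norm_pos_iff.mpr hG
  rw [derivNorm_of_arcPt hG e h, lt_div_iff₀ (by positivity)]
  cases e <;> simp only [sg, Bool.false_eq_true, if_false, if_true]
  all_goals
    constructor <;> intro h1 <;> nlinarith

theorem one_le_derivNorm_iff (hG : beta G ≠ 0) (e : Bool) {ξ : Circle} (h : ξ ≠ arcPt e G) :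
    1 ≤ derivNorm G ξ ↔ ‖beta G‖ ≤ sg e * xc (arcPt e G) ξ := by
  have hb := norm_pos_iff.mpr hG
  rw [derivNorm_of_arcPt hG e h, le_div_iff₀ (by positivity)]
  cases e <;> simp only [sg, Bool.false_eq_true, if_false, if_true]
  all_goals
    constructor <;> intro h1 <;> nlinarith

theorem derivNorm_eq_one_iff (hG : beta G ≠ 0) (ξ : Circle) :
    derivNorm G ξ = 1 ↔ ∃ e, ξ = arcPt e G := by
  constructor
  · intro h
    by_cases h0 : ξ = arcPt true G
    · exact ⟨true, h0⟩
    · refine ⟨false, xc_injective h0 (arcPt_ne hG true) ?_⟩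
      have h1 := (one_le_derivNorm_iff hG true h0).mp h.ge
      have h2 := mt (one_lt_derivNorm_iff hG true h0).mpr h.le.not_gt
      have h3 := xc_arcPt hG true
      simp only [Bool.not_true] at h3
      rw [h3]
      simp only [sg, if_true] at *
      linarith
  · rintro ⟨e, rfl⟩; exact derivNorm_arcPt hG e

end IsoCircle

/-! ### The arcs cut by the sides of the polygon -/

section Arcs

variable {Γ₀ : Subgroup SL(2, ℝ)} {A : Type*} (P : LabelledIdealPolygon Γ₀ A)

theorem isoCircle_of_beta_eq_zero {G : SL(2, ℝ)} (h : beta G = 0) :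
    isoCircle G = {0} := by
  simp [isoCircle, pole, h]

theorem beta_gen_hat (a : A) : beta (P.gen (P.hat a)) = -beta (P.gen a) := by
  rw [P.gen_hat, beta_inv]

/-- If `β` vanished, division by zero would turn the isometric circles of `F_a` and of its inverse
into the single point `0`. The two different labels `a` and `â` would then have the same side. -/
theorem beta_gen_ne (a : A) : beta (P.gen a) ≠ 0 := by
  intro h
  apply P.hat_ne a
  apply P.side_injective
  change isoCircle (P.gen (P.hat (P.hat a))) ∩ _ = isoCircle (P.gen (P.hat a)) ∩ _
  rw [P.hat_hat, isoCircle_of_beta_eq_zero h,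
    isoCircle_of_beta_eq_zero (by rw [beta_gen_hat, h, neg_zero])]

/-- The modulus of the coefficient `β` of a side pairing. -/
def bn (a : A) : ℝ := ‖beta (P.gen a)‖

theorem bn_pos (a : A) : 0 < bn P a := norm_pos_iff.mpr (beta_gen_ne P a)

theorem norm_beta_hat (a : A) : ‖beta (P.gen (P.hat a))‖ = bn P a := by
  rw [beta_gen_hat, norm_neg, bn]

theorem bn_hat (a : A) : bn P (P.hat a) = bn P a := norm_beta_hat P a

/-- The endpoint of `[a]`: `ξ^R_a` for `true` and `ξ^L_a` for `false`. -/
def ep (e : Bool) (a : A) : Circle := if e then xiR P a else xiL P a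

theorem ep_eq_arcPt (e : Bool) (a : A) : ep P e a = arcPt e (P.gen (P.hat a)) := by
  cases e <;> rfl

theorem arcPt_gen (e : Bool) (a : A) : arcPt e (P.gen a) = ep P e (P.hat a) := by
  rw [ep_eq_arcPt, P.hat_hat]

theorem derivNorm_ep (e : Bool) (a : A) : derivNorm (P.gen (P.hat a)) (ep P e a) = 1 := by
  rw [ep_eq_arcPt]; exact derivNorm_arcPt (beta_gen_ne P _) e

theorem derivNorm_gen_ep (e : Bool) (a : A) : derivNorm (P.gen a) (ep P e (P.hat a)) = 1 := by
  rw [← arcPt_gen]; exact derivNorm_arcPt (beta_gen_ne P _) e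

theorem act_gen_ep (e : Bool) (a : A) :
    act (P.gen a) (ep P (!e) (P.hat a)) = ep P e a := by
  rw [← arcPt_gen, act_arcPt (beta_gen_ne P a), ep_eq_arcPt, P.gen_hat, Bool.not_not]

theorem ep_ne (e : Bool) (a : A) : ep P (!e) a ≠ ep P e a := by
  rw [ep_eq_arcPt, ep_eq_arcPt]; exact arcPt_ne (beta_gen_ne P _) e

/-- The coordinate at `ζ`, with the sign of the orientation `e`. -/
def xs (e : Bool) (ζ ξ : Circle) : ℝ := sg e * xc ζ ξ

theorem xs_sq (e : Bool) (ζ ξ : Circle) : xs e ζ ξ ^ 2 = xc ζ ξ ^ 2 := by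
  cases e <;> simp [xs, sg]

theorem xs_not (e : Bool) (ζ ξ : Circle) : xs (!e) ζ ξ = -xs e ζ ξ := by
  rw [xs, xs, sg_not]; ring

theorem xs_pt (e : Bool) (ζ : Circle) (x : ℝ) : xs e ζ (pt ζ (sg e * x)) = x := by
  rw [xs, xc_pt, ← mul_assoc, sg_mul_self, one_mul]

theorem pt_xs (e : Bool) {ζ ξ : Circle} (h : ξ ≠ ζ) : pt ζ (sg e * xs e ζ ξ) = ξ := by
  rw [xs, ← mul_assoc, sg_mul_self, one_mul, pt_xc h]

theorem xs_ep (e : Bool) (a : A) : xs e (ep P e a) (ep P (!e) a) = bn P a := by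
  rw [xs, ep_eq_arcPt, ep_eq_arcPt, xc_arcPt (beta_gen_ne P _), norm_beta_hat, ← mul_assoc,
    sg_mul_self, one_mul]

/-- One letter translates by `2 |β|`. The translation lengths of the cuspidal words are sums of
these steps. -/
theorem xs_act_gen (e : Bool) (a : A) {ξ : Circle} (h : ξ ≠ ep P (!e) (P.hat a)) :
    xs e (ep P e a) (act (P.gen a) ξ) = xs e (ep P (!e) (P.hat a)) ξ + 2 * bn P a := by
  rw [← arcPt_gen] at h ⊢
  have h1 := xc_act_arcPt (beta_gen_ne P a) (!e) h
  rw [xs, xs, ep_eq_arcPt, P.gen_hat]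
  rw [Bool.not_not] at h1
  rw [h1, sg_not, bn, mul_sub]
  linear_combination (2 * ‖beta (P.gen a)‖) * sg_mul_self e

/-- The open arc with the same endpoints as `[a]`. -/
def openArc (a : A) : Set Circle := {ξ | 1 < derivNorm (P.gen (P.hat a)) ξ}

/-- The closed arc with the same endpoints as `[a]`. -/
def closedArc (a : A) : Set Circle := {ξ | 1 ≤ derivNorm (P.gen (P.hat a)) ξ}

variable {P}

theorem mem_openArc_iff (e : Bool) {a : A} {ξ : Circle} (h : ξ ≠ ep P e a) :
    ξ ∈ openArc P a ↔ bn P a < xs e (ep P e a) ξ := by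
  rw [ep_eq_arcPt] at h ⊢
  rw [openArc, Set.mem_ofPred_eq, one_lt_derivNorm_iff (beta_gen_ne P _) e h, norm_beta_hat, xs]

theorem mem_closedArc_iff (e : Bool) {a : A} {ξ : Circle} (h : ξ ≠ ep P e a) :
    ξ ∈ closedArc P a ↔ bn P a ≤ xs e (ep P e a) ξ := by
  rw [ep_eq_arcPt] at h ⊢
  rw [closedArc, Set.mem_ofPred_eq, one_le_derivNorm_iff (beta_gen_ne P _) e h, norm_beta_hat, xs]

theorem mem_closedArc_iff_or {a : A} {ξ : Circle} :
    ξ ∈ closedArc P a ↔ ξ ∈ openArc P a ∨ ∃ e, ξ = ep P e a := by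
  simp_rw [ep_eq_arcPt]
  rw [← derivNorm_eq_one_iff (beta_gen_ne P _), closedArc, openArc, Set.mem_ofPred_eq,
    Set.mem_ofPred_eq, le_iff_lt_or_eq, eq_comm (a := (1 : ℝ))]

theorem mem_arc_iff {a : A} {ξ : Circle} :
    ξ ∈ arc P a ↔ ξ ∈ openArc P a ∨ ξ = ep P false a := by
  rw [arc, Set.mem_ofPred_eq, mem_isoDisc_iff (beta_gen_ne P _)]; rfl

theorem ep_notMem_openArc (e : Bool) (a : A) : ep P e a ∉ openArc P a :=
  (derivNorm_ep P e a).le.not_gt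

theorem mem_arc_iff_closedArc {a : A} {ξ : Circle} :
    ξ ∈ arc P a ↔ ξ ∈ closedArc P a ∧ ξ ≠ ep P true a := by
  rw [mem_arc_iff, mem_closedArc_iff_or]
  constructor
  · rintro (h | rfl)
    · exact ⟨.inl h, fun h' => ep_notMem_openArc true a (h' ▸ h)⟩
    · exact ⟨.inr ⟨_, rfl⟩, ep_ne P true a⟩
  · rintro ⟨h | ⟨e, rfl⟩, h2⟩
    · exact .inl h
    · cases e
      · exact .inr rfl
      · exact absurd rfl h2

theorem openArc_subset_arc (a : A) : openArc P a ⊆ arc P a := fun _ h => mem_arc_iff.mpr (.inl h)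

theorem arc_subset_closedArc (a : A) : arc P a ⊆ closedArc P a :=
  fun _ h => (mem_arc_iff_closedArc.mp h).1

theorem isOpen_openArc (a : A) : IsOpen (openArc P a) :=
  isOpen_lt continuous_const (continuous_derivNorm _)

theorem isClosed_closedArc (a : A) : IsClosed (closedArc P a) :=
  isClosed_le continuous_const (continuous_derivNorm _)

theorem openArc_eq_image (e : Bool) (a : A) :
    openArc P a = (fun x => pt (ep P e a) (sg e * x)) '' Set.Ioi (bn P a) := by
  ext ξ
  constructor
  · intro h
    have h0 : ξ ≠ ep P e a := fun h' => ep_notMem_openArc e a (h' ▸ h)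
    exact ⟨_, (mem_openArc_iff e h0).mp h, pt_xs e h0⟩
  · rintro ⟨x, hx, rfl⟩
    rw [mem_openArc_iff e (pt_ne _ _), xs_pt]
    exact hx

theorem continuous_pt_sg (e : Bool) (ζ : Circle) : Continuous fun x => pt ζ (sg e * x) :=
  (continuous_pt ζ).comp (continuous_const.mul continuous_id)

theorem isPreconnected_openArc (a : A) : IsPreconnected (openArc P a) := by
  rw [openArc_eq_image true]
  exact isPreconnected_Ioi.image _ (continuous_pt_sg _ _).continuousOn

theorem ep_mem_closure (e : Bool) (a : A) : ep P e a ∈ closure (openArc P a) := by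
  have h1 : Tendsto (fun x => pt (ep P (!e) a) (sg (!e) * x)) (𝓝[>] (bn P a))
      (𝓝 (pt (ep P (!e) a) (sg (!e) * bn P a))) :=
    ((continuous_pt_sg _ _).tendsto _).mono_left nhdsWithin_le_nhds
  have h2 : pt (ep P (!e) a) (sg (!e) * bn P a) = ep P e a := by
    have h3 := xs_ep P (!e) a
    rw [Bool.not_not] at h3
    rw [← h3, pt_xs]
    have := ep_ne P (!e) a
    rwa [Bool.not_not] at this
  rw [h2] at h1
  refine mem_closure_of_tendsto h1 ?_
  filter_upwards [self_mem_nhdsWithin] with x hx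
  rw [openArc_eq_image (!e)]
  exact ⟨x, hx, rfl⟩

/-- The sides lie in the closure of the complement of all the discs, and an open disc meeting that
closure would meet the complement itself. -/
theorem side_disjoint (a b : A) {z : ℂ} (hz : z ∈ isoCircle (P.gen (P.hat a)))
    (hz1 : z ∈ Metric.ball (0 : ℂ) 1) : z ∉ isoDisc (P.gen (P.hat b)) := by
  intro h
  have h1 := P.side_subset a ⟨hz, hz1⟩
  rw [region, mem_closure_iff] at h1
  obtain ⟨w, hw, hw1, hw2⟩ := h1 _ Metric.isOpen_ball h
  exact hw2 (Set.mem_biUnion (P.gen_mem _) hw)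

/-- The sides accumulate on their endpoints. -/
theorem eventually_mem_side {G : SL(2, ℝ)} (hG : beta G ≠ 0) (e : Bool) :
    ∀ᶠ τ : ℝ in 𝓝[>] 0, (pole G + ((arcPt e G : ℂ) - pole G) * Circle.exp (-sg e * τ) : ℂ) ∈
      isoCircle G ∩ Metric.ball 0 1 := by
  have hb := norm_pos_iff.mpr hG
  set r := ‖beta G‖⁻¹ with hr
  have hr0 : 0 < r := inv_pos.mpr hb
  have hω := norm_pole_sq hG
  rw [← inv_pow, ← hr] at hω
  have hnorm : ‖(arcPt e G : ℂ) - pole G‖ = r := by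
    have h := derivNorm_arcPt hG e
    rw [derivNorm_eq, inv_eq_one, jac_eq_mul_sub_pole hG,
      pow_eq_one_iff_of_nonneg (norm_nonneg _) two_ne_zero, norm_mul] at h
    rw [hr]
    exact eq_inv_of_mul_eq_one_right h
  -- Rotating the endpoint about the pole by the angle `τ` gives a point of squared modulus `1 - 4 r
  -- sin (τ/2) (cos (τ/2) - r sin (τ/2))`.
  have hpos : ∀ᶠ τ : ℝ in 𝓝[>] 0, 0 < Real.sin (τ / 2) ∧
      0 < Real.cos (τ / 2) - r * Real.sin (τ / 2) := by
    have h1 : ∀ᶠ τ : ℝ in 𝓝[>] 0, 0 < Real.sin (τ / 2) := by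
      have : Set.Ioo (0 : ℝ) 1 ∈ 𝓝[>] (0 : ℝ) := Ioo_mem_nhdsGT (by norm_num)
      filter_upwards [this] with τ hτ
      exact Real.sin_pos_of_pos_of_lt_pi (by linarith [hτ.1]) (by linarith [hτ.2, Real.pi_gt_three])
    have h2 : ∀ᶠ τ : ℝ in 𝓝[>] 0, 0 < Real.cos (τ / 2) - r * Real.sin (τ / 2) := by
      have hc : Continuous fun τ : ℝ => Real.cos (τ / 2) - r * Real.sin (τ / 2) := by fun_prop
      have := hc.tendsto 0
      simp at this
      exact (this.mono_left nhdsWithin_le_nhds).eventually (lt_mem_nhds one_pos)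
    exact h1.and h2
  filter_upwards [hpos] with τ hτ
  refine ⟨?_, ?_⟩
  · rw [isoCircle, mem_sphere_iff_norm, add_sub_cancel_left, norm_mul, Circle.norm_coe, mul_one,
      hnorm]
  · rw [mem_ball_zero_iff, ← sq_lt_one_iff₀ (norm_nonneg _), ← normSq_eq_norm_sq, normSq_add,
      normSq_mul, Circle.normSq_coe, mul_one, normSq_eq_norm_sq, normSq_eq_norm_sq, hnorm, hω]
    have h1 : (pole G * conj (((arcPt e G : ℂ) - pole G) * Circle.exp (-sg e * τ))).re =
        (conj (pole G) * ((arcPt e G : ℂ) - pole G) * Circle.exp (-sg e * τ)).re := by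
      rw [← conj_re]
      congr 1
      simp only [map_mul, conj_conj]
      ring
    have h2 : conj (pole G) * ((arcPt e G : ℂ) - pole G) = -(r : ℂ) ^ 2 - sg e * r * I := by
      rw [mul_sub, conj_pole_mul_arcPt hG, mul_comm _ (pole G), mul_conj, normSq_eq_norm_sq, hω, hr]
      push_cast
      ring
    rw [h1, h2, Circle.coe_exp, exp_mul_I, ← ofReal_cos, ← ofReal_sin]
    have h3 : ((-(r : ℂ) ^ 2 - sg e * r * I) * ((Real.cos (-sg e * τ) : ℂ) +
        (Real.sin (-sg e * τ) : ℂ) * I)).re =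
        -r ^ 2 * Real.cos (-sg e * τ) + sg e * r * Real.sin (-sg e * τ) := by
      have : (-(r : ℂ) ^ 2 - sg e * r * I) = ⟨-r ^ 2, -(sg e * r)⟩ := by
        apply Complex.ext <;> simp [← ofReal_pow]
      rw [this]
      generalize Real.cos (-sg e * τ) = c
      generalize Real.sin (-sg e * τ) = d
      simp [mul_re]
    rw [h3]
    have h4 : -r ^ 2 * Real.cos (-sg e * τ) + sg e * r * Real.sin (-sg e * τ) =
        -r ^ 2 * Real.cos τ - r * Real.sin τ := by
      cases e <;> simp [sg] <;> ring
    have h5 : Real.cos τ = 1 - 2 * Real.sin (τ / 2) ^ 2 := by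
      have := Real.cos_sq_add_sin_sq (τ / 2)
      have h6 := Real.cos_two_mul (τ / 2)
      rw [mul_div_cancel₀ τ two_ne_zero] at h6
      linarith
    have h6 : Real.sin τ = 2 * Real.sin (τ / 2) * Real.cos (τ / 2) := by
      rw [← Real.sin_two_mul, mul_div_cancel₀ τ two_ne_zero]
    rw [h4, h5, h6]
    have := mul_pos (mul_pos hr0 hτ.1) hτ.2
    nlinarith

/-- An endpoint is a limit of points of its side. If it were inside the open disc of another letter,
the side would enter that disc, against `side_disjoint`. -/
theorem ep_notMem_openArc' (e : Bool) (a b : A) : ep P e a ∉ openArc P b := by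
  intro h
  rw [openArc, Set.mem_ofPred_eq, ← mem_isoDisc_iff (beta_gen_ne P _)] at h
  set G := P.gen (P.hat a) with hG
  have hc : Continuous fun τ : ℝ =>
      (pole G + ((arcPt e G : ℂ) - pole G) * Circle.exp (-sg e * τ) : ℂ) := by fun_prop
  have h1 := hc.tendsto 0
  simp only [mul_zero, Circle.exp_zero, Circle.coe_one, mul_one, add_sub_cancel] at h1
  rw [hG, ← ep_eq_arcPt, ← hG] at h1
  have h2 : ∀ᶠ τ : ℝ in 𝓝[>] 0, (pole G + ((arcPt e G : ℂ) - pole G) * Circle.exp (-sg e * τ) : ℂ) ∈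
      isoDisc (P.gen (P.hat b)) := by
    rw [hG, ← ep_eq_arcPt, ← hG]
    exact (h1.mono_left nhdsWithin_le_nhds).eventually (Metric.isOpen_ball.mem_nhds h)
  obtain ⟨τ, h3, h4⟩ := (h2.and (eventually_mem_side (beta_gen_ne P (P.hat a)) e)).exists
  exact side_disjoint a b h4.1 h4.2 h3

/-- Connectedness: the endpoints of the second arc are not in the first, which is therefore covered
by the open second arc and the open complement of its closure. -/
theorem openArc_subset {a b : A} (h : (openArc P a ∩ openArc P b).Nonempty) :
    openArc P a ⊆ openArc P b := by
  refine (isPreconnected_openArc a).subset_left_of_subset_union (isOpen_openArc b)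
    (isClosed_closedArc (P := P) b).isOpen_compl ?_ ?_ h
  · rw [Set.disjoint_compl_right_iff_subset]
    exact fun ξ hξ => mem_closedArc_iff_or.mpr (.inl hξ)
  · intro ξ hξ
    by_cases h1 : ξ ∈ closedArc P b
    · rcases mem_closedArc_iff_or.mp h1 with h2 | ⟨e, rfl⟩
      · exact .inl h2
      · exact absurd hξ (ep_notMem_openArc' e b a)
    · exact .inr h1

theorem isoCircle_eq {a b : A} {e : Bool} (h : ep P e a = ep P e b) (hb : bn P a = bn P b) :
    a = b := by
  apply P.side_injective
  change isoCircle _ ∩ _ = isoCircle _ ∩ _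
  congr 1
  have h1 := conj_pole_mul_arcPt (beta_gen_ne P (P.hat a)) e
  have h2 := conj_pole_mul_arcPt (beta_gen_ne P (P.hat b)) e
  rw [norm_beta_hat, ← ep_eq_arcPt] at h1 h2
  rw [hb, h, ← h2] at h1
  have h3 := (starRingEnd ℂ).injective (mul_right_cancel₀ (Circle.coe_ne_zero _) h1)
  rw [isoCircle, isoCircle, h3, norm_beta_hat, norm_beta_hat, hb]

/-- The open arcs are pairwise disjoint. -/
theorem eq_of_mem_openArc {a b : A} {ξ : Circle} (ha : ξ ∈ openArc P a) (hb : ξ ∈ openArc P b) :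
    a = b := by
  have h1 := openArc_subset ⟨ξ, ha, hb⟩
  have h2 := openArc_subset ⟨ξ, hb, ha⟩
  have h3 : ep P true a ∈ closedArc P b :=
    closure_minimal (h1.trans fun ξ hξ => mem_closedArc_iff_or.mpr (.inl hξ))
      (isClosed_closedArc b) (ep_mem_closure true a)
  -- The right endpoint of `[a]` must be an endpoint of `[b]`. If it is the left one, the coordinate
  -- of `ξ` there has both signs. If it is the right one, the mutual inclusions force equal values
  -- of `bn`, hence equal isometric circles.
  rcases mem_closedArc_iff_or.mp h3 with h4 | ⟨e, he⟩
  · exact absurd h4 (ep_notMem_openArc' _ _ _)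
  · have ha0 : ξ ≠ ep P true a := fun h => ep_notMem_openArc true a (h ▸ ha)
    have hb0 : ξ ≠ ep P e b := fun h => ep_notMem_openArc e b (h ▸ hb)
    cases e
    · have h5 := (mem_openArc_iff true ha0).mp ha
      have h6 := (mem_openArc_iff false hb0).mp hb
      rw [he, xs, sg] at h5
      rw [xs, sg] at h6
      simp at h5 h6
      linarith [bn_pos P a, bn_pos P b]
    · refine isoCircle_eq he ?_
      have key : ∀ c d : A, ep P true c = ep P true d →
          openArc P c ⊆ openArc P d → bn P d ≤ bn P c := by
        intro c d hcd hsub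
        refine le_of_forall_gt_imp_ge_of_dense fun x hx => ?_
        have h7 : pt (ep P true c) (sg true * x) ∈ openArc P c := by
          rw [openArc_eq_image true]; exact ⟨x, hx, rfl⟩
        have h8 := hsub h7
        rw [hcd, mem_openArc_iff true (pt_ne _ _), xs_pt] at h8
        exact h8.le
      exact le_antisymm (key b a he.symm (openArc_subset ⟨ξ, hb, ha⟩))
        (key a b he (openArc_subset ⟨ξ, ha, hb⟩))

theorem ep_injective (e : Bool) : Function.Injective (ep P e) := by
  intro a b h
  set x := max (bn P a) (bn P b) + 1
  have h1 : pt (ep P e a) (sg e * x) ∈ openArc P a := by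
    rw [mem_openArc_iff e (pt_ne _ _), xs_pt]; linarith [le_max_left (bn P a) (bn P b)]
  have h2 : pt (ep P e a) (sg e * x) ∈ openArc P b := by
    rw [h, mem_openArc_iff e (pt_ne _ _), xs_pt]; linarith [le_max_right (bn P a) (bn P b)]
  exact eq_of_mem_openArc h1 h2

/-- The polygon provides a successor for each letter. The successor map is injective on a finite
alphabet, hence surjective, and this provides the predecessors. -/
theorem exists_adjacent [Finite A] (e : Bool) (a : A) : ∃ b, ep P e b = ep P (!e) a := by
  choose f hf using P.ideal
  have hf' : ∀ a, ep P true a = ep P false (f a) := hf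
  cases e
  · exact ⟨f a, (hf' a).symm⟩
  · have hinj : Function.Injective f := by
      intro b c h
      apply ep_injective true
      rw [hf', hf', h]
    obtain ⟨b, rfl⟩ := Finite.surjective_of_injective hinj a
    exact ⟨b, hf' b⟩

variable (P) in
/-- The letter adjacent to `a`: the previous one for `true` and the next one for `false`. -/
def nb [Finite A] (e : Bool) (a : A) : A := (exists_adjacent (P := P) e a).choose

theorem ep_nb [Finite A] (e : Bool) (a : A) : ep P e (nb P e a) = ep P (!e) a :=
  (exists_adjacent e a).choose_spec

theorem eq_nb_iff [Finite A] {e : Bool} {a b : A} : b = nb P e a ↔ ep P e b = ep P (!e) a :=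
  ⟨fun h => h ▸ ep_nb e a, fun h => ep_injective e (h.trans (ep_nb e a).symm)⟩

theorem nb_nb [Finite A] (e : Bool) (a : A) : nb P (!e) (nb P e a) = a := by
  symm
  rw [eq_nb_iff, Bool.not_not, ep_nb]

theorem nb_ne [Finite A] (e : Bool) (a : A) : nb P e a ≠ a := by
  intro h
  have := ep_nb (P := P) e a
  rw [h] at this
  exact ep_ne P e a this.symm

/-- If the two neighbours were the same letter, its arc would have the endpoints of `[a]` exchanged.
The coordinate of one common endpoint at the other would then be both positive and negative. This
excludes polygons with two sides. -/
theorem nb_true_ne_nb_false [Finite A] (a : A) : nb P true a ≠ nb P false a := by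
  intro h
  have h1 := ep_nb (P := P) true a
  have h2 := ep_nb (P := P) false a
  rw [← h] at h2
  have h3 := xs_ep P true a
  have h4 := xs_ep P false (nb P true a)
  simp only [Bool.not_true, Bool.not_false] at h1 h2 h3 h4
  rw [h1, h2] at h4
  have : xs true (ep P true a) (ep P false a) = -xs false (ep P true a) (ep P false a) :=
    xs_not false _ _
  rw [h3, h4] at this
  linarith [bn_pos P a, bn_pos P (nb P true a)]

theorem closedArc_subset_iUnion_arc [Finite A] (a : A) : closedArc P a ⊆ ⋃ b, arc P b := by
  intro ξ h
  rcases mem_closedArc_iff_or.mp h with h | ⟨e, rfl⟩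
  · exact Set.mem_iUnion.mpr ⟨a, mem_arc_iff.mpr (.inl h)⟩
  · cases e
    · exact Set.mem_iUnion.mpr ⟨a, mem_arc_iff.mpr (.inr rfl)⟩
    · exact Set.mem_iUnion.mpr ⟨nb P false a, mem_arc_iff.mpr (.inr (ep_nb false a).symm)⟩

/-- The union is open and closed in the connected circle. It is closed because each missing right
endpoint is the left endpoint of the next arc, and open because near a left endpoint the two
adjacent arcs cover everything. -/
theorem iUnion_arc [Finite A] [Nonempty A] : ⋃ a, arc P a = Set.univ := by
  have heq : ⋃ a, arc P a = ⋃ a, closedArc P a :=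
    subset_antisymm (Set.iUnion_mono arc_subset_closedArc)
      (Set.iUnion_subset closedArc_subset_iUnion_arc)
  have hclosed : IsClosed (⋃ a, arc P a) := by
    rw [heq]; exact isClosed_iUnion_of_finite isClosed_closedArc
  have hopen : IsOpen (⋃ a, arc P a) := by
    rw [isOpen_iff_mem_nhds]
    intro ξ hξ
    obtain ⟨b, hb⟩ := Set.mem_iUnion.mp hξ
    rcases mem_arc_iff.mp hb with h | rfl
    · filter_upwards [(isOpen_openArc b).mem_nhds h] with η hη
      exact Set.mem_iUnion.mpr ⟨b, openArc_subset_arc b hη⟩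
    · set c := nb P true b
      have hc : ep P true c = ep P false b := ep_nb true b
      -- The distance `2 / √(1 + x²)` to the vertex corresponds to a coordinate of absolute value
      -- `x`, beyond which a point lies in one of the two adjacent arcs.
      set x := max (bn P b) (bn P c) with hx
      have hx0 : 0 < x := lt_max_of_lt_left (bn_pos P b)
      have : Metric.ball (ep P false b) (2 / √(1 + x ^ 2)) ∈ 𝓝 (ep P false b) :=
        Metric.ball_mem_nhds _ (by positivity)
      filter_upwards [this] with η hη
      by_cases h0 : η = ep P false b
      · rw [h0]; exact Set.mem_iUnion.mpr ⟨b, mem_arc_iff.mpr (.inr rfl)⟩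
      · have h1 := dist_sq_of_xc h0
        have h2 : dist η (ep P false b) ^ 2 < 4 / (1 + x ^ 2) := by
          have h3 := pow_lt_pow_left₀ (Metric.mem_ball.mp hη) dist_nonneg two_ne_zero
          rwa [div_pow, Real.sq_sqrt (by positivity), show (2 : ℝ) ^ 2 = 4 by norm_num] at h3
        rw [h1, div_lt_div_iff_of_pos_left (by norm_num) (by positivity) (by positivity)] at h2
        have h3 : x < |xc (ep P false b) η| := by
          rw [← abs_of_pos hx0]; exact sq_lt_sq.mp (by linarith)
        rcases lt_abs.mp h3 with h4 | h4
        · refine Set.mem_iUnion.mpr ⟨c, openArc_subset_arc c ?_⟩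
          rw [mem_openArc_iff true (by rwa [hc]), hc, xs, sg]
          simp only [if_true, one_mul]
          exact (le_max_right _ _).trans_lt h4
        · refine Set.mem_iUnion.mpr ⟨b, openArc_subset_arc b ?_⟩
          rw [mem_openArc_iff false h0, xs, sg]
          simp only [Bool.false_eq_true, if_false, neg_one_mul]
          exact (le_max_left _ _).trans_lt h4
  refine IsClopen.eq_univ ⟨hclosed, hopen⟩ ?_
  exact ⟨ep P false (Classical.arbitrary A),
    Set.mem_iUnion.mpr ⟨_, mem_arc_iff.mpr (.inr rfl)⟩⟩

theorem exists_mem_arc [Finite A] [Nonempty A] (ξ : Circle) : ∃ a, ξ ∈ arc P a :=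
  Set.mem_iUnion.mp (iUnion_arc (P := P) ▸ Set.mem_univ ξ)

theorem eq_of_mem_arc {a b : A} {ξ : Circle} (ha : ξ ∈ arc P a) (hb : ξ ∈ arc P b) : a = b := by
  rcases mem_arc_iff.mp ha with ha | rfl
  · rcases mem_arc_iff.mp hb with hb | rfl
    · exact eq_of_mem_openArc ha hb
    · exact absurd ha (ep_notMem_openArc' _ _ _)
  · rcases mem_arc_iff.mp hb with hb | hb
    · exact absurd hb (ep_notMem_openArc' _ _ _)
    · exact ep_injective _ hb

theorem notMem_openArc_of_mem_closedArc {a b : A} {ξ : Circle} (ha : ξ ∈ closedArc P a)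
    (hab : a ≠ b) : ξ ∉ openArc P b := by
  intro h
  rcases mem_closedArc_iff_or.mp ha with ha | ⟨e, rfl⟩
  · exact hab (eq_of_mem_openArc ha h)
  · exact ep_notMem_openArc' _ _ _ h

theorem measurableSet_arc (a : A) : MeasurableSet (arc P a) := by
  have : arc P a = openArc P a ∪ {ep P false a} := by
    ext ξ; rw [mem_arc_iff]; rfl
  rw [this]
  exact (isOpen_openArc a).measurableSet.union (measurableSet_singleton _)

/-! ### The action of the side pairings -/

/-- Ping-pong: the derivative of `F_a⁻¹` at an image point is the reciprocal of that of `F_a`, so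
the exterior of `[â]` goes into the interior of `[a]`. -/
theorem act_gen_mem_openArc {a : A} {ξ : Circle} :
    act (P.gen a) ξ ∈ openArc P a ↔ ξ ∉ closedArc P (P.hat a) := by
  rw [openArc, closedArc, Set.mem_ofPred_eq, Set.mem_ofPred_eq, P.gen_hat, P.gen_hat, P.gen_hat,
    inv_inv, derivNorm_inv, not_le, one_lt_inv₀ (derivNorm_pos _ _)]

theorem act_gen_mem_closedArc {a : A} {ξ : Circle} :
    act (P.gen a) ξ ∈ closedArc P a ↔ ξ ∉ openArc P (P.hat a) := by
  rw [openArc, closedArc, Set.mem_ofPred_eq, Set.mem_ofPred_eq, P.gen_hat, P.gen_hat, P.gen_hat,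
    inv_inv, derivNorm_inv, not_lt, one_le_inv₀ (derivNorm_pos _ _)]

theorem act_gen_mem_arc {a : A} {ξ : Circle} :
    act (P.gen a) ξ ∈ arc P a ↔ ξ ∉ arc P (P.hat a) := by
  have h1 : act (P.gen a) ξ = ep P true a ↔ ξ = ep P false (P.hat a) := by
    rw [← act_gen_ep]; exact (act_injective _).eq_iff
  rw [mem_arc_iff_closedArc, mem_arc_iff, act_gen_mem_closedArc, not_or, Ne, h1]

end Arcs

/-! ### Cuspidal words -/

set_option linter.unusedSectionVars false

section Words

variable {Γ₀ : Subgroup SL(2, ℝ)} {A : Type*} (P : LabelledIdealPolygon Γ₀ A)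

theorem elt_nil : elt P [] = 1 := rfl

theorem elt_cons (a : A) (l : List A) : elt P (a :: l) = P.gen a * elt P l := rfl

theorem elt_append (l l' : List A) : elt P (l ++ l') = elt P l * elt P l' := by
  simp [elt]

theorem act_elt_cons (a : A) (l : List A) (ξ : Circle) :
    act (elt P (a :: l)) ξ = act (P.gen a) (act (elt P l) ξ) := by
  rw [elt_cons, act_mul]

variable [Finite A]

/-- The letter following `a` in the cuspidal words with orientation `e`. -/
def nx (e : Bool) (a : A) : A := nb P e (P.hat a)

/-- The cuspidal word with `n + 1` letters, orientation `e` and first letter `a`. -/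
def cw (e : Bool) (a : A) : ℕ → List A
  | 0 => [a]
  | n + 1 => a :: cw e (nx P e a) n

/-- The last letter of `cw e a n`. -/
def lt (e : Bool) (a : A) : ℕ → A
  | 0 => a
  | n + 1 => lt e (nx P e a) n

/-- The coordinate at `ξ_W` of the initial point of the arc of the word `W = cw e a n`. -/
def px (e : Bool) (a : A) : ℕ → ℝ
  | 0 => bn P a
  | n + 1 => 2 * bn P a + px e (nx P e a) n

/-- The translation length of the word `cw e a n`. -/
def tl (e : Bool) (a : A) (n : ℕ) : ℝ := px P e a n + bn P (lt P e a n)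

variable {P}

theorem ep_nx (e : Bool) (a : A) : ep P e (nx P e a) = ep P (!e) (P.hat a) := ep_nb e _

theorem eq_nx_iff {e : Bool} {a b : A} : b = nx P e a ↔ ep P e b = ep P (!e) (P.hat a) :=
  eq_nb_iff

theorem nx_ne_hat (e : Bool) (a : A) : nx P e a ≠ P.hat a := nb_ne e _

theorem nx_true_ne_nx_false (a : A) : nx P true a ≠ nx P false a := nb_true_ne_nb_false _

theorem nx_injective (e : Bool) : Function.Injective (nx P e) := by
  intro a b h
  have h1 : nb P (!e) (nx P e a) = nb P (!e) (nx P e b) := by rw [h]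
  rw [nx, nx, nb_nb, nb_nb] at h1
  rw [← P.hat_hat a, h1, P.hat_hat]

theorem eq_of_nx_eq {e e' : Bool} {a : A} (h : nx P e a = nx P e' a) : e = e' := by
  cases e <;> cases e'
  · rfl
  · exact absurd h.symm (nx_true_ne_nx_false a)
  · exact absurd h (nx_true_ne_nx_false a)
  · rfl

theorem lt_succ (e : Bool) (a : A) (n : ℕ) : lt P e a (n + 1) = nx P e (lt P e a n) := by
  induction n generalizing a with
  | zero => rfl
  | succ n ih => exact ih _

/-- The definition unfolds from the first letter; this form adds a letter at the end. -/
theorem px_succ (e : Bool) (a : A) (n : ℕ) :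
    px P e a (n + 1) = tl P e a n + bn P (lt P e a (n + 1)) := by
  induction n generalizing a with
  | zero => simp only [px, tl, lt]; ring
  | succ n ih =>
    have h : px P e a (n + 1 + 1) = 2 * bn P a + px P e (nx P e a) (n + 1) := rfl
    rw [h, ih]
    simp only [tl, px, lt]; ring

theorem tl_succ (e : Bool) (a : A) (n : ℕ) :
    tl P e a (n + 1) = 2 * bn P a + tl P e (nx P e a) n := by
  simp only [tl, px, lt]; ring

theorem length_cw (e : Bool) (a : A) (n : ℕ) : (cw P e a n).length = n + 1 := by
  induction n generalizing a with
  | zero => rfl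
  | succ n ih => simp [cw, ih]

theorem cw_ne_nil (e : Bool) (a : A) (n : ℕ) : cw P e a n ≠ [] := by
  cases n <;> simp [cw]

theorem head?_cw (e : Bool) (a : A) (n : ℕ) : (cw P e a n).head? = some a := by
  cases n <;> rfl

theorem cw_succ' (e : Bool) (a : A) (n : ℕ) :
    cw P e a (n + 1) = cw P e a n ++ [lt P e a (n + 1)] := by
  induction n generalizing a with
  | zero => rfl
  | succ n ih =>
    have h : cw P e a (n + 1 + 1) = a :: cw P e (nx P e a) (n + 1) := rfl
    rw [h, ih]; rfl

theorem getLast?_cw (e : Bool) (a : A) (n : ℕ) : (cw P e a n).getLast? = some (lt P e a n) := by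
  cases n with
  | zero => rfl
  | succ n => rw [cw_succ']; simp

theorem dropLast_cw_succ (e : Bool) (a : A) (n : ℕ) :
    (cw P e a (n + 1)).dropLast = cw P e a n := by
  rw [cw_succ']; simp

theorem cw_prefix (e : Bool) (a : A) {m n : ℕ} (h : m ≤ n) : cw P e a m <+: cw P e a n := by
  induction n, h using Nat.le_induction with
  | base => exact List.prefix_rfl
  | succ n _ ih => rw [cw_succ']; exact ih.trans (List.prefix_append _ _)

theorem isChain_cw (e : Bool) (a : A) (n : ℕ) :
    (cw P e a n).IsChain fun a b => b = nx P e a := by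
  induction n generalizing a with
  | zero => exact List.isChain_singleton _
  | succ n ih =>
    cases n with
    | zero => simp [cw]
    | succ n =>
      have := ih (nx P e a)
      simp only [cw] at this ⊢
      rw [List.isChain_cons_cons]
      exact ⟨rfl, this⟩

theorem eq_cw_of_isChain {e : Bool} {a : A} {l : List A}
    (h : (a :: l).IsChain fun a b => b = nx P e a) : a :: l = cw P e a l.length := by
  induction l generalizing a with
  | nil => rfl
  | cons b l ih =>
    rw [List.isChain_cons_cons] at h
    obtain ⟨rfl, h⟩ := h
    exact congrArg (a :: ·) (ih h)

theorem succ_hat_iff {a b : A} : Succ P (P.hat a) b ↔ b = nx P false a :=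
  Iff.trans eq_comm (eq_nx_iff (e := false)).symm

theorem succ_iff_hat {a b : A} : Succ P b (P.hat a) ↔ b = nx P true a :=
  (eq_nx_iff (e := true)).symm

theorem isRight_iff {W : List A} :
    IsRight P W ↔ 2 ≤ W.length ∧ W.IsChain fun a b => b = nx P true a := by
  have : (fun a b => Succ P b (P.hat a)) = fun a b => b = nx P true a := by
    funext a b
    exact propext succ_iff_hat
  rw [IsRight, this]

theorem isLeft_iff {W : List A} :
    IsLeft P W ↔ 2 ≤ W.length ∧ W.IsChain fun a b => b = nx P false a := by
  have : (fun a b => Succ P (P.hat a) b) = fun a b => b = nx P false a := by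
    funext a b
    exact propext succ_hat_iff
  rw [IsLeft, this]

theorem isChain_cw_iff {e e' : Bool} {a : A} {n : ℕ} (hn : 1 ≤ n) :
    ((cw P e a n).IsChain fun a b => b = nx P e' a) ↔ e = e' := by
  constructor
  · intro h
    obtain ⟨m, rfl⟩ : ∃ m, n = m + 1 := ⟨n - 1, by omega⟩
    cases m with
    | zero =>
      simp only [cw, List.isChain_cons_cons] at h
      exact eq_of_nx_eq h.1
    | succ m =>
      simp only [cw, List.isChain_cons_cons] at h
      exact eq_of_nx_eq h.1
  · rintro rfl; exact isChain_cw e a n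

theorem isRight_cw {e : Bool} {a : A} {n : ℕ} : IsRight P (cw P e a n) ↔ 1 ≤ n ∧ e = true := by
  rw [isRight_iff, length_cw]
  constructor
  · rintro ⟨h1, h2⟩; exact ⟨by omega, (isChain_cw_iff (by omega)).mp h2⟩
  · rintro ⟨h1, h2⟩; exact ⟨by omega, (isChain_cw_iff h1).mpr h2⟩

theorem isLeft_cw {e : Bool} {a : A} {n : ℕ} : IsLeft P (cw P e a n) ↔ 1 ≤ n ∧ e = false := by
  rw [isLeft_iff, length_cw]
  constructor
  · rintro ⟨h1, h2⟩; exact ⟨by omega, (isChain_cw_iff (by omega)).mp h2⟩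
  · rintro ⟨h1, h2⟩; exact ⟨by omega, (isChain_cw_iff h1).mpr h2⟩

/-- A one-letter word counts for both orientations, so both letters that could prolong it as a
cuspidal word are excluded. This is the last clause. -/
theorem follows_cw {e : Bool} {a b : A} {n : ℕ} :
    Follows P (cw P e a n) b ↔ b ≠ P.hat (lt P e a n) ∧ b ≠ nx P e (lt P e a n) ∧
      (n = 0 → b ≠ nx P (!e) (lt P e a n)) := by
  rw [Follows, getLast?_cw]
  simp only [Option.mem_def, Option.some.injEq, forall_eq', succ_hat_iff, succ_iff_hat,
    length_cw, isRight_cw, isLeft_cw]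
  cases e <;> rcases Nat.eq_zero_or_pos n with rfl | hn
  · simp
  · have : n ≠ 0 := hn.ne'
    simp [this]; omega
  · simp; tauto
  · have : n ≠ 0 := hn.ne'
    simp [this]; omega

/-! ### The action of the cuspidal words -/

theorem act_elt_cw_ep (e : Bool) (a : A) (n : ℕ) :
    act (elt P (cw P e a n)) (ep P e (lt P e a (n + 1))) = ep P e a := by
  induction n generalizing a with
  | zero =>
    rw [cw, act_elt_cons, elt_nil, act_one]
    change act _ (ep P e (nx P e a)) = _
    rw [ep_nx, act_gen_ep]
  | succ n ih =>
    rw [cw, act_elt_cons]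
    have : lt P e a (n + 1 + 1) = lt P e (nx P e a) (n + 1) := rfl
    rw [this, ih, ep_nx, act_gen_ep]

theorem derivNorm_elt_cw_ep (e : Bool) (a : A) (n : ℕ) :
    derivNorm (elt P (cw P e a n)) (ep P e (lt P e a (n + 1))) = 1 := by
  induction n generalizing a with
  | zero =>
    rw [cw, elt_cons, elt_nil, mul_one]
    change derivNorm _ (ep P e (nx P e a)) = _
    rw [ep_nx, derivNorm_gen_ep]
  | succ n ih =>
    rw [cw, elt_cons, derivNorm_mul]
    have : lt P e a (n + 1 + 1) = lt P e (nx P e a) (n + 1) := rfl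
    rw [this, ih, act_elt_cw_ep, ep_nx, derivNorm_gen_ep, mul_one]

theorem xs_act_elt_cw (e : Bool) (a : A) (n : ℕ) {ξ : Circle}
    (h : ξ ≠ ep P e (lt P e a (n + 1))) :
    xs e (ep P e a) (act (elt P (cw P e a n)) ξ) =
      xs e (ep P e (lt P e a (n + 1))) ξ + tl P e a n := by
  induction n generalizing a with
  | zero =>
    change ξ ≠ ep P e (nx P e a) at h
    change _ = xs e (ep P e (nx P e a)) ξ + _
    rw [ep_nx] at h ⊢
    rw [cw, act_elt_cons, elt_nil, act_one, xs_act_gen P e a h]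
    simp only [tl, px, lt]; ring
  | succ n ih =>
    have h1 : lt P e a (n + 1 + 1) = lt P e (nx P e a) (n + 1) := rfl
    rw [h1] at h ⊢
    have h2 : act (elt P (cw P e (nx P e a) n)) ξ ≠ ep P e (nx P e a) := by
      rw [← act_elt_cw_ep e (nx P e a) n]
      exact fun h3 => h (act_injective _ h3)
    have h3 := ih (nx P e a) h
    rw [ep_nx] at h2 h3
    rw [cw, act_elt_cons, xs_act_gen P e a h2, h3, tl_succ]
    ring

theorem act_elt_cw_ne {e : Bool} {a : A} {n : ℕ} {ξ : Circle}
    (h : ξ ≠ ep P e (lt P e a (n + 1))) : act (elt P (cw P e a n)) ξ ≠ ep P e a := by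
  rw [← act_elt_cw_ep e a n]; exact fun h' => h (act_injective _ h')

theorem px_pos (e : Bool) (a : A) (n : ℕ) : 0 < px P e a n := by
  induction n generalizing a with
  | zero => exact bn_pos P a
  | succ n ih => rw [px]; linarith [ih (nx P e a), bn_pos P a]

theorem tl_pos (e : Bool) (a : A) (n : ℕ) : 0 < tl P e a n :=
  add_pos (px_pos e a n) (bn_pos P _)

/-! ### Classification of the cuspidal words -/

theorem admissible_cw (e : Bool) (a : A) (n : ℕ) : Admissible P (cw P e a n) := by
  refine (isChain_cw e a n).imp ?_
  rintro a b rfl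
  exact nx_ne_hat e a

theorem elt_mem (W : List A) : elt P W ∈ Γ₀ :=
  Γ₀.list_prod_mem fun x hx => by
    obtain ⟨a, -, rfl⟩ := List.mem_map.mp hx
    exact P.gen_mem a

/-- At a fixed point with derivative of modulus one the denominator is real and equal to `±1`. The
trace is then `±2` and the discriminant vanishes. The moved point excludes scalar matrices. -/
theorem isParabolic_of_fixed {G : SL(2, ℝ)} {ζ ξ : Circle} (h : act G ζ = ζ)
    (hd : derivNorm G ζ = 1) (hξ : act G ξ ≠ ξ) :
    (G : Matrix (Fin 2) (Fin 2) ℝ).IsParabolic := by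
  have h1 := coe_act_mul_jac G ζ
  rw [h] at h1
  have h2 : conj (jac G ζ) = jac G ζ := by
    apply mul_left_cancel₀ (Circle.coe_ne_zero ζ)
    rw [h1]
    simp only [jac, map_add, map_mul, conj_conj, circle_conj]
    field_simp [Circle.coe_ne_zero]
    ring
  obtain ⟨r, hr⟩ := conj_eq_iff_real.mp h2
  have h3 : r ^ 2 = 1 := by
    rw [derivNorm_eq, inv_eq_one, hr, norm_real, Real.norm_eq_abs, sq_abs] at hd
    exact hd
  have h4 : alpha G + conj (alpha G) = 2 * r := by
    have e1 : alpha G * ζ = ζ * r - conj (beta G) := by rw [← hr]; linear_combination -h1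
    have e2 : beta G * ζ = r - conj (alpha G) := by rw [← hr, jac]; ring
    have e3 := alpha_mul_conj G
    have e4 : (alpha G - r) * (conj (alpha G) - r) = beta G * conj (beta G) := by
      apply mul_left_cancel₀ (Circle.coe_ne_zero ζ)
      linear_combination (conj (alpha G) - r) * e1 - conj (beta G) * e2
    have e5 : (r : ℂ) ^ 2 = 1 := by exact_mod_cast h3
    have hr0 : (r : ℂ) ≠ 0 := by
      intro h; rw [h] at e5; simp at e5
    apply mul_right_cancel₀ hr0
    linear_combination e3 - e4 + (-1 : ℂ) * e5
  have h5 : G 0 0 + G 1 1 = 2 * r := by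
    have := congrArg Complex.re h4
    simp [alpha] at this
    linarith
  have hdet := Matrix.det_fin_two (G : Matrix (Fin 2) (Fin 2) ℝ)
  rw [G.det_coe] at hdet
  refine ⟨?_, ?_⟩
  · rintro ⟨c, hc⟩
    have c00 := congrFun (congrFun hc 0) 0
    have c01 := congrFun (congrFun hc 0) 1
    have c10 := congrFun (congrFun hc 1) 0
    have c11 := congrFun (congrFun hc 1) 1
    simp at c00 c01 c10 c11
    apply hξ
    have hb : beta G = 0 := by
      apply Complex.ext <;> simp [beta, ← c00, ← c11, ← c01, ← c10]
    have ha : alpha G = c := by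
      apply Complex.ext <;> simp [alpha, ← c00, ← c11, ← c01, ← c10]
    apply Circle.ext
    have hc0 := alpha_ne_zero G
    rw [ha] at hc0
    rw [coe_act, jac, ha, hb]
    simp only [map_zero, add_zero, zero_mul, zero_add, conj_ofReal]
    field_simp
  · rw [Matrix.discr_fin_two, Matrix.trace_fin_two, G.det_coe, h5]
    nlinarith

/-- `nx` permutes a finite alphabet, so every letter is periodic, and multiples of a period are as
long as desired. -/
theorem exists_period (e : Bool) (a : A) (n : ℕ) :
    ∃ m, n ≤ m ∧ lt P e a (m + 1) = a := by
  have hit : ∀ k, lt P e a k = (nx P e)^[k] a := by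
    intro k
    induction k with
    | zero => rfl
    | succ k ih => rw [lt_succ, ih, Function.iterate_succ_apply']
  obtain ⟨k, hk, hk'⟩ := (nx_injective (P := P) e).mem_periodicPts a
  have h1 : Function.IsPeriodicPt (nx P e) (k * (n + 1)) a := hk'.mul_const (n + 1)
  have h2 : n + 1 ≤ k * (n + 1) := Nat.le_mul_of_pos_left _ hk
  refine ⟨k * (n + 1) - 1, by omega, ?_⟩
  rw [Nat.sub_add_cancel (by omega), hit]
  exact h1

theorem isParabolic_of_period {e : Bool} {a : A} {m : ℕ} (h : lt P e a (m + 1) = a) :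
    (elt P (cw P e a m) : Matrix (Fin 2) (Fin 2) ℝ).IsParabolic ∧
      act (elt P (cw P e a m)) (ep P e a) = ep P e a := by
  have h1 := act_elt_cw_ep (P := P) e a m
  have h2 := derivNorm_elt_cw_ep (P := P) e a m
  rw [h] at h1 h2
  refine ⟨isParabolic_of_fixed (ξ := ep P (!e) a) h1 h2 fun h3 => ?_, h1⟩
  have h4 := xs_act_elt_cw (P := P) e a m (ξ := ep P (!e) a) (by rw [h]; exact ep_ne P e a)
  rw [h, h3] at h4
  linarith [tl_pos (P := P) e a m]

theorem isCuspidal_cw (e : Bool) (a : A) (n : ℕ) : IsCuspidal P (cw P e a n) := by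
  obtain ⟨m, hm, hp⟩ := exists_period (P := P) e a n
  obtain ⟨h1, h2⟩ := isParabolic_of_period hp
  refine ⟨cw_ne_nil e a n, _, cw_prefix e a hm, admissible_cw e a m, h1, a, ?_⟩
  cases e
  · exact .inl h2
  · exact .inr h2

theorem act_elt_mem_closedArc {a : A} {l : List A} (h : Admissible P (a :: l)) {ξ : Circle}
    (hξ : ∀ b, ξ ∉ openArc P b) : act (elt P (a :: l)) ξ ∈ closedArc P a := by
  induction l generalizing a with
  | nil =>
    rw [act_elt_cons, act_gen_mem_closedArc, elt_nil, act_one]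
    exact hξ _
  | cons b l ih =>
    rw [Admissible, List.isChain_cons_cons] at h
    rw [act_elt_cons, act_gen_mem_closedArc]
    exact notMem_openArc_of_mem_closedArc (ih h.2) h.1

/-- A vertex lies in no open arc, so ping-pong places the point reached before the first letter `a`
in the closed arc of `â`. It is also in the closed arc of the following letter `b ≠ â`, hence it is
a common endpoint of the two. Thus `b` is adjacent to `â`, and the orientation is passed on along
the word. The final vertex is arbitrary because the fixed point condition does not survive the
removal of a letter. -/
theorem isChain_of_fixed {a : A} {l : List A} (h : Admissible P (a :: l)) {e₀ e₁ : Bool} {b₀ b₁ : A}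
    (hξ : act (elt P (a :: l)) (ep P e₀ b₀) = ep P e₁ b₁) :
    ∃ e, act (elt P (a :: l)) (ep P e₀ b₀) = ep P e a ∧
      (a :: l).IsChain fun a b => b = nx P e a := by
  induction l generalizing a e₁ b₁ with
  | nil =>
    rw [act_elt_cons, elt_nil, act_one] at hξ ⊢
    have h1 : ep P e₀ b₀ ∈ closedArc P (P.hat a) := by
      by_contra h2
      rw [← act_gen_mem_openArc, hξ] at h2
      exact ep_notMem_openArc' _ _ _ h2
    rcases mem_closedArc_iff_or.mp h1 with h2 | ⟨e, he⟩
    · exact absurd h2 (ep_notMem_openArc' _ _ _)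
    · refine ⟨!e, ?_, List.isChain_singleton _⟩
      have := act_gen_ep P (!e) a
      rw [Bool.not_not] at this
      rw [he, this]
  | cons b l ih =>
    rw [Admissible, List.isChain_cons_cons] at h
    rw [act_elt_cons] at hξ ⊢
    have hv : ∀ c, ep P e₀ b₀ ∉ openArc P c := ep_notMem_openArc' _ _
    have h1 : act (elt P (b :: l)) (ep P e₀ b₀) ∈ closedArc P (P.hat a) := by
      by_contra h2
      rw [← act_gen_mem_openArc, hξ] at h2
      exact ep_notMem_openArc' _ _ _ h2
    rcases mem_closedArc_iff_or.mp h1 with h2 | ⟨e', he'⟩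
    · exact absurd h2 (notMem_openArc_of_mem_closedArc (act_elt_mem_closedArc h.2 hv) h.1)
    · obtain ⟨e, h3, h4⟩ := ih h.2 he'
      have h5 : e' = !e := by
        by_contra h6
        have : e' = e := by cases e <;> cases e' <;> simp_all
        subst this
        exact h.1 (ep_injective e' (h3.symm.trans he'))
      subst h5
      refine ⟨e, ?_, ?_⟩
      · rw [he', act_gen_ep]
      · rw [List.isChain_cons_cons]
        exact ⟨eq_nx_iff.mpr (h3.symm.trans he'), h4⟩

/-- All the sums over cuspidal words become sums over an orientation, a first letter and an integer.
The parametrization is not injective: one-letter words occur with both orientations. -/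
theorem isCuspidal_iff {W : List A} : IsCuspidal P W ↔ ∃ e a n, W = cw P e a n := by
  constructor
  · rintro ⟨hne, V, hV, hadm, -, b, hb⟩
    obtain ⟨a, l, rfl⟩ := List.exists_cons_of_ne_nil hne
    obtain ⟨l', rfl⟩ := hV
    have h : ∃ e₀ b₀, act (elt P (a :: (l ++ l'))) (ep P e₀ b₀) = ep P e₀ b₀ := by
      rcases hb with hb | hb
      · exact ⟨false, b, hb⟩
      · exact ⟨true, b, hb⟩
    obtain ⟨e₀, b₀, h⟩ := h
    obtain ⟨e, -, h1⟩ := isChain_of_fixed (l := l ++ l') hadm h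
    have h2 : (a :: l).IsChain fun a b => b = nx P e a := by
      have : a :: (l ++ l') = (a :: l) ++ l' := rfl
      rw [this] at h1
      exact h1.left_of_append
    exact ⟨e, a, l.length, eq_cw_of_isChain h2⟩
  · rintro ⟨e, a, n, rfl⟩; exact isCuspidal_cw e a n

end Words

/-! ### Estimates for the cuspidal words -/

section Estimates

set_option linter.unusedSectionVars false

variable {Γ₀ : Subgroup SL(2, ℝ)} {A : Type*} {P : LabelledIdealPolygon Γ₀ A} [Finite A]

theorem ne_ep_of_follows {e : Bool} {a b : A} {n : ℕ} (h : Follows P (cw P e a n) b) {ξ : Circle}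
    (hξ : ξ ∈ closedArc P b) : ξ ≠ ep P e (lt P e a (n + 1)) := by
  obtain ⟨h1, h2, -⟩ := follows_cw.mp h
  rintro rfl
  rw [lt_succ, ep_nx] at hξ
  rcases mem_closedArc_iff_or.mp hξ with h3 | ⟨e', h3⟩
  · exact ep_notMem_openArc' _ _ _ h3
  · by_cases h4 : e' = e
    · subst h4
      exact h2 (eq_nx_iff.mpr h3.symm)
    · have : e' = !e := by cases e <;> cases e' <;> simp_all
      subst this
      exact h1 (ep_injective _ h3.symm)

/-- In the coordinate at the terminal vertex, the open arcs of `â` for the last letter and of the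
letter that would prolong the word are the two ends of the real line. An arc following the word
avoids both, so its coordinate is bounded. -/
theorem xs_bounds {e : Bool} {a b : A} {n : ℕ} (h : Follows P (cw P e a n) b) {ξ : Circle}
    (hξ : ξ ∈ closedArc P b) :
    -bn P (lt P e a n) ≤ xs e (ep P e (lt P e a (n + 1))) ξ ∧
      xs e (ep P e (lt P e a (n + 1))) ξ ≤ bn P (lt P e a (n + 1)) := by
  have h0 := ne_ep_of_follows h hξ
  obtain ⟨h1, h2, -⟩ := follows_cw.mp h
  constructor
  · have h3 := notMem_openArc_of_mem_closedArc hξ h1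
    rw [lt_succ, ep_nx] at h0 ⊢
    rw [mem_openArc_iff (!e) h0, not_lt, bn_hat, xs_not] at h3
    linarith
  · rw [← lt_succ] at h2
    have h3 := notMem_openArc_of_mem_closedArc hξ h2
    rw [mem_openArc_iff e h0, not_lt] at h3
    exact h3

/-- The words in the domain of which an arc lies map it into the interior of the first arc. -/
theorem act_cw_mem_openArc {e : Bool} {a b : A} {n : ℕ} (h : Follows P (cw P e a n) b) {ξ : Circle}
    (hξ : ξ ∈ closedArc P b) : act (elt P (cw P e a n)) ξ ∈ openArc P a := by
  have h0 := ne_ep_of_follows h hξ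
  have h1 := xs_act_elt_cw e a n h0
  have h2 := xs_bounds h hξ
  have h3 := act_elt_cw_ne h0
  cases n with
  | zero =>
    have hc : act (elt P (cw P e a 0)) ξ ∈ closedArc P a := by
      rw [mem_closedArc_iff e h3, h1]
      simp only [tl, px, lt] at h2 ⊢
      linarith
    -- A one-letter word also has the opposite orientation, so neither endpoint of `[a]` is
    -- attained.
    have h' : Follows P (cw P (!e) a 0) b := h
    have h3' := act_elt_cw_ne (ne_ep_of_follows h' hξ)
    rcases mem_closedArc_iff_or.mp hc with h4 | ⟨e', h4⟩
    · exact h4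
    · by_cases h5 : e' = e
      · subst h5; exact absurd h4 h3
      · have : e' = !e := by cases e <;> cases e' <;> simp_all
        subst this
        exact absurd h4 h3'
  | succ n =>
    rw [mem_openArc_iff e h3, h1]
    have h4 : tl P e a (n + 1) = 2 * bn P a + px P e (nx P e a) n + bn P (lt P e a (n + 1)) := rfl
    have := px_pos (P := P) e (nx P e a) n
    linarith [bn_pos P a]

theorem act_mem_openArc_of_follows {W : List A} (hW : IsCuspidal P W) {a b : A}
    (ha : W.head? = some a) (h : Follows P W b) {ξ : Circle} (hξ : ξ ∈ closedArc P b) :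
    act (elt P W) ξ ∈ openArc P a := by
  obtain ⟨e, a', n, rfl⟩ := isCuspidal_iff.mp hW
  rw [head?_cw, Option.some.injEq] at ha
  subst ha
  exact act_cw_mem_openArc h hξ

variable (P) in
theorem exists_bn_bounds : ∃ b B : ℝ, 0 < b ∧ ∀ a, b ≤ bn P a ∧ bn P a ≤ B := by
  obtain ⟨B, hB⟩ := (Set.finite_range (bn P)).bddAbove
  rcases isEmpty_or_nonempty A with h | h
  · exact ⟨1, 1, one_pos, fun a => (IsEmpty.false a).elim⟩
  · obtain ⟨a₀, ha₀⟩ := Finite.exists_min (bn P)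
    exact ⟨bn P a₀, B, bn_pos P a₀, fun a => ⟨ha₀ a, hB ⟨a, rfl⟩⟩⟩

theorem px_ge {b : ℝ} (hb : ∀ a, b ≤ bn P a) (e : Bool) (a : A) (n : ℕ) :
    (2 * n + 1) * b ≤ px P e a n := by
  induction n generalizing a with
  | zero => simpa [px] using hb a
  | succ n ih =>
    rw [px]; push_cast
    linarith [ih (nx P e a), hb a]

theorem px_le {B : ℝ} (hB : ∀ a, bn P a ≤ B) (e : Bool) (a : A) (n : ℕ) :
    px P e a n ≤ (2 * n + 1) * B := by
  induction n generalizing a with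
  | zero => simpa [px] using hB a
  | succ n ih =>
    rw [px]; push_cast
    linarith [ih (nx P e a), hB a]

theorem derivNorm_cw {e : Bool} {a b : A} {n : ℕ} (h : Follows P (cw P e a n) b) {ξ : Circle}
    (hξ : ξ ∈ closedArc P b) :
    derivNorm (elt P (cw P e a n)) ξ =
      (1 + xs e (ep P e (lt P e a (n + 1))) ξ ^ 2) /
        (1 + (xs e (ep P e (lt P e a (n + 1))) ξ + tl P e a n) ^ 2) := by
  have h0 := ne_ep_of_follows h hξ
  rw [derivNorm_of_xc (derivNorm_elt_cw_ep e a n) h0, act_elt_cw_ep, ← xs_sq e, ← xs_sq e,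
    xs_act_elt_cw e a n h0]

/-- The logarithm of `1 + x²` has a derivative bounded by one; the constant `2` leaves room. -/
theorem one_add_sq_le (x y : ℝ) : 1 + x ^ 2 ≤ (1 + y ^ 2) * Real.exp (2 * |x - y|) := by
  set d := |x - y| with hd
  have hd0 : 0 ≤ d := abs_nonneg _
  have h1 : 1 + 2 * d + 2 * d ^ 2 ≤ Real.exp (2 * d) := by
    have := Real.quadratic_le_exp_of_nonneg (x := 2 * d) (by positivity)
    nlinarith
  have h2 : 1 + x ^ 2 ≤ (1 + y ^ 2) * (1 + 2 * d + 2 * d ^ 2) := by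
    have h3 : (x - y) ^ 2 = d ^ 2 := (sq_abs _).symm
    have h4 : x - y ≤ d := le_abs_self _
    have h5 : -(x - y) ≤ d := neg_le_abs _
    have h6 : 2 * y * (x - y) ≤ (1 + y ^ 2) * d := by
      have h7 : y * (x - y) ≤ |y| * d := by
        rw [hd, ← abs_mul]; exact le_abs_self _
      have h8 : 2 * |y| ≤ 1 + y ^ 2 := by nlinarith [sq_nonneg (|y| - 1), sq_abs y]
      nlinarith
    nlinarith [mul_nonneg (sq_nonneg y) hd0, mul_nonneg (sq_nonneg y) (sq_nonneg d)]
  exact h2.trans (mul_le_mul_of_nonneg_left h1 (by positivity))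

variable (P) in
/-- Distortion, decay and contraction for the branches associated with the cuspidal words. -/
theorem exists_word_bounds :
    ∃ κ C K : ℝ, 0 < κ ∧ κ < 1 ∧ 0 < C ∧ 0 < K ∧
      ∀ (W : List A) (b : A), IsCuspidal P W → Follows P W b → ∀ ξ ∈ closedArc P b,
        derivNorm (elt P W) ξ ≤ κ ∧ derivNorm (elt P W) ξ ≤ C / (W.length : ℝ) ^ 2 ∧
        ∀ η ∈ closedArc P b,
          derivNorm (elt P W) ξ ≤ derivNorm (elt P W) η * Real.exp (K * dist ξ η) := by
  obtain ⟨m, B₀, hm, hbn⟩ := exists_bn_bounds P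
  set B := max B₀ 1 with hBdef
  have hB : ∀ a, bn P a ≤ B := fun a => (hbn a).2.trans (le_max_left _ _)
  have hB1 : 1 ≤ B := le_max_right _ _
  -- contraction for the words with one letter
  have hone : ∀ a : A, ∃ κ < (1 : ℝ), ∀ b, Follows P [a] b → ∀ ξ ∈ closedArc P b,
      derivNorm (P.gen a) ξ ≤ κ := by
    intro a
    set K := ⋃ b ∈ {b | Follows P [a] b}, closedArc P b with hK
    have hKc : IsCompact K :=
      (Set.Finite.isClosed_biUnion (Set.toFinite _) fun b _ => isClosed_closedArc b).isCompact
    rcases K.eq_empty_or_nonempty with h0 | h0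
    · refine ⟨0, one_pos, fun b hb ξ hξ => ?_⟩
      have : ξ ∈ K := Set.mem_biUnion (show b ∈ {b | Follows P [a] b} from hb) hξ
      rw [h0] at this
      exact absurd this (Set.notMem_empty _)
    · obtain ⟨ξ₀, hξ₀, hmax⟩ := hKc.exists_isMaxOn h0 (continuous_derivNorm (P.gen a)).continuousOn
      refine ⟨_, ?_, fun b hb ξ hξ => hmax (Set.mem_biUnion (show b ∈ {b | Follows P [a] b} from hb) hξ)⟩
      obtain ⟨b, hb, hξb⟩ := Set.mem_iUnion₂.mp hξ₀
      -- The image of the maximum point is in the interior of `[a]`, where the inverse branch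
      -- expands strictly. By compactness the contraction is uniform.
      have h1 := act_cw_mem_openArc (e := true) (n := 0) hb hξb
      rw [cw, act_elt_cons, elt_nil, act_one, act_gen_mem_openArc, closedArc, Set.mem_ofPred_eq,
        P.hat_hat, not_le] at h1
      exact h1
  choose κ₀ hκ₀ hκ₀' using hone
  obtain ⟨κ₁, hκ₁, hκ₁'⟩ : ∃ κ₁ < (1 : ℝ), ∀ a, κ₀ a ≤ κ₁ := by
    rcases isEmpty_or_nonempty A with h | h
    · exact ⟨0, one_pos, fun a => (IsEmpty.false a).elim⟩
    · obtain ⟨a₀, ha₀⟩ := Finite.exists_max κ₀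
      exact ⟨_, hκ₀ a₀, ha₀⟩
  -- With at least two letters the coordinate moves from `x`, with `|x| ≤ B`, to at least `|x| + 2
  -- m`, and `(1 + x²) / (1 + x² + 4 m²)` is largest at `|x| = B`.
  set κ₂ := (1 + B ^ 2) / (1 + B ^ 2 + 4 * m ^ 2) with hκ₂
  have hκ₂0 : 0 < κ₂ := by positivity
  have hκ₂1 : κ₂ < 1 := by rw [hκ₂, div_lt_one (by positivity)]; nlinarith
  refine ⟨max κ₁ κ₂, (1 + B ^ 2) / m ^ 2, 2 * (1 + B ^ 2), lt_max_of_lt_right hκ₂0,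
    max_lt hκ₁ hκ₂1, by positivity, by positivity, ?_⟩
  intro W b hW hb ξ hξ
  obtain ⟨e, a, n, rfl⟩ := isCuspidal_iff.mp hW
  have habs : ∀ ξ ∈ closedArc P b, xs e (ep P e (lt P e a (n + 1))) ξ ^ 2 ≤ B ^ 2 := by
    intro ξ hξ
    obtain ⟨h1, h2⟩ := xs_bounds hb hξ
    apply sq_le_sq'
    · linarith [hB (lt P e a n)]
    · linarith [hB (lt P e a (n + 1))]
  obtain ⟨h1, h2⟩ := xs_bounds hb hξ
  have hx := habs ξ hξ
  have hD := derivNorm_cw hb hξ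
  set x := xs e (ep P e (lt P e a (n + 1))) ξ with hxdef
  have hpx := px_ge (fun a => (hbn a).1) e a n
  have hxt : (n + 1) * m ≤ x + tl P e a n := by
    rw [tl]
    have : (0 : ℝ) ≤ n * m := by positivity
    linarith
  refine ⟨?_, ?_, ?_⟩
  · rcases Nat.eq_zero_or_pos n with rfl | hn
    · refine le_trans ?_ (le_max_left _ _)
      refine le_trans ?_ (hκ₁' a)
      have : elt P (cw P e a 0) = P.gen a := by rw [cw, elt_cons, elt_nil, mul_one]
      rw [this]
      exact hκ₀' a b hb ξ hξ
    · refine le_trans ?_ (le_max_right _ _)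
      rw [hD, hκ₂, div_le_div_iff₀ (by positivity) (by positivity)]
      have h3 : |x| + 2 * m ≤ x + tl P e a n := by
        have hn' : (1 : ℝ) ≤ n := by exact_mod_cast hn
        have : m ≤ n * m := by nlinarith
        rcases abs_cases x with ⟨hx1, hx2⟩ | ⟨hx1, hx2⟩
        · rw [hx1, tl]; linarith [bn_pos P (lt P e a n)]
        · rw [hx1, tl]
          obtain ⟨k, rfl⟩ : ∃ k, n = k + 1 := ⟨n - 1, by omega⟩
          have h4 := px_succ (P := P) e a k
          have h5 : m ≤ tl P e a k := by
            rw [tl]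
            have := px_ge (fun a => (hbn a).1) e a k
            have : (0 : ℝ) ≤ k * m := by positivity
            linarith [bn_pos P (lt P e a k)]
          have h6 : 2 * m ≤ tl P e a k := by
            rw [tl]
            have := px_ge (fun a => (hbn a).1) e a k
            have : (0 : ℝ) ≤ k * m := by positivity
            linarith [(hbn (lt P e a k)).1]
          linarith
      have h4 : x ^ 2 + 4 * m ^ 2 ≤ (x + tl P e a n) ^ 2 := by
        have h5 : (|x| + 2 * m) ^ 2 ≤ (x + tl P e a n) ^ 2 :=
          pow_le_pow_left₀ (by positivity) h3 2
        have := sq_abs x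
        nlinarith [abs_nonneg x]
      have hm2 : 0 < m ^ 2 := by positivity
      nlinarith
  · rw [hD, length_cw, div_div, div_le_div_iff₀ (by positivity) (by push_cast; positivity)]
    have h3 : ((n + 1) * m) ^ 2 ≤ (x + tl P e a n) ^ 2 := pow_le_pow_left₀ (by positivity) hxt 2
    push_cast
    rw [mul_pow] at h3
    have h4 : m ^ 2 * ((n : ℝ) + 1) ^ 2 ≤ 1 + (x + tl P e a n) ^ 2 := by linarith
    gcongr
  · intro η hη
    have hy := habs η hη
    have hD' := derivNorm_cw hb hη
    have hd := dist_sq_xc (ne_ep_of_follows hb hξ) (ne_ep_of_follows hb hη)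
    rw [← xs_sq e, ← xs_sq e] at hd
    set y := xs e (ep P e (lt P e a (n + 1))) η with hydef
    have hxy : (xc (ep P e (lt P e a (n + 1))) ξ - xc (ep P e (lt P e a (n + 1))) η) ^ 2 =
        (x - y) ^ 2 := by
      rw [hxdef, hydef, xs, xs, ← mul_sub, mul_pow, sq (sg e), sg_mul_self, one_mul]
    rw [hxy, ← hxdef] at hd
    -- The chordal formula bounds `2 |x - y|` by `(1 + B²) dist ξ η`. Numerator and denominator of
    -- the derivative each contribute one factor `exp (2 |x - y|)`, whence `K = 2 (1 + B²)`.
    have hxy2 : 2 * |x - y| ≤ (1 + B ^ 2) * dist ξ η := by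
      apply abs_le_of_sq_le_sq' _ (by positivity) |>.2
      rw [mul_pow, mul_pow, sq_abs]
      have : (1 + x ^ 2) * (1 + y ^ 2) ≤ (1 + B ^ 2) * (1 + B ^ 2) := by gcongr
      nlinarith [sq_nonneg (dist ξ η)]
    rw [hD, hD', div_mul_eq_mul_div, div_le_div_iff₀ (by positivity) (by positivity)]
    have e1 := one_add_sq_le x y
    have e2 := one_add_sq_le (y + tl P e a n) (x + tl P e a n)
    have e3 : |y + tl P e a n - (x + tl P e a n)| = |x - y| := by
      rw [add_sub_add_right_eq_sub, abs_sub_comm]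
    rw [e3] at e2
    have e4 : Real.exp (2 * |x - y|) * Real.exp (2 * |x - y|) ≤
        Real.exp (2 * (1 + B ^ 2) * dist ξ η) := by
      rw [← Real.exp_add]
      exact Real.exp_le_exp.mpr (by linarith)
    calc (1 + x ^ 2) * (1 + (y + tl P e a n) ^ 2)
        ≤ ((1 + y ^ 2) * Real.exp (2 * |x - y|)) *
          ((1 + (x + tl P e a n) ^ 2) * Real.exp (2 * |x - y|)) := by gcongr
      _ = (1 + y ^ 2) * (1 + (x + tl P e a n) ^ 2) *
          (Real.exp (2 * |x - y|) * Real.exp (2 * |x - y|)) := by ring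
      _ ≤ (1 + y ^ 2) * (1 + (x + tl P e a n) ^ 2) * Real.exp (2 * (1 + B ^ 2) * dist ξ η) := by
          gcongr
      _ = _ := by ring

/-! ### Connecting words -/

/-- Otherwise, for each orientation and each `n`, `b` either is inverse to the letter of index `n +
1` or prolongs the word. Three consecutive values of `n` then force two consecutive letters to
agree, so that `nx` fixes `a`. This cannot happen for both orientations. -/
theorem exists_connecting_word (a b : A) :
    ∃ W, IsCuspidal P W ∧ W.head? = some a ∧ Follows P W b := by
  by_contra hcon
  push Not at hcon
  have key : ∀ (e : Bool) (n : ℕ), b = P.hat (lt P e a (n + 1)) ∨ b = lt P e a (n + 2) := by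
    intro e n
    have h := hcon (cw P e a (n + 1)) (isCuspidal_cw e a _) (head?_cw e a _)
    rw [follows_cw] at h
    by_contra h1
    push Not at h1
    exact h ⟨h1.1, by rw [← lt_succ]; exact h1.2, by omega⟩
  have hfix : ∀ e : Bool, nx P e a = a := by
    intro e
    have hinj : ∀ n, lt P e a (n + 2) = lt P e a (n + 1) → nx P e a = a := by
      intro n h
      induction n with
      | zero =>
        apply nx_injective (P := P) e
        simpa [lt] using h
      | succ n ih =>
        apply ih
        apply nx_injective (P := P) e
        rw [← lt_succ, ← lt_succ]
        exact h
    have hh : Function.Injective P.hat := fun c d hcd => by rw [← P.hat_hat c, hcd, P.hat_hat]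
    rcases key e 0 with h0 | h0 <;> rcases key e 1 with h1 | h1 <;> rcases key e 2 with h2 | h2
    · exact hinj 0 (hh (h1.symm.trans h0))
    · exact hinj 0 (hh (h1.symm.trans h0))
    · exact absurd (h2.symm.trans h1) (P.hat_ne _)
    · exact hinj 2 (h2.symm.trans h1)
    · exact absurd (h1.symm.trans h0) (P.hat_ne _)
    · exact absurd (h1.symm.trans h0) (P.hat_ne _)
    · exact hinj 1 (h1.symm.trans h0)
    · exact hinj 1 (h1.symm.trans h0)
  exact nx_true_ne_nx_false a ((hfix true).trans (hfix false).symm)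

/-! ### The partition by the images of the branches -/

theorem act_elt_mem_arc {l : List A} {a b : A} (h : Admissible P (l ++ [b]))
    (ha : (l ++ [b]).head? = some a) {ξ : Circle} (hξ : ξ ∈ arc P b) :
    act (elt P l) ξ ∈ arc P a := by
  induction l generalizing a with
  | nil =>
    simp only [List.nil_append, List.head?_cons, Option.some.injEq] at ha
    subst ha
    rwa [elt_nil, act_one]
  | cons c l ih =>
    simp only [List.cons_append, List.head?_cons, Option.some.injEq] at ha
    subst ha
    rw [act_elt_cons, act_gen_mem_arc]
    obtain ⟨d, m, hd⟩ : ∃ d m, l ++ [b] = d :: m :=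
      List.exists_cons_of_ne_nil (by simp)
    rw [Admissible, List.cons_append, hd, List.isChain_cons_cons] at h
    have h1 := ih (a := d) (by rw [Admissible, hd]; exact h.2) (by rw [hd]; rfl)
    exact fun h2 => h.1 (eq_of_mem_arc h1 h2)

/-- The arc containing the common point determines the first letter of both words, which can be
removed by injectivity. -/
theorem prefix_of_mem_arc {l l' : List A} {b b' : A} (h : Admissible P (l ++ [b]))
    (h' : Admissible P (l' ++ [b'])) (hlen : l.length ≤ l'.length) {ξ ξ' : Circle}
    (hξ : ξ ∈ arc P b) (hξ' : ξ' ∈ arc P b') (he : act (elt P l) ξ = act (elt P l') ξ') :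
    l ++ [b] <+: l' ++ [b'] := by
  induction l generalizing l' with
  | nil =>
    rw [elt_nil, act_one] at he
    obtain ⟨d, m, hd⟩ : ∃ d m, l' ++ [b'] = d :: m := List.exists_cons_of_ne_nil (by simp)
    have h1 := act_elt_mem_arc (a := d) h' (by rw [hd]; rfl) hξ'
    rw [← he] at h1
    have := eq_of_mem_arc hξ h1
    subst this
    rw [hd]
    exact ⟨m, rfl⟩
  | cons c l ih =>
    cases l' with
    | nil => simp at hlen
    | cons c' l' =>
      have h1 := act_elt_mem_arc (a := c) h rfl hξ
      have h2 := act_elt_mem_arc (a := c') h' rfl hξ'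
      rw [he] at h1
      have := eq_of_mem_arc h1 h2
      subst this
      rw [act_elt_cons, act_elt_cons] at he
      have h3 := ih (l' := l') (List.IsChain.tail h) (List.IsChain.tail h') (by simpa using hlen)
        (act_injective _ he)
      rw [List.cons_append, List.cons_append, List.prefix_cons_inj]
      exact h3

theorem admissible_append {W : List A} (hW : IsCuspidal P W) {b : A} (h : Follows P W b) :
    Admissible P (W ++ [b]) := by
  obtain ⟨e, a, n, rfl⟩ := isCuspidal_iff.mp hW
  rw [Admissible, List.isChain_append]
  refine ⟨admissible_cw e a n, List.isChain_singleton _, ?_⟩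
  intro x hx y hy
  rw [getLast?_cw] at hx
  simp at hx hy
  subst hx hy
  exact (follows_cw.mp h).1

/-- The images of the branches are pairwise disjoint. -/
theorem eq_of_act_eq {W W' : List A} {b b' : A} (hW : IsCuspidal P W) (hW' : IsCuspidal P W')
    (h : Follows P W b) (h' : Follows P W' b') {ξ ξ' : Circle} (hξ : ξ ∈ arc P b)
    (hξ' : ξ' ∈ arc P b') (he : act (elt P W) ξ = act (elt P W') ξ') : W = W' ∧ b = b' := by
  wlog hlen : W.length ≤ W'.length generalizing W W' b b' ξ ξ'
  · have := this hW' hW h' h hξ' hξ he.symm (by omega)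
    exact ⟨this.1.symm, this.2.symm⟩
  have hp := prefix_of_mem_arc (admissible_append hW h) (admissible_append hW' h') hlen hξ hξ' he
  rcases hlen.eq_or_lt with hl | hl
  · have := hp.eq_of_length (by simp [hl])
    have h2 := List.append_inj this hl
    exact ⟨h2.1, by simpa using h2.2⟩
  · exfalso
    -- If `W` were shorter, `b` would prolong `W` to an initial factor of the cuspidal word `W'`,
    -- and this is what `Follows` forbids.
    have hp' : W ++ [b] <+: W' :=
      List.prefix_of_prefix_length_le hp (List.prefix_append W' [b']) (by simpa using hl)
    obtain ⟨e, a, n, rfl⟩ := isCuspidal_iff.mp hW'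
    obtain ⟨k, hk⟩ : ∃ k, W.length = k + 1 :=
      ⟨W.length - 1, (Nat.sub_add_cancel (List.length_pos_iff.mpr hW.1)).symm⟩
    rw [length_cw, hk] at hl
    have h1 : W ++ [b] = cw P e a (k + 1) :=
      (List.prefix_of_prefix_length_le hp' (cw_prefix e a (by omega : k + 1 ≤ n))
        (by rw [length_cw]; simp [hk])).eq_of_length (by rw [length_cw]; simp [hk])
    rw [cw_succ'] at h1
    obtain ⟨h2, h3⟩ := List.append_inj h1 (by rw [length_cw, hk])
    simp only [List.cons.injEq, and_true] at h3
    rw [h2] at h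
    exact (follows_cw.mp h).2.1 (h3.trans (lt_succ _ _ _))

theorem px_tendsto (e : Bool) (a : A) : Tendsto (px P e a) atTop atTop := by
  obtain ⟨m, B, hm, hbn⟩ := exists_bn_bounds P
  refine tendsto_atTop_mono (fun n => px_ge (fun a => (hbn a).1) e a n) ?_
  refine Tendsto.atTop_mul_const hm ?_
  exact tendsto_atTop_add_const_right _ _
    (Tendsto.const_mul_atTop two_pos tendsto_natCast_atTop_atTop)

theorem px_lt_succ (e : Bool) (a : A) (n : ℕ) : px P e a n < px P e a (n + 1) := by
  rw [px_succ, tl]; linarith [bn_pos P (lt P e a n), bn_pos P (lt P e a (n + 1))]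

theorem px_mono (e : Bool) (a : A) : StrictMono (px P e a) :=
  strictMono_nat_of_lt_succ (px_lt_succ e a)

theorem px_le_xs {e : Bool} {a : A} {n : ℕ} {ξ : Circle} (hξ : ξ ≠ ep P e (lt P e a (n + 1)))
    (h : ξ ∈ closedArc P (lt P e a (n + 1))) :
    px P e a (n + 1) ≤ xs e (ep P e a) (act (elt P (cw P e a n)) ξ) := by
  rw [xs_act_elt_cw e a n hξ, px_succ]
  have := (mem_closedArc_iff e hξ).mp h
  linarith

/-- The images of the branches cover the circle, except for the vertices. -/
theorem exists_branch [Nonempty A] {ξ : Circle} (hξ : ∀ a, ξ ≠ ep P false a) :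
    ∃ W b, IsCuspidal P W ∧ Follows P W b ∧ ∃ η ∈ arc P b, act (elt P W) η = ξ := by
  have hξ' : ∀ e a, ξ ≠ ep P e a := by
    intro e a
    cases e
    · exact hξ a
    · have := ep_nb (P := P) false a
      simp only [Bool.not_false] at this
      rw [← this]
      exact hξ _
  obtain ⟨a, ha⟩ := exists_mem_arc (P := P) ξ
  have hfst : ∀ c : A, ∀ η, η ∈ arc P c → ∃ b, b ≠ P.hat c ∧ ∃ θ ∈ arc P b, act (P.gen c) θ = η := by
    intro c η hη
    obtain ⟨b, hb⟩ := exists_mem_arc (P := P) (act (P.gen c)⁻¹ η)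
    refine ⟨b, ?_, _, hb, act_act_inv _ _⟩
    rintro rfl
    rw [← act_act_inv (P.gen c) η, act_gen_mem_arc] at hη
    exact hη hb
  obtain ⟨b, hb, θ, hθ, rfl⟩ := hfst a ξ ha
  by_cases hF : Follows P [a] b
  · exact ⟨[a], b, isCuspidal_cw true a 0, hF, θ, hθ, by rw [act_elt_cons, elt_nil, act_one]⟩
  have he : ∃ e, b = nx P e a := by
    by_contra hcon
    push Not at hcon
    exact hF ((follows_cw (e := true) (n := 0)).mpr ⟨hb, hcon _, fun _ => hcon _⟩)
  obtain ⟨e, rfl⟩ := he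
  -- `Q n` says that the expansion of the point goes on along the cuspidal word of this orientation
  -- beyond its first `n + 1` letters. It fails for some `n`, since the coordinate at the vertex
  -- would otherwise exceed every `px`. The first failure gives the maximal cuspidal initial factor.
  let Q : ℕ → Prop := fun n =>
    ∃ η ∈ arc P (lt P e a (n + 1)), act (elt P (cw P e a n)) η = act (P.gen a) θ
  have hQ0 : Q 0 := ⟨θ, hθ, by rw [cw, act_elt_cons, elt_nil, act_one]⟩
  have hQ : ∃ n, ¬ Q n := by
    by_contra hcon
    push Not at hcon
    obtain ⟨n, hn⟩ := ((tendsto_add_atTop_iff_nat 1).mpr (px_tendsto (P := P) e a)).eventually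
      (eventually_gt_atTop (xs e (ep P e a) (act (P.gen a) θ))) |>.exists
    obtain ⟨η, hη, hη'⟩ := hcon n
    have h1 : η ≠ ep P e (lt P e a (n + 1)) := by
      rintro rfl
      rw [act_elt_cw_ep] at hη'
      exact hξ' e a hη'.symm
    have := px_le_xs h1 (arc_subset_closedArc _ hη)
    rw [hη'] at this
    linarith
  classical
  obtain ⟨n, hn⟩ : ∃ n, Nat.find hQ = n + 1 :=
    Nat.exists_eq_succ_of_ne_zero fun h => Nat.find_spec hQ (h ▸ hQ0)
  have hn1 : Q n := by
    by_contra h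
    have := Nat.find_min' hQ h
    omega
  have hn2 : ¬ Q (n + 1) := hn ▸ Nat.find_spec hQ
  obtain ⟨η, hη, hη'⟩ := hn1
  obtain ⟨b, hb', θ', hθ', rfl⟩ := hfst _ η hη
  have hact : act (elt P (cw P e a (n + 1))) θ' = act (P.gen a) θ := by
    rw [cw_succ', elt_append, act_mul, act_elt_cons, elt_nil, act_one, hη']
  refine ⟨cw P e a (n + 1), b, isCuspidal_cw _ _ _, ?_, θ', hθ', hact⟩
  rw [follows_cw]
  refine ⟨hb', ?_, by omega⟩
  rintro rfl
  rw [← lt_succ] at hθ'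
  exact hn2 ⟨θ', hθ', hact⟩

theorem px_le_xs_image {e : Bool} {a b : A} {n : ℕ} (h : Follows P (cw P e a n) b) {ξ : Circle}
    (hξ : ξ ∈ closedArc P b) :
    px P e a n ≤ xs e (ep P e a) (act (elt P (cw P e a n)) ξ) ∧
      xs e (ep P e a) (act (elt P (cw P e a n)) ξ) ≤ px P e a (n + 1) := by
  rw [xs_act_elt_cw e a n (ne_ep_of_follows h hξ), px_succ]
  obtain ⟨h1, h2⟩ := xs_bounds h hξ
  have : tl P e a n = px P e a n + bn P (lt P e a n) := rfl
  constructor <;> linarith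

theorem mem_nx_of_px_lt {e : Bool} {a : A} {θ : Circle} (h0 : act (P.gen a) θ ≠ ep P e a)
    (h : px P e a 1 < xs e (ep P e a) (act (P.gen a) θ)) : θ ∈ openArc P (nx P e a) := by
  have h1 : θ ≠ ep P e (nx P e a) := by
    rintro rfl
    rw [ep_nx, act_gen_ep] at h0
    exact h0 rfl
  rw [mem_openArc_iff e h1]
  rw [ep_nx] at h1 ⊢
  rw [xs_act_gen P e a h1] at h
  simp only [px] at h
  linarith

/-- A point close to a vertex lies in the image of the branch of a long word. -/
theorem word_of_px_lt {e : Bool} {a b : A} {W : List A} {N : ℕ} (hN : 1 ≤ N)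
    (hW : IsCuspidal P W) (h : Follows P W b) {ξ : Circle} (hξ : ξ ∈ arc P b)
    (h0 : act (elt P W) ξ ≠ ep P e a)
    (hx : px P e a N < xs e (ep P e a) (act (elt P W) ξ)) : ∃ n, N ≤ n ∧ W = cw P e a n := by
  obtain ⟨e', a', n, rfl⟩ := isCuspidal_iff.mp hW
  have hc := arc_subset_closedArc _ hξ
  have h1 := act_cw_mem_openArc h hc
  have h2 : act (elt P (cw P e' a' n)) ξ ∈ openArc P a := by
    rw [mem_openArc_iff e h0]
    exact lt_of_le_of_lt ((px_mono e a).monotone (Nat.zero_le N)) hx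
  have := eq_of_mem_openArc h1 h2
  subst this
  have hx1 : px P e a' 1 < xs e (ep P e a') (act (elt P (cw P e' a' n)) ξ) :=
    lt_of_le_of_lt ((px_mono e a').monotone hN) hx
  cases n with
  | zero =>
    exfalso
    rw [cw, act_elt_cons, elt_nil, act_one] at hx1 h0
    have h3 := mem_nx_of_px_lt h0 hx1
    have h4 := eq_of_mem_arc hξ (openArc_subset_arc _ h3)
    obtain ⟨-, h5, h6⟩ := follows_cw.mp h
    by_cases h7 : e = e'
    · subst h7; exact h5 h4
    · have : e = !e' := by cases e <;> cases e' <;> simp_all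
      subst this
      exact h6 rfl h4
  | succ n =>
    have h3 : e = e' := by
      rw [cw, act_elt_cons] at hx1 h0
      have h4 := mem_nx_of_px_lt h0 hx1
      have h5 : Admissible P (cw P e' (nx P e' a') n ++ [b]) := by
        have := admissible_append hW h
        rw [cw] at this
        exact List.IsChain.tail this
      have h6 := act_elt_mem_arc (a := nx P e' a') h5 (by cases n <;> rfl) hξ
      exact eq_of_nx_eq (eq_of_mem_arc (openArc_subset_arc _ h4) h6)
    subst h3
    refine ⟨n + 1, ?_, rfl⟩
    by_contra hlt
    have h4 := (px_le_xs_image h hc).2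
    have h5 : px P e a' (n + 1 + 1) ≤ px P e a' N := (px_mono e a').monotone (by omega)
    linarith

/-! ### The geometric length -/

variable (Γ : Subgroup SL(2, ℝ)) {p : ℕ} (S : Fin p → SL(2, ℝ))

variable (P) in
/-- The ratio between the geometric length and the coordinate at the vertex. -/
def scale (e : Bool) (a : A) : ℝ := (derivNorm (cuspFrame Γ S (ep P e a))⁻¹ (ep P e a))⁻¹

theorem scale_pos (e : Bool) (a : A) : 0 < scale P Γ S e a := inv_pos.mpr (derivNorm_pos _ _)

/-- The abscissa is, up to an additive constant, minus the coordinate at `1`, and the frame acts on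
coordinates by an affine map whose ratio is its inverse derivative at `ζ`. -/
theorem abscissa_sub {ζ ξ η : Circle} (hf : act (cuspFrame Γ S ζ) 1 = ζ) (h : ξ ≠ ζ)
    (h' : η ≠ ζ) :
    abscissa Γ S ζ ξ - abscissa Γ S ζ η =
      -((xc ζ ξ - xc ζ η) * (derivNorm (cuspFrame Γ S ζ)⁻¹ ζ)⁻¹) := by
  have h1 : act (cuspFrame Γ S ζ)⁻¹ ζ = 1 := by
    nth_rewrite 2 [← hf]; exact act_inv_act _ _
  have h2 := xc_act_sub_mul (cuspFrame Γ S ζ)⁻¹ h h'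
  rw [h1] at h2
  have h3 : ∀ w : Circle, (cayleyInv w).re = -xc 1 w := by
    intro w
    rw [cayleyInv, xc, ← neg_re]
    congr 1
    rw [Circle.coe_one, ← div_neg, neg_sub, add_comm]
  rw [abscissa, abscissa, h3, h3, ← h2]
  ring

/-- Every vertex is fixed by the parabolic element of a periodic cuspidal word, so a frame exists
and the default value in `cuspFrame` is not used. -/
theorem act_cuspFrame {Γ : Subgroup SL(2, ℝ)} {S : Fin p → SL(2, ℝ)} (hle : Γ₀ ≤ Γ)
    (hS : IsCuspSystem Γ S) (e : Bool) (a : A) :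
    act (cuspFrame Γ S (ep P e a)) 1 = ep P e a := by
  obtain ⟨m, -, hm⟩ := exists_period (P := P) e a 0
  obtain ⟨h1, h2⟩ := isParabolic_of_period hm
  obtain ⟨B, hB, k, hk⟩ := hS.2.1 (ep P e a) ⟨_, hle (elt_mem _), h1, h2⟩
  have h : ∃ C : SL(2, ℝ), (∃ B ∈ Γ, ∃ k, C = B * S k) ∧ act C 1 = ep P e a :=
    ⟨B * S k, ⟨B, hB, k, rfl⟩, hk⟩
  rw [cuspFrame, dif_pos h]
  exact h.choose_spec.2

/-- The second geodesic has an endpoint with coordinate exactly `px`. The condition `|W| > T` thus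
becomes a threshold on `px`, with one ratio for each end of an arc. -/
theorem geomLength_cw {Γ : Subgroup SL(2, ℝ)} {S : Fin p → SL(2, ℝ)} (hle : Γ₀ ≤ Γ)
    (hS : IsCuspSystem Γ S) (e : Bool) (a : A) (n : ℕ) :
    geomLength P Γ S (cw P e a n) = scale P Γ S e a * (px P e a n - px P e a 0) := by
  have hlen : geomLength P Γ S (cw P e a n) = if 1 ≤ n then
      |abscissa Γ S (ep P e a) (ep P (!e) a) -
        abscissa Γ S (ep P e a) (act (elt P (cw P e a n).dropLast) (ep P (!e) (lt P e a n)))|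
      else 0 := by
    rw [geomLength, head?_cw, getLast?_cw]
    simp only [isRight_cw, isLeft_cw]
    by_cases hn : 1 ≤ n
    · cases e <;> simp [hn, ep]
    · cases e <;> simp [hn]
  rw [hlen]
  cases n with
  | zero => simp
  | succ n =>
    rw [if_pos (by omega), dropLast_cw_succ]
    have h1 := ep_ne P e (lt P e a (n + 1))
    rw [abscissa_sub Γ S (act_cuspFrame hle hS e a) (ep_ne P e a) (act_elt_cw_ne h1)]
    have h2 := xs_act_elt_cw e a n h1
    rw [xs_ep] at h2
    have h3 := xs_ep P e a
    have hpos := px_mono (P := P) e a (Nat.succ_pos n)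
    have h4 : px P e a (n + 1) - px P e a 0 =
        sg e * (xc (ep P e a) (act (elt P (cw P e a n)) (ep P (!e) (lt P e a (n + 1)))) -
          xc (ep P e a) (ep P (!e) a)) := by
      rw [mul_sub, ← xs, ← xs, h2, h3, px_succ]
      simp only [px]; ring
    have hsg : |sg e| = 1 := by cases e <;> simp [sg]
    have h5 : |px P e a (n + 1) - px P e a 0| =
        |xc (ep P e a) (act (elt P (cw P e a n)) (ep P (!e) (lt P e a (n + 1)))) -
          xc (ep P e a) (ep P (!e) a)| := by
      rw [h4, abs_mul, hsg, one_mul]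
    rw [abs_of_pos (sub_pos.mpr hpos)] at h5
    rw [h5, abs_neg, abs_mul, abs_sub_comm, mul_comm]
    congr 1
    exact abs_of_pos (scale_pos Γ S e a)

/-- The geometric length grows linearly. -/
theorem exists_geomLength_le {Γ : Subgroup SL(2, ℝ)} {S : Fin p → SL(2, ℝ)} (hle : Γ₀ ≤ Γ)
    (hS : IsCuspSystem Γ S) : ∃ c : ℝ, 0 < c ∧ ∀ W, IsCuspidal P W →
      c⁻¹ * (W.length - 1) ≤ geomLength P Γ S W ∧ geomLength P Γ S W ≤ c * W.length := by
  obtain ⟨m, B₀, hm, hbn⟩ := exists_bn_bounds P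
  set B := max B₀ 1
  have hB0 : 0 < B := lt_max_of_lt_right one_pos
  have hB : ∀ a, bn P a ≤ B := fun a => (hbn a).2.trans (le_max_left _ _)
  obtain ⟨c, hc⟩ := (Set.finite_range fun q : Bool × A => scale P Γ S q.1 q.2).bddAbove
  obtain ⟨d, hd⟩ := (Set.finite_range fun q : Bool × A => (scale P Γ S q.1 q.2)⁻¹).bddAbove
  have hc' : ∀ e a, scale P Γ S e a ≤ max c 1 := fun e a =>
    (hc ⟨(e, a), rfl⟩).trans (le_max_left _ _)
  have hd' : ∀ e a, (scale P Γ S e a)⁻¹ ≤ max d 1 := fun e a =>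
    (hd ⟨(e, a), rfl⟩).trans (le_max_left _ _)
  have hc0 : 0 < max c 1 := lt_max_of_lt_right one_pos
  have hd0 : 0 < max d 1 := lt_max_of_lt_right one_pos
  refine ⟨max (max c 1 * (2 * B)) (max d 1 * (2 * m)⁻¹), by positivity, fun W hW => ?_⟩
  obtain ⟨e, a, n, rfl⟩ := isCuspidal_iff.mp hW
  rw [geomLength_cw hle hS, length_cw]
  have hs := scale_pos (P := P) Γ S e a
  have hpx : 2 * n * m ≤ px P e a n - px P e a 0 := by
    have : ∀ (n : ℕ) (a : A), 2 * n * m + bn P a ≤ px P e a n := by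
      intro n
      induction n with
      | zero => intro a; simp [px]
      | succ n ih =>
        intro a
        have := ih (nx P e a)
        rw [px]; push_cast
        linarith [(hbn a).1, (hbn (nx P e a)).1]
    have h1 := this n a
    simp only [px] at h1 ⊢
    linarith
  constructor
  · push_cast
    rw [add_sub_cancel_right]
    have h1 : (max d 1)⁻¹ ≤ scale P Γ S e a := by
      rw [inv_le_comm₀ hd0 hs]; exact hd' e a
    have h2 : (max (max c 1 * (2 * B)) (max d 1 * (2 * m)⁻¹))⁻¹ ≤ (max d 1)⁻¹ * (2 * m) := by
      rw [show (max d 1)⁻¹ * (2 * m) = (max d 1 * (2 * m)⁻¹)⁻¹ by rw [mul_inv, inv_inv]]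
      exact inv_anti₀ (by positivity) (le_max_right _ _)
    calc _ ≤ (max d 1)⁻¹ * (2 * m) * n := by gcongr
      _ = (max d 1)⁻¹ * (2 * n * m) := by ring
      _ ≤ _ := by gcongr
  · have h1 : px P e a n - px P e a 0 ≤ 2 * B * (n + 1) := by
      have := px_le hB e a n
      have := px_pos (P := P) e a 0
      linarith
    calc _ ≤ max c 1 * (2 * B * (n + 1)) :=
          mul_le_mul (hc' e a) h1 (by have : (0 : ℝ) ≤ 2 * n * m := by positivity
                                      linarith) hc0.le
      _ = max c 1 * (2 * B) * (n + 1) := by ring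
      _ ≤ _ := by
        push_cast
        gcongr
        exact le_max_left _ _

end Estimates

/-! ### The Banach space of piecewise Lipschitz functions -/

section PLipSpace

variable {Γ₀ : Subgroup SL(2, ℝ)} {A : Type*} {P : LabelledIdealPolygon Γ₀ A}

namespace PLip

theorem ext {f g : PLip P} (h : ∀ ξ, f ξ = g ξ) : f = g := Subtype.ext (funext h)

theorem add_apply (f g : PLip P) (ξ : Circle) : (f + g) ξ = f ξ + g ξ := rfl

theorem sub_apply (f g : PLip P) (ξ : Circle) : (f - g) ξ = f ξ - g ξ := rfl

theorem zero_apply (ξ : Circle) : (0 : PLip P) ξ = 0 := rfl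

theorem smul_apply (c : ℂ) (f : PLip P) (ξ : Circle) : (c • f) ξ = c * f ξ := rfl

theorem norm_apply_le (f : PLip P) (ξ : Circle) : ‖f ξ‖ ≤ ‖f‖ := by
  rw [norm_def]
  exact (le_ciSup f.2.1 ξ).trans
    (le_add_of_nonneg_right (Real.iSup_nonneg fun q => slope_nonneg P f.1 q))

theorem norm_sub_le (f : PLip P) {a : A} {ξ η : Circle} (hξ : ξ ∈ arc P a) (hη : η ∈ arc P a) :
    ‖f ξ - f η‖ ≤ ‖f‖ * dist ξ η := by
  have h1 : slope P f.1 ⟨a, ⟨ξ, hξ⟩, ⟨η, hη⟩⟩ ≤ ‖f‖ := by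
    rw [norm_def]
    exact (le_ciSup f.2.2 _).trans
      (le_add_of_nonneg_left (Real.iSup_nonneg fun ξ => norm_nonneg _))
  rcases eq_or_ne ξ η with rfl | hne
  · simp
  · rw [slope, div_le_iff₀ (dist_pos.mpr hne)] at h1
    exact h1

/-- A bounded function which is Lipschitz on the arcs, as an element of `ℬ`. -/
def mk (f : Circle → ℂ) (M K : ℝ) (h1 : ∀ ξ, ‖f ξ‖ ≤ M)
    (h2 : ∀ a, ∀ ξ ∈ arc P a, ∀ η ∈ arc P a, ‖f ξ - f η‖ ≤ K * dist ξ η) (hK : 0 ≤ K) : PLip P :=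
  ⟨f, ⟨M, by rintro _ ⟨ξ, rfl⟩; exact h1 ξ⟩, ⟨K, by
    rintro _ ⟨⟨a, ξ, η⟩, rfl⟩
    exact div_le_of_le_mul₀ dist_nonneg hK (h2 a ξ ξ.2 η η.2)⟩⟩

theorem norm_le {f : PLip P} {M K : ℝ} (h1 : ∀ ξ, ‖f ξ‖ ≤ M) (hK : 0 ≤ K)
    (h2 : ∀ a, ∀ ξ ∈ arc P a, ∀ η ∈ arc P a, ‖f ξ - f η‖ ≤ K * dist ξ η) : ‖f‖ ≤ M + K := by
  rw [norm_def]
  refine add_le_add (ciSup_le h1) (Real.iSup_le ?_ hK)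
  rintro ⟨a, ξ, η⟩
  exact div_le_of_le_mul₀ dist_nonneg hK (h2 a ξ ξ.2 η η.2)

/-- Evaluation at a point. -/
def eval (ξ : Circle) : PLip P →L[ℂ] ℂ :=
  LinearMap.mkContinuous
    { toFun := fun f => f ξ, map_add' := fun _ _ => rfl, map_smul' := fun _ _ => rfl } 1
    fun f => by rw [one_mul]; exact norm_apply_le f ξ

instance : CompleteSpace (PLip P) := by
  refine Metric.complete_of_cauchySeq_tendsto fun u hu => ?_
  have hlim : ∀ ξ, ∃ z, Tendsto (fun n => u n ξ) atTop (𝓝 z) := fun ξ =>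
    cauchySeq_tendsto_of_complete (hu.map (eval (P := P) ξ).uniformContinuous)
  choose F hF using hlim
  obtain ⟨M, hM⟩ := hu.norm_bddAbove
  have hM' : ∀ n, ‖u n‖ ≤ M := fun n => hM ⟨n, rfl⟩
  have hM0 : 0 ≤ M := (norm_nonneg _).trans (hM' 0)
  have hb : ∀ ξ, ‖F ξ‖ ≤ M := fun ξ =>
    le_of_tendsto (hF ξ).norm (Eventually.of_forall fun n => (norm_apply_le _ _).trans (hM' n))
  have hl : ∀ a, ∀ ξ ∈ arc P a, ∀ η ∈ arc P a, ‖F ξ - F η‖ ≤ M * dist ξ η := fun a ξ hξ η hη =>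
    le_of_tendsto ((hF ξ).sub (hF η)).norm (Eventually.of_forall fun n =>
      (norm_sub_le (u n) hξ hη).trans (mul_le_mul_of_nonneg_right (hM' n) dist_nonneg))
  refine ⟨mk F M M hb hl hM0, ?_⟩
  rw [tendsto_iff_norm_sub_tendsto_zero]
  rw [Metric.cauchySeq_iff] at hu
  rw [Metric.tendsto_atTop]
  intro ε hε
  obtain ⟨N, hN⟩ := hu (ε / 4) (by positivity)
  refine ⟨N, fun n hn => ?_⟩
  have h1 : ‖u n - mk F M M hb hl hM0‖ ≤ ε / 4 + ε / 4 := by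
    refine norm_le (fun ξ => ?_) (by positivity) fun a ξ hξ η hη => ?_
    · refine le_of_tendsto (tendsto_const_nhds.sub (hF ξ)).norm ?_
      filter_upwards [eventually_ge_atTop N] with m hm
      have := hN n hn m hm
      rw [dist_eq_norm] at this
      exact (norm_apply_le (u n - u m) ξ).trans this.le
    · have h2 : Tendsto (fun m => (u n - u m) ξ - (u n - u m) η) atTop
          (𝓝 ((u n ξ - F ξ) - (u n η - F η))) :=
        (tendsto_const_nhds.sub (hF ξ)).sub (tendsto_const_nhds.sub (hF η))
      refine le_of_tendsto h2.norm ?_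
      filter_upwards [eventually_ge_atTop N] with m hm
      have := hN n hn m hm
      rw [dist_eq_norm] at this
      exact (norm_sub_le (u n - u m) hξ hη).trans
        (mul_le_mul_of_nonneg_right this.le dist_nonneg)
  rw [dist_zero_right, norm_norm]
  linarith

/-- Complex conjugation on `ℬ`. -/
def conjL : PLip P →ₗ⋆[ℂ] PLip P where
  toFun f := mk (fun ξ => conj (f ξ)) ‖f‖ ‖f‖
    (fun ξ => by rw [RCLike.norm_conj]; exact norm_apply_le f ξ)
    (fun a ξ hξ η hη => by rw [← map_sub, RCLike.norm_conj]; exact norm_sub_le f hξ hη)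
    (norm_nonneg _)
  map_add' f g := ext fun ξ => map_add (starRingEnd ℂ) (f ξ) (g ξ)
  map_smul' c f := ext fun ξ => map_mul (starRingEnd ℂ) c (f ξ)

theorem conjL_apply (f : PLip P) (ξ : Circle) : conjL f ξ = conj (f ξ) := rfl

variable (P) in
/-- The constant function `1`. -/
def one : PLip P := mk (fun _ => 1) 1 0 (fun _ => by simp) (fun _ _ _ _ _ => by simp) le_rfl

theorem one_apply (ξ : Circle) : one P ξ = 1 := rfl

/-- The indicator function of an arc. -/
def indicator [DecidableEq A] (a : A) : PLip P :=
  mk (fun ξ => open Classical in if ξ ∈ arc P a then 1 else 0) 1 0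
    (fun ξ => by split_ifs <;> simp)
    (fun b ξ hξ η hη => by
      by_cases h : a = b
      · subst h; simp [hξ, hη]
      · rw [if_neg fun h' => h (eq_of_mem_arc h' hξ), if_neg fun h' => h (eq_of_mem_arc h' hη)]
        simp) le_rfl

theorem continuousOn_arc (f : PLip P) (a : A) : ContinuousOn f.1 (arc P a) := by
  refine LipschitzOnWith.continuousOn (K := ‖f‖₊) ?_
  refine LipschitzOnWith.of_dist_le_mul fun ξ hξ η hη => ?_
  rw [dist_eq_norm]
  exact norm_sub_le f hξ hη

theorem measurable [Finite A] [Nonempty A] (f : PLip P) : Measurable f.1 := by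
  intro s hs
  have : f.1 ⁻¹' s = ⋃ a, Subtype.val '' ((arc P a).domRestrict f.1 ⁻¹' s) := by
    ext ξ
    simp only [Set.mem_preimage, Set.mem_iUnion, Set.mem_image, Subtype.exists,
      exists_and_right, exists_eq_right]
    constructor
    · intro h
      obtain ⟨a, ha⟩ := exists_mem_arc (P := P) ξ
      exact ⟨a, ha, h⟩
    · rintro ⟨a, ha, h⟩; exact h
  rw [this]
  refine MeasurableSet.iUnion fun a => (measurableSet_arc a).subtype_image ?_
  exact (continuousOn_iff_continuous_domRestrict.mp (continuousOn_arc f a)).measurable hs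

theorem re_sub_le (f : PLip P) {a : A} {ξ η : Circle} (hξ : ξ ∈ arc P a) (hη : η ∈ arc P a) :
    |(f ξ).re - (f η).re| ≤ ‖f‖ * dist ξ η := by
  rw [← Complex.sub_re]
  exact (abs_re_le_norm _).trans (norm_sub_le f hξ hη)

end PLip

/-! ### Operators given by sums over cuspidal words -/

section WordOperators

set_option linter.unusedSectionVars false

variable [Finite A]

/-- Choosing an orientation for each word makes the index (orientation, letter, integer) injective,
so each length occurs at most `card (Bool × A)` times. -/
theorem summable_words {v : ℕ → ℝ} (hv : Summable v) (hv0 : ∀ n, 0 ≤ v n) {X : Set (List A)}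
    (hX : ∀ W ∈ X, IsCuspidal P W) :
    Summable (fun W : X => v (W : List A).length) ∧
      ∑' W : X, v (W : List A).length ≤ Nat.card (Bool × A) * ∑' n, v n := by
  have hex : ∀ W : X, ∃ q : (Bool × A) × ℕ, (W : List A) = cw P q.1.1 q.1.2 q.2 := fun W => by
    obtain ⟨e, a, n, h⟩ := isCuspidal_iff.mp (hX W W.2)
    exact ⟨((e, a), n), h⟩
  choose idx hidx using hex
  have hinj : Function.Injective idx := fun W W' h => by
    apply Subtype.ext
    rw [hidx W, hidx W', h]
  set F : (Bool × A) × ℕ → ℝ := fun q => v (q.2 + 1) with hF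
  have hv1 : Summable fun n => v (n + 1) := (summable_nat_add_iff 1).mpr hv
  have hF0 : ∀ q, 0 ≤ F q := fun q => hv0 _
  have hFs : Summable F := by
    rw [summable_prod_of_nonneg hF0]
    exact ⟨fun _ => hv1, Summable.of_finite⟩
  have hcomp : (fun W : X => v (W : List A).length) = F ∘ idx := by
    funext W
    simp only [hF, Function.comp]
    rw [← length_cw (idx W).1.1 (idx W).1.2 (P := P), ← hidx W]
  have hs : Summable (F ∘ idx) := hFs.comp_injective hinj
  rw [hcomp]
  refine ⟨hs, ?_⟩
  have h1 : ∑' W, (F ∘ idx) W ≤ ∑' q, F q :=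
    hs.tsum_le_tsum_of_inj idx hinj (fun q _ => hF0 q) (fun _ => le_rfl) hFs
  refine h1.trans ?_
  rw [hFs.tsum_prod]
  simp only [hF]
  let := Fintype.ofFinite (Bool × A)
  rw [tsum_fintype, Finset.sum_const, Finset.card_univ, nsmul_eq_mul, Nat.card_eq_fintype_card]
  refine mul_le_mul_of_nonneg_left ?_ (Nat.cast_nonneg _)
  rw [hv.tsum_eq_zero_add]
  linarith [hv0 0]

theorem dist_act_le {W : List A} {b : A} {κ : ℝ}
    (hκ : ∀ ξ ∈ closedArc P b, derivNorm (elt P W) ξ ≤ κ) {ξ η : Circle} (hξ : ξ ∈ closedArc P b)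
    (hη : η ∈ closedArc P b) : dist (act (elt P W) ξ) (act (elt P W) η) ≤ κ * dist ξ η := by
  rw [dist_act]
  have h1 := derivNorm_pos (elt P W) ξ
  have h2 := derivNorm_pos (elt P W) η
  have h0 : 0 ≤ κ := h1.le.trans (hκ ξ hξ)
  refine mul_le_mul_of_nonneg_right ?_ dist_nonneg
  rw [← Real.sqrt_sq h0, sq]
  exact Real.sqrt_le_sqrt (mul_le_mul (hκ ξ hξ) (hκ η hη) h2.le h0)

variable (P) in
/-- The sets of words over which the operators are defined. -/
def IsWordFamily (X : A → Set (List A)) : Prop := ∀ b, ∀ W ∈ X b, IsCuspidal P W ∧ Follows P W b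

variable [Nonempty A]

/-- General weights are needed because the lemma serves both for `|D F_W|^s` and for the difference
of two such powers. The constant `3` counts the supremum, the variation of the weight and the
variation of `f` along a branch that does not expand distances. -/
theorem exists_weighted_operator {X : A → Set (List A)} (hX : IsWordFamily P X)
    {φ : List A → Circle → ℝ} {v : ℕ → ℝ} (hv : Summable v) (hv0 : ∀ n, 0 ≤ v n)
    (h1 : ∀ b, ∀ W ∈ X b, ∀ ξ ∈ arc P b, |φ W ξ| ≤ v W.length)
    (h2 : ∀ b, ∀ W ∈ X b, ∀ ξ ∈ arc P b, ∀ η ∈ arc P b,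
      |φ W ξ - φ W η| ≤ v W.length * dist ξ η) :
    ∃ L : PLip P →L[ℂ] PLip P,
      (∀ f b ξ, ξ ∈ arc P b → HasSum (fun W : X b =>
        (φ W ξ : ℂ) * f (act (elt P (W : List A)) ξ)) (L f ξ)) ∧
      ‖L‖ ≤ 3 * (Nat.card (Bool × A) * ∑' n, v n) := by
  obtain ⟨κ, _, _, -, hκ1, -, -, hbd⟩ := exists_word_bounds P
  choose α hα using exists_mem_arc (P := P)
  have hα' : ∀ {ξ b}, ξ ∈ arc P b → α ξ = b := fun h => eq_of_mem_arc (hα _) h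
  set V := Nat.card (Bool × A) * ∑' n, v n with hV
  have hsum := fun b => summable_words hv hv0 (X := X b) fun W hW => (hX b W hW).1
  have hV0 : 0 ≤ V := mul_nonneg (Nat.cast_nonneg _) (tsum_nonneg hv0)
  have hterm : ∀ (f : PLip P) (b : A) (ξ : Circle), ξ ∈ arc P b → ∀ W : X b,
      ‖(φ W ξ : ℂ) * f (act (elt P (W : List A)) ξ)‖ ≤ v (W : List A).length * ‖f‖ := by
    intro f b ξ hξ W
    rw [norm_mul, norm_real, Real.norm_eq_abs]
    exact mul_le_mul (h1 b W W.2 ξ hξ) (PLip.norm_apply_le _ _) (norm_nonneg _) (hv0 _)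
  have hsm : ∀ (f : PLip P) (b : A) (ξ : Circle), ξ ∈ arc P b →
      Summable fun W : X b => (φ W ξ : ℂ) * f (act (elt P (W : List A)) ξ) := fun f b ξ hξ =>
    Summable.of_norm_bounded ((hsum b).1.mul_right ‖f‖) (hterm f b ξ hξ)
  set T : PLip P → Circle → ℂ := fun f ξ =>
    ∑' W : X (α ξ), (φ W ξ : ℂ) * f (act (elt P (W : List A)) ξ) with hT
  have hTarc : ∀ f b ξ, ξ ∈ arc P b → HasSum (fun W : X b =>
        (φ W ξ : ℂ) * f (act (elt P (W : List A)) ξ)) (T f ξ) := by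
    intro f b ξ hξ
    have := hα' hξ
    subst this
    exact (hsm f _ ξ hξ).hasSum
  have hb : ∀ f ξ, ‖T f ξ‖ ≤ V * ‖f‖ := by
    intro f ξ
    have h := tsum_of_norm_bounded ((hsum (α ξ)).1.mul_right ‖f‖).hasSum (hterm f _ ξ (hα ξ))
    refine h.trans ?_
    rw [tsum_mul_right]
    exact mul_le_mul_of_nonneg_right (hsum (α ξ)).2 (norm_nonneg _)
  have hl : ∀ f a, ∀ ξ ∈ arc P a, ∀ η ∈ arc P a, ‖T f ξ - T f η‖ ≤ 2 * (V * ‖f‖) * dist ξ η := by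
    intro f b ξ hξ η hη
    have hs := (hTarc f b ξ hξ).sub (hTarc f b η hη)
    rw [← hs.tsum_eq]
    have h := tsum_of_norm_bounded ((hsum b).1.mul_right (2 * ‖f‖ * dist ξ η)).hasSum
      (f := fun W : X b => (φ W ξ : ℂ) * f (act (elt P (W : List A)) ξ) -
        (φ W η : ℂ) * f (act (elt P (W : List A)) η)) ?_
    · refine h.trans ?_
      rw [tsum_mul_right]
      have := mul_le_mul_of_nonneg_right (hsum b).2
        (by positivity : 0 ≤ 2 * ‖f‖ * dist ξ η)
      refine this.trans (le_of_eq ?_)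
      rw [hV]; ring
    · intro W
      have hW := hX b W W.2
      have hcl := fun ζ hζ => (hbd W b hW.1 hW.2 ζ hζ).1.trans hκ1.le
      have hξc := arc_subset_closedArc b hξ
      have hηc := arc_subset_closedArc b hη
      obtain ⟨a, ha⟩ : ∃ a, (W : List A).head? = some a := by
        obtain ⟨a, l, h⟩ := List.exists_cons_of_ne_nil hW.1.1
        exact ⟨a, by rw [h]; rfl⟩
      have m1 := openArc_subset_arc a (act_mem_openArc_of_follows hW.1 ha hW.2 hξc)
      have m2 := openArc_subset_arc a (act_mem_openArc_of_follows hW.1 ha hW.2 hηc)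
      have e1 : (φ W ξ : ℂ) * f (act (elt P (W : List A)) ξ) -
          (φ W η : ℂ) * f (act (elt P (W : List A)) η) =
          ((φ W ξ - φ W η : ℝ) : ℂ) * f (act (elt P (W : List A)) ξ) +
          (φ W η : ℂ) * (f (act (elt P (W : List A)) ξ) - f (act (elt P (W : List A)) η)) := by
        push_cast; ring
      rw [e1]
      refine (norm_add_le _ _).trans ?_
      rw [norm_mul, norm_mul, norm_real, norm_real, Real.norm_eq_abs, Real.norm_eq_abs]
      have d1 : |φ W ξ - φ W η| * ‖f (act (elt P (W : List A)) ξ)‖ ≤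
          v (W : List A).length * dist ξ η * ‖f‖ :=
        mul_le_mul (h2 b W W.2 ξ hξ η hη) (PLip.norm_apply_le _ _) (norm_nonneg _)
          (mul_nonneg (hv0 _) dist_nonneg)
      have d2 : |φ W η| * ‖f (act (elt P (W : List A)) ξ) - f (act (elt P (W : List A)) η)‖ ≤
          v (W : List A).length * (‖f‖ * dist ξ η) := by
        refine mul_le_mul (h1 b W W.2 η hη) ?_ (norm_nonneg _) (hv0 _)
        refine (PLip.norm_sub_le f m1 m2).trans (mul_le_mul_of_nonneg_left ?_ (norm_nonneg _))
        have := dist_act_le hcl hξc hηc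
        rwa [one_mul] at this
      refine (add_le_add d1 d2).trans (le_of_eq ?_)
      ring
  let Lf : PLip P → PLip P := fun f => PLip.mk (T f) (V * ‖f‖) (2 * (V * ‖f‖)) (hb f) (hl f)
    (by positivity)
  let L : PLip P →ₗ[ℂ] PLip P :=
    { toFun := Lf
      map_add' := fun f g => PLip.ext fun ξ => by
        refine (hTarc (f + g) (α ξ) ξ (hα ξ)).unique ?_
        have := (hTarc f (α ξ) ξ (hα ξ)).add (hTarc g (α ξ) ξ (hα ξ))
        simp only [← mul_add] at this
        exact this
      map_smul' := fun c f => PLip.ext fun ξ => by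
        refine (hTarc (c • f) (α ξ) ξ (hα ξ)).unique ?_
        have := (hTarc f (α ξ) ξ (hα ξ)).mul_left c
        simp only [mul_left_comm c] at this
        exact this }
  have hL : ∀ f, ‖L f‖ ≤ 3 * V * ‖f‖ := fun f => by
    refine (PLip.norm_le (hb f) (by positivity) (hl f)).trans (le_of_eq ?_)
    ring
  refine ⟨L.mkContinuous (3 * V) hL, fun f b ξ hξ => hTarc f b ξ hξ, ?_⟩
  exact L.mkContinuous_norm_le (by positivity) hL

theorem weighted_operator_unique {X : A → Set (List A)} {φ : List A → Circle → ℝ}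
    {L L' : PLip P →L[ℂ] PLip P}
    (h : ∀ f b ξ, ξ ∈ arc P b → HasSum (fun W : X b =>
        (φ W ξ : ℂ) * f (act (elt P (W : List A)) ξ)) (L f ξ))
    (h' : ∀ f b ξ, ξ ∈ arc P b → HasSum (fun W : X b =>
        (φ W ξ : ℂ) * f (act (elt P (W : List A)) ξ)) (L' f ξ)) : L = L' := by
  ext f
  refine PLip.ext fun ξ => ?_
  obtain ⟨b, hb⟩ := exists_mem_arc (P := P) ξ
  exact (h f b ξ hb).unique (h' f b ξ hb)

end WordOperators
end PLipSpace

/-! ### Estimates for powers -/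

section Powers

theorem abs_exp_sub_exp_le (a b : ℝ) : |Real.exp a - Real.exp b| ≤ |a - b| * Real.exp (max a b) := by
  have key : ∀ {a b : ℝ}, b ≤ a → |Real.exp a - Real.exp b| ≤ |a - b| * Real.exp (max a b) := by
    intro a b h
    rw [max_eq_left h, abs_of_nonneg (sub_nonneg.mpr (Real.exp_le_exp.mpr h)),
      abs_of_nonneg (sub_nonneg.mpr h)]
    have h1 := Real.add_one_le_exp (b - a)
    have h2 : Real.exp b = Real.exp a * Real.exp (b - a) := by rw [← Real.exp_add]; ring_nf
    rw [h2]
    nlinarith [Real.exp_pos a]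
  rcases le_total b a with h | h
  · exact key h
  · rw [abs_sub_comm, abs_sub_comm a, max_comm]; exact key h

theorem abs_rpow_sub_rpow_le_of_ratio {x y t s : ℝ} (hx : 0 < x) (hy : 0 < y) (hs : 0 ≤ s)
    (h1 : x ≤ y * Real.exp t) (h2 : y ≤ x * Real.exp t) :
    |x ^ s - y ^ s| ≤ y ^ s * (s * t * Real.exp (s * t)) := by
  have hτ : |Real.log x - Real.log y| ≤ t := by
    rw [abs_sub_le_iff]
    constructor
    · have := Real.log_le_log hx h1
      rw [Real.log_mul hy.ne' (Real.exp_pos t).ne', Real.log_exp] at this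
      linarith
    · have := Real.log_le_log hy h2
      rw [Real.log_mul hx.ne' (Real.exp_pos t).ne', Real.log_exp] at this
      linarith
  have ht : 0 ≤ t := (abs_nonneg _).trans hτ
  set τ := Real.log x - Real.log y with hτdef
  have h3 : x ^ s = y ^ s * Real.exp (s * τ) := by
    rw [Real.rpow_def_of_pos hx, Real.rpow_def_of_pos hy, ← Real.exp_add]
    congr 1; rw [hτdef]; ring
  have h4 := abs_exp_sub_exp_le (s * τ) 0
  rw [Real.exp_zero, sub_zero, abs_mul, abs_of_nonneg hs] at h4
  rw [h3, ← mul_sub_one, abs_mul, abs_of_pos (Real.rpow_pos_of_pos hy s)]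
  refine mul_le_mul_of_nonneg_left (h4.trans ?_) (Real.rpow_pos_of_pos hy s).le
  have h5 : max (s * τ) 0 ≤ s * t :=
    max_le (mul_le_mul_of_nonneg_left ((le_abs_self _).trans hτ) hs) (by positivity)
  gcongr

/-- Differentiation in the exponent produces `|log x|`, absorbed by `20 x^(-1/20)`. The remaining
exponent `17/20` exceeds `1/2`, so the sum over words still converges. -/
theorem abs_rpow_sub_rpow_exponent {x s s' : ℝ} (hx : 0 < x) (hx1 : x ≤ 1)
    (hs : 9 / 10 ≤ s) (hs' : 9 / 10 ≤ s') :
    |x ^ s - x ^ s'| ≤ 20 * |s - s'| * x ^ (17 / 20 : ℝ) := by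
  have hl : Real.log x ≤ 0 := Real.log_nonpos hx.le hx1
  have h1 := abs_exp_sub_exp_le (Real.log x * s) (Real.log x * s')
  rw [← Real.rpow_def_of_pos hx, ← Real.rpow_def_of_pos hx, ← mul_sub, abs_mul,
    abs_of_nonpos hl] at h1
  refine h1.trans ?_
  have h2 : Real.exp (max (Real.log x * s) (Real.log x * s')) ≤ x ^ (9 / 10 : ℝ) := by
    rw [Real.rpow_def_of_pos hx, Real.exp_le_exp]
    exact max_le (mul_le_mul_of_nonpos_left hs hl) (mul_le_mul_of_nonpos_left hs' hl)
  have h3 : -Real.log x ≤ 20 * x ^ (-(1 / 20) : ℝ) := by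
    have := Real.log_le_rpow_div (inv_pos.mpr hx).le (show (0 : ℝ) < 1 / 20 by norm_num)
    rw [Real.log_inv, Real.inv_rpow hx.le, ← Real.rpow_neg hx.le] at this
    linarith
  have h4 : x ^ (-(1 / 20) : ℝ) * x ^ (9 / 10 : ℝ) = x ^ (17 / 20 : ℝ) := by
    rw [← Real.rpow_add hx]; norm_num
  calc -Real.log x * |s - s'| * Real.exp (max (Real.log x * s) (Real.log x * s'))
      ≤ (20 * x ^ (-(1 / 20) : ℝ)) * |s - s'| * x ^ (9 / 10 : ℝ) := by
        gcongr
    _ = 20 * |s - s'| * (x ^ (-(1 / 20) : ℝ) * x ^ (9 / 10 : ℝ)) := by ring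
    _ = _ := by rw [h4]

/-- Second difference, in the base and in the exponent. It is small in both, as required for the
Lipschitz part of the norm of a difference of operators. -/
theorem abs_rpow_sub_sub_le {x y t s s' : ℝ} (hx : 0 < x) (hy : 0 < y) (hy1 : y ≤ 1)
    (hs : s ∈ Set.Icc (9 / 10 : ℝ) 1) (hs' : s' ∈ Set.Icc (9 / 10 : ℝ) 1)
    (h1 : x ≤ y * Real.exp t) (h2 : y ≤ x * Real.exp t) :
    |(x ^ s - x ^ s') - (y ^ s - y ^ s')| ≤
      21 * Real.exp t * |s - s'| * t * y ^ (17 / 20 : ℝ) := by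
  have hτ : |Real.log x - Real.log y| ≤ t := by
    rw [abs_sub_le_iff]
    constructor
    · have := Real.log_le_log hx h1
      rw [Real.log_mul hy.ne' (Real.exp_pos t).ne', Real.log_exp] at this
      linarith
    · have := Real.log_le_log hy h2
      rw [Real.log_mul hx.ne' (Real.exp_pos t).ne', Real.log_exp] at this
      linarith
  have ht : 0 ≤ t := (abs_nonneg _).trans hτ
  set τ := Real.log x - Real.log y with hτdef
  have hp : ∀ r : ℝ, x ^ r = y ^ r * Real.exp (r * τ) := fun r => by
    rw [Real.rpow_def_of_pos hx, Real.rpow_def_of_pos hy, ← Real.exp_add]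
    congr 1; rw [hτdef]; ring
  have e1 : (x ^ s - x ^ s') - (y ^ s - y ^ s') =
      (y ^ s - y ^ s') * (Real.exp (s * τ) - 1) +
        y ^ s' * (Real.exp (s * τ) - Real.exp (s' * τ)) := by
    rw [hp s, hp s']; ring
  have hexp : ∀ r : ℝ, r ∈ Set.Icc (9 / 10 : ℝ) 1 → r * τ ≤ t := fun r hr => by
    have h3 : r * τ ≤ r * t := mul_le_mul_of_nonneg_left ((le_abs_self _).trans hτ) (by linarith [hr.1])
    nlinarith [hr.2]
  have d1 : |Real.exp (s * τ) - 1| ≤ t * Real.exp t := by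
    have h4 := abs_exp_sub_exp_le (s * τ) 0
    rw [Real.exp_zero, sub_zero, abs_mul, abs_of_nonneg (by linarith [hs.1] : (0 : ℝ) ≤ s)] at h4
    refine h4.trans ?_
    have h5 : max (s * τ) 0 ≤ t := max_le (hexp s hs) ht
    have h6 : s * |τ| ≤ t := by nlinarith [hs.2, abs_nonneg τ]
    gcongr
  have d2 : |Real.exp (s * τ) - Real.exp (s' * τ)| ≤ |s - s'| * t * Real.exp t := by
    have h4 := abs_exp_sub_exp_le (s * τ) (s' * τ)
    rw [← sub_mul, abs_mul] at h4
    refine h4.trans ?_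
    have h5 : max (s * τ) (s' * τ) ≤ t := max_le (hexp s hs) (hexp s' hs')
    gcongr
  have d3 := abs_rpow_sub_rpow_exponent hy hy1 hs.1 hs'.1
  have d4 : y ^ s' ≤ y ^ (17 / 20 : ℝ) :=
    Real.rpow_le_rpow_of_exponent_ge hy hy1 (by linarith [hs'.1])
  rw [e1]
  refine (abs_add_le _ _).trans ?_
  rw [abs_mul, abs_mul, abs_of_pos (Real.rpow_pos_of_pos hy s')]
  calc |y ^ s - y ^ s'| * |Real.exp (s * τ) - 1| +
        y ^ s' * |Real.exp (s * τ) - Real.exp (s' * τ)|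
      ≤ (20 * |s - s'| * y ^ (17 / 20 : ℝ)) * (t * Real.exp t) +
        y ^ (17 / 20 : ℝ) * (|s - s'| * t * Real.exp t) := by gcongr
    _ = _ := by ring

theorem summable_div_sq_rpow {C : ℝ} (hC : 0 ≤ C) {s : ℝ} (hs : 1 / 2 < s) :
    Summable fun n : ℕ => (C / (n : ℝ) ^ 2) ^ s := by
  have h : (fun n : ℕ => (C / (n : ℝ) ^ 2) ^ s) = fun n : ℕ => C ^ s * (1 / (n : ℝ) ^ (2 * s)) := by
    funext n
    rw [Real.div_rpow hC (by positivity), ← Real.rpow_natCast, ← Real.rpow_mul (by positivity),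
      div_eq_mul_one_div]
    norm_num
  rw [h]
  exact (Real.summable_one_div_nat_rpow.mpr (by linarith)).mul_left _

theorem tsum_ite_le (v : ℕ → ℝ) (hv : Summable v) (N : ℕ) :
    Summable (fun n => if N ≤ n then v n else 0) ∧
      ∑' n, (if N ≤ n then v n else 0) = ∑' k, v (k + N) := by
  have h1 : Summable (fun n => if N ≤ n then v n else 0) := by
    rw [← summable_nat_add_iff N]
    simpa using (summable_nat_add_iff N).mpr hv
  refine ⟨h1, ?_⟩
  rw [← h1.sum_add_tsum_nat_add N, Finset.sum_eq_zero, zero_add]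
  · simp
  · intro n hn
    rw [if_neg (by simpa using hn)]

/-- Telescoping comparison: `1 / n² ≤ 2/n - 2/(n + 1)` for `n ≥ 1`. -/
theorem tsum_inv_sq_le {N : ℕ} (hN : 1 ≤ N) : ∑' k : ℕ, (1 : ℝ) / ((k + N : ℕ) : ℝ) ^ 2 ≤ (2 : ℝ) / (N : ℝ) := by
  have hN' : (0 : ℝ) < N := by exact_mod_cast hN
  have hN1 : (1 : ℝ) ≤ N := by exact_mod_cast hN
  refine Real.tsum_le_of_sum_range_le (fun _ => by positivity) fun n => ?_
  have h : ∀ k ∈ Finset.range n, 1 / ((k + N : ℕ) : ℝ) ^ 2 ≤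
      2 / ((k : ℝ) + N) - 2 / (((k + 1 : ℕ) : ℝ) + N) := by
    intro k _
    have hk : (0 : ℝ) ≤ k := Nat.cast_nonneg k
    push_cast
    rw [div_sub_div _ _ (by positivity) (by positivity), div_le_div_iff₀ (by positivity) (by positivity)]
    nlinarith
  refine (Finset.sum_le_sum h).trans ?_
  rw [Finset.sum_range_sub' (fun k : ℕ => 2 / ((k : ℝ) + N))]
  simp only [Nat.cast_zero, zero_add, sub_le_self_iff]
  positivity

end Powers

/-! ### The transfer operators -/

section Transfer

set_option linter.unusedSectionVars false

variable {Γ₀ : Subgroup SL(2, ℝ)} {A : Type*} {P : LabelledIdealPolygon Γ₀ A} [Finite A]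
  [Nonempty A]

theorem IsWordOperator.unique {s : ℝ} {X : A → Set (List A)} {L L' : PLip P →L[ℂ] PLip P}
    (h : IsWordOperator P s X L) (h' : IsWordOperator P s X L') : L = L' :=
  weighted_operator_unique (φ := fun W ξ => derivNorm (elt P W) ξ ^ s) h h'

theorem exists_isWordOperator {X : A → Set (List A)} (hX : IsWordFamily P X) {s : ℝ}
    (hs : 1 / 2 < s) : ∃ L, IsWordOperator P s X L := by
  obtain ⟨κ, C, K, hκ0, hκ1, hC, hK, hbd⟩ := exists_word_bounds P
  set c := 1 + s * (K) * Real.exp (s * (K * 2)) with hc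
  have hc0 : 0 ≤ c := by positivity
  have hc1 : 1 ≤ c := by rw [hc]; linarith [show 0 ≤ s * K * Real.exp (s * (K * 2)) by positivity]
  obtain ⟨L, hL, -⟩ := exists_weighted_operator (P := P) hX
    (φ := fun W ξ => derivNorm (elt P W) ξ ^ s) (v := fun n => c * (C / (n : ℝ) ^ 2) ^ s)
    ((summable_div_sq_rpow hC.le hs).mul_left c) (fun n => by positivity)
    (fun b W hW ξ hξ => by
      have h1 := (hbd W b (hX b W hW).1 (hX b W hW).2 ξ (arc_subset_closedArc b hξ)).2.1
      have h0 := derivNorm_pos (elt P W) ξ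
      rw [abs_of_pos (Real.rpow_pos_of_pos h0 s)]
      have := Real.rpow_le_rpow h0.le h1 (by linarith : 0 ≤ s)
      refine this.trans ?_
      exact le_mul_of_one_le_left (by positivity) hc1)
    (fun b W hW ξ hξ η hη => by
      have hξc := arc_subset_closedArc b hξ
      have hηc := arc_subset_closedArc b hη
      have h1 := (hbd W b (hX b W hW).1 (hX b W hW).2 η hηc).2.1
      have h2 := (hbd W b (hX b W hW).1 (hX b W hW).2 ξ hξc).2.2 η hηc
      have h3 := (hbd W b (hX b W hW).1 (hX b W hW).2 η hηc).2.2 ξ hξc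
      rw [dist_comm η ξ] at h3
      have h0 := derivNorm_pos (elt P W) ξ
      have h0' := derivNorm_pos (elt P W) η
      refine (abs_rpow_sub_rpow_le_of_ratio h0 h0' (by linarith) h2 h3).trans ?_
      have h4 := Real.rpow_le_rpow h0'.le h1 (by linarith : 0 ≤ s)
      have h5 : s * (K * dist ξ η) * Real.exp (s * (K * dist ξ η)) ≤ c * dist ξ η := by
        have h6 : Real.exp (s * (K * dist ξ η)) ≤ Real.exp (s * (K * 2)) := by
          rw [Real.exp_le_exp]
          have := circle_dist_le_two ξ η
          gcongr
        calc s * (K * dist ξ η) * Real.exp (s * (K * dist ξ η))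
            ≤ s * (K * dist ξ η) * Real.exp (s * (K * 2)) := by gcongr
          _ = (s * K * Real.exp (s * (K * 2))) * dist ξ η := by ring
          _ ≤ c * dist ξ η := by
            gcongr
            rw [hc]; linarith
      calc _ ≤ (C / (W.length : ℝ) ^ 2) ^ s * (c * dist ξ η) := by gcongr
        _ = _ := by ring)
  exact ⟨L, hL⟩

theorem isWordOperator_wordOperator {X : A → Set (List A)} (hX : IsWordFamily P X) {s : ℝ}
    (hs : 1 / 2 < s) : IsWordOperator P s X (wordOperator P s X) := by
  have h := exists_isWordOperator hX hs
  rw [wordOperator, dif_pos h]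
  exact h.choose_spec

variable (P) in
/-- Lipschitz dependence of the operators on the exponent. -/
theorem exists_wordOperator_sub_le : ∃ v : ℕ → ℝ, Summable v ∧ (∀ n, 0 ≤ v n) ∧
    ∀ (X : A → Set (List A)) (N : ℕ), IsWordFamily P X → (∀ b, ∀ W ∈ X b, N ≤ W.length) →
    ∀ s ∈ Set.Icc (9 / 10 : ℝ) 1, ∀ s' ∈ Set.Icc (9 / 10 : ℝ) 1,
      ‖wordOperator P s X - wordOperator P s' X‖ ≤ |s - s'| * ∑' k, v (k + N) := by
  obtain ⟨κ, C, K, hκ0, hκ1, hC, hK, hbd⟩ := exists_word_bounds P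
  set c := 20 + 21 * Real.exp (K * 2) * K with hc
  have hc0 : 0 ≤ c := by positivity
  set w : ℕ → ℝ := fun n => c * (C / (n : ℝ) ^ 2) ^ (17 / 20 : ℝ) with hw
  have hws : Summable w := (summable_div_sq_rpow hC.le (by norm_num)).mul_left c
  have hw0 : ∀ n, 0 ≤ w n := fun n => by positivity
  set M : ℝ := 3 * Nat.card (Bool × A) with hM
  refine ⟨fun n => M * w n, hws.mul_left _, fun n => by positivity, ?_⟩
  intro X N hX hN s hs s' hs'
  have h0 : ∀ s ∈ Set.Icc (9 / 10 : ℝ) 1, IsWordOperator P s X (wordOperator P s X) :=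
    fun s hs => isWordOperator_wordOperator hX (by linarith [hs.1])
  obtain ⟨hts, ht⟩ := tsum_ite_le w hws N
  have hδ := abs_nonneg (s - s')
  obtain ⟨L, hL, hLn⟩ := exists_weighted_operator (P := P) hX
    (φ := fun W ξ => derivNorm (elt P W) ξ ^ s - derivNorm (elt P W) ξ ^ s')
    (v := fun n => |s - s'| * (if N ≤ n then w n else 0)) (hts.mul_left _)
    (fun n => by split_ifs <;> positivity)
    (fun b W hW ξ hξ => by
      obtain ⟨h1, h2, -⟩ := hbd W b (hX b W hW).1 (hX b W hW).2 ξ (arc_subset_closedArc b hξ)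
      have h3 := derivNorm_pos (elt P W) ξ
      rw [if_pos (hN b W hW)]
      refine (abs_rpow_sub_rpow_exponent h3 (h1.trans hκ1.le) hs.1 hs'.1).trans ?_
      have h4 := Real.rpow_le_rpow h3.le h2 (by norm_num : (0 : ℝ) ≤ 17 / 20)
      have h5 : 20 ≤ c := by rw [hc]; linarith [show 0 ≤ 21 * Real.exp (K * 2) * K by positivity]
      calc _ ≤ 20 * |s - s'| * (C / (W.length : ℝ) ^ 2) ^ (17 / 20 : ℝ) := by gcongr
        _ = |s - s'| * (20 * (C / (W.length : ℝ) ^ 2) ^ (17 / 20 : ℝ)) := by ring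
        _ ≤ _ := by simp only [hw]; gcongr)
    (fun b W hW ξ hξ η hη => by
      have hξc := arc_subset_closedArc b hξ
      have hηc := arc_subset_closedArc b hη
      have h1 := hbd W b (hX b W hW).1 (hX b W hW).2 η hηc
      have h2 := (hbd W b (hX b W hW).1 (hX b W hW).2 ξ hξc).2.2 η hηc
      have h3 := h1.2.2 ξ hξc
      rw [dist_comm η ξ] at h3
      have h4 := derivNorm_pos (elt P W) ξ
      have h4' := derivNorm_pos (elt P W) η
      rw [if_pos (hN b W hW)]
      refine (abs_rpow_sub_sub_le h4 h4' (h1.1.trans hκ1.le) hs hs' h2 h3).trans ?_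
      have h5 := Real.rpow_le_rpow h4'.le h1.2.1 (by norm_num : (0 : ℝ) ≤ 17 / 20)
      have h6 : Real.exp (K * dist ξ η) ≤ Real.exp (K * 2) := by
        rw [Real.exp_le_exp]
        have := circle_dist_le_two ξ η
        gcongr
      have h7 : 21 * Real.exp (K * 2) * K ≤ c := by rw [hc]; linarith
      calc _ ≤ 21 * Real.exp (K * 2) * |s - s'| * (K * dist ξ η) *
            (C / (W.length : ℝ) ^ 2) ^ (17 / 20 : ℝ) := by gcongr
        _ = |s - s'| * ((21 * Real.exp (K * 2) * K) *
            (C / (W.length : ℝ) ^ 2) ^ (17 / 20 : ℝ)) * dist ξ η := by ring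
        _ ≤ _ := by simp only [hw]; gcongr)
  have hLe : wordOperator P s X - wordOperator P s' X = L := by
    refine weighted_operator_unique
      (φ := fun W ξ => derivNorm (elt P W) ξ ^ s - derivNorm (elt P W) ξ ^ s') ?_ hL
    intro f b ξ hξ
    have := (h0 s hs f b ξ hξ).sub (h0 s' hs' f b ξ hξ)
    simp only [← sub_mul, ← ofReal_sub] at this
    exact this
  rw [hLe]
  refine hLn.trans (le_of_eq ?_)
  rw [tsum_mul_left, tsum_mul_left, ht, hM]
  ring

variable (P) in
/-- The operators for the exponent `1` and long words are small. -/
theorem exists_wordOperator_one_le : ∃ C : ℝ, 0 < C ∧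
    ∀ (X : A → Set (List A)) (N : ℕ), 1 ≤ N → IsWordFamily P X →
      (∀ b, ∀ W ∈ X b, N ≤ W.length) → ‖wordOperator P 1 X‖ ≤ C / N := by
  obtain ⟨κ, C, K, hκ0, hκ1, hC, hK, hbd⟩ := exists_word_bounds P
  set c := C * (1 + K * Real.exp (K * 2)) with hc
  have hc0 : 0 < c := by positivity
  set w : ℕ → ℝ := fun n => c * (1 / (n : ℝ) ^ 2) with hw
  have hws : Summable w := (Real.summable_one_div_nat_pow.mpr one_lt_two).mul_left c
  have hM : (0 : ℝ) < Nat.card (Bool × A) := by exact_mod_cast Nat.card_pos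
  refine ⟨6 * Nat.card (Bool × A) * c, by positivity, ?_⟩
  intro X N hN1 hX hN
  have h0 := isWordOperator_wordOperator hX (s := 1) (by norm_num)
  obtain ⟨hts, ht⟩ := tsum_ite_le w hws N
  obtain ⟨L, hL, hLn⟩ := exists_weighted_operator (P := P) hX
    (φ := fun W ξ => derivNorm (elt P W) ξ ^ (1 : ℝ))
    (v := fun n => if N ≤ n then w n else 0) hts
    (fun n => by split_ifs <;> positivity)
    (fun b W hW ξ hξ => by
      obtain ⟨h1, h2, -⟩ := hbd W b (hX b W hW).1 (hX b W hW).2 ξ (arc_subset_closedArc b hξ)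
      have h3 := derivNorm_pos (elt P W) ξ
      rw [if_pos (hN b W hW), Real.rpow_one, abs_of_pos h3]
      refine h2.trans ?_
      simp only [hw, hc]
      rw [div_eq_mul_one_div]
      gcongr
      nlinarith [show 0 ≤ K * Real.exp (K * 2) by positivity])
    (fun b W hW ξ hξ η hη => by
      have hξc := arc_subset_closedArc b hξ
      have hηc := arc_subset_closedArc b hη
      have h1 := hbd W b (hX b W hW).1 (hX b W hW).2 η hηc
      have h2 := (hbd W b (hX b W hW).1 (hX b W hW).2 ξ hξc).2.2 η hηc
      have h3 := h1.2.2 ξ hξc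
      rw [dist_comm η ξ] at h3
      have h4 := derivNorm_pos (elt P W) ξ
      have h4' := derivNorm_pos (elt P W) η
      rw [if_pos (hN b W hW)]
      refine (abs_rpow_sub_rpow_le_of_ratio h4 h4' zero_le_one h2 h3).trans ?_
      have h6 : Real.exp (K * dist ξ η) ≤ Real.exp (K * 2) := by
        rw [Real.exp_le_exp]
        have := circle_dist_le_two ξ η
        gcongr
      rw [Real.rpow_one, one_mul]
      calc _ ≤ (C / (W.length : ℝ) ^ 2) * (K * dist ξ η * Real.exp (K * 2)) := by
            gcongr
            exact h1.2.1
        _ = C * (K * Real.exp (K * 2)) * (1 / (W.length : ℝ) ^ 2) * dist ξ η := by ring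
        _ ≤ _ := by
          simp only [hw, hc]
          gcongr
          linarith)
  have hLe : wordOperator P 1 X = L :=
    weighted_operator_unique (φ := fun W ξ => derivNorm (elt P W) ξ ^ (1 : ℝ)) h0 hL
  rw [hLe]
  refine hLn.trans ?_
  rw [ht]
  simp only [hw]
  rw [tsum_mul_left]
  have := tsum_inv_sq_le hN1
  calc _ ≤ 3 * ((Nat.card (Bool × A) : ℝ) * (c * (2 / N))) := by gcongr
    _ = _ := by ring

/-! ### Positivity -/

section Positivity

variable {s : ℝ} {X : A → Set (List A)} {L : PLip P →L[ℂ] PLip P}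

theorem IsWordOperator.hasSum_re (h : IsWordOperator P s X L) (f : PLip P) {b : A} {ξ : Circle}
    (hξ : ξ ∈ arc P b) : HasSum (fun W : X b =>
      derivNorm (elt P (W : List A)) ξ ^ s * (f (act (elt P (W : List A)) ξ)).re) (L f ξ).re := by
  have := Complex.hasSum_re (h f b ξ hξ)
  simpa only [re_ofReal_mul] using this

theorem IsWordOperator.conjL (h : IsWordOperator P s X L) (f : PLip P) :
    L (PLip.conjL f) = PLip.conjL (L f) := by
  refine PLip.ext fun ξ => ?_
  obtain ⟨b, hb⟩ := exists_mem_arc (P := P) ξ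
  refine (h (PLip.conjL f) b ξ hb).unique ?_
  have := Complex.hasSum_conj'.mpr (h f b ξ hb)
  simpa only [map_mul, conj_ofReal, PLip.conjL_apply] using this

theorem IsWordOperator.re_mono (h : IsWordOperator P s X L) {f g : PLip P}
    (hfg : ∀ ξ, (f ξ).re ≤ (g ξ).re) (ξ : Circle) : (L f ξ).re ≤ (L g ξ).re := by
  obtain ⟨b, hb⟩ := exists_mem_arc (P := P) ξ
  exact hasSum_le (fun W => mul_le_mul_of_nonneg_left (hfg _)
    (Real.rpow_nonneg (derivNorm_pos _ _).le s)) (h.hasSum_re f hb) (h.hasSum_re g hb)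

theorem IsWordOperator.re_nonneg (h : IsWordOperator P s X L) {f : PLip P}
    (hf : ∀ ξ, 0 ≤ (f ξ).re) (ξ : Circle) : 0 ≤ (L f ξ).re := by
  have := h.re_mono (f := 0) (g := f) hf ξ
  rwa [map_zero] at this

theorem IsWordOperator.term_le (h : IsWordOperator P s X L) {f : PLip P}
    (hf : ∀ ξ, 0 ≤ (f ξ).re) {b : A} {ξ : Circle} (hξ : ξ ∈ arc P b) {W : List A} (hW : W ∈ X b) :
    derivNorm (elt P W) ξ ^ s * (f (act (elt P W) ξ)).re ≤ (L f ξ).re :=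
  le_hasSum (h.hasSum_re f hξ) (⟨W, hW⟩ : X b) fun _ _ =>
    mul_nonneg (Real.rpow_nonneg (derivNorm_pos _ _).le s) (hf _)

/-- Lowering the exponent from `s'` to `s` multiplies each term by a nonpositive power of a
derivative at most `κ`. This quantitative monotonicity locates the root of Bowen's equation. -/
theorem IsWordOperator.scale_le {κ s' : ℝ} {L' : PLip P →L[ℂ] PLip P} (h : IsWordOperator P s X L)
    (h' : IsWordOperator P s' X L') (hss : s ≤ s')
    (hκ : ∀ b, ∀ W ∈ X b, ∀ ξ ∈ closedArc P b, derivNorm (elt P W) ξ ≤ κ) {f : PLip P}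
    (hf : ∀ ξ, 0 ≤ (f ξ).re) (ξ : Circle) : κ ^ (s - s') * (L' f ξ).re ≤ (L f ξ).re := by
  obtain ⟨b, hb⟩ := exists_mem_arc (P := P) ξ
  refine hasSum_le (fun W => ?_) ((h'.hasSum_re f hb).mul_left _) (h.hasSum_re f hb)
  have h0 := derivNorm_pos (elt P (W : List A)) ξ
  rw [← mul_assoc]
  refine mul_le_mul_of_nonneg_right ?_ (hf _)
  have h1 := Real.rpow_le_rpow_of_nonpos h0 (hκ b W W.2 ξ (arc_subset_closedArc b hb))
    (by linarith : s - s' ≤ 0)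
  calc _ ≤ derivNorm (elt P (W : List A)) ξ ^ (s - s') * derivNorm (elt P (W : List A)) ξ ^ s' := by
        gcongr
    _ = _ := by rw [← Real.rpow_add h0]; congr 1; ring

end Positivity

/-! ### The families of words -/

section Families

variable (Γ : Subgroup SL(2, ℝ)) {p : ℕ} (S : Fin p → SL(2, ℝ))

theorem isWordFamily_words (T : EReal) : IsWordFamily P (words P Γ S T) :=
  fun _ _ hW => ⟨hW.1, hW.2.1⟩

theorem isWordFamily_longWords (T : ℝ) : IsWordFamily P (longWords P Γ S T) :=
  fun _ _ hW => ⟨hW.1, hW.2.1⟩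

theorem isWordOperator_transferOp {s : ℝ} (hs : 1 / 2 < s) (T : EReal) :
    IsWordOperator P s (words P Γ S T) (transferOp P Γ S s T) :=
  isWordOperator_wordOperator (isWordFamily_words Γ S T) hs

theorem isWordOperator_deltaOp {s : ℝ} (hs : 1 / 2 < s) (T : ℝ) :
    IsWordOperator P s (longWords P Γ S T) (deltaOp P Γ S s T) :=
  isWordOperator_wordOperator (isWordFamily_longWords Γ S T) hs

theorem mem_words_top {a : A} {W : List A} :
    W ∈ words P Γ S ⊤ a ↔ IsCuspidal P W ∧ Follows P W a := by
  simp [words]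

theorem mem_words_coe {a : A} {W : List A} {T : ℝ} :
    W ∈ words P Γ S T a ↔ IsCuspidal P W ∧ Follows P W a ∧ geomLength P Γ S W ≤ T := by
  simp [words]

theorem transferOp_top_eq {s : ℝ} (hs : 1 / 2 < s) (T : ℝ) :
    transferOp P Γ S s ⊤ = transferOp P Γ S s T + deltaOp P Γ S s T := by
  refine (isWordOperator_transferOp Γ S hs ⊤).unique ?_
  intro f b ξ hξ
  have h1 := isWordOperator_transferOp Γ S hs T f b ξ hξ
  have h2 := isWordOperator_deltaOp Γ S hs T f b ξ hξ
  have hu : words P Γ S ⊤ b = words P Γ S T b ∪ longWords P Γ S T b := by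
    ext W
    rw [Set.mem_union, mem_words_top, mem_words_coe, longWords, Set.mem_ofPred_eq]
    rcases le_or_gt (geomLength P Γ S W) T with h | h
    · simp [h, h.not_gt]
    · simp [h, h.not_ge]
  have hd : Disjoint (words P Γ S T b) (longWords P Γ S T b) := by
    rw [Set.disjoint_left]
    intro W h h'
    exact (mem_words_coe Γ S |>.mp h).2.2.not_gt h'.2.2
  rw [hu]
  exact HasSum.add_disjoint (f := fun W : List A =>
    ((derivNorm (elt P W) ξ ^ s : ℝ) : ℂ) * f (act (elt P W) ξ)) hd h1 h2

end Families
end Transfer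

/-! ### The uniform measure on the circle -/

section CircleMeasure

/-- The substitution `x = tan θ` turns the weight `dx / (1 + x²)` into `dθ`. -/
theorem pt_tan (ζ : Circle) {θ : ℝ} (h : Real.cos θ ≠ 0) :
    pt ζ (Real.tan θ) = ζ * Circle.exp (Real.pi - 2 * θ) := by
  apply Circle.ext
  have h1 := real_sub_I_ne (Real.tan θ)
  have hc : (Real.cos θ : ℂ) ≠ 0 := by exact_mod_cast h
  rw [coe_pt, Circle.coe_mul, Circle.coe_exp]
  congr 1
  rw [div_eq_iff h1, Real.tan_eq_sin_div_cos]
  have e1 : Complex.exp (((Real.pi - 2 * θ : ℝ) : ℂ) * I) = -Complex.exp (-(θ : ℂ) * I) ^ 2 := by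
    rw [← Complex.exp_nat_mul]
    have : ((Real.pi - 2 * θ : ℝ) : ℂ) * I = Real.pi * I + ((2 : ℕ) : ℂ) * (-(θ : ℂ) * I) := by
      push_cast; ring
    rw [this, Complex.exp_add, Complex.exp_pi_mul_I]; ring
  have e2 : Complex.exp (-(θ : ℂ) * I) = Real.cos θ - Real.sin θ * I := by
    rw [Complex.exp_mul_I, Complex.cos_neg, Complex.sin_neg, ofReal_cos, ofReal_sin]; ring
  have e3 : (Real.sin θ : ℂ) ^ 2 + (Real.cos θ : ℂ) ^ 2 = 1 := by
    exact_mod_cast Real.sin_sq_add_cos_sq θ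
  rw [e1, e2]
  rw [ofReal_div]
  have ht : (Real.sin θ : ℂ) / Real.cos θ * Real.cos θ = Real.sin θ := div_mul_cancel₀ _ hc
  have hI : I ^ 2 = -1 := I_sq
  set c : ℂ := ((Real.cos θ : ℝ) : ℂ)
  set s : ℂ := ((Real.sin θ : ℝ) : ℂ)
  refine mul_right_cancel₀ hc ?_
  linear_combination (1 + (c - s * I) ^ 2) * ht + (s + c * s * (c - s * I)) * hI -
    (I * c - s * I ^ 2) * e3

theorem lintegral_pt (ζ : Circle) (f : Circle → ENNReal) :
    ∫⁻ x : ℝ, ENNReal.ofReal (1 / (1 + x ^ 2)) * f (pt ζ x) =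
      ∫⁻ θ in Set.Ioc (-(Real.pi / 2)) (-(Real.pi / 2) + Real.pi),
        f (ζ * Circle.exp (Real.pi - 2 * θ)) := by
  have h1 := lintegral_image_eq_lintegral_abs_deriv_mul (s := Set.univ) (f := Real.arctan)
    (f' := fun x => 1 / (1 + x ^ 2)) MeasurableSet.univ
    (fun x _ => (Real.hasDerivAt_arctan x).hasDerivWithinAt) Real.arctan_injective.injOn
    (fun θ => f (pt ζ (Real.tan θ)))
  rw [Set.image_univ, Real.range_arctan, setLIntegral_univ] at h1
  simp only [Real.tan_arctan] at h1
  have h2 : ∀ x : ℝ, |1 / (1 + x ^ 2)| = 1 / (1 + x ^ 2) := fun x => abs_of_pos (by positivity)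
  simp only [h2] at h1
  rw [← h1]
  have h3 : -(Real.pi / 2) + Real.pi = Real.pi / 2 := by ring
  rw [h3, ← restrict_Ioo_eq_restrict_Ioc]
  refine setLIntegral_congr_fun measurableSet_Ioo fun θ hθ => ?_
  rw [pt_tan ζ (Real.cos_pos_of_mem_Ioo hθ).ne']

/-- Both sides are integrals over one period of the same `π`-periodic function, translated by half
the argument of the base point. -/
theorem lintegral_pt_eq (ζ ζ' : Circle) (f : Circle → ENNReal) :
    ∫⁻ x : ℝ, ENNReal.ofReal (1 / (1 + x ^ 2)) * f (pt ζ x) =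
      ∫⁻ x : ℝ, ENNReal.ofReal (1 / (1 + x ^ 2)) * f (pt ζ' x) := by
  have hper : Function.Periodic (fun θ : ℝ => f (Circle.exp (Real.pi - 2 * θ))) Real.pi := by
    intro θ
    have : Real.pi - 2 * (θ + Real.pi) = Real.pi - 2 * θ - 2 * Real.pi := by ring
    simp only [this, Circle.exp_sub, Circle.exp_two_pi, div_one]
  have : Fact (0 < Real.pi) := ⟨Real.pi_pos⟩
  suffices h : ∀ ζ : Circle, ∫⁻ x : ℝ, ENNReal.ofReal (1 / (1 + x ^ 2)) * f (pt ζ x) =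
      ∫⁻ b : AddCircle Real.pi, hper.lift b by rw [h, h]
  intro ζ
  obtain ⟨t, ht⟩ : ∃ t : ℝ, Circle.exp (2 * t) = ζ := by
    refine ⟨arg ζ / 2, ?_⟩
    rw [mul_div_cancel₀ _ two_ne_zero, Circle.exp_arg]
  rw [lintegral_pt, ← AddCircle.lintegral_preimage Real.pi (-(Real.pi / 2) - t)]
  have h1 := (measurePreserving_sub_right volume t).setLIntegral_comp_preimage_emb
    (measurableEmbedding_subRight t) (fun θ => f (Circle.exp (Real.pi - 2 * θ)))
    (Set.Ioc (-(Real.pi / 2) - t) (-(Real.pi / 2) - t + Real.pi))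
  simp only [Function.Periodic.lift_coe]
  rw [← h1]
  have h2 : (fun x => x - t) ⁻¹' Set.Ioc (-(Real.pi / 2) - t) (-(Real.pi / 2) - t + Real.pi) =
      Set.Ioc (-(Real.pi / 2)) (-(Real.pi / 2) + Real.pi) := by
    ext x; simp only [Set.mem_preimage, Set.mem_Ioc]
    constructor <;> rintro ⟨h, h'⟩ <;> constructor <;> linarith
  rw [h2]
  refine lintegral_congr fun θ => ?_
  rw [← ht, ← Circle.exp_add]
  congr 2; ring

/-- The rotation invariant probability measure on the circle. -/
def circleMeasure : Measure Circle :=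
  ENNReal.ofReal Real.pi⁻¹ •
    (volume.withDensity fun x : ℝ => ENNReal.ofReal (1 / (1 + x ^ 2))).map (pt 1)

theorem measurable_weight : Measurable fun x : ℝ => ENNReal.ofReal (1 / (1 + x ^ 2)) := by
  fun_prop

theorem lintegral_circleMeasure (ζ : Circle) {f : Circle → ENNReal} (hf : Measurable f) :
    ∫⁻ ξ, f ξ ∂circleMeasure = ENNReal.ofReal Real.pi⁻¹ *
      ∫⁻ x : ℝ, ENNReal.ofReal (1 / (1 + x ^ 2)) * f (pt ζ x) := by
  have h := lintegral_withDensity_eq_lintegral_mul volume measurable_weight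
    (hf.comp (continuous_pt 1).measurable)
  simp only [Function.comp_apply, Pi.mul_apply] at h
  rw [circleMeasure, lintegral_smul_measure, lintegral_map hf (continuous_pt 1).measurable, h,
    lintegral_pt_eq ζ 1, smul_eq_mul]

instance : IsProbabilityMeasure circleMeasure := by
  constructor
  have h := lintegral_circleMeasure 1 (f := fun _ => 1) measurable_const
  rw [lintegral_one] at h
  rw [h, lintegral_pt 1 fun _ => 1]
  simp only [lintegral_one, Measure.restrict_apply_univ, Real.volume_Ioc]
  rw [← ENNReal.ofReal_mul (by positivity)]
  have := Real.pi_ne_zero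
  rw [← ENNReal.ofReal_one]
  congr 1
  field_simp; ring

instance : NullSingletonClass circleMeasure := by
  constructor
  intro ξ
  have h := lintegral_circleMeasure ξ (f := Set.indicator {ξ} 1)
    (measurable_one.indicator (measurableSet_singleton ξ))
  rw [lintegral_indicator_one (measurableSet_singleton ξ)] at h
  rw [h]
  simp [pt_ne]

/-- Change of variables. -/
theorem lintegral_derivNorm_mul (G : SL(2, ℝ)) {f : Circle → ENNReal} (hf : Measurable f) :
    ∫⁻ ξ, ENNReal.ofReal (derivNorm G ξ) * f (act G ξ) ∂circleMeasure =
      ∫⁻ ξ, f ξ ∂circleMeasure := by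
  have hm : Measurable fun ξ => ENNReal.ofReal (derivNorm G ξ) * f (act G ξ) :=
    (continuous_derivNorm G).measurable.ennreal_ofReal.mul
      (hf.comp (continuous_act G).measurable)
  rw [lintegral_circleMeasure 1 hm, lintegral_circleMeasure (act G 1) hf]
  congr 1
  -- In the coordinates at `1` and at `G 1` the map is `x ↦ c x + t`. Its Jacobian `c`, together
  -- with the two weights, is the derivative on the circle.
  set c := (derivNorm G 1)⁻¹ with hc
  have hc0 : 0 < c := inv_pos.mpr (derivNorm_pos _ _)
  set t := xc (act G 1) (act G (pt 1 0)) with ht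
  have hxc : ∀ x, xc (act G 1) (act G (pt 1 x)) = x * c + t := by
    intro x
    have := xc_act_sub_mul G (pt_ne 1 x) (pt_ne 1 0)
    rw [xc_pt, xc_pt, sub_zero] at this
    linarith
  have hne : ∀ x, act G (pt 1 x) ≠ act G 1 := fun x h => pt_ne 1 x (act_injective G h)
  have hpt : ∀ x, act G (pt 1 x) = pt (act G 1) (x * c + t) := by
    intro x
    rw [← hxc, pt_xc (hne x)]
  have h1 := lintegral_image_eq_lintegral_abs_deriv_mul (s := Set.univ) (f := fun x => x * c + t)
    (f' := fun _ => c) MeasurableSet.univ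
    (fun x _ => (((hasDerivAt_mul_const c).add_const t)).hasDerivWithinAt)
    (fun x _ y _ h => by
      simp only [add_left_inj] at h
      exact mul_right_cancel₀ hc0.ne' h)
    (fun x => ENNReal.ofReal (1 / (1 + x ^ 2)) * f (pt (act G 1) x))
  have him : (fun x => x * c + t) '' Set.univ = Set.univ := by
    rw [Set.image_univ, Set.range_eq_univ]
    intro y
    exact ⟨(y - t) / c, by field_simp; ring⟩
  rw [him, setLIntegral_univ, setLIntegral_univ] at h1
  rw [h1]
  refine lintegral_congr fun x => ?_
  rw [hpt, ← mul_assoc, ← mul_assoc, abs_of_pos hc0, ← ENNReal.ofReal_mul (by positivity),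
    ← ENNReal.ofReal_mul hc0.le]
  congr 2
  have h2 := dist_act_sq G (pt 1 x) 1
  rw [dist_sq_of_xc (hne x), dist_sq_of_xc (pt_ne 1 x), hxc, xc_pt] at h2
  have h3 := derivNorm_pos G 1
  rw [hc] at h2 ⊢
  field_simp at h2 ⊢
  linarith

theorem map_act_withDensity (G : SL(2, ℝ)) :
    (circleMeasure.withDensity fun ξ => ENNReal.ofReal (derivNorm G ξ)).map (act G) =
      circleMeasure := by
  ext s hs
  have hm := (continuous_act G).measurable
  rw [Measure.map_apply hm hs, withDensity_apply _ (hm hs), ← lintegral_indicator (hm hs)]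
  have := lintegral_derivNorm_mul G (f := s.indicator 1) (measurable_one.indicator hs)
  rw [lintegral_indicator_one hs] at this
  rw [← this]
  refine lintegral_congr fun ξ => ?_
  by_cases h : act G ξ ∈ s
  · rw [Set.indicator_of_mem (show ξ ∈ act G ⁻¹' s from h), Set.indicator_of_mem h]; simp
  · rw [Set.indicator_of_notMem (show ξ ∉ act G ⁻¹' s from h), Set.indicator_of_notMem h]; simp

theorem setIntegral_image_act (G : SL(2, ℝ)) (s : Set Circle) {E : Type*} [NormedAddCommGroup E]
    [NormedSpace ℝ E] (f : Circle → E) :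
    ∫ ξ in act G '' s, f ξ ∂circleMeasure =
      ∫ ξ in s, derivNorm G ξ • f (act G ξ) ∂circleMeasure := by
  have hemb : MeasurableEmbedding (act G) :=
    ((continuous_act G).isClosedEmbedding (act_injective G)).measurableEmbedding
  conv_lhs => rw [← map_act_withDensity G]
  rw [hemb.setIntegral_map, Set.preimage_image_eq _ (act_injective G)]
  have hd : (fun ξ => ENNReal.ofReal (derivNorm G ξ)) =
      fun ξ => ((derivNorm G ξ).toNNReal : ENNReal) := rfl
  rw [hd, setIntegral_withDensity_eq_setIntegral_smul₀' _
    (continuous_derivNorm G).measurable.real_toNNReal.aemeasurable]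
  refine integral_congr_ae (Eventually.of_forall fun ξ => ?_)
  simp only [NNReal.smul_def, Real.coe_toNNReal _ (derivNorm_pos G ξ).le]

end CircleMeasure

/-! ### Invariance of the uniform measure under the transfer operator with exponent one -/

section Invariance

set_option linter.unusedSectionVars false

variable {Γ₀ : Subgroup SL(2, ℝ)} {A : Type*} {P : LabelledIdealPolygon Γ₀ A} [Finite A]
  [Nonempty A]

theorem measurableEmbedding_act (G : SL(2, ℝ)) : MeasurableEmbedding (act G) :=
  ((continuous_act G).isClosedEmbedding (act_injective G)).measurableEmbedding

theorem PLip.integrable (f : PLip P) (μ : Measure Circle) [IsFiniteMeasure μ] :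
    Integrable f.1 μ :=
  Integrable.of_bound f.measurable.aestronglyMeasurable ‖f‖
    (Eventually.of_forall fun ξ => PLip.norm_apply_le f ξ)

variable (P) in
/-- The union of the images of the branches of a family of words, for a given next letter. -/
def branchImage (X : A → Set (List A)) (b : A) : Set Circle :=
  ⋃ W : X b, act (elt P (W : List A)) '' arc P b

/-- With exponent one the weights are Jacobians: each term integrates to `∫ f` over the image of its
branch, and these images are disjoint. -/
theorem IsWordOperator.setIntegral_arc {X : A → Set (List A)} (hX : IsWordFamily P X)
    {L : PLip P →L[ℂ] PLip P} (h : IsWordOperator P 1 X L) (f : PLip P) (b : A) :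
    ∫ ξ in arc P b, L f ξ ∂circleMeasure = ∫ ξ in branchImage P X b, f ξ ∂circleMeasure := by
  obtain ⟨κ, _, _, hκ0, hκ1, -, -, hbd⟩ := exists_word_bounds P
  have hm : ∀ W : X b, MeasurableSet (act (elt P (W : List A)) '' arc P b) := fun W =>
    (measurableEmbedding_act _).measurableSet_image.mpr (measurableSet_arc b)
  have hd : Pairwise (Function.onFun Disjoint fun W : X b => act (elt P (W : List A)) '' arc P b) := by
    intro W W' hne
    rw [Function.onFun, Set.disjoint_left]
    rintro _ ⟨ξ, hξ, rfl⟩ ⟨ξ', hξ', he⟩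
    have hW := hX b W W.2
    have hW' := hX b W' W'.2
    exact hne (Subtype.ext (eq_of_act_eq hW.1 hW'.1 hW.2 hW'.2 hξ hξ' he.symm).1)
  have hi := f.integrable circleMeasure
  have h1 := hasSum_integral_iUnion (μ := circleMeasure) hm hd hi.integrableOn
  have h2 := hasSum_integral_iUnion (μ := circleMeasure) hm hd hi.norm.integrableOn
  simp only [setIntegral_image_act] at h1 h2
  have hF : ∀ W : X b, Integrable (fun ξ => derivNorm (elt P (W : List A)) ξ •
      f (act (elt P (W : List A)) ξ)) (circleMeasure.restrict (arc P b)) := by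
    intro W
    refine Integrable.of_bound ?_ ‖f‖ ?_
    · exact ((continuous_derivNorm _).measurable.smul
        (f.measurable.comp (continuous_act _).measurable)).aestronglyMeasurable
    · refine ae_restrict_of_forall_mem (measurableSet_arc b) fun ξ hξ => ?_
      have hW := hX b W W.2
      have h3 := (hbd _ b hW.1 hW.2 ξ (arc_subset_closedArc b hξ)).1
      have h4 := derivNorm_pos (elt P (W : List A)) ξ
      rw [norm_smul, Real.norm_eq_abs, abs_of_pos h4]
      have := PLip.norm_apply_le f (act (elt P (W : List A)) ξ)
      nlinarith [norm_nonneg (f (act (elt P (W : List A)) ξ))]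
  have h3 := hasSum_integral_of_summable_integral_norm hF (by
    refine h2.summable.congr fun W => ?_
    refine integral_congr_ae (Eventually.of_forall fun ξ => ?_)
    simp only [norm_smul, Real.norm_eq_abs, abs_of_pos (derivNorm_pos _ _), smul_eq_mul])
  refine Eq.trans ?_ (h1.unique h3).symm
  refine setIntegral_congr_fun (measurableSet_arc b) fun ξ hξ => ?_
  have := h f b ξ hξ
  simp only [Real.rpow_one] at this
  rw [← this.tsum_eq]
  rfl

theorem measurableSet_branchImage (X : A → Set (List A)) (b : A) :
    MeasurableSet (branchImage P X b) :=
  MeasurableSet.iUnion fun _ => (measurableEmbedding_act _).measurableSet_image.mpr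
    (measurableSet_arc b)

theorem IsWordOperator.integral_eq {X : A → Set (List A)} (hX : IsWordFamily P X)
    {L : PLip P →L[ℂ] PLip P} (h : IsWordOperator P 1 X L) (f : PLip P) :
    ∫ ξ, L f ξ ∂circleMeasure = ∫ ξ in ⋃ b, branchImage P X b, f ξ ∂circleMeasure := by
  have hd : Pairwise (Function.onFun Disjoint (arc P)) := fun a b hne =>
    Set.disjoint_left.mpr fun ξ ha hb => hne (eq_of_mem_arc ha hb)
  have hd' : Pairwise (Function.onFun Disjoint (branchImage P X)) := by
    intro a b hne
    rw [Function.onFun, Set.disjoint_left]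
    intro η h1 h2
    simp only [branchImage, Set.mem_iUnion] at h1 h2
    obtain ⟨W, ξ, hξ, rfl⟩ := h1
    obtain ⟨W', ξ', hξ', he⟩ := h2
    have hW := hX a W W.2
    have hW' := hX b W' W'.2
    exact hne (eq_of_act_eq hW.1 hW'.1 hW.2 hW'.2 hξ hξ' he.symm).2
  have h1 := hasSum_integral_iUnion (μ := circleMeasure) (measurableSet_arc (P := P)) hd
    ((L f).integrable circleMeasure).integrableOn
  have h2 := hasSum_integral_iUnion (μ := circleMeasure) (measurableSet_branchImage X) hd'
    (f.integrable circleMeasure).integrableOn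
  simp only [h.setIntegral_arc hX] at h1
  refine Eq.trans ?_ (h2.unique h1).symm
  rw [iUnion_arc, setIntegral_univ]

variable (P) in
theorem ae_ne_ep : ∀ᵐ ξ ∂circleMeasure, ∀ e a, ξ ≠ ep P e a := by
  simp only [ae_all_iff]
  intro e a
  exact compl_mem_ae_iff.mpr (measure_singleton _)

/-! ### Images of the long words as neighbourhoods of the vertices -/

section Families

variable (Γ : Subgroup SL(2, ℝ)) {p : ℕ} (S : Fin p → SL(2, ℝ))

/-- The images of all the branches form a partition of the circle up to the finitely many vertices,
which are null. -/
theorem integral_transferOp (f : PLip P) :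
    ∫ ξ, transferOp P Γ S 1 ⊤ f ξ ∂circleMeasure = ∫ ξ, f ξ ∂circleMeasure := by
  rw [(isWordOperator_transferOp Γ S (by norm_num) ⊤).integral_eq (isWordFamily_words Γ S ⊤),
    ← setIntegral_univ (μ := circleMeasure)]
  refine setIntegral_congr_set ?_
  filter_upwards [ae_ne_ep P] with ξ hξ
  refine propext ⟨fun _ => trivial, fun _ => ?_⟩
  obtain ⟨W, b, hW, hf, η, hη, he⟩ := exists_branch (P := P) (hξ false)
  exact Set.mem_iUnion.mpr ⟨b, Set.mem_iUnion.mpr ⟨⟨W, (mem_words_top Γ S).mpr ⟨hW, hf⟩⟩, η, hη, he⟩⟩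

variable (P) in
/-- The horocyclic neighbourhoods of the vertices. -/
def tail (e : Bool) (a : A) (y : ℝ) : Set Circle := {ξ | ξ ≠ ep P e a ∧ y < xs e (ep P e a) ξ}

variable (P) in
/-- The first index for which the word of the vertex has geometric length more than `T`. -/
def cut (T : ℝ) (e : Bool) (a : A) : ℕ :=
  sInf {n | T < scale P Γ S e a * (px P e a n - px P e a 0)}

theorem lt_cut_iff {T : ℝ} {e : Bool} {a : A} {n : ℕ} :
    T < scale P Γ S e a * (px P e a n - px P e a 0) ↔ cut P Γ S T e a ≤ n := by
  have hs := scale_pos (P := P) (Γ := Γ) (S := S) e a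
  have hne : {n | T < scale P Γ S e a * (px P e a n - px P e a 0)}.Nonempty := by
    have : Tendsto (fun n => scale P Γ S e a * (px P e a n - px P e a 0)) atTop atTop :=
      Tendsto.const_mul_atTop hs (tendsto_atTop_add_const_right _ _ (px_tendsto e a))
    exact (this.eventually_gt_atTop T).exists
  constructor
  · exact fun h => Nat.sInf_le h
  · intro h
    have h1 : T < scale P Γ S e a * (px P e a (cut P Γ S T e a) - px P e a 0) := Nat.sInf_mem hne
    refine h1.trans_le (mul_le_mul_of_nonneg_left ?_ hs.le)
    exact sub_le_sub_right ((px_mono e a).monotone h) _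

theorem one_le_cut {T : ℝ} (hT : 0 ≤ T) (e : Bool) (a : A) : 1 ≤ cut P Γ S T e a := by
  by_contra h
  have := (lt_cut_iff (P := P) Γ S (T := T) (e := e) (a := a) (n := 0)).mpr (by omega)
  rw [sub_self, mul_zero] at this
  linarith

/-- The image of the word of index `n` at an end of an arc has coordinates in `[px n, px (n + 1)]`,
and the word is long exactly when `n` reaches the cut. Conversely, by `word_of_px_lt`, only such
words reach these coordinates. -/
theorem branchImage_longWords {Γ : Subgroup SL(2, ℝ)} {S : Fin p → SL(2, ℝ)} (hle : Γ₀ ≤ Γ)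
    (hS : IsCuspSystem Γ S) {T : ℝ} (hT : 0 ≤ T) :
    (⋃ b, branchImage P (longWords P Γ S T) b : Set Circle) =ᵐ[circleMeasure]
      (⋃ q : Bool × A, tail P q.1 q.2 (px P q.1 q.2 (cut P Γ S T q.1 q.2)) : Set Circle) := by
  have hlong : ∀ e a n, T < geomLength P Γ S (cw P e a n) ↔ cut P Γ S T e a ≤ n := fun e a n => by
    rw [geomLength_cw hle hS, lt_cut_iff]
  -- The endpoints of the intervals of coordinates are discarded to pass from weak to strict
  -- inequalities.
  have hnull : ∀ᵐ ξ ∂circleMeasure, ∀ e a n, xs e (ep P e a) ξ = px P e a n → ξ = ep P e a := by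
    simp only [ae_all_iff]
    intro e a n
    have : ∀ᵐ ξ ∂circleMeasure, ξ ≠ pt (ep P e a) (sg e * px P e a n) :=
      compl_mem_ae_iff.mpr (measure_singleton _)
    filter_upwards [this] with ξ h1 h2
    by_contra h3
    exact h1 (by rw [← h2, pt_xs e h3])
  filter_upwards [ae_ne_ep P, hnull] with ξ hξ hξ'
  refine propext ?_
  change ξ ∈ (⋃ b, branchImage P (longWords P Γ S T) b) ↔
    ξ ∈ ⋃ q : Bool × A, tail P q.1 q.2 (px P q.1 q.2 (cut P Γ S T q.1 q.2))
  simp only [branchImage, Set.mem_iUnion]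
  constructor
  · rintro ⟨b, ⟨W, hW, hf, hl⟩, η, hη, rfl⟩
    obtain ⟨e, a, n, rfl⟩ := isCuspidal_iff.mp hW
    refine ⟨(e, a), hξ e a, ?_⟩
    have h1 := (px_le_xs_image hf (arc_subset_closedArc b hη)).1
    have h2 := (px_mono (P := P) e a).monotone ((hlong e a n).mp hl)
    refine lt_of_le_of_ne (h2.trans h1) fun h => hξ e a (hξ' e a _ h.symm)
  · rintro ⟨⟨e, a⟩, hne, hx⟩
    obtain ⟨W, b, hW, hf, η, hη, rfl⟩ := exists_branch (P := P) (hξ false)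
    obtain ⟨n, hn, rfl⟩ := word_of_px_lt (one_le_cut Γ S hT e a) hW hf hη hne hx
    exact ⟨b, ⟨_, hW, hf, (hlong e a n).mpr hn⟩, η, hη, rfl⟩

/-- A common point would be in the image of a word of at least two letters belonging to both ends.
The first letter determines the arc and the second one the orientation. -/
theorem aedisjoint_tail {N : Bool × A → ℕ} (hN : ∀ q, 1 ≤ N q) :
    Pairwise (Function.onFun (AEDisjoint circleMeasure)
      fun q : Bool × A => tail P q.1 q.2 (px P q.1 q.2 (N q))) := by
  rintro ⟨e, a⟩ ⟨e', a'⟩ hne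
  have : ∀ᵐ ξ ∂circleMeasure, ξ ∉ tail P e a (px P e a (N (e, a))) ∩
      tail P e' a' (px P e' a' (N (e', a'))) := by
    filter_upwards [ae_ne_ep P] with ξ hξ
    rintro ⟨⟨h1, h2⟩, h1', h2'⟩
    obtain ⟨W, b, hW, hf, η, hη, rfl⟩ := exists_branch (P := P) (hξ false)
    obtain ⟨n, hn, rfl⟩ := word_of_px_lt (hN (e, a)) hW hf hη h1 h2
    obtain ⟨n', hn', hc⟩ := word_of_px_lt (hN (e', a')) hW hf hη h1' h2'
    have ha : a = a' := by
      have := congrArg List.head? hc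
      rwa [head?_cw, head?_cw, Option.some.injEq] at this
    subst ha
    have hee : e ≠ e' := fun h => hne (by rw [h])
    have hn1 := (hN (e, a)).trans hn
    have hn1' := (hN (e', a)).trans hn'
    obtain ⟨m, rfl⟩ : ∃ m, n = m + 1 := ⟨n - 1, by omega⟩
    obtain ⟨m', rfl⟩ : ∃ m, n' = m + 1 := ⟨n' - 1, by omega⟩
    have h3 : nx P e a = nx P e' a := by
      have := congrArg (fun l => l.tail.head?) hc
      simpa only [cw, List.tail_cons, head?_cw, Option.some.injEq] using this
    cases e <;> cases e'
    · exact hee rfl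
    · exact nx_true_ne_nx_false a h3.symm
    · exact nx_true_ne_nx_false a h3
    · exact hee rfl
  exact measure_eq_zero_iff_ae_notMem.mpr this

/-! ### Integrals over the neighbourhoods of the vertices -/

theorem measurable_xc (ζ : Circle) : Measurable (xc ζ) := by
  unfold xc
  have h1 : Measurable fun ξ : Circle => I * ((ξ : ℂ) + ζ) :=
    Continuous.measurable (by fun_prop)
  have h2 : Measurable fun ξ : Circle => (ξ : ℂ) - ζ := Continuous.measurable (by fun_prop)
  exact measurable_re.comp (h1.div h2)

theorem measurableSet_tail (e : Bool) (a : A) (y : ℝ) : MeasurableSet (tail P e a y) :=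
  (measurableSet_singleton (ep P e a)).compl.inter
    (measurableSet_lt measurable_const ((measurable_xc _).const_mul _))

theorem measureReal_tail (e : Bool) (a : A) (y : ℝ) :
    circleMeasure.real (tail P e a y) = (Real.pi / 2 - Real.arctan y) / Real.pi := by
  have h := lintegral_circleMeasure (ep P e a) (f := (tail P e a y).indicator 1)
    (measurable_one.indicator (measurableSet_tail e a y))
  rw [lintegral_indicator_one (measurableSet_tail e a y)] at h
  have h1 : ∫⁻ x : ℝ, ENNReal.ofReal (1 / (1 + x ^ 2)) *
      (tail P e a y).indicator 1 (pt (ep P e a) x) =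
      ∫⁻ x in Set.Ioi y, ENNReal.ofReal (1 / (1 + x ^ 2)) := by
    rw [← lintegral_indicator measurableSet_Ioi]
    have h2 : ∀ x : ℝ, ENNReal.ofReal (1 / (1 + x ^ 2)) *
        (tail P e a y).indicator 1 (pt (ep P e a) x) =
        (Set.Ioi y).indicator (fun x => ENNReal.ofReal (1 / (1 + x ^ 2))) (sg e * x) := by
      intro x
      have h3 : pt (ep P e a) x ∈ tail P e a y ↔ sg e * x ∈ Set.Ioi y := by
        simp only [tail, Set.mem_ofPred_eq, xs, xc_pt, Set.mem_Ioi, and_iff_right_iff_imp]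
        exact fun _ => pt_ne _ _
      have h4 : (sg e * x) ^ 2 = x ^ 2 := by rw [mul_pow, sq (sg e), sg_mul_self, one_mul]
      by_cases hx : sg e * x ∈ Set.Ioi y
      · rw [Set.indicator_of_mem (h3.mpr hx), Set.indicator_of_mem hx, h4]; simp
      · rw [Set.indicator_of_notMem (fun h => hx (h3.mp h)), Set.indicator_of_notMem hx, mul_zero]
    simp only [h2]
    cases e
    · simp only [sg, Bool.false_eq_true, if_false, neg_mul, one_mul]
      exact lintegral_neg_eq_self (μ := volume)
        (fun x => (Set.Ioi y).indicator (fun x => ENNReal.ofReal (1 / (1 + x ^ 2))) x)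
    · simp only [sg, if_true, one_mul]
  rw [h1, ← ofReal_integral_eq_lintegral_ofReal] at h
  · simp only [one_div, integral_Ioi_inv_one_add_sq] at h
    rw [Measure.real, h, ← ENNReal.ofReal_mul (by positivity), ENNReal.toReal_ofReal]
    · ring
    · have := Real.arctan_lt_pi_div_two y
      have := Real.pi_pos
      exact mul_nonneg (by positivity) (by linarith)
  · simp only [one_div]
    exact integrable_inv_one_add_sq.integrableOn
  · exact Eventually.of_forall fun x => by positivity

/-- The bracket is `arctan (1/y)`, so this is the derivative of `arctan` at `0`. -/
theorem tendsto_mul_tail : Tendsto (fun y : ℝ => y * (Real.pi / 2 - Real.arctan y)) atTop (𝓝 1) := by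
  have h := (Real.hasDerivAt_arctan 0).tendsto_slope_zero_right
  have h1 := h.comp tendsto_inv_atTop_nhdsGT_zero
  simp only [Real.arctan_zero, sub_zero, zero_add] at h1
  have h2 : (1 : ℝ) / (1 + 0 ^ 2) = 1 := by norm_num
  rw [h2] at h1
  refine h1.congr' ?_
  filter_upwards [eventually_gt_atTop 0] with y hy
  simp only [Function.comp_apply, inv_inv, smul_eq_mul, Real.arctan_inv_of_pos hy]

/-- The boundary values of the functions of `ℬ` at the endpoints of the arcs. -/
theorem PLip.exists_boundary_value (f : PLip P) (e : Bool) (a : A) :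
    ∃ z : ℂ, ∀ ξ ∈ arc P a, ‖f ξ - z‖ ≤ ‖f‖ * dist ξ (ep P e a) := by
  obtain ⟨u, hu, hl⟩ := mem_closure_iff_seq_limit.mp (ep_mem_closure (P := P) e a)
  have hc : CauchySeq fun n => f (u n) := by
    have hc : ∀ ε > 0, ∃ N, ∀ m ≥ N, ∀ n ≥ N, dist (u m) (u n) < ε :=
      Metric.cauchySeq_iff.mp hl.cauchySeq
    rw [Metric.cauchySeq_iff]
    intro ε hε
    obtain ⟨N, hN⟩ := hc (ε / (‖f‖ + 1)) (by positivity)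
    refine ⟨N, fun m hm n hn => ?_⟩
    rw [dist_eq_norm]
    have h1 := PLip.norm_sub_le f (openArc_subset_arc a (hu m)) (openArc_subset_arc a (hu n))
    have h2 := hN m hm n hn
    rw [lt_div_iff₀ (by positivity)] at h2
    nlinarith [norm_nonneg f, dist_nonneg (x := u m) (y := u n)]
  obtain ⟨z, hz⟩ := cauchySeq_tendsto_of_complete hc
  refine ⟨z, fun ξ hξ => ?_⟩
  refine le_of_tendsto_of_tendsto (tendsto_const_nhds.sub hz).norm
    ((tendsto_const_nhds.dist hl).const_mul ‖f‖) (Eventually.of_forall fun n => ?_)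
  exact PLip.norm_sub_le f hξ (openArc_subset_arc a (hu n))

/-- The steps of `px` are bounded, so `scale * px` at the cut exceeds `T` by a bounded amount only.
-/
theorem tendsto_cut (e : Bool) (a : A) :
    Tendsto (fun T => px P e a (cut P Γ S T e a)) atTop atTop ∧
    Tendsto (fun T => T / px P e a (cut P Γ S T e a)) atTop (𝓝 (scale P Γ S e a)) := by
  obtain ⟨m, B, hm, hbn⟩ := exists_bn_bounds P
  have hs := scale_pos (P := P) (Γ := Γ) (S := S) e a
  set σ := scale P Γ S e a with hσ
  set y : ℝ → ℝ := fun T => px P e a (cut P Γ S T e a) with hy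
  have hlow : ∀ T, T < σ * (y T - px P e a 0) := fun T => (lt_cut_iff Γ S).mpr le_rfl
  have hup : ∀ T, 0 ≤ T → σ * (y T - px P e a 0 - 2 * B) ≤ T := by
    intro T hT
    obtain ⟨n, hn⟩ : ∃ n, cut P Γ S T e a = n + 1 :=
      ⟨cut P Γ S T e a - 1, by have := one_le_cut (P := P) Γ S hT e a; omega⟩
    have h1 : ¬ T < σ * (px P e a n - px P e a 0) := by
      rw [hσ, lt_cut_iff, hn]; omega
    have h2 : y T ≤ px P e a n + 2 * B := by
      simp only [hy, hn]
      rw [px_succ, tl]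
      linarith [(hbn (lt P e a n)).2, (hbn (lt P e a (n + 1))).2]
    push Not at h1
    refine le_trans (mul_le_mul_of_nonneg_left ?_ hs.le) h1
    linarith
  have ht : Tendsto y atTop atTop := by
    refine tendsto_atTop_mono (f := fun T => σ⁻¹ * T) (fun T => ?_)
      (Tendsto.const_mul_atTop (inv_pos.mpr hs) tendsto_id)
    have := hlow T
    have h0 := px_pos (P := P) e a 0
    rw [inv_mul_le_iff₀ hs]
    nlinarith
  refine ⟨ht, ?_⟩
  have hy0 : ∀ᶠ T in atTop, 0 < y T := ht.eventually_gt_atTop 0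
  have h1 : Tendsto (fun T => σ - σ * (px P e a 0 + 2 * B) / y T) atTop (𝓝 (σ - 0)) :=
    tendsto_const_nhds.sub (tendsto_const_nhds.div_atTop ht)
  rw [sub_zero] at h1
  refine tendsto_of_tendsto_of_tendsto_of_le_of_le' h1 tendsto_const_nhds ?_ ?_
  · filter_upwards [hy0, eventually_ge_atTop 0] with T h2 h3
    rw [sub_div' h2.ne', div_le_div_iff_of_pos_right h2]
    linarith [hup T h3]
  · filter_upwards [hy0] with T h2
    rw [div_le_iff₀ h2]
    have h0 := px_pos (P := P) e a 0
    nlinarith [hlow T]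

/-- Points with coordinate larger than `y` are within `2 / y` of the vertex. Replacing `f` by its
boundary value thus costs `O(1/y)` times a measure of order `1/y`. -/
theorem tendsto_integral_tail (f : PLip P) {e : Bool} {a : A} {z : ℂ}
    (hz : ∀ ξ ∈ arc P a, ‖f ξ - z‖ ≤ ‖f‖ * dist ξ (ep P e a)) :
    Tendsto (fun T : ℝ => (T : ℂ) * ∫ ξ in tail P e a (px P e a (cut P Γ S T e a)), f ξ ∂circleMeasure)
      atTop (𝓝 ((scale P Γ S e a / Real.pi : ℝ) * z)) := by
  obtain ⟨h1, h2⟩ := tendsto_cut (P := P) Γ S e a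
  set y : ℝ → ℝ := fun T => px P e a (cut P Γ S T e a) with hy
  have hm : Tendsto (fun T => T * circleMeasure.real (tail P e a (y T))) atTop
      (𝓝 (scale P Γ S e a / Real.pi)) := by
    have h3 := (h2.mul (tendsto_mul_tail.comp h1)).div_const Real.pi
    rw [mul_one] at h3
    refine h3.congr' ?_
    filter_upwards [h1.eventually_gt_atTop 0] with T hT
    rw [measureReal_tail]
    simp only [Function.comp_apply]
    change T / y T * (y T * (Real.pi / 2 - Real.arctan (y T))) / Real.pi = _
    have : y T ≠ 0 := hT.ne'
    field_simp
  have hm' : Tendsto (fun T => ((T * circleMeasure.real (tail P e a (y T)) : ℝ) : ℂ) * z) atTop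
      (𝓝 ((scale P Γ S e a / Real.pi : ℝ) * z)) :=
    ((continuous_ofReal.tendsto _).comp hm).mul_const z
  have he : Tendsto (fun T => (T * circleMeasure.real (tail P e a (y T))) * (‖f‖ * (2 / y T))) atTop
      (𝓝 0) := by
    have h3 : Tendsto (fun T => ‖f‖ * (2 / y T)) atTop (𝓝 (‖f‖ * 0)) :=
      (tendsto_const_nhds.div_atTop h1).const_mul _
    simpa using hm.mul h3
  refine (tendsto_iff_of_dist (squeeze_zero' (Eventually.of_forall fun _ => dist_nonneg) ?_ he)).mp hm'
  filter_upwards [eventually_ge_atTop 0, h1.eventually_gt_atTop 0, h1.eventually_ge_atTop (bn P a)]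
    with T hT hy0 hyb
  have hfin : circleMeasure (tail P e a (y T)) ≠ ⊤ := measure_ne_top _ _
  have h3 : ∫ ξ in tail P e a (y T), (f ξ - z) ∂circleMeasure =
      (∫ ξ in tail P e a (y T), f ξ ∂circleMeasure) -
        (circleMeasure.real (tail P e a (y T)) : ℂ) * z := by
    rw [integral_sub (f.integrable _) (integrable_const _), setIntegral_const, real_smul]
  have h4 : ‖∫ ξ in tail P e a (y T), (f ξ - z) ∂circleMeasure‖ ≤
      ‖f‖ * (2 / y T) * circleMeasure.real (tail P e a (y T)) := by
    refine norm_setIntegral_le_of_norm_le_const hfin.lt_top fun ξ hξ => ?_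
    have h5 : ξ ∈ arc P a := openArc_subset_arc a
      ((mem_openArc_iff e hξ.1).mpr (hyb.trans_lt hξ.2))
    refine (hz ξ h5).trans (mul_le_mul_of_nonneg_left ?_ (norm_nonneg f))
    have h6 := one_add_xc_sq hξ.1
    rw [← xs_sq e] at h6
    have h7 := hξ.2
    rw [le_div_iff₀ hy0]
    have h8 : dist ξ (ep P e a) * y T ≤ dist ξ (ep P e a) * xs e (ep P e a) ξ :=
      mul_le_mul_of_nonneg_left h7.le dist_nonneg
    have h9 : (dist ξ (ep P e a) * xs e (ep P e a) ξ) ^ 2 ≤ 2 ^ 2 := by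
      nlinarith [sq_nonneg (dist ξ (ep P e a))]
    exact h8.trans (abs_le_of_sq_le_sq' h9 (by norm_num)).2
  rw [dist_comm, dist_eq_norm]
  have h5 : (T : ℂ) * (∫ ξ in tail P e a (y T), f ξ ∂circleMeasure) -
      ((T * circleMeasure.real (tail P e a (y T)) : ℝ) : ℂ) * z =
      (T : ℂ) * ∫ ξ in tail P e a (y T), (f ξ - z) ∂circleMeasure := by
    rw [h3]; push_cast; ring
  rw [h5, norm_mul, norm_real, Real.norm_eq_abs, abs_of_nonneg hT]
  calc _ ≤ T * (‖f‖ * (2 / y T) * circleMeasure.real (tail P e a (y T))) := by gcongr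
    _ = _ := by ring

/-- The asymptotics of the integrals of `Δ_{(1,T)} f`. -/
theorem exists_tendsto_integral_deltaOp {Γ : Subgroup SL(2, ℝ)} {S : Fin p → SL(2, ℝ)}
    (hle : Γ₀ ≤ Γ) (hS : IsCuspSystem Γ S) (f : PLip P) {c : ℝ} (hc : 0 < c)
    (hf : ∀ ξ, c ≤ (f ξ).re ∧ (f ξ).im = 0) :
    ∃ β : ℝ, 0 < β ∧ Tendsto (fun T : ℝ => (T : ℂ) * ∫ ξ, deltaOp P Γ S 1 T f ξ ∂circleMeasure)
      atTop (𝓝 (β : ℂ)) := by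
  have := Fintype.ofFinite A
  choose z hz using fun q : Bool × A => f.exists_boundary_value q.1 q.2
  have hzc : ∀ q, c ≤ (z q).re ∧ (z q).im = 0 := by
    intro q
    obtain ⟨u, hu, hl⟩ := mem_closure_iff_seq_limit.mp (ep_mem_closure (P := P) q.1 q.2)
    have h1 : Tendsto (fun n => f (u n)) atTop (𝓝 (z q)) := by
      rw [tendsto_iff_norm_sub_tendsto_zero]
      have h2 : Tendsto (fun n => ‖f‖ * dist (u n) (ep P q.1 q.2)) atTop (𝓝 (‖f‖ * 0)) :=
        (tendsto_iff_dist_tendsto_zero.mp hl).const_mul _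
      rw [mul_zero] at h2
      exact squeeze_zero (fun _ => norm_nonneg _)
        (fun n => hz q _ (openArc_subset_arc _ (hu n))) h2
    refine ⟨ge_of_tendsto ((continuous_re.tendsto _).comp h1) (Eventually.of_forall fun n => (hf _).1),
      ?_⟩
    refine tendsto_nhds_unique ((continuous_im.tendsto _).comp h1) ?_
    simp only [Function.comp_def, (hf _).2]
    exact tendsto_const_nhds
  -- All the ends of the arcs contribute, each vertex being counted from its two sides.
  set β : ℝ := ∑ q : Bool × A, scale P Γ S q.1 q.2 / Real.pi * (z q).re with hβ
  refine ⟨β, ?_, ?_⟩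
  · refine Finset.sum_pos (fun q _ => ?_) Finset.univ_nonempty
    have := scale_pos (P := P) (Γ := Γ) (S := S) q.1 q.2
    have := Real.pi_pos
    have := hc.trans_le (hzc q).1
    positivity
  · have h1 := tendsto_finsetSum Finset.univ fun (q : Bool × A) _ =>
      tendsto_integral_tail Γ S f (hz q)
    have h2 : ∑ q : Bool × A, ((scale P Γ S q.1 q.2 / Real.pi : ℝ) : ℂ) * z q = (β : ℂ) := by
      rw [hβ]; push_cast
      refine Finset.sum_congr rfl fun q _ => ?_
      congr 1
      exact Complex.ext (by simp) (by simp [(hzc q).2])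
    rw [h2] at h1
    refine h1.congr' ?_
    filter_upwards [eventually_ge_atTop 0] with T hT
    rw [← Finset.mul_sum]
    congr 1
    have h3 := (isWordOperator_deltaOp (P := P) Γ S (s := 1) (by norm_num) T).integral_eq
      (isWordFamily_longWords Γ S T) f
    refine Eq.trans ?_ h3.symm
    rw [setIntegral_congr_set (branchImage_longWords hle hS hT)]
    have h4 := hasSum_integral_iUnion_ae (μ := circleMeasure) (f := f.1)
      (s := fun q : Bool × A => tail P q.1 q.2 (px P q.1 q.2 (cut P Γ S T q.1 q.2)))
      (fun q => (measurableSet_tail q.1 q.2 _).nullMeasurableSet)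
      (aedisjoint_tail fun q => one_le_cut Γ S hT q.1 q.2) (f.integrable _).integrableOn
    exact (hasSum_fintype _).unique h4

end Families
end Invariance

/-! ### Perturbation of a simple isolated eigenvalue -/

section Perturbation

variable {E : Type*} [NormedAddCommGroup E] [NormedSpace ℂ E]

/-- The operator `L - z - g₀ ⊗ ψ₀`. -/
def bordered (g₀ : E) (ψ₀ : E →L[ℂ] ℂ) (L : E →L[ℂ] E) (z : ℂ) : E →L[ℂ] E :=
  L - z • 1 - ψ₀.smulRight g₀

/-- The candidate for the perturbed eigenvector. -/
def pertVec (g₀ : E) (ψ₀ : E →L[ℂ] ℂ) (L : E →L[ℂ] E) (z : ℂ) : E :=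
  -Ring.inverse (bordered g₀ ψ₀ L z) g₀

/-- The candidate for the perturbed eigenfunctional. -/
def pertFun (g₀ : E) (ψ₀ : E →L[ℂ] ℂ) (L : E →L[ℂ] E) (z : ℂ) : E →L[ℂ] ℂ :=
  -ψ₀.comp (Ring.inverse (bordered g₀ ψ₀ L z))

variable {g₀ : E} {ψ₀ : E →L[ℂ] ℂ} {L : E →L[ℂ] E} {z : ℂ}

theorem bordered_apply (f : E) : bordered g₀ ψ₀ L z f = L f - z • f - ψ₀ f • g₀ := rfl

theorem bordered_inverse_apply (h : IsUnit (bordered g₀ ψ₀ L z)) (f : E) :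
    bordered g₀ ψ₀ L z (Ring.inverse (bordered g₀ ψ₀ L z) f) = f := by
  have := Ring.mul_inverse_cancel _ h
  exact congrArg (fun A : E →L[ℂ] E => A f) this

theorem inverse_bordered_apply (h : IsUnit (bordered g₀ ψ₀ L z)) (f : E) :
    Ring.inverse (bordered g₀ ψ₀ L z) (bordered g₀ ψ₀ L z f) = f := by
  have := Ring.inverse_mul_cancel _ h
  exact congrArg (fun A : E →L[ℂ] E => A f) this

/-- The bordered operator can be invertible although `z` is an eigenvalue of `L`. The vector `v` it
produces satisfies `(L - z) v = (ψ₀ v - 1) g₀`, so the eigenvalue equation reduces to the scalar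
equation `ψ₀ v = 1`. -/
theorem apply_pertVec (h : IsUnit (bordered g₀ ψ₀ L z)) :
    L (pertVec g₀ ψ₀ L z) =
      z • pertVec g₀ ψ₀ L z + (ψ₀ (pertVec g₀ ψ₀ L z) - 1) • g₀ := by
  have h1 : bordered g₀ ψ₀ L z (pertVec g₀ ψ₀ L z) = -g₀ := by
    rw [pertVec, map_neg, bordered_inverse_apply h]
  rw [bordered_apply] at h1
  rw [sub_smul, one_smul, ← sub_eq_zero]
  rw [← sub_eq_zero] at h1
  rw [← h1]; abel

/-- The defect for the functional is the same scalar, so eigenvector and eigenfunctional appear for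
the same `z`. -/
theorem pertFun_apply (h : IsUnit (bordered g₀ ψ₀ L z)) (f : E) :
    pertFun g₀ ψ₀ L z (L f) =
      z * pertFun g₀ ψ₀ L z f + (ψ₀ (pertVec g₀ ψ₀ L z) - 1) * ψ₀ f := by
  have h1 : pertFun g₀ ψ₀ L z (bordered g₀ ψ₀ L z f) = -ψ₀ f := by
    change -ψ₀ (Ring.inverse (bordered g₀ ψ₀ L z) (bordered g₀ ψ₀ L z f)) = _
    rw [inverse_bordered_apply h]
  have h2 : pertFun g₀ ψ₀ L z g₀ = ψ₀ (pertVec g₀ ψ₀ L z) := by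
    rw [pertVec, map_neg]; rfl
  rw [bordered_apply, map_sub, map_sub, map_smul, map_smul, h2, smul_eq_mul, smul_eq_mul] at h1
  linear_combination h1

/-- Conjugation commutes with the bordered operator when `z` is real. The scalar equation is then
real and the intermediate value theorem applies to it. -/
theorem conj_pertVec {J : E →ₗ⋆[ℂ] E} (hJg : J g₀ = g₀) (hJψ : ∀ f, ψ₀ (J f) = conj (ψ₀ f))
    {t : ℝ} (h : IsUnit (bordered g₀ ψ₀ L t)) (hJL : ∀ f, L (J f) = J (L f)) :
    J (pertVec g₀ ψ₀ L t) = pertVec g₀ ψ₀ L t ∧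
      ∀ f, pertFun g₀ ψ₀ L t (J f) = conj (pertFun g₀ ψ₀ L t f) := by
  have h0 : ∀ f, bordered g₀ ψ₀ L t (J f) = J (bordered g₀ ψ₀ L t f) := by
    intro f
    rw [bordered_apply, bordered_apply, map_sub, map_sub, hJL, hJψ, map_smulₛₗ, map_smulₛₗ, hJg,
      conj_ofReal]
  have h1 : ∀ f, Ring.inverse (bordered g₀ ψ₀ L t) (J f) =
      J (Ring.inverse (bordered g₀ ψ₀ L t) f) := by
    intro f
    rw [← inverse_bordered_apply h (J (Ring.inverse (bordered g₀ ψ₀ L t) f)), h0,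
      bordered_inverse_apply h]
  constructor
  · rw [pertVec, map_neg, ← h1, hJg]
  · intro f
    change -ψ₀ (Ring.inverse (bordered g₀ ψ₀ L t) (J f)) =
      conj (-ψ₀ (Ring.inverse (bordered g₀ ψ₀ L t) f))
    rw [h1, hJψ, map_neg]

theorem pertVec_of_eigenvector {c : ℂ} (h : IsUnit (bordered g₀ ψ₀ L z)) (hL : L g₀ = c • g₀)
    (h1 : ψ₀ g₀ = 1) : (1 + z - c) • pertVec g₀ ψ₀ L z = g₀ := by
  have h2 : bordered g₀ ψ₀ L z g₀ = -(1 + z - c) • g₀ := by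
    rw [bordered_apply, hL, h1]; module
  have h3 := inverse_bordered_apply h g₀
  rw [h2, map_smul] at h3
  rw [pertVec, smul_neg, ← neg_smul, h3]

theorem pertFun_of_eigenfunctional (h : IsUnit (bordered g₀ ψ₀ L 1))
    (hL : ∀ f, ψ₀ (L f) = ψ₀ f) (h1 : ψ₀ g₀ = 1) : pertFun g₀ ψ₀ L 1 = ψ₀ := by
  ext f
  have h2 : ψ₀ (bordered g₀ ψ₀ L 1 (Ring.inverse (bordered g₀ ψ₀ L 1) f)) =
      -ψ₀ (Ring.inverse (bordered g₀ ψ₀ L 1) f) := by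
    rw [bordered_apply, map_sub, map_sub, hL, map_smul, map_smul, h1]; simp
  rw [bordered_inverse_apply h] at h2
  rw [h2]; rfl

theorem continuous_bordered :
    Continuous fun q : (E →L[ℂ] E) × ℂ => bordered g₀ ψ₀ q.1 q.2 := by
  unfold bordered; fun_prop

variable [CompleteSpace E]

theorem continuousAt_inverse_bordered (h : IsUnit (bordered g₀ ψ₀ L z)) :
    ContinuousAt (fun q : (E →L[ℂ] E) × ℂ => Ring.inverse (bordered g₀ ψ₀ q.1 q.2)) (L, z) := by
  obtain ⟨u, hu⟩ := h
  have h1 : ContinuousAt Ring.inverse (bordered g₀ ψ₀ (L, z).1 (L, z).2) := by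
    rw [← hu]; exact NormedRing.inverse_continuousAt u
  exact ContinuousAt.comp (f := fun q : (E →L[ℂ] E) × ℂ => bordered g₀ ψ₀ q.1 q.2) h1
    continuous_bordered.continuousAt

theorem continuousAt_pertVec (h : IsUnit (bordered g₀ ψ₀ L z)) :
    ContinuousAt (fun q : (E →L[ℂ] E) × ℂ => pertVec g₀ ψ₀ q.1 q.2) (L, z) :=
  ((continuousAt_inverse_bordered h).clm_apply continuousAt_const).neg

theorem continuousAt_pertFun (h : IsUnit (bordered g₀ ψ₀ L z)) :
    ContinuousAt (fun q : (E →L[ℂ] E) × ℂ => pertFun g₀ ψ₀ q.1 q.2) (L, z) :=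
  (continuousAt_const.clm_comp (continuousAt_inverse_bordered h)).neg

theorem eventually_isUnit_bordered (h : IsUnit (bordered g₀ ψ₀ L z)) :
    ∀ᶠ q : (E →L[ℂ] E) × ℂ in 𝓝 (L, z), IsUnit (bordered g₀ ψ₀ q.1 q.2) :=
  continuous_bordered.continuousAt.eventually (Units.isOpen.mem_nhds h)

/-- Control of the eigenvector and of the eigenfunctional in a neighbourhood. -/
theorem exists_bordered_nhds {L₀ : E →L[ℂ] E} (hU : IsUnit (bordered g₀ ψ₀ L₀ 1))
    (hg : L₀ g₀ = g₀) (hψ : ∀ f, ψ₀ (L₀ f) = ψ₀ f) (h1 : ψ₀ g₀ = 1) {δ : ℝ} (hδ : 0 < δ) :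
    ∃ η > 0, ∀ L z, ‖L - L₀‖ < η → ‖z - 1‖ < η → IsUnit (bordered g₀ ψ₀ L z) ∧
      ‖pertVec g₀ ψ₀ L z - g₀‖ < δ ∧ ‖pertFun g₀ ψ₀ L z - ψ₀‖ < δ := by
  have e1 : pertVec g₀ ψ₀ L₀ 1 = g₀ := by
    have := pertVec_of_eigenvector (c := 1) hU (by rw [hg, one_smul]) h1
    rwa [add_sub_cancel_right, one_smul] at this
  have e2 := pertFun_of_eigenfunctional hU hψ h1
  have c1 := Metric.continuousAt_iff'.mp (continuousAt_pertVec hU) δ hδ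
  have c2 := Metric.continuousAt_iff'.mp (continuousAt_pertFun hU) δ hδ
  obtain ⟨η, hη, h⟩ := Metric.eventually_nhds_iff.mp ((eventually_isUnit_bordered hU).and (c1.and c2))
  refine ⟨η, hη, fun L z hL hz => ?_⟩
  have := @h (L, z) (by rw [Prod.dist_eq, dist_eq_norm, dist_eq_norm]; exact max_lt hL hz)
  simpa only [dist_eq_norm, e1, e2] using this

/-- A real eigenvalue close to `1`, with its eigenvector and its eigenfunctional. -/
theorem eventually_exists_eigenpair {L₀ : E →L[ℂ] E} (hU : IsUnit (bordered g₀ ψ₀ L₀ 1))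
    (hg : L₀ g₀ = g₀) (hψ : ∀ f, ψ₀ (L₀ f) = ψ₀ f) (h1 : ψ₀ g₀ = 1) {J : E →ₗ⋆[ℂ] E}
    (hJg : J g₀ = g₀) (hJψ : ∀ f, ψ₀ (J f) = conj (ψ₀ f)) {δ : ℝ} (hδ : 0 < δ) :
    ∀ᶠ L in 𝓝 L₀, (∀ f, L (J f) = J (L f)) → ∃ (t : ℝ) (v : E) (ψ : E →L[ℂ] ℂ),
      |t - 1| < δ ∧ ‖v - g₀‖ < δ ∧ ‖ψ - ψ₀‖ < δ ∧ L v = (t : ℂ) • v ∧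
      (∀ f, ψ (L f) = t * ψ f) ∧ J v = v ∧ ∀ f, ψ (J f) = conj (ψ f) := by
  obtain ⟨η, hη, hη'⟩ := exists_bordered_nhds hU hg hψ h1 hδ
  set τ := min (min η δ) 1 / 2 with hτ
  have hτ0 : 0 < τ := by positivity
  have hτη : τ < η := by
    have : min (min η δ) 1 ≤ η := (min_le_left _ _).trans (min_le_left _ _)
    linarith
  have hτδ : τ < δ := by
    have : min (min η δ) 1 ≤ δ := (min_le_left _ _).trans (min_le_right _ _)
    linarith
  have hτ1 : τ < 1 := by
    have : min (min η δ) 1 ≤ 1 := min_le_right _ _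
    linarith
  have hin : ∀ t ∈ Set.Icc (1 - τ) (1 + τ), ‖(t : ℂ) - 1‖ < η := by
    intro t ht
    rw [← ofReal_one, ← ofReal_sub, norm_real, Real.norm_eq_abs, abs_lt]
    constructor <;> linarith [ht.1, ht.2]
  -- For `L₀` the function `t ↦ ψ₀ v` is `1/t`, which crosses the value `1` strictly between `1 - τ`
  -- and `1 + τ`. Strict inequalities at these two points persist for `L` near `L₀`.
  have hval : ∀ t ∈ Set.Icc (1 - τ) (1 + τ), t * (ψ₀ (pertVec g₀ ψ₀ L₀ t)).re = 1 := by
    intro t ht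
    have h2 := (hη' L₀ t (by simpa using hη) (hin t ht)).1
    have h3 := pertVec_of_eigenvector (c := 1) h2 (by rw [hg, one_smul]) h1
    have h4 := congrArg (fun x => (ψ₀ x).re) h3
    simpa [h1] using h4
  have hcont : ∀ t ∈ Set.Icc (1 - τ) (1 + τ),
      ContinuousAt (fun q : (E →L[ℂ] E) × ℂ => (ψ₀ (pertVec g₀ ψ₀ q.1 q.2)).re) (L₀, t) := by
    intro t ht
    have := continuousAt_pertVec (hη' L₀ t (by simpa using hη) (hin t ht)).1
    exact continuous_re.continuousAt.comp (ψ₀.continuous.continuousAt.comp this)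
  have hl : (1 - τ) ∈ Set.Icc (1 - τ) (1 + τ) := ⟨le_rfl, by linarith⟩
  have hr : (1 + τ) ∈ Set.Icc (1 - τ) (1 + τ) := ⟨by linarith, le_rfl⟩
  have hsec : ∀ t ∈ Set.Icc (1 - τ) (1 + τ),
      ContinuousAt (fun L : E →L[ℂ] E => (ψ₀ (pertVec g₀ ψ₀ L t)).re) L₀ := by
    intro t ht
    exact ContinuousAt.comp (f := fun L : E →L[ℂ] E => (L, (t : ℂ))) (hcont t ht)
      (by fun_prop)
  have hL1 : ∀ᶠ L in 𝓝 L₀, 1 < (ψ₀ (pertVec g₀ ψ₀ L ((1 - τ : ℝ) : ℂ))).re := by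
    refine (hsec _ hl).eventually_const_lt ?_
    have := hval _ hl
    nlinarith
  have hL2 : ∀ᶠ L in 𝓝 L₀, (ψ₀ (pertVec g₀ ψ₀ L ((1 + τ : ℝ) : ℂ))).re < 1 := by
    refine (hsec _ hr).eventually_lt_const ?_
    have := hval _ hr
    nlinarith
  filter_upwards [hL1, hL2, Metric.ball_mem_nhds L₀ hη] with L h2 h3 h4 hJL
  rw [mem_ball_iff_norm] at h4
  have hcL : ContinuousOn (fun t : ℝ => (ψ₀ (pertVec g₀ ψ₀ L t)).re) (Set.Icc (1 - τ) (1 + τ)) := by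
    refine fun t ht => ContinuousAt.continuousWithinAt ?_
    have h5 := continuousAt_pertVec (hη' L t h4 (hin t ht)).1
    have h6 : ContinuousAt (fun t : ℝ => pertVec g₀ ψ₀ L t) t :=
      ContinuousAt.comp (f := fun t : ℝ => (L, (t : ℂ))) h5 (by fun_prop)
    exact continuous_re.continuousAt.comp (ψ₀.continuous.continuousAt.comp h6)
  have hIVT := intermediate_value_Icc' (by linarith) hcL
  obtain ⟨t, ht, ht1⟩ := hIVT ⟨h3.le, h2.le⟩
  obtain ⟨h5, h6, h7⟩ := hη' L t h4 (hin t ht)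
  obtain ⟨h8, h9⟩ := conj_pertVec hJg hJψ h5 hJL
  have h10 : ψ₀ (pertVec g₀ ψ₀ L t) = 1 := by
    refine Complex.ext ht1 ?_
    have := hJψ (pertVec g₀ ψ₀ L t)
    rw [h8] at this
    rw [conj_eq_iff_im.mp this.symm, one_im]
  refine ⟨t, pertVec g₀ ψ₀ L t, pertFun g₀ ψ₀ L t, ?_, h6, h7, ?_, fun f => ?_, h8, h9⟩
  · rw [abs_lt]; constructor <;> linarith [ht.1, ht.2]
  · rw [apply_pertVec h5, h10, sub_self, zero_smul, add_zero]
  · rw [pertFun_apply h5, h10, sub_self, zero_mul, add_zero]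

end Perturbation

/-! ### The spectral projector -/

section Projector

variable {E : Type*} [NormedAddCommGroup E] [NormedSpace ℂ E]

/-- The inverse of `L - z` for an operator `L` equal to `t` on `v` and to `R` on the kernel of
`ψ`. -/
theorem inverse_sub_of_deflated {L R : E →L[ℂ] E} {v : E} {ψ : E →L[ℂ] ℂ} {t z : ℂ}
    (hψv : ψ v = 1) (hv : L v = t • v) (hψ : ∀ f, ψ (L f) = t * ψ f)
    (hR : R = L - t • ψ.smulRight v) (hU : IsUnit (R - z • 1)) (hz : z ≠ 0) (hzt : z ≠ t) :
    IsUnit (L - z • 1) ∧ Ring.inverse (L - z • 1) =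
      Ring.inverse (R - z • 1) + ((t - z)⁻¹ + z⁻¹) • ψ.smulRight v := by
  set B := Ring.inverse (R - z • 1) with hB
  have b1 : ∀ f, (R - z • 1) (B f) = f := fun f =>
    congrArg (fun A : E →L[ℂ] E => A f) (Ring.mul_inverse_cancel _ hU)
  have b2 : ∀ f, B ((R - z • 1) f) = f := fun f =>
    congrArg (fun A : E →L[ℂ] E => A f) (Ring.inverse_mul_cancel _ hU)
  have hRa : ∀ f, (R - z • 1) f = L f - (t * ψ f) • v - z • f := by
    intro f; rw [hR, mul_smul]; rfl
  have hψB : ∀ f, ψ (B f) = -z⁻¹ * ψ f := by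
    intro f
    have h := congrArg ψ (b1 f)
    rw [hRa, map_sub, map_sub, hψ, map_smul, map_smul, hψv, smul_eq_mul, smul_eq_mul] at h
    rw [← h]; field_simp; ring
  have hBv : B v = -z⁻¹ • v := by
    have h := b2 v
    rw [hRa, hv, hψv, mul_one, sub_self, zero_sub, map_neg, map_smul] at h
    rw [neg_smul, ← h, smul_neg, smul_smul, inv_mul_cancel₀ hz, one_smul, neg_neg, h]
  have htz : t - z ≠ 0 := sub_ne_zero.mpr (Ne.symm hzt)
  -- `L - z` is `t - z` on `v`, whereas `R - z` is `-z` there; `c` is the difference of the inverses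
  -- of these two numbers.
  set c := (t - z)⁻¹ + z⁻¹ with hc
  have hc1 : (t - z) * c = t * z⁻¹ := by rw [hc]; field_simp; ring
  have e1 : (L - z • 1) * (B + c • ψ.smulRight v) = 1 := by
    ext f
    change (L (B f + c • (ψ f • v)) - z • (B f + c • (ψ f • v))) = f
    have h := b1 f
    rw [hRa, hψB] at h
    rw [map_add, map_smul, map_smul, hv]
    have h2 : ((t - z) * c - t * z⁻¹) • (ψ f • v) = 0 := by rw [hc1, sub_self, zero_smul]
    calc _ = (L (B f) - (t * (-z⁻¹ * ψ f)) • v - z • B f) +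
          ((t - z) * c - t * z⁻¹) • (ψ f • v) := by module
      _ = f := by rw [h, h2, add_zero]
  have e2 : (B + c • ψ.smulRight v) * (L - z • 1) = 1 := by
    ext f
    change B (L f - z • f) + c • (ψ (L f - z • f) • v) = f
    have h := b2 f
    rw [hRa] at h
    have h3 : L f - z • f = (L f - (t * ψ f) • v - z • f) + (t * ψ f) • v := by module
    have h2 : ((t - z) * c - t * z⁻¹) • (ψ f • v) = 0 := by rw [hc1, sub_self, zero_smul]
    rw [map_sub ψ, hψ, map_smul ψ, h3, map_add, h, map_smul, hBv, smul_eq_mul]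
    calc _ = f + ((t - z) * c - t * z⁻¹) • (ψ f • v) := by module
      _ = f := by rw [h2, add_zero]
  have hu : IsUnit (L - z • 1) := ⟨⟨_, _, e1, e2⟩, rfl⟩
  refine ⟨hu, ?_⟩
  exact Ring.inverse_unit (⟨_, _, e1, e2⟩ : (E →L[ℂ] E)ˣ)

theorem ne_zero_of_isUnit_deflated {R : E →L[ℂ] E} {v : E} (hv : v ≠ 0) (hR : R v = 0) {z : ℂ}
    (hU : IsUnit (R - z • 1)) : z ≠ 0 := by
  rintro rfl
  rw [zero_smul, sub_zero] at hU
  have := congrArg (fun A : E →L[ℂ] E => A v) (Ring.inverse_mul_cancel _ hU)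
  change Ring.inverse R (R v) = v at this
  rw [hR, map_zero] at this
  exact hv this.symm

variable [CompleteSpace E]

theorem circleIntegral_inverse_sub {R : E →L[ℂ] E} {c : ℂ} {r : ℝ} (hr : 0 ≤ r)
    (hU : ∀ z ∈ Metric.closedBall c r, IsUnit (R - z • 1)) :
    ContinuousOn (fun z : ℂ => Ring.inverse (R - z • 1)) (Metric.closedBall c r) ∧
    ∮ z in C(c, r), Ring.inverse (R - z • 1) = 0 := by
  have hd : ∀ z ∈ Metric.closedBall c r,
      DifferentiableAt ℂ (fun z : ℂ => Ring.inverse (R - z • 1)) z := by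
    intro z hz
    obtain ⟨u, hu⟩ := hU z hz
    have h1 : DifferentiableAt ℂ Ring.inverse (R - z • (1 : E →L[ℂ] E)) := by
      rw [← hu]; exact differentiableAt_inverse (𝕜 := ℂ) u.isUnit
    exact DifferentiableAt.comp (f := fun z : ℂ => R - z • (1 : E →L[ℂ] E)) z h1 (by fun_prop)
  have hc : ContinuousOn (fun z : ℂ => Ring.inverse (R - z • 1)) (Metric.closedBall c r) :=
    fun z hz => (hd z hz).continuousAt.continuousWithinAt
  exact ⟨hc, circleIntegral_eq_zero_of_differentiable_on_off_countable hr
    Set.countable_empty hc fun z hz => hd z (Metric.ball_subset_closedBall hz.1)⟩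

/-- The resolvent of `L` is a holomorphic part plus `((t - z)⁻¹ + z⁻¹) ψ ⊗ v`. Only the pole at `t`
is enclosed: `R v = 0`, so the invertibility of `R - z` on the closed disc keeps `0` outside it. -/
theorem circleIntegral_inverse_of_deflated {L R : E →L[ℂ] E} {v : E} {ψ : E →L[ℂ] ℂ} {t : ℂ}
    {ε : ℝ} (hε : 0 < ε) (hψv : ψ v = 1) (hv : L v = t • v) (hψ : ∀ f, ψ (L f) = t * ψ f)
    (hR : R = L - t • ψ.smulRight v) (hU : ∀ z ∈ Metric.closedBall (1 : ℂ) ε, IsUnit (R - z • 1))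
    (ht : t ∈ Metric.ball (1 : ℂ) ε) :
    (∀ z ∈ Metric.sphere (1 : ℂ) ε, IsUnit (L - z • 1)) ∧
    ∮ z in C(1, ε), Ring.inverse (L - z • 1) = -(2 * Real.pi * I) • ψ.smulRight v := by
  have hv0 : v ≠ 0 := by rintro rfl; simp at hψv
  have hRv : R v = 0 := by
    rw [hR]; change L v - t • (ψ v • v) = 0
    rw [hψv, hv, one_smul, sub_self]
  have hz0 : ∀ z ∈ Metric.closedBall (1 : ℂ) ε, z ≠ 0 := fun z hz =>
    ne_zero_of_isUnit_deflated hv0 hRv (hU z hz)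
  have hzt : ∀ z ∈ Metric.sphere (1 : ℂ) ε, z ≠ t := by
    rintro z hz rfl
    exact (Metric.mem_ball.mp ht).ne (Metric.mem_sphere.mp hz)
  have hs := fun z (hz : z ∈ Metric.sphere (1 : ℂ) ε) =>
    inverse_sub_of_deflated hψv hv hψ hR (hU z (Metric.sphere_subset_closedBall hz))
      (hz0 z (Metric.sphere_subset_closedBall hz)) (hzt z hz)
  refine ⟨fun z hz => (hs z hz).1, ?_⟩
  rw [circleIntegral.integral_congr hε.le fun z hz => (hs z hz).2]
  obtain ⟨hc, h0⟩ := circleIntegral_inverse_sub hε.le hU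
  have i1 : CircleIntegrable (fun z : ℂ => Ring.inverse (R - z • 1)) 1 ε :=
    (hc.mono Metric.sphere_subset_closedBall).circleIntegrable hε.le
  have c2 : ContinuousOn (fun z : ℂ => (t - z)⁻¹) (Metric.sphere 1 ε) :=
    ContinuousOn.inv₀ (by fun_prop) fun z hz => sub_ne_zero.mpr (hzt z hz).symm
  have c3 : ContinuousOn (fun z : ℂ => z⁻¹) (Metric.closedBall 1 ε) :=
    ContinuousOn.inv₀ (by fun_prop) hz0
  have e2 : ∮ z in C(1, ε), (t - z)⁻¹ = -(2 * Real.pi * I) := by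
    have := circleIntegral.integral_sub_inv_of_mem_ball ht
    rw [← this, ← neg_one_mul, ← circleIntegral.integral_const_mul]
    refine circleIntegral.integral_congr hε.le fun z _ => ?_
    simp only [neg_one_mul, ← inv_neg, neg_sub]
  have e3 : ∮ z in C(1, ε), z⁻¹ = 0 :=
    circleIntegral_eq_zero_of_differentiable_on_off_countable hε.le Set.countable_empty c3
      fun z hz => differentiableAt_inv (hz0 z (Metric.ball_subset_closedBall hz.1))
  have i2 := c2.circleIntegrable hε.le
  have i3 := (c3.mono Metric.sphere_subset_closedBall).circleIntegrable hε.le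
  have i4 : CircleIntegrable (fun z : ℂ => ((t - z)⁻¹ + z⁻¹) • ψ.smulRight v) 1 ε :=
    ContinuousOn.circleIntegrable hε.le
      ((c2.add (c3.mono Metric.sphere_subset_closedBall)).smul continuousOn_const)
  rw [circleIntegral.integral_add i1 i4, h0, zero_add, circleIntegral.integral_smul_const,
    circleIntegral.integral_add i2 i3, e2, e3, add_zero]

/-- Invertibility is stable, uniformly on compact sets. -/
theorem eventually_isUnit_sub {R₀ : E →L[ℂ] E} {K : Set ℂ} (hK : IsCompact K)
    (hU : ∀ z ∈ K, IsUnit (R₀ - z • 1)) : ∀ᶠ R in 𝓝 R₀, ∀ z ∈ K, IsUnit (R - z • 1) := by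
  refine hK.eventually_forall_of_forall_eventually fun z hz => ?_
  have hc : Continuous fun q : (E →L[ℂ] E) × ℂ => q.1 - q.2 • (1 : E →L[ℂ] E) := by fun_prop
  exact hc.continuousAt.eventually (Units.isOpen.mem_nhds (hU z hz))

end Projector

/-! ### The mean, and the cone of functions with Lipschitz logarithm -/

section Cone

set_option linter.unusedSectionVars false

variable {Γ₀ : Subgroup SL(2, ℝ)} {A : Type*} {P : LabelledIdealPolygon Γ₀ A} [Finite A]
  [Nonempty A]

/-- The integral for the uniform measure. -/
def meanL : PLip P →L[ℂ] ℂ :=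
  LinearMap.mkContinuous
    { toFun := fun f => ∫ ξ, f ξ ∂circleMeasure
      map_add' := fun f g => integral_add (f.integrable _) (g.integrable _)
      map_smul' := fun c f => integral_const_mul c _ } 1
    fun f => by
      rw [one_mul]
      have := norm_integral_le_of_norm_le_const (μ := circleMeasure)
        (Eventually.of_forall fun ξ => PLip.norm_apply_le f ξ)
      rw [probReal_univ, mul_one] at this
      exact this

theorem meanL_apply (f : PLip P) : meanL f = ∫ ξ, f ξ ∂circleMeasure := rfl

theorem meanL_one : meanL (PLip.one P) = 1 := by
  rw [meanL_apply]; simp [PLip.one_apply]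

theorem meanL_conj (f : PLip P) : meanL (PLip.conjL f) = conj (meanL f) := by
  rw [meanL_apply, meanL_apply, ← integral_conj]; rfl

theorem re_meanL (f : PLip P) : (meanL f).re = ∫ ξ, (f ξ).re ∂circleMeasure :=
  (integral_re (𝕜 := ℂ) (f.integrable circleMeasure)).symm

theorem re_meanL_mono {f g : PLip P} (h : ∀ ξ, (f ξ).re ≤ (g ξ).re) :
    (meanL f).re ≤ (meanL g).re := by
  rw [re_meanL, re_meanL]
  exact integral_mono (f.integrable circleMeasure).re (g.integrable circleMeasure).re h

theorem im_meanL {f : PLip P} (h : ∀ ξ, (f ξ).im = 0) : (meanL f).im = 0 := by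
  have h1 : PLip.conjL f = f := PLip.ext fun ξ => by
    rw [PLip.conjL_apply, conj_eq_iff_im.mpr (h ξ)]
  have h2 := meanL_conj f
  rw [h1] at h2
  exact conj_eq_iff_im.mp h2.symm

/-- The cone of positive functions whose logarithm is `K`-Lipschitz on the arcs. -/
def InCone (K : ℝ) (f : PLip P) : Prop :=
  (∀ ξ, (f ξ).im = 0 ∧ 0 ≤ (f ξ).re) ∧
    ∀ a, ∀ ξ ∈ arc P a, ∀ η ∈ arc P a, (f ξ).re ≤ Real.exp (K * dist ξ η) * (f η).re

theorem InCone.mono {K K' : ℝ} {f : PLip P} (h : InCone K f) (hK : K ≤ K') : InCone K' f := by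
  refine ⟨h.1, fun a ξ hξ η hη => (h.2 a ξ hξ η hη).trans ?_⟩
  have := (h.1 η).2
  gcongr

theorem inCone_one {K : ℝ} (hK : 0 ≤ K) : InCone K (PLip.one P) := by
  refine ⟨fun ξ => by simp [PLip.one_apply], fun a ξ _ η _ => ?_⟩
  simp only [PLip.one_apply, one_re, mul_one]
  exact Real.one_le_exp (by positivity)

theorem inCone_real_smul {K c : ℝ} {f : PLip P} (h : InCone K f) (hc : 0 ≤ c) :
    InCone K ((c : ℂ) • f) := by
  refine ⟨fun ξ => ?_, fun a ξ hξ η hη => ?_⟩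
  · rw [PLip.smul_apply, re_ofReal_mul, im_ofReal_mul, (h.1 ξ).1, mul_zero]
    exact ⟨rfl, mul_nonneg hc (h.1 ξ).2⟩
  · rw [PLip.smul_apply, PLip.smul_apply, re_ofReal_mul, re_ofReal_mul, mul_left_comm]
    exact mul_le_mul_of_nonneg_left (h.2 a ξ hξ η hη) hc

theorem inCone_of_tendsto {K : ℝ} {u : ℕ → PLip P} {f : PLip P} (hu : ∀ n, InCone K (u n))
    (h : Tendsto u atTop (𝓝 f)) : InCone K f := by
  have h0 : ∀ ξ, Tendsto (fun n => u n ξ) atTop (𝓝 (f ξ)) := fun ξ =>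
    ((PLip.eval ξ).continuous.tendsto f).comp h
  have hr : ∀ ξ, Tendsto (fun n => (u n ξ).re) atTop (𝓝 (f ξ).re) := fun ξ =>
    (continuous_re.tendsto _).comp (h0 ξ)
  refine ⟨fun ξ => ⟨?_, ?_⟩, fun a ξ hξ η hη => ?_⟩
  · refine tendsto_nhds_unique ((continuous_im.tendsto _).comp (h0 ξ)) ?_
    simp only [Function.comp_def, fun n => ((hu n).1 ξ).1]
    exact tendsto_const_nhds
  · exact ge_of_tendsto (hr ξ) (Eventually.of_forall fun n => ((hu n).1 ξ).2)
  · exact le_of_tendsto_of_tendsto (hr ξ) ((hr η).const_mul _)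
      (Eventually.of_forall fun n => (hu n).2 a ξ hξ η hη)

variable (P) in
theorem exists_arc_measure_ge : ∃ c : ℝ, 0 < c ∧ ∀ a, c ≤ circleMeasure.real (arc P a) := by
  obtain ⟨a₀, h₀⟩ := Finite.exists_min fun a => circleMeasure.real (arc P a)
  refine ⟨_, ?_, h₀⟩
  have h1 : tail P true a₀ (bn P a₀) ⊆ arc P a₀ := fun ξ hξ =>
    openArc_subset_arc a₀ ((mem_openArc_iff true hξ.1).mpr hξ.2)
  refine lt_of_lt_of_le ?_ (measureReal_mono h1)
  rw [measureReal_tail]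
  have := Real.arctan_lt_pi_div_two (bn P a₀)
  have := Real.pi_pos
  exact div_pos (by linarith) this

variable (P) in
/-- On the cone, the norm is controlled by the mean. -/
theorem InCone.exists_norm_le {K : ℝ} (hK : 0 ≤ K) :
    ∃ C : ℝ, 0 < C ∧ ∀ f : PLip P, InCone K f → ‖f‖ ≤ C * (meanL f).re := by
  obtain ⟨c, hc, hca⟩ := exists_arc_measure_ge P
  set e := Real.exp (K * 2) with he
  have he0 : 0 < e := Real.exp_pos _
  refine ⟨e / c + K * e * (e / c), by positivity, fun f hf => ?_⟩
  have hexp : ∀ ξ η : Circle, Real.exp (K * dist ξ η) ≤ e := fun ξ η => by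
    rw [he, Real.exp_le_exp]
    exact mul_le_mul_of_nonneg_left (circle_dist_le_two ξ η) hK
  have hsup : ∀ ξ, (f ξ).re ≤ e / c * (meanL f).re := by
    intro ξ
    obtain ⟨a, ha⟩ := exists_mem_arc (P := P) ξ
    have hint : Integrable (fun ξ => (f ξ).re) circleMeasure := (f.integrable circleMeasure).re
    have h1 : e⁻¹ * (f ξ).re * circleMeasure.real (arc P a) ≤
        ∫ η in arc P a, (f η).re ∂circleMeasure := by
      have := setIntegral_mono_on (μ := circleMeasure) (s := arc P a)
        (f := fun _ => e⁻¹ * (f ξ).re) (g := fun η => (f η).re)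
        (integrable_const _) hint.integrableOn (measurableSet_arc a) (fun η hη => by
          rw [inv_mul_le_iff₀ he0]
          refine (hf.2 a ξ ha η hη).trans ?_
          exact mul_le_mul_of_nonneg_right (hexp ξ η) (hf.1 η).2)
      rwa [setIntegral_const, smul_eq_mul, mul_comm] at this
    have h2 : ∫ η in arc P a, (f η).re ∂circleMeasure ≤ (meanL f).re := by
      rw [re_meanL]
      exact setIntegral_le_integral hint (Eventually.of_forall fun η => (hf.1 η).2)
    have h3 : e⁻¹ * (f ξ).re * c ≤ (meanL f).re := by
      refine le_trans ?_ (h1.trans h2)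
      have := (hf.1 ξ).2
      gcongr
      exact hca a
    rw [div_mul_eq_mul_div, le_div_iff₀ hc]
    calc (f ξ).re * c = e * (e⁻¹ * (f ξ).re * c) := by field_simp
      _ ≤ _ := by gcongr
  have hn : ∀ ξ, f ξ = ((f ξ).re : ℂ) := fun ξ => Complex.ext rfl (hf.1 ξ).1
  rw [add_mul]
  have hM : 0 ≤ e / c * (meanL f).re := by
    obtain ⟨ξ⟩ : Nonempty Circle := inferInstance
    exact (hf.1 ξ).2.trans (hsup ξ)
  have hkey : ∀ a, ∀ ξ ∈ arc P a, ∀ η ∈ arc P a,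
      (f ξ).re - (f η).re ≤ K * e * (e / c * (meanL f).re) * dist ξ η := by
    intro a ξ hξ η hη
    have h1 := hf.2 a ξ hξ η hη
    have h2 : Real.exp (K * dist ξ η) - 1 ≤ K * dist ξ η * e := by
      have h3 := abs_exp_sub_exp_le (K * dist ξ η) 0
      rw [Real.exp_zero, sub_zero, max_eq_left (by positivity), abs_of_nonneg (a := K * _)
        (by positivity)] at h3
      exact ((le_abs_self _).trans h3).trans (by gcongr; exact hexp ξ η)
    have h4 := (hf.1 η).2
    calc (f ξ).re - (f η).re ≤ (Real.exp (K * dist ξ η) - 1) * (f η).re := by linarith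
      _ ≤ (K * dist ξ η * e) * (e / c * (meanL f).re) := by
        gcongr
        exact hsup η
      _ = _ := by ring
  refine PLip.norm_le (fun ξ => ?_) (by rw [mul_assoc]; positivity) fun a ξ hξ η hη => ?_
  · rw [hn ξ, norm_real, Real.norm_eq_abs, abs_of_nonneg (hf.1 ξ).2]
    exact hsup ξ
  · rw [hn ξ, hn η, ← ofReal_sub, norm_real, Real.norm_eq_abs, abs_sub_le_iff, mul_assoc (K * e)]
    refine ⟨hkey a ξ hξ η hη, ?_⟩
    rw [dist_comm]
    exact hkey a η hη ξ hξ

/-- A real function becomes an element of the cone after addition of a constant. -/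
theorem inCone_add_const {K : ℝ} (hK : 0 < K) {f : PLip P} (hf : ∀ ξ, (f ξ).im = 0) :
    InCone K (f + (((1 + K⁻¹) * ‖f‖ : ℝ) : ℂ) • PLip.one P) := by
  set t := (1 + K⁻¹) * ‖f‖ with ht
  have hv : ∀ ξ, (f + (t : ℂ) • PLip.one P) ξ = f ξ + t := fun ξ => by
    rw [PLip.add_apply, PLip.smul_apply, PLip.one_apply, mul_one]
  have hlow : ∀ ξ, K⁻¹ * ‖f‖ ≤ (f ξ).re + t := by
    intro ξ
    have h1 := (abs_re_le_norm (f ξ)).trans (PLip.norm_apply_le f ξ)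
    have := (abs_le.mp h1).1
    rw [ht]; linarith
  have hK' : 0 ≤ K⁻¹ * ‖f‖ := by positivity
  refine ⟨fun ξ => ?_, fun a ξ hξ η hη => ?_⟩
  · rw [hv, add_im, add_re, hf, ofReal_im, ofReal_re, add_zero]
    exact ⟨rfl, hK'.trans (hlow ξ)⟩
  · rw [hv, hv, add_re, add_re, ofReal_re]
    have h1 := (abs_le.mp (PLip.re_sub_le f hξ hη)).2
    have h2 := Real.add_one_le_exp (K * dist ξ η)
    have h3 : K * dist ξ η * (K⁻¹ * ‖f‖) ≤ (Real.exp (K * dist ξ η) - 1) * ((f η).re + t) := by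
      gcongr
      · have : 0 ≤ K * dist ξ η := by positivity
        linarith
      · linarith
      · exact hlow η
    have h4 : K * dist ξ η * (K⁻¹ * ‖f‖) = ‖f‖ * dist ξ η := by field_simp
    linarith

/-! ### The spectral gap -/

variable {L : PLip P →L[ℂ] PLip P}

/-- The distortion of the weights adds `K₀`, while composition with a branch multiplies the constant
by its contraction `κ`. -/
theorem InCone.image {X : A → Set (List A)} (hX : IsWordFamily P X) {s κ K K₀ : ℝ} (hs : s = 1)
    (hK : 0 ≤ K) (hbd : ∀ W b, IsCuspidal P W → Follows P W b → ∀ ξ ∈ closedArc P b,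
        derivNorm (elt P W) ξ ≤ κ ∧ ∀ η ∈ closedArc P b,
          derivNorm (elt P W) ξ ≤ derivNorm (elt P W) η * Real.exp (K₀ * dist ξ η))
    (h : IsWordOperator P s X L) {f : PLip P} (hf : InCone K f) : InCone (K₀ + κ * K) (L f) := by
  subst hs
  refine ⟨fun ξ => ⟨?_, h.re_nonneg (fun ξ => (hf.1 ξ).2) ξ⟩, fun b ξ hξ η hη => ?_⟩
  · have h1 : PLip.conjL f = f := PLip.ext fun ξ => by
      rw [PLip.conjL_apply, conj_eq_iff_im.mpr (hf.1 ξ).1]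
    have h2 := h.conjL f
    rw [h1] at h2
    have h3 := congrArg (fun f : PLip P => f ξ) h2
    simp only [PLip.conjL_apply] at h3
    exact conj_eq_iff_im.mp h3.symm
  · refine hasSum_le (fun W => ?_) (h.hasSum_re f hξ) ((h.hasSum_re f hη).mul_left _)
    have hW := hX b W W.2
    have hξc := arc_subset_closedArc b hξ
    have hηc := arc_subset_closedArc b hη
    have hκ : ∀ ξ ∈ closedArc P b, derivNorm (elt P (W : List A)) ξ ≤ κ :=
      fun ξ hξ => (hbd _ b hW.1 hW.2 ξ hξ).1
    obtain ⟨a, ha⟩ : ∃ a, (W : List A).head? = some a := by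
      obtain ⟨a, l, h⟩ := List.exists_cons_of_ne_nil hW.1.1
      exact ⟨a, by rw [h]; rfl⟩
    have m1 := openArc_subset_arc a (act_mem_openArc_of_follows hW.1 ha hW.2 hξc)
    have m2 := openArc_subset_arc a (act_mem_openArc_of_follows hW.1 ha hW.2 hηc)
    have h1 := (hbd _ b hW.1 hW.2 ξ hξc).2 η hηc
    have h2 := hf.2 a _ m1 _ m2
    have h3 := dist_act_le hκ hξc hηc
    have h4 := derivNorm_pos (elt P (W : List A)) ξ
    have h5 := derivNorm_pos (elt P (W : List A)) η
    have h6 := (hf.1 (act (elt P (W : List A)) ξ)).2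
    have h7 := (hf.1 (act (elt P (W : List A)) η)).2
    rw [Real.rpow_one, Real.rpow_one, add_mul, Real.exp_add]
    calc _ ≤ (derivNorm (elt P (W : List A)) η * Real.exp (K₀ * dist ξ η)) *
          (Real.exp (K * (κ * dist ξ η)) * (f (act (elt P (W : List A)) η)).re) := by
          gcongr
          refine h2.trans ?_
          gcongr
      _ = _ := by rw [← mul_assoc K, mul_comm K κ]; ring

variable (P) in
/-- Uniform lower bound for the derivatives of the words connecting two letters. -/
theorem exists_connecting_bound : ∃ c : ℝ, 0 < c ∧ c ≤ 1 ∧ ∀ a b, ∃ W, IsCuspidal P W ∧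
    W.head? = some a ∧ Follows P W b ∧ ∀ ξ, c ≤ derivNorm (elt P W) ξ := by
  choose W h1 h2 h3 using fun a b => exists_connecting_word (P := P) a b
  obtain ⟨q, hq⟩ := Finite.exists_min fun q : A × A =>
    ((‖beta (elt P (W q.1 q.2))‖ + ‖alpha (elt P (W q.1 q.2))‖) ^ 2)⁻¹
  refine ⟨min 1 ((‖beta (elt P (W q.1 q.2))‖ + ‖alpha (elt P (W q.1 q.2))‖) ^ 2)⁻¹, ?_,
    min_le_left _ _, fun a b => ⟨W a b, h1 a b, h2 a b, h3 a b, fun ξ =>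
      (min_le_right _ _).trans ((hq (a, b)).trans (derivNorm_ge _ ξ))⟩⟩
  refine lt_min one_pos (inv_pos.mpr (pow_pos ?_ 2))
  exact add_pos_of_nonneg_of_pos (norm_nonneg _) ((norm_nonneg _).trans_lt (norm_beta_lt _))

/-- The Doeblin-Fortet type decomposition. -/
theorem exists_doeblin {X : A → Set (List A)}
    (hXt : ∀ b W, W ∈ X b ↔ IsCuspidal P W ∧ Follows P W b) (h : IsWordOperator P 1 X L) :
    ∃ K δ : ℝ, 0 < K ∧ 0 < δ ∧ δ < 1 ∧ ∀ f, InCone K f →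
      InCone K (L f) ∧ InCone K (L f - ((δ * (meanL f).re : ℝ) : ℂ) • PLip.one P) := by
  obtain ⟨κ, _, K₀, hκ0, hκ1, -, hK₀, hbd⟩ := exists_word_bounds P
  obtain ⟨c, hc, hc1, hconn⟩ := exists_connecting_bound P
  -- The solution of `K₀ + κ K + K₀ = K`: the image cone is smaller by a margin `K₀`, which pays for
  -- the subtraction of a constant.
  set K := 2 * K₀ / (1 - κ) with hK
  have hκ' : 0 < 1 - κ := by linarith
  have hK0 : 0 < K := by positivity
  have hKK : K₀ + κ * K + K₀ = K := by rw [hK]; field_simp; ring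
  set e := Real.exp (K * 2) with he
  have he1 : 1 ≤ e := Real.one_le_exp (by positivity)
  -- Two constraints: `δ ≤ c / e` keeps the difference nonnegative, and the factor `K₀ / (K e)`
  -- keeps its logarithm within the margin `K₀`.
  set δ := c / e * (K₀ / (K * e)) / 2 with hδ
  have hδ0 : 0 < δ := by positivity
  have hr : K₀ / (K * e) ≤ 1 := by
    rw [div_le_one (by positivity)]
    nlinarith
  have hce : c / e ≤ 1 := by rw [div_le_one (by positivity)]; linarith
  have hδ1 : δ < 1 := by
    have : c / e * (K₀ / (K * e)) ≤ 1 := mul_le_one₀ hce (by positivity) hr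
    linarith
  have hδc : δ ≤ c / e := by
    have : c / e * (K₀ / (K * e)) ≤ c / e * 1 := by gcongr
    have : 0 < c / e * (K₀ / (K * e)) := by positivity
    linarith
  refine ⟨K, δ, hK0, hδ0, hδ1, fun f hf => ?_⟩
  have hX : IsWordFamily P X := fun b W hW => (hXt b W).mp hW
  have h1 := InCone.image hX rfl hK0.le (fun W b hW hf ξ hξ =>
    ⟨(hbd W b hW hf ξ hξ).1, (hbd W b hW hf ξ hξ).2.2⟩) h hf
  refine ⟨h1.mono (by linarith), ?_⟩
  set M := (meanL f).re with hM
  have hM0 : 0 ≤ M := by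
    rw [hM, re_meanL]; exact integral_nonneg fun ξ => (hf.1 ξ).2
  -- At some point `f` is at least its mean. A connecting word sends `ξ` into the arc of that point,
  -- and its single term is enough for the lower bound.
  have hlow : ∀ ξ, c / e * M ≤ (L f ξ).re := by
    intro ξ
    obtain ⟨ξ₀, h2⟩ := exists_integral_le (μ := circleMeasure) (f.integrable circleMeasure).re
    have h2' : M ≤ (f ξ₀).re := by rw [hM, re_meanL]; exact h2
    obtain ⟨a, ha⟩ := exists_mem_arc (P := P) ξ₀
    obtain ⟨b, hb⟩ := exists_mem_arc (P := P) ξ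
    obtain ⟨W, hW, hWa, hWb, hWc⟩ := hconn a b
    have h3 := h.term_le (fun ξ => (hf.1 ξ).2) hb ((hXt b W).mpr ⟨hW, hWb⟩)
    rw [Real.rpow_one] at h3
    refine le_trans ?_ h3
    have h4 := hf.2 a ξ₀ ha _ (openArc_subset_arc a
      (act_mem_openArc_of_follows hW hWa hWb (arc_subset_closedArc b hb)))
    have h5 : Real.exp (K * dist ξ₀ (act (elt P W) ξ)) ≤ e := by
      rw [he, Real.exp_le_exp]
      exact mul_le_mul_of_nonneg_left (circle_dist_le_two _ _) hK0.le
    have h6 := (hf.1 (act (elt P W) ξ)).2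
    have h7 : M ≤ e * (f (act (elt P W) ξ)).re := h2'.trans (h4.trans (by gcongr))
    rw [div_mul_eq_mul_div, div_le_iff₀ (by positivity)]
    calc c * M ≤ derivNorm (elt P W) ξ * (e * (f (act (elt P W) ξ)).re) := by
          exact mul_le_mul (hWc ξ) h7 hM0 (derivNorm_pos _ _).le
      _ = _ := by ring
  have hv : ∀ ξ, (L f - ((δ * M : ℝ) : ℂ) • PLip.one P) ξ = L f ξ - (δ * M : ℝ) := fun ξ => by
    rw [PLip.sub_apply, PLip.smul_apply, PLip.one_apply, mul_one]
  refine ⟨fun ξ => ?_, fun a ξ hξ η hη => ?_⟩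
  · rw [hv, sub_im, sub_re, (h1.1 ξ).1, ofReal_im, ofReal_re, sub_zero]
    refine ⟨rfl, ?_⟩
    have : δ * M ≤ c / e * M := by gcongr
    linarith [hlow ξ]
  · rw [hv, hv, sub_re, sub_re, ofReal_re]
    have h2 := h1.2 a ξ hξ η hη
    set d := dist ξ η with hd
    have hd0 : 0 ≤ d := dist_nonneg
    have hd2 : d ≤ 2 := circle_dist_le_two ξ η
    have h3 : Real.exp (K * d) - 1 ≤ K * d * e := by
      have h3 := abs_exp_sub_exp_le (K * d) 0
      rw [Real.exp_zero, sub_zero, max_eq_left (by positivity), abs_of_nonneg (a := K * _)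
        (by positivity)] at h3
      refine ((le_abs_self _).trans h3).trans ?_
      rw [he]; gcongr
    have h4 : K₀ * d ≤ Real.exp (K * d) - Real.exp ((K₀ + κ * K) * d) := by
      have : K * d = (K₀ + κ * K) * d + K₀ * d := by rw [← add_mul, hKK]
      rw [this, Real.exp_add]
      have h5 := Real.add_one_le_exp (K₀ * d)
      have h6 : 1 ≤ Real.exp ((K₀ + κ * K) * d) := Real.one_le_exp (by positivity)
      nlinarith [show 0 ≤ K₀ * d by positivity]
    have h5 : δ * M * (Real.exp (K * d) - 1) ≤ K₀ * d * (L f η).re := by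
      calc δ * M * (Real.exp (K * d) - 1) ≤ δ * M * (K * d * e) := by gcongr
        _ = (K₀ * d) * (c / e * M) / 2 := by rw [hδ]; field_simp
        _ ≤ (K₀ * d) * (c / e * M) := by
          have : 0 ≤ (K₀ * d) * (c / e * M) := by positivity
          linarith
        _ ≤ _ := by gcongr; exact hlow η
    have h6 : K₀ * d * (L f η).re ≤
        (Real.exp (K * d) - Real.exp ((K₀ + κ * K) * d)) * (L f η).re := by
      have := (h1.1 η).2
      gcongr
    linarith

end Cone

/-! ### Spectra of operators converging to a rank one operator -/

section AbstractGap

variable {E : Type*} [NormedAddCommGroup E] [NormedSpace ℂ E] {L : E →L[ℂ] E} {g : E}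
  {ψ : E →L[ℂ] ℂ}

theorem isUnit_sub_smul_iff {z : ℂ} : IsUnit (L - z • 1) ↔ z ∉ spectrum ℂ L := by
  rw [spectrum.notMem_iff, Algebra.algebraMap_eq_smul_one, ← IsUnit.neg_iff, neg_sub]

/-- The inverse is the resolvent of `L` corrected by a rank one term, since `g` is sent to `(1 -
z)⁻¹ g` by the resolvent and to `-z⁻¹ g` by the new inverse. -/
theorem isUnit_deflated (hg : L g = g) (hψ : ∀ f, ψ (L f) = ψ f) (h1 : ψ g = 1) {z : ℂ}
    (hU : IsUnit (L - z • 1)) (hz : z ≠ 0) (hz1 : z ≠ 1) :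
    IsUnit (L - ψ.smulRight g - z • 1) := by
  set B := Ring.inverse (L - z • 1) with hB
  have b1 : ∀ f, L (B f) - z • B f = f := fun f =>
    congrArg (fun A : E →L[ℂ] E => A f) (Ring.mul_inverse_cancel _ hU)
  have b2 : ∀ f, B (L f - z • f) = f := fun f =>
    congrArg (fun A : E →L[ℂ] E => A f) (Ring.inverse_mul_cancel _ hU)
  have hz1' : 1 - z ≠ 0 := sub_ne_zero.mpr hz1.symm
  have hψB : ∀ f, (1 - z) * ψ (B f) = ψ f := by
    intro f
    have h := congrArg ψ (b1 f)
    rw [map_sub, hψ, map_smul, smul_eq_mul] at h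
    linear_combination h
  have hBg : (1 - z) • B g = g := by
    have h := b2 g
    rwa [hg, map_sub, map_smul, ← one_smul ℂ (B g), smul_smul, mul_one, ← sub_smul] at h
  set c := -(z * (1 - z))⁻¹ with hc
  have hψB' : ∀ f, ψ (B f) = (1 - z)⁻¹ * ψ f := fun f => by
    rw [← hψB f, inv_mul_cancel_left₀ hz1']
  have hcz : c * (1 - z) - (1 - z)⁻¹ - c = 0 := by rw [hc]; field_simp; ring
  refine ⟨⟨_, B + c • ψ.smulRight g, ?_, ?_⟩, rfl⟩
  · ext f
    change L (B f + c • (ψ f • g)) - ψ (B f + c • (ψ f • g)) • g - z • (B f + c • (ψ f • g)) = f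
    rw [map_add, map_add, map_smul, map_smul, map_smul, map_smul, hg, h1, hψB', smul_eq_mul,
      smul_eq_mul, mul_one]
    calc _ = (L (B f) - z • B f) + ((c * (1 - z) - (1 - z)⁻¹ - c) * ψ f) • g := by module
      _ = f := by rw [b1, hcz, zero_mul, zero_smul, add_zero]
  · ext f
    change B (L f - ψ f • g - z • f) + c • (ψ (L f - ψ f • g - z • f) • g) = f
    have h2 : L f - ψ f • g - z • f = (L f - z • f) - ψ f • g := by abel
    have h3 : B g = (1 - z)⁻¹ • g := by
      rw [eq_inv_smul_iff₀ hz1']; exact hBg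
    rw [h2, map_sub, b2, map_smul, h3, map_sub, map_sub, hψ, map_smul, map_smul, h1, smul_eq_mul,
      smul_eq_mul, mul_one]
    have h4 : -(1 - z)⁻¹ - c * z = 0 := by rw [hc]; field_simp; ring
    calc _ = f + ((-(1 - z)⁻¹ - c * z) * ψ f) • g := by module
      _ = f := by rw [h4, zero_mul, zero_smul, add_zero]

theorem one_mem_spectrum (hg : L g = g) (hg0 : g ≠ 0) : (1 : ℂ) ∈ spectrum ℂ L := by
  by_contra h
  have hU := isUnit_sub_smul_iff.mpr h
  have := congrArg (fun A : E →L[ℂ] E => A g) (Ring.inverse_mul_cancel _ hU)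
  change Ring.inverse (L - (1 : ℂ) • 1) (L g - (1 : ℂ) • g) = g at this
  rw [hg, one_smul ℂ g, sub_self, map_zero] at this
  exact hg0 this.symm

variable [CompleteSpace E]

/-- The restriction of `L` to the nonzero space `ker ψ` has nonempty spectrum. This spectrum avoids
`1` and is contained in that of `L`. The use is to show `1 - 2ε > 0` for any admissible `ε`, so that
the circle of radius `ε` about `1` stays away from `0`. -/
theorem exists_mem_spectrum_ne_one (hψ : ∀ f, ψ (L f) = ψ f) (h1 : ψ g = 1)
    (hU : IsUnit (L - ψ.smulRight g - (1 : ℂ) • 1)) (hk : ∃ f, f ≠ 0 ∧ ψ f = 0) :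
    ∃ z ∈ spectrum ℂ L, z ≠ 1 := by
  obtain ⟨f₀, hf₀, hψf₀⟩ := hk
  let K : Submodule ℂ E := ψ.ker
  have hmem : ∀ {f}, f ∈ K ↔ ψ f = 0 := Iff.rfl
  have hcK : CompleteSpace K := (ContinuousLinearMap.isClosed_ker ψ).completeSpace_coe
  have hn : Nontrivial K := ⟨⟨⟨f₀, hψf₀⟩, 0, fun h => hf₀ (congrArg Subtype.val h)⟩⟩
  let L' : K →L[ℂ] K := (L.comp K.subtypeL).codRestrict K fun f => by
    rw [hmem]; exact (hψ f).trans f.2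
  obtain ⟨z, hz⟩ := spectrum.nonempty L'
  have key : ∀ U : E →L[ℂ] E, IsUnit U → (∀ f, ψ (U f) = 0 → ψ f = 0) →
      (∀ f, ψ f = 0 → U f = z • f - L f) → False := by
    intro U hU h2 h3
    have u1 : ∀ f, U (Ring.inverse U f) = f := fun f =>
      congrArg (fun A : E →L[ℂ] E => A f) (Ring.mul_inverse_cancel _ hU)
    have u2 : ∀ f, Ring.inverse U (U f) = f := fun f =>
      congrArg (fun A : E →L[ℂ] E => A f) (Ring.inverse_mul_cancel _ hU)
    have u3 : ∀ f : K, ψ (Ring.inverse U f) = 0 := fun f => h2 _ (by rw [u1]; exact f.2)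
    let B : K →L[ℂ] K := ((Ring.inverse U).comp K.subtypeL).codRestrict K fun f => hmem.mpr (u3 f)
    refine (spectrum.mem_iff.mp hz) ⟨⟨_, B, ?_, ?_⟩, rfl⟩
    · ext f
      change z • Ring.inverse U f - L (Ring.inverse U f) = f
      rw [← h3 _ (u3 f), u1]
    · ext f
      change Ring.inverse U (z • (f : E) - L f) = f
      rw [← h3 _ f.2, u2]
  by_cases hz1 : z = 1
  · exfalso
    refine key (-(L - ψ.smulRight g - (1 : ℂ) • 1)) hU.neg (fun f hf => ?_) fun f hf => ?_
    · change ψ (-(L f - ψ f • g - (1 : ℂ) • f)) = 0 at hf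
      rw [map_neg, map_sub, map_sub, hψ, map_smul, map_smul, h1] at hf
      simpa using hf
    · change -(L f - ψ f • g - (1 : ℂ) • f) = _
      rw [hf, zero_smul, sub_zero, neg_sub, hz1]
  · refine ⟨z, ?_, hz1⟩
    by_contra h
    refine key (algebraMap ℂ _ z - L) (spectrum.notMem_iff.mp h) (fun f hf => ?_) fun f hf => rfl
    change ψ (z • f - L f) = 0 at hf
    rw [map_sub, hψ, map_smul, smul_eq_mul] at hf
    have : (z - 1) * ψ f = 0 := by linear_combination hf
    exact (mul_eq_zero.mp this).resolve_left (sub_ne_zero.mpr hz1)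

/-- The positive powers of the deflated operator are `L^n - ψ ⊗ g`, so the estimate bounds its
spectral radius by `ρ`. -/
theorem isUnit_deflated_of_lt (hg : L g = g) (h1 : ψ g = 1) {C ρ : ℝ}
    (hψ : ∀ f, ψ (L f) = ψ f) (hρ0 : 0 < ρ)
    (hC : ∀ n f, ‖(L ^ n) f - ψ f • g‖ ≤ C * ρ ^ n * ‖f‖) {z : ℂ} (hz : ρ < ‖z‖) :
    IsUnit (L - ψ.smulRight g - z • 1) := by
  have hg0 : g ≠ 0 := by rintro rfl; simp at h1
  have : Nontrivial E := ⟨⟨g, 0, hg0⟩⟩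
  set R := L - ψ.smulRight g with hR
  have hRa : ∀ f, R f = L f - ψ f • g := fun f => rfl
  have hψR : ∀ f, ψ (R f) = 0 := fun f => by rw [hRa, map_sub, hψ, map_smul, h1]; simp
  have hLg : ∀ n, (L ^ n) g = g := by
    intro n
    induction n with
    | zero => rfl
    | succ n ih => rw [pow_succ]; change (L ^ n) (L g) = g; rw [hg, ih]
  have hRn : ∀ n f, (R ^ (n + 1)) f = (L ^ (n + 1)) f - ψ f • g := by
    intro n
    induction n with
    | zero => intro f; rw [zero_add, pow_one, pow_one, hRa]
    | succ n ih =>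
      intro f
      rw [pow_succ]; change (R ^ (n + 1)) (R f) = _
      rw [ih, hψR, zero_smul, sub_zero, hRa, map_sub, map_smul, hLg, pow_succ L (n + 1)]; rfl
  rw [isUnit_sub_smul_iff]
  intro hmem
  have hb : ∀ n : ℕ, (‖z‖ / ρ) ^ (n + 1) ≤ C := by
    intro n
    have h2 := spectrum.norm_le_norm_of_mem (spectrum.pow_mem_pow R (n + 1) hmem)
    have hC0 : 0 ≤ C := by
      have := (norm_nonneg _).trans (hC 0 g)
      rw [pow_zero, mul_one] at this
      exact nonneg_of_mul_nonneg_left this (norm_pos_iff.mpr hg0)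
    have h3 : ‖R ^ (n + 1)‖ ≤ C * ρ ^ (n + 1) :=
      ContinuousLinearMap.opNorm_le_bound _ (by positivity) fun f => by rw [hRn]; exact hC _ f
    rw [norm_pow] at h2
    rw [div_pow, div_le_iff₀ (by positivity)]
    exact h2.trans h3
  have ht := (tendsto_pow_atTop_atTop_of_one_lt ((one_lt_div hρ0).mpr hz)).comp
    (tendsto_add_atTop_nat 1)
  obtain ⟨n, hn⟩ := (ht.eventually_gt_atTop C).exists
  exact (hb n).not_gt hn

end AbstractGap

/-! ### The spectral gap of the transfer operator -/

section Gap

set_option linter.unusedSectionVars false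

variable {Γ₀ : Subgroup SL(2, ℝ)} {A : Type*} {P : LabelledIdealPolygon Γ₀ A} [Finite A]
  [Nonempty A] {L : PLip P →L[ℂ] PLip P}

/-- Coupling: for two functions of the same mean, the constants subtracted at each step are equal
and cancel in the difference, while the means decrease by the factor `1 - δ`. -/
theorem exists_iterate_sub {K δ : ℝ}
    (hD : ∀ f, InCone K f → InCone K (L f - ((δ * (meanL f).re : ℝ) : ℂ) • PLip.one P))
    (hm : ∀ f, meanL (L f) = meanL f) (n : ℕ) {f f' : PLip P} (hf : InCone K f)
    (hf' : InCone K f') (hff : (meanL f).re = (meanL f').re) :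
    ∃ u u', InCone K u ∧ InCone K u' ∧ (L ^ n) f - (L ^ n) f' = u - u' ∧
      (meanL u).re = (1 - δ) ^ n * (meanL f).re ∧ (meanL u').re = (1 - δ) ^ n * (meanL f).re := by
  induction n with
  | zero => exact ⟨f, f', hf, hf', rfl, by simp, by simp [hff]⟩
  | succ n ih =>
    obtain ⟨u, u', hu, hu', he, hmu, hmu'⟩ := ih
    have hmean : ∀ v : PLip P, (meanL (L v - ((δ * (meanL v).re : ℝ) : ℂ) • PLip.one P)).re =
        (1 - δ) * (meanL v).re := by
      intro v
      rw [map_sub, map_smul, hm, meanL_one, smul_eq_mul, mul_one, sub_re, ofReal_re]; ring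
    refine ⟨_, _, hD u hu, hD u' hu', ?_, ?_, ?_⟩
    · rw [pow_succ']
      change L ((L ^ n) f) - L ((L ^ n) f') = _
      rw [← map_sub, he, map_sub, hmu, hmu']; abel
    · rw [hmean, hmu]; ring
    · rw [hmean, hmu']; ring

/-- The coupling makes the iterates of `1` a Cauchy sequence, with limit `g`. A real function is
moved into the cone by a constant proportional to its norm, and a complex one is split into real and
imaginary parts. -/
theorem exists_limit_eigenfunction {X : A → Set (List A)}
    (hXt : ∀ b W, W ∈ X b ↔ IsCuspidal P W ∧ Follows P W b) (h : IsWordOperator P 1 X L)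
    (hm : ∀ f, meanL (L f) = meanL f) :
    ∃ (g : PLip P) (c C ρ : ℝ), 0 < c ∧ (∀ ξ, c ≤ (g ξ).re ∧ (g ξ).im = 0) ∧ L g = g ∧
      meanL g = 1 ∧ 0 < ρ ∧ ρ < 1 ∧ ∀ n f, ‖(L ^ n) f - meanL f • g‖ ≤ C * ρ ^ n * ‖f‖ := by
  obtain ⟨K, δ, hK, hδ, hδ1, hD⟩ := exists_doeblin hXt h
  obtain ⟨C₀, hC₀, hC₀'⟩ := InCone.exists_norm_le P hK.le
  set ρ := 1 - δ with hρ
  have hρ0 : 0 < ρ := by linarith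
  have hρ1 : ρ < 1 := by linarith
  have hdiff : ∀ n {f f' : PLip P}, InCone K f → InCone K f' → (meanL f).re = (meanL f').re →
      ‖(L ^ n) f - (L ^ n) f'‖ ≤ 2 * C₀ * ρ ^ n * (meanL f).re := by
    intro n f f' hf hf' hff
    obtain ⟨u, u', hu, hu', he, hmu, hmu'⟩ :=
      exists_iterate_sub (fun f hf => (hD f hf).2) hm n hf hf' hff
    rw [he]
    refine (norm_sub_le u u').trans ?_
    have h1 := hC₀' u hu
    have h2 := hC₀' u' hu'
    rw [hmu] at h1
    rw [hmu'] at h2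
    linarith
  have hone : InCone K (PLip.one P) := inCone_one hK.le
  have hcone : ∀ n, InCone K ((L ^ n) (PLip.one P)) := by
    intro n
    induction n with
    | zero => exact hone
    | succ n ih => rw [pow_succ']; exact (hD _ ih).1
  have hmn : ∀ n f, meanL ((L ^ n) f) = meanL f := by
    intro n
    induction n with
    | zero => intro f; rfl
    | succ n ih =>
      intro f
      rw [pow_succ]; change meanL ((L ^ n) (L f)) = _
      rw [ih, hm]
  have hstep : ∀ n, dist ((L ^ n) (PLip.one P)) ((L ^ (n + 1)) (PLip.one P)) ≤
      2 * C₀ * ρ ^ n := by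
    intro n
    have h1 := hdiff n hone (hD _ hone).1 (by rw [hm])
    rw [meanL_one, one_re, mul_one] at h1
    rw [dist_eq_norm, pow_succ]
    exact h1
  obtain ⟨g, hg⟩ := cauchySeq_tendsto_of_complete
    (cauchySeq_of_le_geometric ρ (2 * C₀) hρ1 hstep)
  have hgd := dist_le_of_le_geometric_of_tendsto ρ (2 * C₀) hρ1 hstep hg
  have hgK : InCone K g := inCone_of_tendsto hcone hg
  have hLg : L g = g := by
    refine tendsto_nhds_unique ((L.continuous.tendsto g).comp hg) ?_
    have := hg.comp (tendsto_add_atTop_nat 1)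
    refine this.congr fun n => ?_
    simp only [Function.comp_apply, pow_succ']; rfl
  have hmg : meanL g = 1 := by
    refine tendsto_nhds_unique ((meanL.continuous.tendsto g).comp hg) ?_
    simp only [Function.comp_def, hmn, meanL_one]
    exact tendsto_const_nhds
  have hreal : ∀ f : PLip P, (∀ ξ, (f ξ).im = 0) → ∀ n,
      ‖(L ^ n) f - meanL f • g‖ ≤
        (2 * C₀ * (2 + K⁻¹) + 2 * C₀ / (1 - ρ)) * ρ ^ n * ‖f‖ := by
    intro f hf n
    set t := (1 + K⁻¹) * ‖f‖ with ht
    have hc := inCone_add_const hK hf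
    rw [← ht] at hc
    set f' := f + (t : ℂ) • PLip.one P with hf'
    have hmf' : meanL f' = meanL f + t := by
      rw [hf', map_add, map_smul, meanL_one, smul_eq_mul, mul_one]
    set M := (meanL f').re with hM
    have hM0 : 0 ≤ M := by
      rw [hM, re_meanL]; exact integral_nonneg fun ξ => (hc.1 ξ).2
    have hMeq : meanL f' = (M : ℂ) := Complex.ext rfl (im_meanL fun ξ => (hc.1 ξ).1)
    have hMle : M ≤ (2 + K⁻¹) * ‖f‖ := by
      have h1 : ‖meanL f‖ ≤ ‖f‖ := by
        refine (ContinuousLinearMap.le_of_opNorm_le _ ?_ f).trans (le_of_eq (one_mul _))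
        exact LinearMap.mkContinuous_norm_le _ zero_le_one _
      have h2 : M = (meanL f).re + t := by rw [hM, hmf', add_re, ofReal_re]
      have h3 := (re_le_norm (meanL f)).trans h1
      rw [h2, ht]; linarith
    have h1 := hdiff n hc (inCone_real_smul hone hM0) (by
      rw [map_smul, meanL_one, smul_eq_mul, mul_one, ofReal_re])
    have h2 := hgd n
    rw [dist_eq_norm] at h2
    have e1 : (L ^ n) f - meanL f • g = ((L ^ n) f' - (L ^ n) ((M : ℂ) • PLip.one P)) +
        (meanL f) • ((L ^ n) (PLip.one P) - g) := by
      rw [hf', map_add, map_smul, map_smul, ← hMeq, hmf', smul_sub]; module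
    rw [e1]
    refine (norm_add_le _ _).trans ?_
    rw [norm_smul]
    have h3 : ‖meanL f‖ ≤ ‖f‖ := by
      refine (ContinuousLinearMap.le_of_opNorm_le _ ?_ f).trans (le_of_eq (one_mul _))
      exact LinearMap.mkContinuous_norm_le _ zero_le_one _
    have h4 : 0 < 1 - ρ := by linarith
    calc _ ≤ 2 * C₀ * ρ ^ n * ((2 + K⁻¹) * ‖f‖) + ‖f‖ * (2 * C₀ * ρ ^ n / (1 - ρ)) := by
          refine add_le_add (h1.trans ?_) (mul_le_mul h3 h2 (norm_nonneg _) (norm_nonneg _))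
          gcongr
      _ = _ := by ring
  -- The lower bound of `g` is `δ`: the Doeblin decomposition applied to `L g = g`, of mean one,
  -- says `g - δ ≥ 0`.
  refine ⟨g, δ, 2 * (2 * C₀ * (2 + K⁻¹) + 2 * C₀ / (1 - ρ)), ρ, hδ, fun ξ => ⟨?_, (hgK.1 ξ).1⟩,
    hLg, hmg, hρ0, hρ1, fun n f => ?_⟩
  · have h1 := ((hD g hgK).2.1 ξ).2
    rw [hLg, hmg, PLip.sub_apply, PLip.smul_apply, PLip.one_apply, one_re, mul_one, mul_one, sub_re,
      ofReal_re] at h1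
    linarith
  · set D := 2 * C₀ * (2 + K⁻¹) + 2 * C₀ / (1 - ρ) with hDdef
    have hD0 : 0 ≤ D := by
      have : 0 < 1 - ρ := by linarith
      positivity
    have hJn : ‖PLip.conjL f‖ ≤ ‖f‖ := by
      rw [PLip.norm_def, PLip.norm_def]
      have h1 : ∀ ξ, (PLip.conjL f).1 ξ = conj (f.1 ξ) := fun _ => rfl
      simp only [slope, h1, ← map_sub, RCLike.norm_conj, le_refl]
    set f₁ : PLip P := (1 / 2 : ℂ) • (f + PLip.conjL f) with hf₁
    set f₂ : PLip P := (-I / 2 : ℂ) • (f - PLip.conjL f) with hf₂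
    have e : f = f₁ + I • f₂ := by
      rw [hf₁, hf₂, smul_smul]
      have : I * (-I / 2) = 1 / 2 := by rw [mul_div_assoc', mul_neg, I_mul_I, neg_neg]
      rw [this]; module
    have r1 : ∀ ξ, (f₁ ξ).im = 0 := fun ξ => by
      rw [hf₁, PLip.smul_apply, PLip.add_apply, PLip.conjL_apply, add_conj]
      simp
    have r2 : ∀ ξ, (f₂ ξ).im = 0 := fun ξ => by
      rw [hf₂, PLip.smul_apply, PLip.sub_apply, PLip.conjL_apply, sub_conj]
      simp
    have n1 : ‖f₁‖ ≤ ‖f‖ := by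
      rw [hf₁, norm_smul]
      have := norm_add_le f (PLip.conjL f)
      have h2 : ‖(1 / 2 : ℂ)‖ = 1 / 2 := by norm_num
      rw [h2]; linarith
    have n2 : ‖f₂‖ ≤ ‖f‖ := by
      rw [hf₂, norm_smul]
      have := norm_sub_le f (PLip.conjL f)
      have h2 : ‖(-I / 2 : ℂ)‖ = 1 / 2 := by simp
      rw [h2]; linarith
    have e1 : (L ^ n) f - meanL f • g = ((L ^ n) f₁ - meanL f₁ • g) +
        I • ((L ^ n) f₂ - meanL f₂ • g) := by
      conv_lhs => rw [e]
      simp only [map_add, map_smul, smul_eq_mul]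
      module
    rw [e1]
    refine (norm_add_le _ _).trans ?_
    rw [norm_smul, norm_I, one_mul]
    have h1 := hreal f₁ r1 n
    have h2 := hreal f₂ r2 n
    have h3 : D * ρ ^ n * ‖f₁‖ ≤ D * ρ ^ n * ‖f‖ := by gcongr
    have h4 : D * ρ ^ n * ‖f₂‖ ≤ D * ρ ^ n * ‖f‖ := by gcongr
    linarith

variable (P) in
theorem exists_ne_zero_meanL_eq_zero : ∃ f : PLip P, f ≠ 0 ∧ meanL f = 0 := by
  classical
  obtain ⟨a⟩ := ‹Nonempty A›
  have : Nonempty A := ⟨a⟩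
  refine ⟨PLip.indicator a - meanL (PLip.indicator a : PLip P) • PLip.one P, fun h => ?_, ?_⟩
  · have hv : ∀ ξ, (PLip.indicator a : PLip P) ξ = meanL (PLip.indicator a : PLip P) := by
      intro ξ
      have h1 := congrArg (fun f : PLip P => f ξ) h
      simp only [PLip.sub_apply, PLip.smul_apply, PLip.one_apply, mul_one, PLip.zero_apply] at h1
      exact sub_eq_zero.mp h1
    have hmem : ∀ b, ep P false b ∈ arc P b := fun b => mem_arc_iff.mpr (Or.inr rfl)
    have h1 := hv (ep P false a)
    rw [← hv (ep P false (P.hat a))] at h1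
    have h2 : ep P false (P.hat a) ∉ arc P a := fun h' =>
      P.hat_ne a (eq_of_mem_arc (hmem _) h')
    simp only [PLip.indicator, PLip.mk, hmem a, h2, if_true, if_false] at h1
    exact one_ne_zero h1
  · rw [map_sub, map_smul, meanL_one, smul_eq_mul, mul_one, sub_self]

end Gap

section Eigenfunctions

set_option linter.unusedSectionVars false

variable {Γ₀ : Subgroup SL(2, ℝ)} {A : Type*} {P : LabelledIdealPolygon Γ₀ A} [Finite A]
  [Nonempty A]

/-! ### Positive eigenfunctions -/

/-- Pointwise positivity is not enough, since `g` may jump at the vertices. A word from `b` to `b`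
sends the closed arc to a compact subset of `[b]`, where `g` is continuous, and the eigenvalue
equation carries the minimum there back to all of `[b]`. -/
theorem IsPositiveEigenfunction.exists_lower_bound {X : A → Set (List A)}
    (hXt : ∀ b W, W ∈ X b ↔ IsCuspidal P W ∧ Follows P W b) {s : ℝ}
    {L : PLip P →L[ℂ] PLip P} (h : IsWordOperator P s X L) (hs : 0 ≤ s) {g : PLip P} {lam : ℝ}
    (hg : IsPositiveEigenfunction L g lam) : ∃ c : ℝ, 0 < c ∧ ∀ ξ, c ≤ (g ξ).re := by
  obtain ⟨c, hc, -, hconn⟩ := exists_connecting_bound P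
  have hmin : ∀ b : A, ∃ m : ℝ, 0 < m ∧ ∀ ξ ∈ arc P b, m ≤ (g ξ).re := by
    intro b
    obtain ⟨W, hW, hWa, hWb, hWc⟩ := hconn b b
    have hsub : act (elt P W) '' closedArc P b ⊆ arc P b := by
      rintro _ ⟨ξ, hξ, rfl⟩
      exact openArc_subset_arc b (act_mem_openArc_of_follows hW hWa hWb hξ)
    have hcomp : IsCompact (act (elt P W) '' closedArc P b) :=
      (isClosed_closedArc b).isCompact.image (continuous_act _)
    have hne : (act (elt P W) '' closedArc P b).Nonempty :=
      ⟨_, _, arc_subset_closedArc b (mem_arc_iff.mpr (Or.inr rfl)), rfl⟩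
    obtain ⟨η, hη, hmin⟩ := hcomp.exists_isMinOn hne
      (continuous_re.comp_continuousOn ((PLip.continuousOn_arc g b).mono hsub))
    have hgη := (hg.2.1 η).1
    refine ⟨lam⁻¹ * (c ^ s * (g η).re), ?_, fun ξ hξ => ?_⟩
    · have := hg.1
      have := Real.rpow_pos_of_pos hc s
      positivity
    · have h1 := h.term_le (fun ξ => (hg.2.1 ξ).1.le) hξ ((hXt b W).mpr ⟨hW, hWb⟩)
      rw [hg.2.2, PLip.smul_apply, re_ofReal_mul] at h1
      rw [inv_mul_le_iff₀ hg.1]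
      refine le_trans ?_ h1
      have h2 : (g η).re ≤ (g (act (elt P W) ξ)).re :=
        hmin ⟨ξ, arc_subset_closedArc b hξ, rfl⟩
      exact mul_le_mul (Real.rpow_le_rpow hc.le (hWc ξ) hs) h2 hgη.le
        (Real.rpow_nonneg (derivNorm_pos _ _).le s)
  choose m hm hm' using hmin
  obtain ⟨b₀, hb₀⟩ := Finite.exists_min m
  refine ⟨m b₀, hm b₀, fun ξ => ?_⟩
  obtain ⟨b, hb⟩ := exists_mem_arc (P := P) ξ
  exact (hb₀ b).trans (hm' b ξ hb)

/-- Let `r` be the supremum of `f / g`, finite because `g` is bounded below. Applying the positive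
operator to `f ≤ r g` gives `r ≤ r μ / lam`. -/
theorem eigenvalue_le_of_lower_bound {X : A → Set (List A)} {s : ℝ} {L : PLip P →L[ℂ] PLip P}
    (h : IsWordOperator P s X L) {f g : PLip P} {lam μ c : ℝ}
    (hf : IsPositiveEigenfunction L f lam) (hg : IsPositiveEigenfunction L g μ) (hc : 0 < c)
    (hgc : ∀ ξ, c ≤ (g ξ).re) : lam ≤ μ := by
  have hg0 : ∀ ξ, 0 < (g ξ).re := fun ξ => (hg.2.1 ξ).1
  have hbdd : BddAbove (Set.range fun ξ => (f ξ).re / (g ξ).re) := by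
    refine ⟨‖f‖ / c, ?_⟩
    rintro _ ⟨ξ, rfl⟩
    exact div_le_div₀ (norm_nonneg f) ((re_le_norm _).trans (PLip.norm_apply_le f ξ)) hc (hgc ξ)
  set r := ⨆ ξ, (f ξ).re / (g ξ).re with hr
  have hle : ∀ ξ, (f ξ).re ≤ r * (g ξ).re := fun ξ => by
    rw [← div_le_iff₀ (hg0 ξ)]; exact le_ciSup hbdd ξ
  obtain ⟨ξ₀⟩ : Nonempty Circle := inferInstance
  have hr0 : 0 < r := lt_of_lt_of_le (div_pos (hf.2.1 ξ₀).1 (hg0 ξ₀)) (le_ciSup hbdd ξ₀)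
  have hstep : ∀ ξ, lam * (f ξ).re ≤ r * (μ * (g ξ).re) := by
    intro ξ
    have h1 := h.re_mono (f := f) (g := (r : ℂ) • g)
      (fun ξ => by rw [PLip.smul_apply, re_ofReal_mul]; exact hle ξ) ξ
    rw [map_smul, hf.2.2, hg.2.2] at h1
    simpa only [PLip.smul_apply, re_ofReal_mul] using h1
  have h2 : r ≤ r * (μ / lam) := by
    refine ciSup_le fun ξ => ?_
    rw [div_le_iff₀ (hg0 ξ), ← mul_le_mul_iff_right₀ hf.1]
    refine (hstep ξ).trans (le_of_eq ?_)
    have := hf.1.ne'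
    field_simp
  have h3 : 1 ≤ μ / lam := by
    by_contra h4
    push Not at h4
    nlinarith
  rwa [one_le_div hf.1] at h3

/-! ### The spectral coefficient -/

variable (Γ : Subgroup SL(2, ℝ)) {p : ℕ} (S : Fin p → SL(2, ℝ))

/-- The projector is `ψ ⊗ v`, so the coefficient is `ψ (Δ v)` when `ψ v = 1`. Comparison of positive
eigenfunctions shows that any other one has the same eigenvalue, hence is a multiple of `v`, and the
coefficient does not change under scaling. -/
theorem isSpectralCoefficient_of_eigenpair {ε s T t c : ℝ} (hε : 0 < ε) (hs : 1 / 2 < s)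
    {v : PLip P} {ψ : PLip P →L[ℂ] ℂ} {R : PLip P →L[ℂ] PLip P} (ht0 : 0 < t)
    (ht : (t : ℂ) ∈ Metric.ball (1 : ℂ) ε) (hψv : ψ v = 1)
    (hv : transferOp P Γ S s ⊤ v = (t : ℂ) • v) (hψ : ∀ f, ψ (transferOp P Γ S s ⊤ f) = t * ψ f)
    (hJv : PLip.conjL v = v) (hJψ : ∀ f, ψ (PLip.conjL f) = conj (ψ f)) (hc : 0 < c)
    (hvc : ∀ ξ, c ≤ (v ξ).re) (hR : R = transferOp P Γ S s ⊤ - (t : ℂ) • ψ.smulRight v)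
    (hU : ∀ z ∈ Metric.closedBall (1 : ℂ) ε, IsUnit (R - z • 1)) :
    IsSpectralCoefficient P Γ S ε s T (ψ (deltaOp P Γ S s T v)).re := by
  set L := transferOp P Γ S s ⊤ with hL
  have hop : IsWordOperator P s (words P Γ S ⊤) L := isWordOperator_transferOp Γ S hs ⊤
  have hXt : ∀ b W, W ∈ words P Γ S ⊤ b ↔ IsCuspidal P W ∧ Follows P W b :=
    fun b W => mem_words_top Γ S
  have hvpos : IsPositiveEigenfunction L v t := by
    refine ⟨ht0, fun ξ => ⟨hc.trans_le (hvc ξ), ?_⟩, hv⟩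
    have := congrArg (fun f : PLip P => f ξ) hJv
    exact conj_eq_iff_im.mp this
  obtain ⟨h1, h2⟩ := circleIntegral_inverse_of_deflated hε hψv hv hψ hR hU ht
  have hproj : spectralProjector L ε = ψ.smulRight v := by
    change (-1 / (2 * Real.pi * I) : ℂ) • (∮ z in C(1, ε), Ring.inverse (L - z • 1)) = _
    rw [h2, smul_smul]
    have : (-1 / (2 * Real.pi * I) : ℂ) * -(2 * Real.pi * I) = 1 := by
      have := Real.pi_ne_zero
      field_simp
    rw [this, one_smul]
  have hv0 : v ≠ 0 := by rintro rfl; simp at hψv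
  refine ⟨fun z hz => ?_, ⟨v, t, hvpos⟩, fun g lam hg b => ?_⟩
  · have := isUnit_sub_smul_iff.mp (h1 z hz)
    exact not_not.mp this
  · obtain ⟨c', hc', hgc⟩ := hg.exists_lower_bound hXt hop (by linarith)
    have hlam : lam = t := le_antisymm (eigenvalue_le_of_lower_bound hop hg hvpos hc hvc)
      (eigenvalue_le_of_lower_bound hop hvpos hg hc' hgc)
    -- The vector `g - ψ(g) v` is killed by `R - t`, which is invertible.
    have hgv : g = ψ g • v := by
      have hx : (R - (t : ℂ) • 1) (g - ψ g • v) = 0 := by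
        rw [hR]
        change L (g - ψ g • v) - (t : ℂ) • (ψ (g - ψ g • v) • v) - (t : ℂ) • (g - ψ g • v) = 0
        rw [map_sub, map_sub, map_smul, map_smul, hψv, hg.2.2, hv, hlam, smul_eq_mul, mul_one,
          sub_self, zero_smul, smul_zero]
        module
      have hUt := hU t (Metric.ball_subset_closedBall ht)
      have := congrArg (fun A : PLip P →L[ℂ] PLip P => A (g - ψ g • v))
        (Ring.inverse_mul_cancel _ hUt)
      change Ring.inverse (R - (t : ℂ) • 1) ((R - (t : ℂ) • 1) (g - ψ g • v)) = g - ψ g • v at this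
      rw [hx, map_zero] at this
      exact sub_eq_zero.mp this.symm
    have hψg : ψ g ≠ 0 := by
      intro h0
      rw [h0, zero_smul] at hgv
      obtain ⟨ξ₀⟩ : Nonempty Circle := inferInstance
      have := (hg.2.1 ξ₀).1
      rw [hgv, PLip.zero_apply] at this
      exact lt_irrefl _ this
    have hreal : ((ψ (deltaOp P Γ S s T v)).re : ℂ) = ψ (deltaOp P Γ S s T v) := by
      have h3 := (isWordOperator_deltaOp (P := P) Γ S hs T).conjL v
      rw [hJv] at h3
      have h4 := hJψ (deltaOp P Γ S s T v)
      rw [← h3] at h4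
      exact conj_eq_iff_re.mp h4.symm
    have hψΔ : ψ (deltaOp P Γ S s T g) = ψ g * ψ (deltaOp P Γ S s T v) := by
      conv_lhs => rw [hgv]
      rw [map_smul, map_smul, smul_eq_mul]
    rw [hreal, hproj]
    constructor
    · rintro ⟨u, hu, he⟩
      have hu' : ψ u = 0 := by
        have : ψ u • v = 0 := hu
        exact (smul_eq_zero.mp this).resolve_right hv0
      have h5 := congrArg ψ he
      rw [hψΔ, map_add, map_smul, hu', add_zero, smul_eq_mul, mul_comm] at h5
      exact (mul_right_cancel₀ hψg h5).symm
    · rintro rfl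
      refine ⟨deltaOp P Γ S s T g - ψ (deltaOp P Γ S s T v) • g, ?_, by abel⟩
      change ψ (deltaOp P Γ S s T g - ψ (deltaOp P Γ S s T v) • g) • v = 0
      rw [map_sub, map_smul, hψΔ, smul_eq_mul, mul_comm, sub_self, zero_smul]

/-! ### The operators for large parameters -/

theorem exists_transferOp_sub_le : ∃ C : ℝ, 0 ≤ C ∧ ∀ (T : EReal), ∀ s ∈ Set.Icc (9 / 10 : ℝ) 1,
    ∀ s' ∈ Set.Icc (9 / 10 : ℝ) 1,
      ‖transferOp P Γ S s T - transferOp P Γ S s' T‖ ≤ C * |s - s'| := by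
  obtain ⟨v, hv, hv0, h⟩ := exists_wordOperator_sub_le P
  refine ⟨∑' k, v k, tsum_nonneg hv0, fun T s hs s' hs' => ?_⟩
  rw [mul_comm]
  exact h (words P Γ S T) 0 (isWordFamily_words Γ S T) (fun _ _ _ => Nat.zero_le _) s hs s' hs'

theorem le_length_of_mem_longWords {c T : ℝ} (hc : 0 < c)
    (h : ∀ W, IsCuspidal P W → geomLength P Γ S W ≤ c * W.length) (b : A) :
    ∀ W ∈ longWords P Γ S T b, ⌈T / c⌉₊ ≤ W.length := by
  intro W hW
  rw [Nat.ceil_le, div_le_iff₀ hc, mul_comm]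
  exact hW.2.2.le.trans (h W hW.1)

theorem exists_deltaOp_one_le {Γ : Subgroup SL(2, ℝ)} {S : Fin p → SL(2, ℝ)} (hle : Γ₀ ≤ Γ)
    (hS : IsCuspSystem Γ S) : ∃ C : ℝ, 0 < C ∧ ∀ T : ℝ, 0 < T → ‖deltaOp P Γ S 1 T‖ ≤ C / T := by
  obtain ⟨c, hc, hlen⟩ := exists_geomLength_le (P := P) hle hS
  obtain ⟨C, hC, h⟩ := exists_wordOperator_one_le P
  refine ⟨C * c, by positivity, fun T hT => ?_⟩
  have h1 : 0 < T / c := by positivity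
  refine (h _ ⌈T / c⌉₊ (Nat.one_le_iff_ne_zero.mpr (Nat.ceil_pos.mpr h1).ne')
    (isWordFamily_longWords Γ S T)
    (le_length_of_mem_longWords Γ S hc fun W hW => (hlen W hW).2)).trans ?_
  calc C / (⌈T / c⌉₊ : ℝ) ≤ C / (T / c) := by
        gcongr
        exact Nat.le_ceil _
    _ = _ := by field_simp

/-- The difference is at most `|s_T - 1|` times the tail of a convergent series. The first factor
compensates `T`, and the tail tends to zero because long words have many letters. -/
theorem tendsto_mul_deltaOp_sub {Γ : Subgroup SL(2, ℝ)} {S : Fin p → SL(2, ℝ)} (hle : Γ₀ ≤ Γ)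
    (hS : IsCuspSystem Γ S) {s : ℝ → ℝ} {C : ℝ}
    (hs : ∀ᶠ T in atTop, s T ≤ 1 ∧ |s T - 1| ≤ C / T) :
    Tendsto (fun T => T * ‖deltaOp P Γ S (s T) T - deltaOp P Γ S 1 T‖) atTop (𝓝 0) := by
  obtain ⟨c, hc, hlen⟩ := exists_geomLength_le (P := P) hle hS
  obtain ⟨v, hv, hv0, h⟩ := exists_wordOperator_sub_le P
  have h1 : Tendsto (fun T : ℝ => C * ∑' k, v (k + ⌈T / c⌉₊)) atTop (𝓝 (C * 0)) :=
    ((tendsto_sum_nat_add v).comp (tendsto_nat_ceil_atTop.comp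
      (tendsto_id.atTop_div_const hc))).const_mul C
  rw [mul_zero] at h1
  have h2 : Tendsto (fun T : ℝ => C / T) atTop (𝓝 0) := tendsto_const_nhds.div_atTop tendsto_id
  refine squeeze_zero' ?_ ?_ h1
  · filter_upwards [eventually_ge_atTop 0] with T hT
    positivity
  · filter_upwards [hs, eventually_gt_atTop 0, h2.eventually_lt_const (show (0 : ℝ) < 1 / 10 by
      norm_num)] with T hsT hT hCT
    have h3 : s T ∈ Set.Icc (9 / 10 : ℝ) 1 := by
      refine ⟨?_, hsT.1⟩
      have := (abs_le.mp hsT.2).1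
      linarith
    have h4 := h (longWords P Γ S T) ⌈T / c⌉₊ (isWordFamily_longWords Γ S T)
      (le_length_of_mem_longWords Γ S hc fun W hW => (hlen W hW).2) (s T) h3 1 (by norm_num)
    have hsum : 0 ≤ ∑' k, v (k + ⌈T / c⌉₊) := tsum_nonneg fun _ => hv0 _
    calc T * ‖deltaOp P Γ S (s T) T - deltaOp P Γ S 1 T‖
        ≤ T * (|s T - 1| * ∑' k, v (k + ⌈T / c⌉₊)) := by gcongr; exact h4
      _ ≤ T * (C / T * ∑' k, v (k + ⌈T / c⌉₊)) := by gcongr; exact hsT.2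
      _ = _ := by field_simp

/-! ### Eigenmeasures -/

/-- The quotient of two functions of `ℬ`, the denominator being bounded below. -/
theorem exists_div_apply {f g : PLip P} {c : ℝ} (hc : 0 < c) (hg : ∀ ξ, c ≤ (g ξ).re) :
    ∃ q : PLip P, ∀ ξ, q ξ = (g ξ)⁻¹ * f ξ := by
  have hn : ∀ ξ, c ≤ ‖g ξ‖ := fun ξ => (hg ξ).trans (re_le_norm _)
  have hn0 : ∀ ξ, g ξ ≠ 0 := fun ξ h => by
    have := hn ξ
    rw [h, norm_zero] at this
    linarith
  have hinv : ∀ ξ, ‖(g ξ)⁻¹‖ ≤ c⁻¹ := fun ξ => by rw [norm_inv]; exact inv_anti₀ hc (hn ξ)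
  refine ⟨PLip.mk (fun ξ => (g ξ)⁻¹ * f ξ) (c⁻¹ * ‖f‖) (c⁻¹ * ‖f‖ + c⁻¹ * c⁻¹ * ‖g‖ * ‖f‖)
    (fun ξ => ?_) (fun a ξ hξ η hη => ?_) (by positivity), fun ξ => rfl⟩
  · rw [norm_mul]
    exact mul_le_mul (hinv ξ) (PLip.norm_apply_le f ξ) (norm_nonneg _) (by positivity)
  · have e : (g ξ)⁻¹ * f ξ - (g η)⁻¹ * f η =
        (g ξ)⁻¹ * (f ξ - f η) - (g ξ)⁻¹ * (g η)⁻¹ * (g ξ - g η) * f η := by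
      have := hn0 ξ
      have := hn0 η
      field_simp; ring
    rw [e]
    refine (norm_sub_le _ _).trans ?_
    rw [norm_mul, norm_mul, norm_mul, norm_mul, add_mul]
    have h1 := PLip.norm_sub_le f hξ hη
    have h2 := PLip.norm_sub_le g hξ hη
    have h3 := PLip.norm_apply_le f η
    have h4 : ‖(g ξ)⁻¹‖ * ‖f ξ - f η‖ ≤ c⁻¹ * (‖f‖ * dist ξ η) :=
      mul_le_mul (hinv ξ) h1 (norm_nonneg _) (by positivity)
    have h5 : ‖(g ξ)⁻¹‖ * ‖(g η)⁻¹‖ * ‖g ξ - g η‖ * ‖f η‖ ≤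
        c⁻¹ * c⁻¹ * (‖g‖ * dist ξ η) * ‖f‖ := by
      have := hinv ξ
      have := hinv η
      gcongr
    linarith

/-- The measure `ν = g` times the uniform measure is invariant under the normalized operator, since
the operator itself preserves the mean. -/
theorem exists_isEigenmeasure {L : PLip P →L[ℂ] PLip P} (hm : ∀ f, meanL (L f) = meanL f)
    {g : PLip P} {c : ℝ} (hc : 0 < c) (hg : ∀ ξ, c ≤ (g ξ).re ∧ (g ξ).im = 0)
    (hmg : meanL g = 1) : ∃ μ, IsEigenmeasure L g 1 μ := by
  set ν := circleMeasure.withDensity fun ξ => ENNReal.ofReal (g ξ).re with hν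
  have hmeas : Measurable fun ξ => (g ξ).re := measurable_re.comp g.measurable
  have hint : ∀ F : Circle → ℂ, ∫ ξ, F ξ ∂ν = ∫ ξ, g ξ * F ξ ∂circleMeasure := by
    intro F
    have h1 := integral_withDensity_eq_integral_smul (μ := circleMeasure)
      hmeas.real_toNNReal F
    refine h1.trans (integral_congr_ae (Eventually.of_forall fun ξ => ?_))
    simp only [NNReal.smul_def, Real.coe_toNNReal _ (hc.le.trans (hg ξ).1), real_smul]
    congr 1
    exact Complex.ext rfl (by rw [(hg ξ).2, ofReal_im])
  refine ⟨_, ν, ⟨?_⟩, fun f gf hgf => ?_, rfl⟩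
  · have hi : Integrable (fun ξ => (g ξ).re) circleMeasure := (g.integrable circleMeasure).re
    have h1 := ofReal_integral_eq_lintegral_ofReal hi
      (Eventually.of_forall fun ξ => hc.le.trans (hg ξ).1)
    have h2 := re_meanL g
    rw [hmg, one_re] at h2
    rw [hν, withDensity_apply _ MeasurableSet.univ, setLIntegral_univ, ← h1, ← h2,
      ENNReal.ofReal_one]
  · rw [hint, hint]
    have h1 : ∀ ξ, g ξ * (((1 : ℝ) : ℂ)⁻¹ * (g ξ)⁻¹ * L gf ξ) = L gf ξ := by
      intro ξ
      have : g ξ ≠ 0 := fun h => by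
        have := (hg ξ).1
        rw [h, zero_re] at this
        linarith
      rw [ofReal_one, inv_one, one_mul, mul_inv_cancel_left₀ this]
    simp only [h1, ← hgf]
    exact hm gf

/-- The functional `f ↦ ∫ g⁻¹ f dν` is bounded and invariant under `L`. As `L^n f → mean(f) g₀`, it
is a multiple of the mean, and `g` is a multiple of `g₀`. Since `ν` has mass one, the two constants
are inverse to each other. -/
theorem IsEigenmeasure.integral_eq {X : A → Set (List A)} {L : PLip P →L[ℂ] PLip P}
    (hXt : ∀ b W, W ∈ X b ↔ IsCuspidal P W ∧ Follows P W b) (h : IsWordOperator P 1 X L)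
    {g₀ : PLip P} (hlim : ∀ f, Tendsto (fun n : ℕ => (L ^ n) f) atTop (𝓝 (meanL f • g₀)))
    {g : PLip P} (hg : IsPositiveEigenfunction L g 1) {μ : Measure Circle}
    (hμ : IsEigenmeasure L g 1 μ) (Δ : PLip P →L[ℂ] PLip P) :
    ∫ ξ, Δ g ξ ∂μ = ∫ ξ, Δ g₀ ξ ∂circleMeasure := by
  obtain ⟨c, hc, hgc⟩ := hg.exists_lower_bound hXt h zero_le_one
  obtain ⟨ν, hν, hinv, rfl⟩ := hμ
  have hgn : ∀ ξ, g ξ ≠ 0 := fun ξ h0 => by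
    have := hgc ξ
    rw [h0, zero_re] at this
    linarith
  have hmeas : Measurable fun ξ => ((g ξ).re)⁻¹ := (measurable_re.comp g.measurable).inv
  have hint : ∀ F : Circle → ℂ, ∫ ξ, F ξ ∂(ν.withDensity fun ξ => ENNReal.ofReal ((g ξ).re)⁻¹) =
      ∫ ξ, (g ξ)⁻¹ * F ξ ∂ν := by
    intro F
    have h1 := integral_withDensity_eq_integral_smul (μ := ν) hmeas.real_toNNReal F
    refine h1.trans (integral_congr_ae (Eventually.of_forall fun ξ => ?_))
    simp only [NNReal.smul_def, Real.coe_toNNReal _ (inv_pos.mpr (hg.2.1 ξ).1).le, real_smul]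
    congr 1
    rw [ofReal_inv]
    congr 1
    exact Complex.ext rfl (by rw [(hg.2.1 ξ).2, ofReal_im])
  set ℓ : PLip P → ℂ := fun f => ∫ ξ, (g ξ)⁻¹ * f ξ ∂ν with hℓ
  choose q hq using fun f : PLip P => exists_div_apply (f := f) hc hgc
  have hbound : ∀ f, ‖ℓ f‖ ≤ c⁻¹ * ‖f‖ := by
    intro f
    have := norm_integral_le_of_norm_le_const (μ := ν) (f := fun ξ => (g ξ)⁻¹ * f ξ)
      (C := c⁻¹ * ‖f‖) (Eventually.of_forall fun ξ => by
        rw [norm_mul, norm_inv]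
        exact mul_le_mul (inv_anti₀ hc ((hgc ξ).trans (re_le_norm _)))
          (PLip.norm_apply_le f ξ) (norm_nonneg _) (by positivity))
    simpa using this
  have hi : ∀ f : PLip P, Integrable (fun ξ => (g ξ)⁻¹ * f ξ) ν := fun f => by
    simp only [← hq]; exact (q f).integrable ν
  have hsub : ∀ f f', ℓ f - ℓ f' = ℓ (f - f') := by
    intro f f'
    simp only [hℓ]
    rw [← integral_sub (hi f) (hi f')]
    simp only [PLip.sub_apply, mul_sub]
  have hsmul : ∀ (k : ℂ) f, ℓ (k • f) = k * ℓ f := by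
    intro k f
    simp only [hℓ]
    rw [← integral_const_mul]
    simp only [PLip.smul_apply, mul_left_comm]
  have hL : ∀ f, ℓ (L f) = ℓ f := by
    intro f
    have h1 := hinv (q f) f fun ξ => by rw [hq, mul_inv_cancel_left₀ (hgn ξ)]
    simp only [ofReal_one, inv_one, one_mul, hq] at h1
    exact h1
  have hLn : ∀ n f, ℓ ((L ^ n) f) = ℓ f := by
    intro n
    induction n with
    | zero => intro f; rfl
    | succ n ih =>
      intro f
      rw [pow_succ]; change ℓ ((L ^ n) (L f)) = _
      rw [ih, hL]
  have hval : ∀ f, ℓ f = meanL f * ℓ g₀ := by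
    intro f
    rw [← hsmul]
    have h1 : Tendsto (fun n : ℕ => ℓ ((L ^ n) f)) atTop (𝓝 (ℓ (meanL f • g₀))) := by
      rw [tendsto_iff_norm_sub_tendsto_zero]
      have h2 := (tendsto_iff_norm_sub_tendsto_zero.mp (hlim f)).const_mul c⁻¹
      rw [mul_zero] at h2
      refine squeeze_zero (fun _ => norm_nonneg _) (fun n => ?_) h2
      rw [hsub]; exact hbound _
    simp only [hLn] at h1
    exact tendsto_nhds_unique tendsto_const_nhds h1
  have hgg : g = meanL g • g₀ := by
    have h1 : ∀ n : ℕ, (L ^ n) g = g := by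
      have h2 : L g = g := by rw [hg.2.2, ofReal_one, one_smul]
      intro n
      induction n with
      | zero => rfl
      | succ n ih => rw [pow_succ]; change (L ^ n) (L g) = g; rw [h2, ih]
    have := hlim g
    simp only [h1] at this
    exact tendsto_nhds_unique tendsto_const_nhds this
  have hone : ℓ g = 1 := by
    simp only [hℓ, inv_mul_cancel₀ (hgn _)]
    simp
  have h3 : meanL g * ℓ g₀ = 1 := by rw [← hval, hone]
  calc _ = ℓ (Δ g) := hint _
    _ = meanL (Δ g) * ℓ g₀ := hval _
    _ = (meanL g * ℓ g₀) * meanL (Δ g₀) := by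
      conv_lhs => rw [hgg]
      rw [map_smul, map_smul, smul_eq_mul]; ring
    _ = _ := by rw [h3, one_mul]; rfl

end Eigenfunctions

section Coding

set_option linter.unusedSectionVars false

variable {Γ₀ : Subgroup SL(2, ℝ)} {A : Type*} {P : LabelledIdealPolygon Γ₀ A} [Finite A]
  [Nonempty A]

/-! ### The coding map of the shift -/

/-- The concatenation of the first `r` words of a sequence. -/
def initialWord (w : ℕ → List A) (r : ℕ) : List A := ((List.range r).map w).flatten

theorem initialWord_succ (w : ℕ → List A) (r : ℕ) :
    initialWord w (r + 1) = initialWord w r ++ w r := by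
  simp [initialWord, List.range_succ]

theorem initialWord_succ' (w : ℕ → List A) (r : ℕ) :
    initialWord w (r + 1) = w 0 ++ initialWord (fun r => w (r + 1)) r := by
  simp [initialWord, List.range_succ_eq_map, Function.comp_def]

theorem initialWord_congr {w w' : ℕ → List A} {r : ℕ} (h : ∀ k < r, w k = w' k) :
    initialWord w r = initialWord w' r := by
  unfold initialWord
  congr 1
  exact List.map_congr_left fun k hk => h k (List.mem_range.mp hk)

variable (P) in
/-- Sequences of cuspidal words with allowed transitions. -/
def IsItinerary (w : ℕ → List A) : Prop :=
  ∀ r, IsCuspidal P (w r) ∧ Transition P (w r) (w (r + 1))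

variable (P) in
/-- The point is in all the closures of the cylinders. -/
def IsCoded (w : ℕ → List A) (ξ : Circle) : Prop :=
  ∀ r, ∃ a ∈ (w r).head?, ∃ η ∈ closedArc P a, ξ = act (elt P (initialWord w r)) η

theorem IsCuspidal.exists_head {W : List A} (h : IsCuspidal P W) : ∃ a, W.head? = some a := by
  obtain ⟨a, l, rfl⟩ := List.exists_cons_of_ne_nil h.1
  exact ⟨a, rfl⟩

theorem IsCuspidal.admissible {W : List A} (h : IsCuspidal P W) : Admissible P W := by
  obtain ⟨_, V, ⟨l, rfl⟩, hV, _⟩ := h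
  exact hV.left_of_append

variable {w w' : ℕ → List A}

theorem IsItinerary.act_mem (hw : IsItinerary P w) (r : ℕ) {a b : A} (ha : (w r).head? = some a)
    (hb : (w (r + 1)).head? = some b) {η : Circle} (hη : η ∈ closedArc P b) :
    act (elt P (w r)) η ∈ openArc P a :=
  act_mem_openArc_of_follows (hw r).1 ha ((hw r).2 b hb) hη

theorem openArc_subset_closedArc (a : A) : openArc P a ⊆ closedArc P a :=
  (openArc_subset_arc a).trans (arc_subset_closedArc a)

theorem IsItinerary.dist_le (hw : IsItinerary P w) {κ : ℝ} (hκ0 : 0 ≤ κ)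
    (hκ : ∀ W b, IsCuspidal P W → Follows P W b → ∀ ξ ∈ closedArc P b, derivNorm (elt P W) ξ ≤ κ)
    (r : ℕ) : ∀ {a : A}, (w r).head? = some a → ∀ {ξ η : Circle}, ξ ∈ closedArc P a →
      η ∈ closedArc P a → dist (act (elt P (initialWord w r)) ξ)
        (act (elt P (initialWord w r)) η) ≤ κ ^ r * dist ξ η := by
  induction r with
  | zero => intro a _ ξ η _ _; simp [initialWord, elt_nil, act_one]
  | succ r ih =>
    intro b hb ξ η hξ hη
    obtain ⟨a, ha⟩ := (hw r).1.exists_head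
    rw [initialWord_succ, elt_append, act_mul, act_mul, pow_succ, mul_assoc]
    refine (ih ha (openArc_subset_closedArc a (hw.act_mem r ha hb hξ))
      (openArc_subset_closedArc a (hw.act_mem r ha hb hη))).trans ?_
    gcongr
    exact dist_act_le (hκ _ _ (hw r).1 ((hw r).2 b hb)) hξ hη

theorem IsCoded.dist_le (hw : IsItinerary P w) {κ : ℝ} (hκ0 : 0 ≤ κ)
    (hκ : ∀ W b, IsCuspidal P W → Follows P W b → ∀ ξ ∈ closedArc P b, derivNorm (elt P W) ξ ≤ κ)
    {ξ η : Circle} (hξ : IsCoded P w ξ) (hη : IsCoded P w' η) {n : ℕ}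
    (h : ∀ r ≤ n, w r = w' r) : dist ξ η ≤ 2 * κ ^ n := by
  obtain ⟨a, ha, ξ', hξ', rfl⟩ := hξ n
  obtain ⟨b, hb, η', hη', rfl⟩ := hη n
  rw [← h n le_rfl] at hb
  obtain rfl : a = b := Option.some.inj (ha.symm.trans hb)
  rw [← initialWord_congr fun k hk => h k hk.le]
  refine (hw.dist_le hκ0 hκ n ha hξ' hη').trans ?_
  nlinarith [circle_dist_le_two ξ' η', pow_nonneg hκ0 n]

theorem IsItinerary.eq_of_isCoded (hw : IsItinerary P w) {ξ η : Circle} (hξ : IsCoded P w ξ)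
    (hη : IsCoded P w η) : ξ = η := by
  obtain ⟨κ, C, K, hκ0, hκ1, -, -, hb⟩ := exists_word_bounds P
  refine dist_le_zero.mp (ge_of_tendsto' (x := atTop) (f := fun n : ℕ => 2 * κ ^ n) ?_ fun n =>
    IsCoded.dist_le hw hκ0.le (fun W b h1 h2 ξ hξ => (hb W b h1 h2 ξ hξ).1) hξ hη fun _ _ => rfl)
  simpa using (tendsto_pow_atTop_nhds_zero_of_lt_one hκ0.le hκ1).const_mul 2

theorem IsItinerary.exists_isCoded (hw : IsItinerary P w) : ∃ ξ, IsCoded P w ξ := by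
  choose a ha using fun r => (hw r).1.exists_head
  have hK : ∀ r, IsCompact (act (elt P (initialWord w r)) '' closedArc P (a r)) := fun r =>
    (isClosed_closedArc _).isCompact.image (continuous_act _)
  have hsub : ∀ r, act (elt P (initialWord w (r + 1))) '' closedArc P (a (r + 1)) ⊆
      act (elt P (initialWord w r)) '' closedArc P (a r) := by
    rintro r _ ⟨η, hη, rfl⟩
    refine ⟨_, openArc_subset_closedArc _ (hw.act_mem r (ha r) (ha (r + 1)) hη), ?_⟩
    rw [initialWord_succ, elt_append, act_mul]
  obtain ⟨ξ, hξ⟩ := IsCompact.nonempty_iInter_of_sequence_nonempty_isCompact_isClosed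
    (fun r => act (elt P (initialWord w r)) '' closedArc P (a r)) hsub
    (fun r => ⟨_, _, arc_subset_closedArc _ (mem_arc_iff.mpr (Or.inr rfl)), rfl⟩) (hK 0)
    fun r => (hK r).isClosed
  refine ⟨ξ, fun r => ?_⟩
  obtain ⟨η, hη, h⟩ := Set.mem_iInter.mp hξ r
  exact ⟨a r, ha r, η, hη, h.symm⟩

/-- The closed version gives nested compact sets and hence existence. The half-open arcs are
recovered because each following word sends the closed arc into an open one, so the coded point
never sits at an endpoint. -/
theorem IsItinerary.isCoded_iff (hw : IsItinerary P w) {ξ : Circle} :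
    (∀ r, ξ ∈ cylinder P (initialWord w (r + 1))) ↔ IsCoded P w ξ := by
  have hsplit : ∀ r, ∃ b, w r = (w r).dropLast ++ [b] := fun r =>
    ⟨_, (List.dropLast_append_getLast (hw r).1.1).symm⟩
  have hlast : ∀ r b, w r = (w r).dropLast ++ [b] →
      (initialWord w (r + 1)).getLast? = some b ∧
        (initialWord w (r + 1)).dropLast = initialWord w r ++ (w r).dropLast := by
    intro r b hb
    rw [initialWord_succ]
    refine ⟨?_, List.dropLast_append_of_ne_nil (hw r).1.1⟩
    rw [hb, ← List.append_assoc, List.getLast?_concat]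
  constructor
  · intro h r
    obtain ⟨b, hb⟩ := hsplit r
    obtain ⟨a, ha⟩ := (hw r).1.exists_head
    obtain ⟨h1, h2⟩ := hlast r b hb
    obtain ⟨b', hb', η, hη, rfl⟩ := h r
    obtain rfl : b = b' := Option.some.inj (h1.symm.trans hb')
    rw [h2, elt_append, act_mul]
    refine ⟨a, ha, _, arc_subset_closedArc a (act_elt_mem_arc ?_ ?_ hη), rfl⟩
    · rw [← hb]; exact (hw r).1.admissible
    · rw [← hb, ha]
  · intro h r
    obtain ⟨b, hb⟩ := hsplit r
    obtain ⟨h1, h2⟩ := hlast r b hb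
    obtain ⟨a, ha, η, -, rfl⟩ := h (r + 1)
    obtain ⟨a', ha', η', hη', h3⟩ := h (r + 2)
    have h4 : η ∈ openArc P a := by
      rw [initialWord_succ w (r + 1), elt_append, act_mul] at h3
      rw [act_injective _ h3]
      exact hw.act_mem (r + 1) ha ha' hη'
    refine ⟨b, h1, act (P.gen b) η, ?_, ?_⟩
    · rw [act_gen_mem_arc]
      intro h5
      refine ((hw r).2 a ha b ?_).1 (eq_of_mem_arc (openArc_subset_arc a h4) h5)
      rw [hb, List.getLast?_concat]; rfl
    · rw [h2, initialWord_succ]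
      conv_rhs => rw [hb]
      rw [← List.append_assoc, elt_append P (initialWord w r ++ (w r).dropLast) [b], act_mul,
        act_elt_cons, elt_nil, act_one]

variable {Γ : Subgroup SL(2, ℝ)} {p : ℕ} {S : Fin p → SL(2, ℝ)} {T : ℝ}

theorem isItinerary_shiftSpace (w : ShiftSpace P Γ S T) : IsItinerary P w.1 :=
  fun r => ⟨(w.2 r).1, (w.2 r).2.2⟩

theorem isCoded_coding (w : ShiftSpace P Γ S T) : IsCoded P w.1 (coding P Γ S w) := by
  have hw := isItinerary_shiftSpace w
  rw [← hw.isCoded_iff]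
  obtain ⟨ξ, hξ⟩ := hw.exists_isCoded
  exact Classical.epsilon_spec (p := fun ξ => ∀ r : ℕ, ξ ∈ cylinder P (initialWord w.1 (r + 1)))
    ⟨ξ, hw.isCoded_iff.mpr hξ⟩

theorem coding_mem_closedArc (w : ShiftSpace P Γ S T) {a : A} (ha : (w.1 0).head? = some a) :
    coding P Γ S w ∈ closedArc P a := by
  obtain ⟨b, hb, η, hη, h⟩ := isCoded_coding w 0
  obtain rfl : a = b := Option.some.inj (ha.symm.trans hb)
  rw [h]
  simpa [initialWord, elt_nil, act_one] using hη

theorem follows_head_shift (w : ShiftSpace P Γ S T) {a : A}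
    (ha : ((shift P Γ S w).1 0).head? = some a) : Follows P (w.1 0) a := (w.2 0).2.2 a ha

/-- The image of the point coded by the shifted sequence is coded by the whole sequence, and coded
points are unique by contraction. -/
theorem coding_eq (w : ShiftSpace P Γ S T) :
    coding P Γ S w = act (elt P (w.1 0)) (coding P Γ S (shift P Γ S w)) := by
  refine (isItinerary_shiftSpace w).eq_of_isCoded (isCoded_coding w) ?_
  obtain ⟨b, hb⟩ := ((shift P Γ S w).2 0).1.exists_head
  rintro (_ | r)
  · obtain ⟨a, ha⟩ := (w.2 0).1.exists_head
    refine ⟨a, ha, _, openArc_subset_closedArc a (act_mem_openArc_of_follows (w.2 0).1 ha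
      (follows_head_shift w hb) (coding_mem_closedArc _ hb)), ?_⟩
    simp [initialWord, elt_nil, act_one]
  · obtain ⟨c, hc, η, hη, h⟩ := isCoded_coding (shift P Γ S w) r
    refine ⟨c, hc, η, hη, ?_⟩
    rw [h, initialWord_succ', elt_append, act_mul]
    rfl

theorem coding_mem_arc (w : ShiftSpace P Γ S T) {a : A} (ha : (w.1 0).head? = some a) :
    coding P Γ S w ∈ arc P a := by
  obtain ⟨b, hb⟩ := ((shift P Γ S w).2 0).1.exists_head
  rw [coding_eq]
  exact openArc_subset_arc a (act_mem_openArc_of_follows (w.2 0).1 ha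
    (follows_head_shift w hb) (coding_mem_closedArc _ hb))

/-! ### Inverse branches of the shift -/

/-- The sequence obtained by adding a word in front. -/
def consShift (w : ShiftSpace P Γ S T) (W : List A) (hW : IsCuspidal P W)
    (hT : geomLength P Γ S W ≤ T) (h : Transition P W (w.1 0)) : ShiftSpace P Γ S T :=
  ⟨fun r => Nat.casesOn r W w.1, fun r => by
    cases r with
    | zero => exact ⟨hW, hT, h⟩
    | succ r => exact w.2 r⟩

/-- The preimages of a sequence under the shift. -/
def shiftFiberEquiv (w : ShiftSpace P Γ S T) {a : A} (ha : (w.1 0).head? = some a) :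
    words P Γ S T a ≃ {w' : ShiftSpace P Γ S T // shift P Γ S w' = w} where
  toFun W := ⟨consShift w W.1 W.2.1 (EReal.coe_le_coe_iff.mp W.2.2.2) fun b hb => by
    obtain rfl : a = b := Option.some.inj (ha.symm.trans hb)
    exact W.2.2.1, rfl⟩
  invFun w' := ⟨w'.1.1 0, (w'.1.2 0).1, (w'.1.2 0).2.2 a (by
    have h : (w'.1.1 1).head? = (w.1 0).head? :=
      congrArg (fun x : ShiftSpace P Γ S T => (x.1 0).head?) w'.2
    exact h.trans ha), EReal.coe_le_coe_iff.mpr (w'.1.2 0).2.1⟩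
  left_inv W := rfl
  right_inv w' := by
    obtain ⟨w', rfl⟩ := w'
    refine Subtype.ext (Subtype.ext (funext fun r => ?_))
    cases r <;> rfl

theorem shiftFiberEquiv_apply_zero (w : ShiftSpace P Γ S T) {a : A} (ha : (w.1 0).head? = some a)
    (W : words P Γ S T a) : (shiftFiberEquiv w ha W).1.1 0 = W := rfl

variable (Γ S) in
/-- An eigenfunction of the transfer operator on the circle gives one on the shift space. -/
theorem isLeadingEigenvalue_of_eigenfunction {s lam c : ℝ} (hs : 1 / 2 < s) (hlam : 0 < lam)
    {v : PLip P} (hc : 0 < c) (hvc : ∀ ξ, c ≤ (v ξ).re)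
    (hv : transferOp P Γ S s T v = (lam : ℂ) • v) : IsLeadingEigenvalue P Γ S s T lam := by
  obtain ⟨κ, C, K, hκ0, hκ1, -, -, hb⟩ := exists_word_bounds P
  refine ⟨hlam, fun w => (v (coding P Γ S w)).re, κ, ‖v‖ * 2, hκ0, hκ1,
    fun w => hc.trans_le (hvc _), fun n w w' h => ?_, fun w => ?_⟩
  · obtain ⟨a, ha⟩ := (w.2 0).1.exists_head
    refine (v.re_sub_le (coding_mem_arc w ha) (coding_mem_arc w' (h 0 n.zero_le ▸ ha))).trans ?_
    rw [mul_assoc]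
    gcongr
    exact IsCoded.dist_le (isItinerary_shiftSpace w) hκ0.le
      (fun W b h1 h2 ξ hξ => (hb W b h1 h2 ξ hξ).1) (isCoded_coding w) (isCoded_coding w') h
  · obtain ⟨a, ha⟩ := (w.2 0).1.exists_head
    have h1 := (isWordOperator_transferOp Γ S hs (T : EReal)).hasSum_re v (coding_mem_arc w ha)
    rw [← (shiftFiberEquiv w ha).hasSum_iff]
    have h2 : (transferOp P Γ S s T v (coding P Γ S w)).re =
        lam * (v (coding P Γ S w)).re := by
      have h3 : transferOp P Γ S s T v (coding P Γ S w) = (lam : ℂ) * v (coding P Γ S w) :=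
        congrArg (fun f : PLip P => f (coding P Γ S w)) hv
      rw [h3, re_ofReal_mul]
    rw [h2] at h1
    convert h1 using 1
    funext W
    have h3 : coding P Γ S (shiftFiberEquiv w ha W).1 =
        act (elt P (W : List A)) (coding P Γ S w) := by
      refine (coding_eq _).trans ?_
      exact congrArg (fun x => act (elt P (W : List A)) (coding P Γ S x)) (shiftFiberEquiv w ha W).2
    simp only [Function.comp_apply, shiftFiberEquiv_apply_zero]
    exact congrArg (fun x => derivNorm (elt P (W : List A)) (coding P Γ S w) ^ s * (v x).re) h3

end Coding

section Bowen

set_option linter.unusedSectionVars false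

variable {Γ₀ : Subgroup SL(2, ℝ)} {A : Type*} {P : LabelledIdealPolygon Γ₀ A} [Finite A]
  [Nonempty A] {Γ : Subgroup SL(2, ℝ)} {p : ℕ} {S : Fin p → SL(2, ℝ)}

/-! ### Bowen's equation -/

theorem finite_setOf_geomLength_le (hle : Γ₀ ≤ Γ) (hS : IsCuspSystem Γ S) (T : ℝ) :
    {W | IsCuspidal P W ∧ geomLength P Γ S W ≤ T}.Finite := by
  obtain ⟨c, hc, h⟩ := exists_geomLength_le (P := P) hle hS
  refine (List.finite_length_le A ⌈c * T + 1⌉₊).subset fun W hW => ?_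
  have h1 := (h W hW.1).1.trans hW.2
  rw [inv_mul_le_iff₀ hc] at h1
  exact Nat.cast_le.mp ((by linarith : (W.length : ℝ) ≤ c * T + 1).trans (Nat.le_ceil _))

/-- A continuous function on the shift space has a maximum. -/
theorem exists_forall_le_shiftSpace (hle : Γ₀ ≤ Γ) (hS : IsCuspSystem Γ S) {T : ℝ}
    [Nonempty (ShiftSpace P Γ S T)] {F : ShiftSpace P Γ S T → ℝ}
    (hF : ∀ w, ∀ ε > 0, ∃ n : ℕ, ∀ w', (∀ r ≤ n, w.1 r = w'.1 r) → |F w' - F w| < ε) :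
    ∃ w, ∀ w', F w' ≤ F w := by
  let _ : TopologicalSpace (List A) := ⊥
  have : DiscreteTopology (List A) := ⟨rfl⟩
  set X : Set (ℕ → List A) := {w | ∀ r, IsCuspidal P (w r) ∧ geomLength P Γ S (w r) ≤ T ∧
    Transition P (w r) (w (r + 1))} with hX
  have hcl : IsClosed X := by
    have h1 : X = ⋂ r, (fun w : ℕ → List A => (w r, w (r + 1))) ⁻¹'
        {q : List A × List A | IsCuspidal P q.1 ∧ geomLength P Γ S q.1 ≤ T ∧
          Transition P q.1 q.2} := by
      ext w
      simp [hX]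
    rw [h1]
    exact isClosed_iInter fun r => (isClosed_discrete _).preimage
      ((continuous_apply r).prodMk (continuous_apply (r + 1)))
  have hK : IsCompact (Set.univ.pi fun _ : ℕ =>
      {W : List A | IsCuspidal P W ∧ geomLength P Γ S W ≤ T}) :=
    isCompact_univ_pi fun _ => (finite_setOf_geomLength_le hle hS T).isCompact
  have : CompactSpace X := isCompact_iff_compactSpace.mp
    (hK.of_isClosed_subset hcl fun w hw r _ => ⟨(hw r).1, (hw r).2.1⟩)
  have : Nonempty X := ‹Nonempty (ShiftSpace P Γ S T)›
  have hc : @Continuous X ℝ _ _ F := by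
    refine continuous_iff_continuousAt.mpr fun w => Metric.tendsto_nhds.mpr fun ε hε => ?_
    obtain ⟨n, hn⟩ := hF w ε hε
    have h1 : ∀ r ∈ Set.Iic n, ∀ᶠ w' : X in 𝓝 w, w.1 r = w'.1 r := fun r _ => by
      have h2 : ContinuousAt (fun w' : X => w'.1 r) w :=
        ((continuous_apply r).comp continuous_subtype_val).continuousAt
      filter_upwards [h2 ((isOpen_discrete {w.1 r}).mem_nhds rfl)] with w' h3
      exact (Set.mem_singleton_iff.mp h3).symm
    filter_upwards [(Filter.eventually_all_finite (Set.finite_Iic n)).mpr h1] with w' h3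
    exact hn w' h3
  obtain ⟨w, -, hw⟩ := isCompact_univ.exists_isMaxOn Set.univ_nonempty hc.continuousOn
  exact ⟨w, fun w' => isMaxOn_iff.mp hw w' (Set.mem_univ w')⟩

/-- If `s < s'`, take a maximum `w` of `f' / f`, with value `r`. Comparing the two eigenvalue
equations at `w`, term by term with `f' ≤ r f`, gives `lam f'(w) ≤ κ^(s' - s) lam f'(w)`, which is
impossible as `κ < 1`. -/
theorem IsLeadingEigenvalue.exponent_le (hle : Γ₀ ≤ Γ) (hS : IsCuspSystem Γ S) {T : ℝ}
    [Nonempty (ShiftSpace P Γ S T)] {s s' lam : ℝ} (h : IsLeadingEigenvalue P Γ S s T lam)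
    (h' : IsLeadingEigenvalue P Γ S s' T lam) : s' ≤ s := by
  by_contra! hss
  obtain ⟨κ, _, _, hκ0, hκ1, -, -, hb⟩ := exists_word_bounds P
  obtain ⟨hl, f, θ, C, hθ0, hθ1, hf0, hf, hfs⟩ := h
  obtain ⟨-, f', θ', C', hθ0', hθ1', hf0', hf', hfs'⟩ := h'
  have hcont : ∀ w : ShiftSpace P Γ S T, ∀ ε > 0, ∃ n : ℕ, ∀ w' : ShiftSpace P Γ S T,
      (∀ r ≤ n, w.1 r = w'.1 r) → |f' w' / f w' - f' w / f w| < ε := by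
    intro w ε hε
    have h1 : Tendsto (fun q : ℝ × ℝ => q.1 / q.2) (𝓝 (f' w, f w)) (𝓝 (f' w / f w)) :=
      (continuousAt_fst.div continuousAt_snd (hf0 w).ne').tendsto
    obtain ⟨δ, hδ, h2⟩ := Metric.tendsto_nhds_nhds.mp h1 ε hε
    have h3 : Tendsto (fun n : ℕ => max (C' * θ' ^ n) (C * θ ^ n)) atTop (𝓝 (max 0 0)) := by
      refine Tendsto.max ?_ ?_
      · simpa using (tendsto_pow_atTop_nhds_zero_of_lt_one hθ0'.le hθ1').const_mul C'
      · simpa using (tendsto_pow_atTop_nhds_zero_of_lt_one hθ0.le hθ1).const_mul C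
    rw [max_self] at h3
    obtain ⟨n, hn⟩ := (h3.eventually_lt_const hδ).exists
    refine ⟨n, fun w' hw' => ?_⟩
    have h4 := @h2 (f' w', f w') ?_
    · exact h4
    · rw [Prod.dist_eq, max_lt_iff, Real.dist_eq, Real.dist_eq, abs_sub_comm,
        abs_sub_comm (f w')]
      exact ⟨(hf' n w w' hw').trans_lt ((le_max_left _ _).trans_lt hn),
        (hf n w w' hw').trans_lt ((le_max_right _ _).trans_lt hn)⟩
  obtain ⟨w, hw⟩ := exists_forall_le_shiftSpace hle hS hcont
  set r := f' w / f w with hr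
  have hr0 : 0 < r := div_pos (hf0' w) (hf0 w)
  have hle' : ∀ w', f' w' ≤ r * f w' := fun w' => (div_le_iff₀ (hf0 w')).mp (hw w')
  have h1 : lam * f' w ≤ κ ^ (s' - s) * r * (lam * f w) := by
    refine hasSum_le (fun w' => ?_) (hfs' w) ((hfs w).mul_left (κ ^ (s' - s) * r))
    obtain ⟨w', rfl⟩ := w'
    obtain ⟨b, hb'⟩ := ((shift P Γ S w').2 0).1.exists_head
    have hD := (hb _ b (w'.2 0).1 (follows_head_shift w' hb') _ (coding_mem_closedArc _ hb')).1
    have hD0 := derivNorm_pos (elt P (w'.1 0)) (coding P Γ S (shift P Γ S w'))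
    calc _ = derivNorm (elt P (w'.1 0)) (coding P Γ S (shift P Γ S w')) ^ (s' - s) *
          (derivNorm (elt P (w'.1 0)) (coding P Γ S (shift P Γ S w')) ^ s * f' w') := by
          rw [← mul_assoc, ← Real.rpow_add hD0, sub_add_cancel]
      _ ≤ κ ^ (s' - s) *
          (derivNorm (elt P (w'.1 0)) (coding P Γ S (shift P Γ S w')) ^ s * (r * f w')) := by
          have := (hf0' w').le
          gcongr
          exact hle' w'
      _ = _ := by ring
  have h2 : r * f w = f' w := div_mul_cancel₀ _ (hf0 w).ne'
  have h3 : κ ^ (s' - s) < 1 := Real.rpow_lt_one hκ0.le hκ1 (by linarith)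
  have h4 : κ ^ (s' - s) * r * (lam * f w) = κ ^ (s' - s) * (lam * f' w) := by rw [← h2]; ring
  rw [h4] at h1
  nlinarith [mul_pos hl (hf0' w)]

theorem IsBowenRoot.eq (hle : Γ₀ ≤ Γ) (hS : IsCuspSystem Γ S) {T : ℝ}
    [Nonempty (ShiftSpace P Γ S T)] {s s' : ℝ} (h : IsBowenRoot P Γ S T s)
    (h' : IsBowenRoot P Γ S T s') : s = s' := by
  obtain ⟨-, -, lam, hl, hlog⟩ := h
  obtain ⟨-, -, lam', hl', hlog'⟩ := h'
  obtain rfl : lam = 1 := Real.eq_one_of_pos_of_log_eq_zero hl.1 hlog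
  obtain rfl : lam' = 1 := Real.eq_one_of_pos_of_log_eq_zero hl'.1 hlog'
  exact le_antisymm (hl'.exponent_le hle hS hl) (hl.exponent_le hle hS hl')

theorem eventually_nonempty_shiftSpace : ∀ᶠ T in atTop, Nonempty (ShiftSpace P Γ S T) := by
  obtain ⟨c, -, -, h⟩ := exists_connecting_bound P
  obtain ⟨a⟩ := ‹Nonempty A›
  obtain ⟨W, hW, ha, hf, -⟩ := h a a
  filter_upwards [eventually_ge_atTop (geomLength P Γ S W)] with T hT
  exact ⟨fun _ => W, fun _ => ⟨hW, hT, fun b hb => Option.some.inj (ha.symm.trans hb) ▸ hf⟩⟩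

theorem PLip.sub_le_re {f g : PLip P} {c δ : ℝ} (hg : ∀ ξ, c ≤ (g ξ).re) (h : ‖f - g‖ ≤ δ)
    (ξ : Circle) : c - δ ≤ (f ξ).re := by
  have h1 : |((f - g) ξ).re| ≤ δ := (abs_re_le_norm _).trans ((PLip.norm_apply_le _ ξ).trans h)
  rw [PLip.sub_apply, sub_re] at h1
  linarith [(abs_le.mp h1).1, hg ξ]

/-- With `z = 1` fixed, the unknown is the exponent. Truncation at length `T` loses a proportion
`O(1/T)` of the mean and lowering the exponent by `a` gains a factor `κ^(-a)`, so the balance occurs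
for some `a = O(1/T)`. -/
theorem exists_bowenRoot (hle : Γ₀ ≤ Γ) (hS : IsCuspSystem Γ S) {g₀ : PLip P} {c : ℝ} (hc : 0 < c)
    (hgc : ∀ ξ, c ≤ (g₀ ξ).re ∧ (g₀ ξ).im = 0) (hg : transferOp P Γ S 1 ⊤ g₀ = g₀)
    (hm1 : meanL g₀ = 1) (hU : IsUnit (bordered g₀ meanL (transferOp P Γ S 1 ⊤) 1)) :
    ∃ C : ℝ, 0 < C ∧ ∀ᶠ T in atTop, ∃ s, 1 - C / T ≤ s ∧ s ≤ 1 ∧ IsBowenRoot P Γ S T s := by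
  have hmL : ∀ f : PLip P, meanL (transferOp P Γ S 1 ⊤ f) = meanL f := fun f =>
    integral_transferOp Γ S f
  obtain ⟨κ, _, _, hκ0, hκ1, -, -, hb⟩ := exists_word_bounds P
  obtain ⟨η, hη, hpert⟩ := exists_bordered_nhds hU hg hmL hm1 (half_pos hc)
  obtain ⟨C₁, hC₁, hs⟩ := exists_transferOp_sub_le (P := P) Γ S
  obtain ⟨C₂, hC₂, hΔ⟩ := exists_deltaOp_one_le (P := P) hle hS
  have hℓ : 0 < -Real.log κ := neg_pos.mpr (Real.log_neg hκ0 hκ1)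
  set ℓ := -Real.log κ
  -- Chosen so that the loss `mean(Δ v)` is at most `(B/T) mean(v)`, using `c/2 ≤ mean(v)` and `‖v‖
  -- ≤ ‖g₀‖ + c/2`.
  obtain ⟨B, hB, hBdef⟩ : ∃ B : ℝ, 0 < B ∧
      ‖(meanL : PLip P →L[ℂ] ℂ)‖ * C₂ * (‖g₀‖ + c / 2) ≤ B * (c / 2) := by
    refine ⟨‖(meanL : PLip P →L[ℂ] ℂ)‖ * C₂ * (‖g₀‖ + c / 2) / (c / 2) + 1, by positivity, ?_⟩
    rw [add_mul, div_mul_cancel₀ _ (by positivity)]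
    linarith
  refine ⟨2 * B / ℓ, by positivity, ?_⟩
  have ht1 : Tendsto (fun T : ℝ => 2 * B / ℓ / T) atTop (𝓝 0) := tendsto_const_nhds.div_atTop tendsto_id
  have ht2 : Tendsto (fun T : ℝ => C₁ * (2 * B / ℓ / T) + C₂ / T) atTop (𝓝 0) := by
    simpa using (ht1.const_mul C₁).add ((tendsto_const_nhds (x := C₂)).div_atTop tendsto_id)
  filter_upwards [ht1.eventually_le_const (by norm_num : (0 : ℝ) < 1 / 10),
    ht2.eventually_lt_const hη, eventually_ge_atTop (2 * B), eventually_gt_atTop 0] with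
    T hT1 hT2 hT3 hT0
  -- The gain is then at least `1 + a ℓ = 1 + 2B/T`. Against the loss `1 - B/T` the product is at
  -- least `1`, since `B/T ≤ 1/2`.
  set a := 2 * B / ℓ / T with ha
  have ha0 : 0 ≤ a := by positivity
  have hmem : ∀ s ∈ Set.Icc (1 - a) 1, s ∈ Set.Icc (9 / 10 : ℝ) 1 := fun s h =>
    ⟨by linarith [h.1], h.2⟩
  have h1mem : (1 : ℝ) ∈ Set.Icc (9 / 10 : ℝ) 1 := by norm_num
  have hclose : ∀ s ∈ Set.Icc (1 - a) 1,
      ‖transferOp P Γ S s T - transferOp P Γ S 1 ⊤‖ < η := by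
    intro s h
    have h1 : transferOp P Γ S s T - transferOp P Γ S 1 ⊤ =
        (transferOp P Γ S s T - transferOp P Γ S 1 T) - deltaOp P Γ S 1 T := by
      rw [transferOp_top_eq Γ S (by norm_num) T]; abel
    rw [h1]
    refine (norm_sub_le _ _).trans_lt (lt_of_le_of_lt (add_le_add ((hs T s (hmem s h) 1 h1mem).trans
      (mul_le_mul_of_nonneg_left ?_ hC₁)) (hΔ T hT0)) hT2)
    rw [abs_le]
    constructor <;> linarith [h.1, h.2]
  set v : ℝ → PLip P := fun s => pertVec g₀ meanL (transferOp P Γ S s T) 1 with hvdef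
  have hunit : ∀ s ∈ Set.Icc (1 - a) 1,
      IsUnit (bordered g₀ meanL (transferOp P Γ S s T) 1) := fun s h =>
    (hpert _ 1 (hclose s h) (by simpa using hη)).1
  have hv : ∀ s ∈ Set.Icc (1 - a) 1, ‖v s - g₀‖ ≤ c / 2 := fun s h =>
    (hpert _ 1 (hclose s h) (by simpa using hη)).2.1.le
  have hvc : ∀ s ∈ Set.Icc (1 - a) 1, ∀ ξ, c / 2 ≤ (v s ξ).re := fun s h ξ => by
    linarith [PLip.sub_le_re (fun ξ => (hgc ξ).1) (hv s h) ξ]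
  have hLv : ∀ s ∈ Set.Icc (1 - a) 1, transferOp P Γ S s T (v s) =
      v s + (meanL (v s) - 1) • g₀ := fun s h => by
    have := apply_pertVec (hunit s h)
    rwa [one_smul] at this
  have hop : ∀ s ∈ Set.Icc (1 - a) 1, IsWordOperator P s (words P Γ S T) (transferOp P Γ S s T) :=
    fun s h => isWordOperator_transferOp Γ S (by linarith [(hmem s h).1]) T
  have hΦ : ∀ s ∈ Set.Icc (1 - a) 1, (meanL (transferOp P Γ S s T (v s))).re =
      (meanL (v s)).re + ((meanL (v s)).re - 1) := fun s h => by
    rw [hLv s h, map_add, map_smul, hm1]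
    simp
  have hreal : ∀ s ∈ Set.Icc (1 - a) 1, (meanL (v s)).im = 0 := by
    intro s h
    have h1 := (conj_pertVec (J := PLip.conjL) (g₀ := g₀) (ψ₀ := meanL) (t := 1)
      (PLip.ext fun ξ => by rw [PLip.conjL_apply, conj_eq_iff_im.mpr (hgc ξ).2]) meanL_conj
      (by simpa using hunit s h) (hop s h).conjL).1
    rw [ofReal_one] at h1
    rw [← conj_eq_iff_im, ← meanL_conj]
    exact congrArg meanL h1
  have hcont : ContinuousOn (fun s => (meanL (v s)).re) (Set.Icc (1 - a) 1) := by
    have h1 : ContinuousOn (fun s => transferOp P Γ S s T) (Set.Icc (1 - a) 1) := by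
      refine Metric.continuousOn_iff.mpr fun s h ε hε => ⟨ε / (C₁ + 1), by positivity, ?_⟩
      intro s' h' hd
      rw [dist_eq_norm]
      refine (hs T s' (hmem s' h') s (hmem s h)).trans_lt ?_
      rw [Real.dist_eq, lt_div_iff₀ (by positivity)] at hd
      nlinarith [abs_nonneg (s' - s)]
    intro s h
    have h2 := (continuousAt_pertVec (hunit s h)).comp_continuousWithinAt (f := fun s =>
      ((transferOp P Γ S s T, 1) : (PLip P →L[ℂ] PLip P) × ℂ))
      ((h1 s h).prodMk continuousWithinAt_const)
    exact (continuous_re.comp meanL.continuous).continuousAt.comp_continuousWithinAt h2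
  have hmem1 : (1 : ℝ) ∈ Set.Icc (1 - a) 1 := ⟨by linarith, le_rfl⟩
  have hmem0 : 1 - a ∈ Set.Icc (1 - a) 1 := ⟨le_rfl, by linarith⟩
  have hsplit : ∀ f : PLip P, (meanL (transferOp P Γ S 1 T f)).re =
      (meanL f).re - (meanL (deltaOp P Γ S 1 T f)).re := fun f => by
    have h1 := hmL f
    rw [transferOp_top_eq Γ S (by norm_num) T, add_apply, map_add] at h1
    rw [← h1, add_re]; ring
  -- By `hΦ` the mean of `L v` is `2 mean(v) - 1`. With exponent one, removing the long words can
  -- only decrease the mean, so this is at most `mean(v)`.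
  have hlow : (meanL (v 1)).re ≤ 1 := by
    have h1 := hΦ 1 hmem1
    have h2 : (0 : ℝ) ≤ (meanL (deltaOp P Γ S 1 T (v 1))).re := by
      have h3 := re_meanL_mono (f := 0) (g := deltaOp P Γ S 1 T (v 1))
        ((isWordOperator_deltaOp Γ S (by norm_num) T).re_nonneg fun ξ =>
          (half_pos hc).le.trans (hvc 1 hmem1 ξ))
      rwa [map_zero, zero_re] at h3
    rw [hsplit] at h1
    linarith
  have hhigh : 1 ≤ (meanL (v (1 - a))).re := by
    set u := v (1 - a) with hu
    have hu0 : ∀ ξ, 0 ≤ (u ξ).re := fun ξ => (half_pos hc).le.trans (hvc _ hmem0 ξ)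
    have h1 : κ ^ ((1 - a) - 1) * (meanL (transferOp P Γ S 1 T u)).re ≤
        (meanL (transferOp P Γ S (1 - a) T u)).re := by
      have h2 := re_meanL_mono (f := ((κ ^ ((1 - a) - 1) : ℝ) : ℂ) • transferOp P Γ S 1 T u)
        (g := transferOp P Γ S (1 - a) T u) fun ξ => by
          rw [PLip.smul_apply, re_ofReal_mul]
          exact (hop _ hmem0).scale_le (isWordOperator_transferOp Γ S (by norm_num) T)
            (by linarith) (fun b W hW ξ hξ => (hb W b hW.1 hW.2.1 ξ hξ).1) hu0 ξ
      rwa [map_smul, smul_eq_mul, re_ofReal_mul] at h2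
    have h2 : 1 + a * ℓ ≤ κ ^ ((1 - a) - 1) := by
      rw [Real.rpow_def_of_pos hκ0]
      have := Real.add_one_le_exp (Real.log κ * (1 - a - 1))
      have h3 : Real.log κ * (1 - a - 1) = a * ℓ := by simp only [ℓ]; ring
      linarith
    have h3 : c / 2 ≤ (meanL u).re := by
      have h4 := re_meanL_mono (f := ((c / 2 : ℝ) : ℂ) • PLip.one P) (g := u) fun ξ => by
        rw [PLip.smul_apply, re_ofReal_mul, PLip.one_apply, one_re, mul_one]
        exact hvc _ hmem0 ξ
      rwa [map_smul, smul_eq_mul, re_ofReal_mul, meanL_one, one_re, mul_one] at h4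
    have h4 : (meanL (deltaOp P Γ S 1 T u)).re ≤ B / T * (meanL u).re := by
      have hun : ‖u‖ ≤ ‖g₀‖ + c / 2 := by
        have := norm_add_le g₀ (u - g₀)
        rw [add_sub_cancel] at this
        linarith [hv _ hmem0]
      calc (meanL (deltaOp P Γ S 1 T u)).re ≤ ‖meanL (deltaOp P Γ S 1 T u)‖ := re_le_norm _
        _ ≤ ‖(meanL : PLip P →L[ℂ] ℂ)‖ * (‖deltaOp P Γ S 1 T‖ * ‖u‖) :=
            (meanL.le_opNorm _).trans (mul_le_mul_of_nonneg_left
              (ContinuousLinearMap.le_opNorm _ _) (norm_nonneg _))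
        _ ≤ ‖(meanL : PLip P →L[ℂ] ℂ)‖ * (C₂ / T * (‖g₀‖ + c / 2)) := by
            gcongr
            exact hΔ T hT0
        _ = ‖(meanL : PLip P →L[ℂ] ℂ)‖ * C₂ * (‖g₀‖ + c / 2) / T := by ring
        _ ≤ B * (c / 2) / T := by gcongr
        _ = B / T * (c / 2) := by ring
        _ ≤ B / T * (meanL u).re := by gcongr
    have h5 : 1 ≤ (1 + a * ℓ) * (1 - B / T) := by
      have h6 : a * ℓ = 2 * (B / T) := by rw [ha]; field_simp
      have h7 : B / T ≤ 1 / 2 := by rw [div_le_iff₀ hT0]; linarith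
      rw [h6]
      nlinarith [div_pos hB hT0]
    have h6 := hΦ _ hmem0
    have h7 := hsplit u
    have h8 : (1 - B / T) * (meanL u).re ≤ (meanL (transferOp P Γ S 1 T u)).re := by
      rw [h7]; linarith
    have h9 : 0 ≤ (1 - B / T) * (meanL u).re := by
      have : B / T ≤ 1 / 2 := by rw [div_le_iff₀ hT0]; linarith
      exact mul_nonneg (by linarith) (by linarith)
    have h10 : (meanL u).re ≤ (meanL (transferOp P Γ S (1 - a) T u)).re := by
      calc (meanL u).re ≤ (1 + a * ℓ) * (1 - B / T) * (meanL u).re :=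
            le_mul_of_one_le_left (by linarith) h5
        _ = (1 + a * ℓ) * ((1 - B / T) * (meanL u).re) := by ring
        _ ≤ κ ^ ((1 - a) - 1) * (meanL (transferOp P Γ S 1 T u)).re :=
            mul_le_mul h2 h8 h9 (Real.rpow_nonneg hκ0.le _)
        _ ≤ _ := h1
    linarith
  obtain ⟨s, hsm, hs1⟩ := intermediate_value_Icc' (by linarith : 1 - a ≤ 1) hcont ⟨hlow, hhigh⟩
  have hs2 : meanL (v s) = 1 := Complex.ext hs1 (hreal s hsm)
  refine ⟨s, hsm.1, hsm.2, by linarith [(hmem s hsm).1], hsm.2, 1, ?_, Real.log_one⟩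
  refine isLeadingEigenvalue_of_eigenfunction Γ S (by linarith [(hmem s hsm).1]) one_pos
    (half_pos hc) (hvc s hsm) ?_
  rw [hLv s hsm, hs2, sub_self, zero_smul, add_zero, ofReal_one, one_smul]

end Bowen

/-! ### Perturbation of the leading eigenpair and of the complementary part -/

section NormalizedEigenpair

variable {E : Type*} [NormedAddCommGroup E] [NormedSpace ℂ E] [CompleteSpace E] {g₀ : E}
  {ψ₀ : E →L[ℂ] ℂ}

/-- Dividing `ψ` by `ψ v` normalizes the pair. The deflated operator then depends continuously on
`(L, t, v, ψ)`, and invertibility of its translates is stable, uniformly for `z` in the compact `K`.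
-/
theorem eventually_exists_normalized_eigenpair {L₀ : E →L[ℂ] E}
    (hU : IsUnit (bordered g₀ ψ₀ L₀ 1)) (hg : L₀ g₀ = g₀) (hψ : ∀ f, ψ₀ (L₀ f) = ψ₀ f)
    (h1 : ψ₀ g₀ = 1) {J : E →ₗ⋆[ℂ] E} (hJg : J g₀ = g₀) (hJψ : ∀ f, ψ₀ (J f) = conj (ψ₀ f))
    {K : Set ℂ} (hK : IsCompact K) (hUK : ∀ z ∈ K, IsUnit (L₀ - ψ₀.smulRight g₀ - z • 1))
    {δ : ℝ} (hδ : 0 < δ) :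
    ∀ᶠ L in 𝓝 L₀, (∀ f, L (J f) = J (L f)) → ∃ (t : ℝ) (v : E) (ψ : E →L[ℂ] ℂ),
      |t - 1| < δ ∧ ‖v - g₀‖ < δ ∧ ‖ψ - ψ₀‖ < δ ∧ ψ v = 1 ∧ L v = (t : ℂ) • v ∧
      (∀ f, ψ (L f) = t * ψ f) ∧ J v = v ∧ (∀ f, ψ (J f) = conj (ψ f)) ∧
      ∀ z ∈ K, IsUnit (L - (t : ℂ) • ψ.smulRight v - z • 1) := by
  let n : E × (E →L[ℂ] ℂ) → (E →L[ℂ] ℂ) := fun q => (q.2 q.1)⁻¹ • q.2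
  have happ : ContinuousAt (fun q : E × (E →L[ℂ] ℂ) => q.2 q.1) (g₀, ψ₀) :=
    (continuous_snd.clm_apply continuous_fst).continuousAt
  have hn : ContinuousAt n (g₀, ψ₀) :=
    (happ.inv₀ (by simp [h1])).smul continuousAt_snd
  have hn0 : n (g₀, ψ₀) = ψ₀ := by simp [n, h1]
  let R : (E →L[ℂ] E) × ℝ × E × (E →L[ℂ] ℂ) → (E →L[ℂ] E) := fun q =>
    q.1 - (q.2.1 : ℂ) • (n q.2.2).smulRight q.2.2.1
  have hn' : ContinuousAt (fun q : (E →L[ℂ] E) × ℝ × E × (E →L[ℂ] ℂ) => n q.2.2)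
      (L₀, 1, g₀, ψ₀) := 
    ContinuousAt.comp (f := fun q : (E →L[ℂ] E) × ℝ × E × (E →L[ℂ] ℂ) => q.2.2)
      (x := (L₀, 1, g₀, ψ₀)) hn continuousAt_snd.snd
  have hR : ContinuousAt R (L₀, 1, g₀, ψ₀) := by
    have h3 : ContinuousAt (fun q : (E →L[ℂ] E) × ℝ × E × (E →L[ℂ] ℂ) => (q.2.1 : ℂ))
        (L₀, 1, g₀, ψ₀) := (continuous_ofReal.comp (continuous_fst.comp continuous_snd)).continuousAt
    refine continuousAt_fst.sub (h3.smul ?_)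
    have h2 : ContinuousAt (fun q : (E →L[ℂ] E) × ℝ × E × (E →L[ℂ] ℂ) =>
        ContinuousLinearMap.smulRightL ℂ E E (n q.2.2) q.2.2.1) (L₀, 1, g₀, ψ₀) :=
      ((ContinuousLinearMap.smulRightL ℂ E E).continuous.continuousAt.comp hn').clm_apply
        continuousAt_snd.snd.fst
    exact h2
  have hR0 : R (L₀, 1, g₀, ψ₀) = L₀ - ψ₀.smulRight g₀ := by
    simp only [R, hn0, ofReal_one, one_smul]
  have e1 := hR.eventually (hR0.symm ▸ eventually_isUnit_sub hK hUK)
  have e2 := hn'.eventually (Metric.ball_mem_nhds _ hδ)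
  have e3 : ∀ᶠ q : (E →L[ℂ] E) × ℝ × E × (E →L[ℂ] ℂ) in 𝓝 (L₀, 1, g₀, ψ₀),
      q.2.2.2 q.2.2.1 ≠ 0 := by
    have h2 : ContinuousAt (fun q : (E →L[ℂ] E) × ℝ × E × (E →L[ℂ] ℂ) => q.2.2.2 q.2.2.1)
        (L₀, 1, g₀, ψ₀) := by fun_prop
    exact h2.eventually_ne (by simp [h1])
  obtain ⟨δ', hδ', hall⟩ := Metric.eventually_nhds_iff.mp (e1.and (e2.and e3))
  filter_upwards [Metric.ball_mem_nhds L₀ hδ',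
    eventually_exists_eigenpair hU hg hψ h1 hJg hJψ (lt_min hδ hδ')] with L hL hpair hJL
  obtain ⟨t, v, ψ, ht, hv, hψ', hLv, hψL, hJv, hψJ⟩ := hpair hJL
  obtain ⟨a1, a2, a3⟩ := hall (y := (L, t, v, ψ)) (by
    rw [Prod.dist_eq, Prod.dist_eq, Prod.dist_eq, Real.dist_eq, dist_eq_norm v, dist_eq_norm ψ]
    exact max_lt hL (max_lt (ht.trans_le (min_le_right _ _)) (max_lt (hv.trans_le (min_le_right _ _))
      (hψ'.trans_le (min_le_right _ _)))))
  have hreal : conj (ψ v) = ψ v := by rw [← hψJ, hJv]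
  refine ⟨t, v, n (v, ψ), ht.trans_le (min_le_left _ _), hv.trans_le (min_le_left _ _), ?_,
    inv_mul_cancel₀ a3, hLv, fun f => ?_, hJv, fun f => ?_, a1⟩
  · have a4 : dist (n (v, ψ)) (n (g₀, ψ₀)) < δ := a2
    rwa [hn0, dist_eq_norm] at a4
  · change (ψ v)⁻¹ * ψ (L f) = t * ((ψ v)⁻¹ * ψ f)
    rw [hψL]; ring
  · change (ψ v)⁻¹ * ψ (J f) = conj ((ψ v)⁻¹ * ψ f)
    rw [map_mul, map_inv₀, hreal, hψJ]

end NormalizedEigenpair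

section Asymptotics

set_option linter.unusedSectionVars false

variable {Γ₀ : Subgroup SL(2, ℝ)} {A : Type*} {P : LabelledIdealPolygon Γ₀ A} [Finite A]
  [Nonempty A] {Γ : Subgroup SL(2, ℝ)} {p : ℕ} {S : Fin p → SL(2, ℝ)}

/-! ### The spectral gap -/

/-- With `ε = (1 - ρ)/4` one has `1 - 2ε = (1 + ρ)/2 > ρ`, so outside the ball the deflated operator
is invertible and `1` is the only point of the spectrum. -/
theorem hasSpectralGap_of_iterate {L : PLip P →L[ℂ] PLip P} {g : PLip P}
    (hm : ∀ f, meanL (L f) = meanL f) (hg : L g = g) (hmg : meanL g = 1) {C ρ : ℝ} (hρ0 : 0 < ρ)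
    (hρ1 : ρ < 1) (hit : ∀ n f, ‖(L ^ n) f - meanL f • g‖ ≤ C * ρ ^ n * ‖f‖) :
    HasSpectralGap L ((1 - ρ) / 4) := by
  have hg0 : g ≠ 0 := by
    rintro rfl
    simp at hmg
  refine ⟨by linarith, one_mem_spectrum hg hg0, ?_⟩
  rintro z ⟨hz, hz1⟩
  by_contra hball
  rw [mem_ball_zero_iff, not_lt] at hball
  have h1 := isUnit_deflated_of_lt hg hmg hm hρ0 hit (by linarith : ρ < ‖z‖)
  refine isUnit_sub_smul_iff.mp (inverse_sub_of_deflated (t := 1) (z := z) hmg ?_ ?_ ?_ h1 ?_ hz1).1 hz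
  · rw [hg, one_smul]
  · simpa using hm
  · rw [one_smul]
  · rintro rfl
    rw [norm_zero] at hball
    linarith

/-- In the closed disc `|z| ≥ 1 - ε > 1 - 2ε > 0`, so a point other than `1` is neither zero nor in
the spectrum. The point `1` itself is covered by the decay of the iterates. -/
theorem HasSpectralGap.isUnit_deflated {L : PLip P →L[ℂ] PLip P} {g : PLip P}
    (hm : ∀ f, meanL (L f) = meanL f) (hg : L g = g) (hmg : meanL g = 1) {C ρ : ℝ} (hρ0 : 0 < ρ)
    (hρ1 : ρ < 1) (hit : ∀ n f, ‖(L ^ n) f - meanL f • g‖ ≤ C * ρ ^ n * ‖f‖) {ε : ℝ}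
    (hε : HasSpectralGap L ε) :
    ∀ z ∈ Metric.closedBall (1 : ℂ) ε, IsUnit (L - meanL.smulRight g - z • 1) := by
  have h1 : IsUnit (L - meanL.smulRight g - (1 : ℂ) • 1) :=
    isUnit_deflated_of_lt hg hmg hm hρ0 hit (by simpa using hρ1)
  obtain ⟨z, hz, hz1⟩ := exists_mem_spectrum_ne_one hm hmg h1 (exists_ne_zero_meanL_eq_zero P)
  have hlt : 0 < 1 - 2 * ε :=
    (norm_nonneg z).trans_lt (mem_ball_zero_iff.mp (hε.2.2 ⟨hz, hz1⟩))
  intro z hz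
  by_cases hz1 : z = 1
  · rw [hz1]; exact h1
  have hzn : 1 - ε ≤ ‖z‖ := by
    have h2 := norm_sub_norm_le (1 : ℂ) z
    rw [norm_one, norm_sub_rev, ← dist_eq_norm] at h2
    linarith [Metric.mem_closedBall.mp hz]
  refine CuspidalCoding.isUnit_deflated hg hm hmg (isUnit_sub_smul_iff.mpr fun hs => ?_) ?_ hz1
  · linarith [mem_ball_zero_iff.mp (hε.2.2 ⟨hs, hz1⟩), hε.1]
  · rintro rfl
    rw [norm_zero] at hzn
    linarith [hε.1]

/-! ### The coefficient of the perturbation -/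

theorem IsSpectralCoefficient.eq {ε s T b b' : ℝ} (h : IsSpectralCoefficient P Γ S ε s T b)
    (h' : IsSpectralCoefficient P Γ S ε s T b') : b = b' := by
  obtain ⟨g, lam, hg⟩ := h.2.1
  exact ofReal_injective ((h'.2.2 g lam hg b).mp ((h.2.2 g lam hg b).mpr rfl))

/-- Qualitative convergence of the eigenpair suffices: it is only used multiplied by `T
‖Δ_{(1,T)}‖`, which is bounded. No rate in `|s_T - 1|` is needed. -/
theorem exists_tendsto_spectralCoefficient (hle : Γ₀ ≤ Γ) (hS : IsCuspSystem Γ S) {g₀ : PLip P}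
    {c : ℝ} (hc : 0 < c) (hgc : ∀ ξ, c ≤ (g₀ ξ).re ∧ (g₀ ξ).im = 0)
    (hg : transferOp P Γ S 1 ⊤ g₀ = g₀) (hm1 : meanL g₀ = 1)
    (hU : IsUnit (bordered g₀ meanL (transferOp P Γ S 1 ⊤) 1)) {ε : ℝ} (hε : 0 < ε)
    (hR : ∀ z ∈ Metric.closedBall (1 : ℂ) ε,
      IsUnit (transferOp P Γ S 1 ⊤ - meanL.smulRight g₀ - z • 1))
    {sT : ℝ → ℝ} {C : ℝ} (hsT : ∀ᶠ T in atTop, sT T ≤ 1 ∧ |sT T - 1| ≤ C / T) {β : ℝ}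
    (hβ : Tendsto (fun T : ℝ => (T : ℂ) * meanL (deltaOp P Γ S 1 T g₀)) atTop (𝓝 (β : ℂ))) :
    ∃ βT : ℝ → ℝ, (∀ᶠ T in atTop, IsSpectralCoefficient P Γ S ε (sT T) T (βT T)) ∧
      Tendsto (fun T => T * βT T) atTop (𝓝 β) := by
  have hmL : ∀ f : PLip P, meanL (transferOp P Γ S 1 ⊤ f) = meanL f := fun f =>
    integral_transferOp Γ S f
  obtain ⟨C₁, hC₁, hs⟩ := exists_transferOp_sub_le (P := P) Γ S
  obtain ⟨C₂, hC₂, hΔ⟩ := exists_deltaOp_one_le (P := P) hle hS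
  have hCT : Tendsto (fun T : ℝ => C / T) atTop (𝓝 0) := tendsto_const_nhds.div_atTop tendsto_id
  have hs910 : ∀ᶠ T in atTop, sT T ∈ Set.Icc (9 / 10 : ℝ) 1 := by
    filter_upwards [hsT, hCT.eventually_le_const (by norm_num : (0 : ℝ) < 1 / 10)] with T h1 h2
    exact ⟨by linarith [(abs_le.mp (h1.2.trans h2)).1], h1.1⟩
  have hlim : Tendsto (fun T => transferOp P Γ S (sT T) ⊤) atTop (𝓝 (transferOp P Γ S 1 ⊤)) := by
    rw [tendsto_iff_norm_sub_tendsto_zero]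
    refine squeeze_zero' (Eventually.of_forall fun _ => norm_nonneg _) ?_
      (by simpa using hCT.const_mul C₁)
    filter_upwards [hsT, hs910] with T h1 h2
    exact (hs ⊤ _ h2 1 (by norm_num)).trans (mul_le_mul_of_nonneg_left h1.2 hC₁)
  have hpair : ∀ δ > 0, ∀ᶠ T in atTop, ∃ (v : PLip P) (ψ : PLip P →L[ℂ] ℂ),
      ‖v - g₀‖ ≤ δ ∧ ‖ψ - meanL‖ ≤ δ ∧
      IsSpectralCoefficient P Γ S ε (sT T) T (ψ (deltaOp P Γ S (sT T) T v)).re := by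
    intro δ hδ
    have hδ' : 0 < min δ (min ε (min (1 / 2) (c / 2))) := by positivity
    have hJg : PLip.conjL g₀ = g₀ :=
      PLip.ext fun ξ => by rw [PLip.conjL_apply, conj_eq_iff_im.mpr (hgc ξ).2]
    filter_upwards [hlim.eventually (eventually_exists_normalized_eigenpair hU hg hmL hm1
      (J := PLip.conjL) hJg meanL_conj (isCompact_closedBall 1 ε) hR hδ'), hs910] with T hT hT'
    have hs12 : 1 / 2 < sT T := by linarith [hT'.1]
    obtain ⟨t, v, ψ, ht, hv, hψ, hψv, hLv, hψL, hJv, hψJ, hunit⟩ :=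
      hT (isWordOperator_transferOp Γ S hs12 ⊤).conjL
    simp only [lt_min_iff] at ht hv hψ
    refine ⟨v, ψ, hv.1.le, hψ.1.le, isSpectralCoefficient_of_eigenpair Γ S hε hs12 ?_ ?_ hψv hLv
      hψL hJv hψJ (half_pos hc) (fun ξ => ?_) rfl hunit⟩
    · linarith [(abs_lt.mp ht.2.2.1).1]
    · rw [Metric.mem_ball, dist_eq_norm, ← ofReal_one, ← ofReal_sub, norm_real]
      exact ht.2.1
    · linarith [PLip.sub_le_re (fun ξ => (hgc ξ).1) hv.2.2.2.le ξ]
  refine ⟨fun T => Classical.epsilon fun b => IsSpectralCoefficient P Γ S ε (sT T) T b, ?_, ?_⟩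
  · filter_upwards [hpair 1 one_pos] with T ⟨v, ψ, _, _, h⟩
    exact Classical.epsilon_spec (p := fun b => IsSpectralCoefficient P Γ S ε (sT T) T b) ⟨_, h⟩
  have hre : Tendsto (fun T : ℝ => T * (meanL (deltaOp P Γ S 1 T g₀)).re) atTop (𝓝 β) := by
    have h1 := (continuous_re.tendsto _).comp hβ
    simpa only [Function.comp_def, re_ofReal_mul, ofReal_re] using h1
  refine tendsto_of_tendsto_of_dist hre (Metric.tendsto_nhds.mpr fun e he => ?_)
  set m := ‖(meanL : PLip P →L[ℂ] ℂ)‖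
  set M := (m + 1) * (‖g₀‖ + 1) with hM
  have hm0 : 0 ≤ m := norm_nonneg _
  have hM1 : 0 < M := by positivity
  obtain ⟨δ, hδ, hδ1, hδe⟩ : ∃ δ : ℝ, 0 < δ ∧ δ ≤ 1 ∧ 2 * (M * C₂ * δ) ≤ e / 2 := by
    refine ⟨min 1 (e / 2 / (2 * (M * C₂))), by positivity, min_le_left _ _, ?_⟩
    calc 2 * (M * C₂ * min 1 (e / 2 / (2 * (M * C₂)))) ≤
          2 * (M * C₂ * (e / 2 / (2 * (M * C₂)))) := by gcongr; exact min_le_right _ _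
      _ = e / 2 := by field_simp
  have hd := (tendsto_mul_deltaOp_sub (P := P) hle hS hsT).const_mul M
  rw [mul_zero] at hd
  filter_upwards [hpair δ hδ, hd.eventually_lt_const (half_pos he), eventually_gt_atTop 0] with
    T ⟨v, ψ, hv, hψ, h⟩ hT hT0
  have hb : Classical.epsilon (fun b => IsSpectralCoefficient P Γ S ε (sT T) T b) =
      (ψ (deltaOp P Γ S (sT T) T v)).re :=
    IsSpectralCoefficient.eq
      (Classical.epsilon_spec (p := fun b => IsSpectralCoefficient P Γ S ε (sT T) T b) ⟨_, h⟩) h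
  rw [hb]
  set D := deltaOp P Γ S (sT T) T
  set D₁ := deltaOp P Γ S 1 T with hD₁
  have hvn : ‖v‖ ≤ ‖g₀‖ + 1 := by
    have := norm_add_le g₀ (v - g₀)
    rw [add_sub_cancel] at this
    linarith
  have hψn : ‖ψ‖ ≤ m + 1 := by
    have := norm_add_le (meanL : PLip P →L[ℂ] ℂ) (ψ - meanL)
    rw [add_sub_cancel] at this
    linarith
  have hD1 : T * ‖D₁‖ ≤ C₂ := by
    have := hΔ T hT0
    rwa [le_div_iff₀ hT0, mul_comm] at this
  -- The three errors come from the exponent, the functional and the eigenfunction. After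
  -- multiplication by `T` the first tends to zero, and the two others are at most `M C₂ δ` each.
  have hsum : ψ (D v) - meanL (D₁ g₀) =
      ψ ((D - D₁) v) + (ψ - meanL : PLip P →L[ℂ] ℂ) (D₁ v) + meanL (D₁ (v - g₀)) := by
    simp only [sub_apply, map_sub]
    ring
  have b1 : ‖ψ ((D - D₁) v)‖ ≤ (m + 1) * (‖D - D₁‖ * (‖g₀‖ + 1)) :=
    (ψ.le_opNorm _).trans (by gcongr; exact (ContinuousLinearMap.le_opNorm _ _).trans (by gcongr))
  have b2 : ‖(ψ - meanL : PLip P →L[ℂ] ℂ) (D₁ v)‖ ≤ δ * (‖D₁‖ * (‖g₀‖ + 1)) :=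
    ((ψ - meanL : PLip P →L[ℂ] ℂ).le_opNorm _).trans
      (by gcongr; exact (ContinuousLinearMap.le_opNorm _ _).trans (by gcongr))
  have b3 : ‖meanL (D₁ (v - g₀))‖ ≤ m * (‖D₁‖ * δ) :=
    (meanL.le_opNorm _).trans (by gcongr; exact (ContinuousLinearMap.le_opNorm _ _).trans (by gcongr))
  have key : ‖ψ (D v) - meanL (D₁ g₀)‖ ≤ M * ‖D - D₁‖ + 2 * (M * ‖D₁‖ * δ) := by
    rw [hsum]
    refine (norm_add₃_le).trans ((add_le_add (add_le_add b1 b2) b3).trans ?_)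
    have q1 : δ * (‖D₁‖ * (‖g₀‖ + 1)) ≤ M * ‖D₁‖ * δ := by
      have : (‖g₀‖ + 1) ≤ M := le_mul_of_one_le_left (by positivity) (by linarith)
      calc _ = (‖g₀‖ + 1) * ‖D₁‖ * δ := by ring
        _ ≤ _ := by gcongr
    have q2 : m * (‖D₁‖ * δ) ≤ M * ‖D₁‖ * δ := by
      have : m ≤ M := (by linarith : m ≤ m + 1).trans
        (le_mul_of_one_le_right (by positivity) (by linarith [norm_nonneg g₀]))
      calc _ = m * ‖D₁‖ * δ := by ring
        _ ≤ _ := by gcongr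
    have q3 : (m + 1) * (‖D - D₁‖ * (‖g₀‖ + 1)) = M * ‖D - D₁‖ := by rw [hM]; ring
    linarith
  have hre' : |(ψ (D v)).re - (meanL (D₁ g₀)).re| ≤ ‖ψ (D v) - meanL (D₁ g₀)‖ := by
    rw [← sub_re]; exact abs_re_le_norm _
  rw [dist_zero_right, Real.norm_of_nonneg dist_nonneg, Real.dist_eq, abs_sub_comm, ← mul_sub,
    abs_mul, abs_of_pos hT0]
  calc _ ≤ T * (M * ‖D - D₁‖ + 2 * (M * ‖D₁‖ * δ)) := by gcongr; exact hre'.trans key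
    _ = M * (T * ‖D - D₁‖) + 2 * (M * (T * ‖D₁‖) * δ) := by ring
    _ ≤ M * (T * ‖D - D₁‖) + 2 * (M * C₂ * δ) := by gcongr
    _ < e := by linarith

end Asymptotics

end

end CuspidalCoding

/-! ### The main theorem -/

open CuspidalCoding in
theorem mainTheorem8 {A : Type*} [Fintype A] [Nonempty A]
    (Γ Γ₀ : Subgroup SL(2, ℝ)) (hΓ : IsNonuniformLattice Γ)
    (hle : Γ₀ ≤ Γ) (hfin : (Γ₀.subgroupOf Γ).FiniteIndex) (hfree : IsFreeGroup Γ₀)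
    {p : ℕ} (S : Fin p → SL(2, ℝ)) (hS : IsCuspSystem Γ S)
    (P : LabelledIdealPolygon Γ₀ A) :
    -- the operators are well defined and bounded
    (∀ s : ℝ, 1 / 2 < s →
      (∀ T : EReal, 0 < T → IsWordOperator P s (words P Γ S T) (transferOp P Γ S s T)) ∧
      (∀ T : ℝ, 0 < T → IsWordOperator P s (longWords P Γ S T) (deltaOp P Γ S s T))) ∧
    -- the eigenfunction and the measure for the parameters `(1,∞)` exist, with eigenvalue `1`
    (∃ g μ, IsPositiveEigenfunction (transferOp P Γ S 1 ⊤) g 1 ∧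
      IsEigenmeasure (transferOp P Γ S 1 ⊤) g 1 μ) ∧
    ∃ β : ℝ, 0 < β ∧
      -- the limit defining `β`
      (∀ g μ, IsPositiveEigenfunction (transferOp P Γ S 1 ⊤) g 1 →
        IsEigenmeasure (transferOp P Γ S 1 ⊤) g 1 μ →
        Tendsto (fun T : ℝ => (T : ℂ) * ∫ ξ, deltaOp P Γ S 1 T g ξ ∂μ) atTop (𝓝 (β : ℂ))) ∧
      -- the expansion of `β_T`
      (∃ ε, HasSpectralGap (transferOp P Γ S 1 ⊤) ε) ∧
      ∃ sT : ℝ → ℝ,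
        (∀ᶠ T in atTop, IsBowenRoot P Γ S T (sT T) ∧
          ∀ s, IsBowenRoot P Γ S T s → s = sT T) ∧
        ∀ ε, HasSpectralGap (transferOp P Γ S 1 ⊤) ε →
          ∃ βT E₁ E₂ : ℝ → ℝ,
            (∀ᶠ T in atTop, IsSpectralCoefficient P Γ S ε (sT T) T (βT T)) ∧
            (∀ᶠ T in atTop, βT T = β / T + E₁ T + E₂ T) ∧
            E₁ =O[atTop] (fun T : ℝ => |sT T - 1| * T ^ (-(3 / 5) : ℝ)) ∧
            E₂ =o[atTop] (fun T : ℝ => 1 / T) := by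
  set L₀ := transferOp P Γ S 1 ⊤ with hL₀
  have hm : ∀ f : PLip P, meanL (L₀ f) = meanL f := fun f => integral_transferOp Γ S f
  have hop : IsWordOperator P 1 (words P Γ S ⊤) L₀ :=
    isWordOperator_transferOp Γ S (by norm_num) ⊤
  have hXt : ∀ b W, W ∈ words P Γ S ⊤ b ↔ IsCuspidal P W ∧ Follows P W b := fun _ _ =>
    mem_words_top Γ S
  obtain ⟨g₀, c, C, ρ, hc, hgc, hg, hmg, hρ0, hρ1, hit⟩ := exists_limit_eigenfunction hXt hop hm
  obtain ⟨μ₀, hμ₀⟩ := exists_isEigenmeasure hm hc hgc hmg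
  obtain ⟨β, hβ, hβlim⟩ := exists_tendsto_integral_deltaOp (P := P) hle hS g₀ hc hgc
  have hU : IsUnit (bordered g₀ meanL L₀ 1) := by
    have h1 := isUnit_deflated_of_lt hg hmg hm hρ0 hit (z := 1) (by simpa using hρ1)
    -- At `z = 1` the bordered operator is the deflated operator minus the identity, with the two
    -- subtractions exchanged.
    rwa [sub_right_comm] at h1
  have hlim : ∀ f : PLip P, Tendsto (fun n : ℕ => (L₀ ^ n) f) atTop (𝓝 (meanL f • g₀)) := by
    intro f
    rw [tendsto_iff_norm_sub_tendsto_zero]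
    refine squeeze_zero (fun _ => norm_nonneg _) (fun n => hit n f) ?_
    simpa using ((tendsto_pow_atTop_nhds_zero_of_lt_one hρ0.le hρ1).const_mul C).mul_const ‖f‖
  refine ⟨fun s hs => ⟨fun T _ => isWordOperator_transferOp Γ S hs T,
    fun T _ => isWordOperator_deltaOp Γ S hs T⟩, ⟨g₀, μ₀, ⟨one_pos, fun ξ =>
      ⟨hc.trans_le (hgc ξ).1, (hgc ξ).2⟩, by rw [hg, ofReal_one, one_smul]⟩, hμ₀⟩, β, hβ,
    fun g μ hg' hμ => ?_, ⟨_, hasSpectralGap_of_iterate hm hg hmg hρ0 hρ1 hit⟩, ?_⟩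
  · simp only [hμ.integral_eq hXt hop hlim hg']
    exact hβlim
  obtain ⟨C', hC', hroot⟩ := exists_bowenRoot hle hS hc hgc hg hmg hU
  -- The chosen root carries the lower bound `1 - C'/T`. By uniqueness it is eventually the root, so
  -- the bound holds for `s_T`.
  set sT : ℝ → ℝ := fun T =>
    Classical.epsilon fun s => 1 - C' / T ≤ s ∧ s ≤ 1 ∧ IsBowenRoot P Γ S T s
  have hsT : ∀ᶠ T in atTop, 1 - C' / T ≤ sT T ∧ sT T ≤ 1 ∧ IsBowenRoot P Γ S T (sT T) := by
    filter_upwards [hroot] with T hT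
    exact Classical.epsilon_spec hT
  refine ⟨sT, ?_, fun ε hε => ?_⟩
  · filter_upwards [hsT, eventually_nonempty_shiftSpace (P := P) (Γ := Γ) (S := S)] with T hT hne
    exact ⟨hT.2.2, fun s hs => hs.eq hle hS hT.2.2⟩
  obtain ⟨βT, h1, h2⟩ := exists_tendsto_spectralCoefficient hle hS hc hgc hg hmg hU hε.1
    (hε.isUnit_deflated hm hg hmg hρ0 hρ1 hit) (sT := sT) (C := C')
    (hsT.mono fun T hT => ⟨hT.2.1, abs_le.mpr ⟨by linarith [hT.1], by
      linarith [hT.1, hT.2.1]⟩⟩) hβlim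
  -- The first error term is zero: `T β_T → β` already gives `β_T = β/T + o(1/T)`.
  refine ⟨βT, 0, fun T => βT T - β / T, h1, Eventually.of_forall fun T => ?_,
    Asymptotics.isBigO_zero _ _, ?_⟩
  · simp
  · rw [Asymptotics.isLittleO_iff_tendsto']
    · have h3 := h2.sub_const β
      rw [sub_self] at h3
      refine h3.congr' ?_
      filter_upwards [eventually_ne_atTop 0] with T hT
      field_simp
    · filter_upwards [eventually_ne_atTop 0] with T hT h3
      exact absurd h3 (one_div_ne_zero hT)
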